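/- **Notation.** For a field $F:\mathbb{R}^3\to\mathbb{C}^3$, $x\in\mathbb{R}^3$, unit vectors $\theta,\kappa$ and $p\in\mathbb{R}$, let $$\mathcal{X}F(\theta,x)=\lim_{T\to\infty}\int_{-T}^{T}F(x+s\theta)\,ds,\qquad \mathcal{Y}F(\theta,x)=\lim_{T\to\infty}\int_{-T}^{T}F(x+s\theta)\,\mathrm{sgn}(s)\,ds,$$ $$F^{\mathcal R}(p,\kappa)=\lim_{\varepsilon\to0+}\int_{\kappa^\perp}e^{-\varepsilon|y|^2}F(p\kappa+y)\,dy,\qquad \mathcal{I}^2[F](x)=\lim_{\varepsilon\to0+}\int_{\mathbb{R}^3}\frac{e^{-\varepsilon|y|^2}}{4\pi|y|}F(x-y)\,dy$$ (the ordinary integrals when these converge absolutely), $\mathcal{BS}[F]=\nabla\times\mathcal{I}^2[F]$, and let $\mathcal{H}[r](x)=\frac1\pi\,\mathrm{PV}\!\int\frac{r(y)}{x-y}\,dy$ be the Hilbert transform in the variable $p$, the principal value being symmetric at $0$ and at $\infty$. For a function $\varphi$ on $S^2$ let $\mathcal{M}[\varphi](\theta)=\int_{S^2}\varphi(\kappa)\,\delta(\kappa\cdot\theta)\,d\Omega_\kappa$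 (the arc-length integral over the great circle $\kappa\cdot\theta=0$) be its Minkowski–Funk transform. A field is *Trkalian* with eigenvalue $\nu$ if it is $C^1$ and $\nabla\times F=\nu F$. We write $\mathcal{XBS}[F]=\mathcal{X}(\mathcal{BS}[F])$ and $\mathcal{YBS}[F]=\mathcal{Y}(\mathcal{BS}[F])$. **(1)** Let $F$ be a Schwartz field. Then $\mathcal{I}^2[F]$ exists and is differentiable; for every unit vector $\kappa$ and every $p$, $F^{\mathcal R}(p,\kappa)$ (an absolutely convergent integral), $\mathcal{H}F^{\mathcal R}(\cdot,\kappa)$ and the Radon transform $\mathcal{BS}[F]^{\mathcal R}(p,\kappa)$ exist, with $\partial_p\,\mathcal{BS}[F]^{\mathcal R}(p,\kappa)=-\kappa\times F^{\mathcal R}(p,\kappa)$. For every unit vector $\theta$ and every $x$, $\mathcal{BS}[F]$ is integrable on the line $x+\mathbb{R}\theta$, all the integrals below converge, and $$\mathcal{XBS}[F](\theta,x)=\frac1{4\pi}\int_{S^2}\bigl[\mathcal{H}\,\partial_p\,\mathcal{BS}[F]^{\mathcal R}(p,\kappa)\bigr](\kappa\cdot x,\kappa)\,\delta(\kappa\cdot\theta)\,d\Omega_\kappa=-\frac1{4\pi}\int_{S^2}\kappa\times\bigl[\mathcal{H}F^{\mathcal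 R}(p,\kappa)\bigr](\kappa\cdot x,\kappa)\,\delta(\kappa\cdot\theta)\,d\Omega_\kappa,$$ $$\mathcal{YBS}[F](\theta,x)=-\frac1{(2\pi)^2}\,\mathrm{PV}\!\int_{S^2}\kappa\times F^{\mathcal R}(\kappa\cdot x,\kappa)\,\frac1{\kappa\cdot\theta}\,d\Omega_\kappa .$$ **(2)** Let $F$ be a Trkalian field with eigenvalue $\nu\in\mathbb{R}\setminus\{0\}$ and at most polynomial growth. Then $\mathcal{I}^2[F]$ exists everywhere and is differentiable, and $\mathcal{BS}[F]=\frac1\nu F$ at every point. For every unit vector $\theta$ and every $x$, $\mathcal{XBS}[F](\theta,x)$ converges if and only if $\mathcal{X}F(\theta,x)$ converges, and then $$\mathcal{XBS}[F](\theta,x)=\frac1\nu\,\mathcal{X}F(\theta,x);$$ likewise $\mathcal{YBS}[F](\theta,x)$ converges if and only if $\mathcal{Y}F(\theta,x)$ converges, and then $\mathcal{YBS}[F](\theta,x)=\frac1\nu\,\mathcal{Y}F(\theta,x)$. **(3)** Let $F$ be a Trkalian field with eigenvalue $\nu\in\mathbb{R}\setminus\{0\}$ of the form $F(x)=\int_{S^2}e^{i\nu\kappa\cdot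 x}g(\kappa)\,d\Omega_\kappa$ with a $C^1$ amplitude $g:S^2\to\mathbb{C}^3$. Then $F^{\mathcal R}$, $\mathcal{H}F^{\mathcal R}$ and $\mathcal{H}\partial_pF^{\mathcal R}$ exist for all $p$ and all unit vectors $\kappa$, and $\partial_pF^{\mathcal R}=-\nu\,\kappa\times F^{\mathcal R}$. For every unit vector $\theta$ and every $x$, $\mathcal{X}F$, $\mathcal{Y}F$, $\mathcal{XBS}[F]$, $\mathcal{YBS}[F]$ and all the integrals below converge, and $$\mathcal{XBS}[F](\theta,x)=-\frac1{4\pi}\int_{S^2}\kappa\times\bigl[\mathcal{H}F^{\mathcal R}(p,\kappa)\bigr](\kappa\cdot x,\kappa)\,\delta(\kappa\cdot\theta)\,d\Omega_\kappa=\frac1{4\pi}\frac1\nu\int_{S^2}\bigl[\mathcal{H}\partial_pF^{\mathcal R}(p,\kappa)\bigr](\kappa\cdot x,\kappa)\,\delta(\kappa\cdot\theta)\,d\Omega_\kappa=\frac1\nu\,\mathcal{X}F(\theta,x),$$ $$\mathcal{YBS}[F](\theta,x)=-\frac1{(2\pi)^2}\,\mathrm{PV}\!\int_{S^2}\kappa\times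 F^{\mathcal R}(\kappa\cdot x,\kappa)\,\frac1{\kappa\cdot\theta}\,d\Omega_\kappa=\frac1\nu\,\mathcal{Y}F(\theta,x).$$ -/

import Mathlib

open MeasureTheory Filter Topology
open scoped SchwartzMap

noncomputable section

namespace BiotSavartXray

/-- Euclidean three-space. -/
abbrev Space := EuclideanSpace ℝ (Fin 3)

/-- The values of the vector fields: (complex) vectors with three Cartesian components. -/
abbrev Vec := Fin 3 → ℂ

/-- The cross product `κ × v` of a real vector and a complex vector. -/
def cross (κ : Space) (v : Vec) : Vec :=
  crossProduct (fun i => (κ i : ℂ)) v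

/-- `partialD F x i j` is the partial derivative `∂ᵢ Fⱼ` at `x`. -/
def partialD (F : Space → Vec) (x : Space) (i j : Fin 3) : ℂ :=
  fderiv ℝ F x (EuclideanSpace.single i 1) j

/-- The curl of a vector field. -/
def curl (F : Space → Vec) (x : Space) : Vec :=
  ![partialD F x 1 2 - partialD F x 2 1,
    partialD F x 2 0 - partialD F x 0 2,
    partialD F x 0 1 - partialD F x 1 0]

/-- Trkalian fields: continuously differentiable eigenfields of the curl, with constant
eigenvalue `ν`. -/
def IsTrkalian (ν : ℝ) (F : Space → Vec) : Prop :=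
  ContDiff ℝ 1 F ∧ ∀ x, curl F x = ν • F x

/-- At most polynomial growth. -/
def PolynomialGrowth (F : Space → Vec) : Prop :=
  ∃ (C : ℝ) (N : ℕ), ∀ x, ‖F x‖ ≤ C * (1 + ‖x‖) ^ N

/-- The truncated line integral `∫_{-T}^{T} F(x + sθ) ds`. -/
def xrayTrunc (F : Space → Vec) (θ x : Space) (T : ℝ) : Vec :=
  ∫ s in (-T)..T, F (x + s • θ)

/-- The (symmetric improper) line integral of `F` through `x` in the direction `θ` converges. -/
def XrayExists (F : Space → Vec) (θ x : Space) : Prop :=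
  (∀ T : ℝ, IntervalIntegrable (fun s : ℝ => F (x + s • θ)) volume (-T) T) ∧
  ∃ v, Tendsto (xrayTrunc F θ x) atTop (𝓝 v)

/-- The X-ray transform `XF(θ, x) = ∫_{-∞}^{∞} F(x + sθ) ds`. -/
def xray (F : Space → Vec) (θ x : Space) : Vec :=
  limUnder atTop (xrayTrunc F θ x)

/-- The truncated signed line integral `∫_{-T}^{T} F(x + sθ) sgn(s) ds`. -/
def signedTrunc (F : Space → Vec) (θ x : Space) (T : ℝ) : Vec :=
  ∫ s in (-T)..T, Real.sign s • F (x + s • θ)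

/-- The (improper) signed line integral converges. -/
def SignedExists (F : Space → Vec) (θ x : Space) : Prop :=
  (∀ T : ℝ, IntervalIntegrable (fun s : ℝ => F (x + s • θ)) volume (-T) T) ∧
  ∃ v, Tendsto (signedTrunc F θ x) atTop (𝓝 v)

/-- The signed transform `YF(θ, x) = ∫_{-∞}^{∞} F(x + sθ) sgn(s) ds`. -/
def signedXray (F : Space → Vec) (θ x : Space) : Vec :=
  limUnder atTop (signedTrunc F θ x)

/-- The integral of `F` over the plane `{y | κ · y = p}`, with the Gaussian weight `exp (-ε |y|²)`
in the plane (`|y|` is the distance to the point `pκ`). -/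
def radonReg (F : Space → Vec) (p : ℝ) (κ : Space) (ε : ℝ) : Vec :=
  ∫ y : (Submodule.span ℝ {κ})ᗮ, Real.exp (-ε * ‖y‖ ^ 2) • F (p • κ + (y : Space))

/-- The integral over the plane `{y | κ · y = p}` converges. -/
def RadonExists (F : Space → Vec) (p : ℝ) (κ : Space) : Prop :=
  (∀ ε > 0, Integrable fun y : (Submodule.span ℝ {κ})ᗮ =>
    Real.exp (-ε * ‖y‖ ^ 2) • F (p • κ + (y : Space))) ∧
  ∃ v, Tendsto (radonReg F p κ) (𝓝[>] 0) (𝓝 v)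

/-- The Radon transform `F^R(p, κ)`: the integral over the plane `{y | κ · y = p}`. The limit
`ε → 0+` is the ordinary integral when `F` is integrable on the plane, and gives its value by
Gaussian summation for the oscillating fields that are not. -/
def radon (F : Space → Vec) (p : ℝ) (κ : Space) : Vec :=
  limUnder (𝓝[>] 0) (radonReg F p κ)

/-- The convolution of `F` with the kernel `exp (-ε |y|²) / (4π |y|)`, at `x`. -/
def rieszReg (F : Space → Vec) (x : Space) (ε : ℝ) : Vec :=
  ∫ y : Space, (Real.exp (-ε * ‖y‖ ^ 2) * (4 * Real.pi * ‖y‖)⁻¹) • F (x - y)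

/-- The Riesz potential of order two of `F` converges at `x`. -/
def RieszExists (F : Space → Vec) (x : Space) : Prop :=
  (∀ ε > 0, Integrable fun y : Space =>
    (Real.exp (-ε * ‖y‖ ^ 2) * (4 * Real.pi * ‖y‖)⁻¹) • F (x - y)) ∧
  ∃ v, Tendsto (rieszReg F x) (𝓝[>] 0) (𝓝 v)

/-- The Riesz potential of order two, `I²[F](x) = (4π)⁻¹ ∫ F(x - y) / |y| dy`. The limit
`ε → 0+` is the ordinary integral when that converges absolutely, and gives its value by
Gaussian summation for the oscillating fields for which it does not. -/
def rieszPotential (F : Space → Vec) (x : Space) : Vec :=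
  limUnder (𝓝[>] 0) (rieszReg F x)

/-- The Biot–Savart integral `BS[F] = ∇ × I²[F]`. -/
def biotSavart (F : Space → Vec) : Space → Vec :=
  curl (rieszPotential F)

/-- The truncated Hilbert transform `π⁻¹ ∫_{ε < |x - y| < 1/ε} r(y) / (x - y) dy`
(written with `t = x - y`). -/
def hilbertTrunc (r : ℝ → Vec) (x ε : ℝ) : Vec :=
  Real.pi⁻¹ • ∫ t in {t : ℝ | ε < |t| ∧ |t| < ε⁻¹}, t⁻¹ • r (x - t)

/-- The principal-value integral of the Hilbert transform converges at `x`. -/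
def HilbertExists (r : ℝ → Vec) (x : ℝ) : Prop :=
  (∀ ε > 0, IntegrableOn (fun t : ℝ => t⁻¹ • r (x - t)) {t : ℝ | ε < |t| ∧ |t| < ε⁻¹}) ∧
  ∃ v, Tendsto (hilbertTrunc r x) (𝓝[>] 0) (𝓝 v)

/-- The Hilbert transform `H[r](x) = π⁻¹ PV ∫ r(y) / (x - y) dy`. -/
def hilbert (r : ℝ → Vec) (x : ℝ) : Vec :=
  limUnder (𝓝[>] 0) (hilbertTrunc r x)

/-- `φ` is integrable on the great circle `{κ | |κ| = 1, κ · θ = 0}`. -/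
def FunkIntegrable (φ : Space → Vec) (θ : Space) : Prop :=
  Integrable (fun κ : Metric.sphere (0 : (Submodule.span ℝ {θ})ᗮ) 1 =>
    φ ((κ : (Submodule.span ℝ {θ})ᗮ) : Space))
    (volume : Measure (Submodule.span ℝ {θ})ᗮ).toSphere

/-- The Minkowski–Funk transform `M[φ](θ) = ∫_{S²} φ(κ) δ(κ · θ) dΩ(κ)`: the integral, with
respect to arc length, over the great circle `{κ | |κ| = 1, κ · θ = 0}`. -/
def funk (φ : Space → Vec) (θ : Space) : Vec :=
  ∫ κ : Metric.sphere (0 : (Submodule.span ℝ {θ})ᗮ) 1,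
    φ ((κ : (Submodule.span ℝ {θ})ᗮ) : Space)
    ∂(volume : Measure (Submodule.span ℝ {θ})ᗮ).toSphere

/-- The truncated integral `∫_{κ ∈ S², |κ · θ| > ε} φ(κ) / (κ · θ) dΩ(κ)`. -/
def pvSphereTrunc (φ : Space → Vec) (θ : Space) (ε : ℝ) : Vec :=
  ∫ κ : Metric.sphere (0 : Space) 1 in {κ | ε < |inner ℝ (κ : Space) θ|},
    (inner ℝ (κ : Space) θ)⁻¹ • φ κ ∂(volume : Measure Space).toSphere

/-- The principal-value integral of `φ(κ) / (κ · θ)` over the sphere converges, with an integrand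
that is integrable off every neighbourhood of the great circle `κ · θ = 0`. -/
def PvSphereExists (φ : Space → Vec) (θ : Space) : Prop :=
  (∀ ε > 0, IntegrableOn (fun κ : Metric.sphere (0 : Space) 1 =>
    (inner ℝ (κ : Space) θ)⁻¹ • φ κ) {κ | ε < |inner ℝ (κ : Space) θ|}
    (volume : Measure Space).toSphere) ∧
  ∃ v, Tendsto (pvSphereTrunc φ θ) (𝓝[>] 0) (𝓝 v)

/-- The principal-value integral `PV ∫_{S²} φ(κ) / (κ · θ) dΩ(κ)`. -/
def pvSphere (φ : Space → Vec) (θ : Space) : Vec :=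
  limUnder (𝓝[>] 0) (pvSphereTrunc φ θ)

/-- The superposition `∫_{S²} exp(i ν κ · x) g(κ) dΩ(κ)` of plane waves, with amplitude `g` on the
unit sphere (the inverse spherical curl transform, when `g` is polarized). -/
def sphereSuperposition (ν : ℝ) (g : Space → Vec) (x : Space) : Vec :=
  ∫ κ : Metric.sphere (0 : Space) 1,
    Complex.exp (Complex.I * ((ν * inner ℝ (κ : Space) x : ℝ) : ℂ)) • g κ
    ∂(volume : Measure Space).toSphere

/-- On a plane on which `F` is integrable, the Radon transform is the ordinary integral. -/
theorem radon_eq_integral (F : Space → Vec) (p : ℝ) (κ : Space)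
    (hF : Integrable fun y : (Submodule.span ℝ {κ})ᗮ => F (p • κ + (y : Space))) :
    radon F p κ = ∫ y : (Submodule.span ℝ {κ})ᗮ, F (p • κ + (y : Space)) := by
  refine Tendsto.limUnder_eq ?_
  refine tendsto_integral_filter_of_dominated_convergence
    (fun y => ‖F (p • κ + (y : Space))‖) ?_ ?_ hF.norm ?_
  · refine Eventually.of_forall fun ε => ?_
    have h : Continuous fun y : (Submodule.span ℝ {κ})ᗮ => Real.exp (-ε * ‖y‖ ^ 2) := by fun_prop
    exact h.aestronglyMeasurable.smul hF.aestronglyMeasurable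
  · filter_upwards [self_mem_nhdsWithin] with ε hε
    refine Eventually.of_forall fun y => ?_
    rw [norm_smul, Real.norm_eq_abs, Real.abs_exp]
    refine mul_le_of_le_one_left (norm_nonneg _) (Real.exp_le_one_iff.2 ?_)
    have : 0 ≤ ε * ‖y‖ ^ 2 := mul_nonneg (le_of_lt hε) (sq_nonneg _)
    linarith
  · refine Eventually.of_forall fun y => ?_
    have h : Continuous fun ε : ℝ => Real.exp (-ε * ‖y‖ ^ 2) • F (p • κ + (y : Space)) := by
      fun_prop
    have h0 := (h.tendsto 0).mono_left (nhdsWithin_le_nhds (s := Set.Ioi (0 : ℝ)))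
    simpa using h0

/-- Where the Newtonian integral converges absolutely, it is the Riesz potential. -/
theorem rieszPotential_eq_integral (F : Space → Vec) (x : Space)
    (hF : Integrable fun y : Space => (4 * Real.pi * ‖y‖)⁻¹ • F (x - y)) :
    rieszPotential F x = ∫ y : Space, (4 * Real.pi * ‖y‖)⁻¹ • F (x - y) := by
  refine Tendsto.limUnder_eq ?_
  have hR : rieszReg F x = fun ε : ℝ => ∫ y : Space,
      Real.exp (-ε * ‖y‖ ^ 2) • ((4 * Real.pi * ‖y‖)⁻¹ • F (x - y)) := by
    funext ε
    simp only [rieszReg, mul_smul]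
  rw [hR]
  refine tendsto_integral_filter_of_dominated_convergence
    (fun y => ‖(4 * Real.pi * ‖y‖)⁻¹ • F (x - y)‖) ?_ ?_ hF.norm ?_
  · refine Eventually.of_forall fun ε => ?_
    have h : Continuous fun y : Space => Real.exp (-ε * ‖y‖ ^ 2) := by fun_prop
    exact h.aestronglyMeasurable.smul hF.aestronglyMeasurable
  · filter_upwards [self_mem_nhdsWithin] with ε hε
    refine Eventually.of_forall fun y => ?_
    rw [norm_smul, Real.norm_eq_abs, Real.abs_exp]
    refine mul_le_of_le_one_left (norm_nonneg _) (Real.exp_le_one_iff.2 ?_)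
    have : 0 ≤ ε * ‖y‖ ^ 2 := mul_nonneg (le_of_lt hε) (sq_nonneg _)
    linarith
  · refine Eventually.of_forall fun y => ?_
    have h : Continuous fun ε : ℝ =>
        Real.exp (-ε * ‖y‖ ^ 2) • ((4 * Real.pi * ‖y‖)⁻¹ • F (x - y)) := by
      fun_prop
    have h0 := (h.tendsto 0).mono_left (nhdsWithin_le_nhds (s := Set.Ioi (0 : ℝ)))
    simpa using h0

/-- On a line on which `F` is integrable, the X-ray transform is the ordinary integral. -/
theorem xray_eq_integral (F : Space → Vec) (θ x : Space)
    (hF : Integrable fun s : ℝ => F (x + s • θ)) :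
    xray F θ x = ∫ s : ℝ, F (x + s • θ) :=
  Tendsto.limUnder_eq
    (intervalIntegral_tendsto_integral hF tendsto_neg_atTop_atBot tendsto_id)

end BiotSavartXray

end

open BiotSavartXray

/-! The three parts rest on three different mechanisms.

Trkalian fields. Formally `curl F = ν F` gives `div F = 0` and `ΔF = -ν² F`, so `F / ν²` is the
natural candidate for the Riesz potential; the point is that Gaussian summation selects it. For
`H(y) = F(x - y)` consider the Gaussian average `Q(t) = ∫ exp(-t|y|²) H(y) dy`. As `H` is only `C¹`,
the Helmholtz equation is replaced by identities between Gaussian moments, each of them one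
integration by parts of the curl (`gaussian_helmholtz`). They turn into a linear differential
equation for `Q` in `t`; with the limit `t → ∞` as normalization, `Q(t) = (π/t)^(3/2) exp(-ν²/(4t))
H(0)` (`gaussian_integral_of_curl_eq`). Since `1/|y|` is a superposition of Gaussians, the
regularized potential is `F(x)` times a scalar integral that tends to `1/ν²`. One curl gives `BS[F]
= F/ν`, and the line transforms follow by linearity.

Superpositions of plane waves. On a line, `F(x + sθ) = ∫ exp(iνsu) L(u) du` over `-1 < u < 1`, where
`L(u)` is the integral of the phased amplitude over the circle of latitude at height `u` above the
equator `θ^⊥`. The symmetric integral in `s` reproduces `L(0)` (Dirichlet integral and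
Riemann–Lebesgue), the signed one the principal value of `L(u)/u`. In the Radon transform the
Gaussian regularization concentrates the amplitude at the two poles: `F^R(p, κ) = (4π²/ν²) (exp(iνp)
g(κ) + exp(-iνp) g(-κ))`. Applied to `iκ × g - g`, whose superposition vanishes by the curl
equation, the same formula forces the polarization `κ × g(κ) = -i g(κ)` (`cross_amplitude`). Both
sides of every formula are then explicit multiples of `L(0)` or of the principal value.

Schwartz fields. Both sides of the X-ray formulas become volume integrals of a vector kernel crossed
with `F(x - z)`. Let `w` be the component of `z` perpendicular to `θ`. The Biot–Savart kernel is
`-z/(4π|z|³)`, and the integral of `z/|z|³` along the direction `θ` is `2w/|w|²`, its signed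
integral `2 perpKernel θ z`. On the other side, the truncated Hilbert transform of `F^R` is a volume
integral against `1/(κ·z)`, and the integral of `κ/(κ·z)` over the great circle `θ^⊥` is `2πw/|w|²`
(`IsFrame.integral_circle_inv`). For the principal value the Radon transform is a delta function of
`κ·z`, approximated by Poisson kernels; it leaves the integral of `κ/(κ·θ)` over the great circle
`z^⊥`, which is the same lemma with `z` and `θ` exchanged.

For the Radon transform of `BS[F]` itself the gradient of the Newtonian potential is split along the
plane. It decays only like `|x|⁻²`, so the tangential part is not absolutely integrable there; but
the potential is asymptotic to that of a point charge, whose tangential derivatives are odd, and the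
Gaussian sums tend to `0`. The normal part is governed by the flux `2π sgn t` of `z/|z|³` through a
plane at signed distance `t`. Hence `BS[F]^R(p) = κ × (-½ ∫ sgn(t) F^R(p - t) dt)`, which is
differentiable in `p` with derivative `-κ × F^R(p)`. -/

noncomputable section

namespace BiotSavartXray

/-! ### Orthonormal frames and the measures they parametrize -/

/-- The unit vectors `e₁, e₂, e₃` form an orthonormal frame of space. -/
def IsFrame (e₁ e₂ e₃ : Space) : Prop := Orthonormal ℝ ![e₁, e₂, e₃]

theorem isFrame_iff {e₁ e₂ e₃ : Space} : IsFrame e₁ e₂ e₃ ↔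
    (‖e₁‖ = 1 ∧ ‖e₂‖ = 1 ∧ ‖e₃‖ = 1) ∧
      inner ℝ e₁ e₂ = 0 ∧ inner ℝ e₁ e₃ = 0 ∧ inner ℝ e₂ e₃ = 0 := by
  unfold IsFrame Orthonormal
  constructor
  · rintro ⟨h1, h2⟩
    refine ⟨⟨h1 0, h1 1, h1 2⟩, h2 (i := 0) (j := 1) (by decide),
      h2 (i := 0) (j := 2) (by decide), h2 (i := 1) (j := 2) (by decide)⟩
  · rintro ⟨⟨h1, h2, h3⟩, h12, h13, h23⟩
    refine ⟨fun i => ?_, fun i j hij => ?_⟩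
    · fin_cases i <;> assumption
    · have h21 := h12; have h31 := h13; have h32 := h23
      rw [real_inner_comm] at h21 h31 h32
      fin_cases i <;> fin_cases j <;> first | assumption | exact absurd rfl hij

theorem finrank_space : Module.finrank ℝ Space = 3 := by simp

theorem IsFrame.exists_basis {e₁ e₂ e₃ : Space} (h : IsFrame e₁ e₂ e₃) :
    ∃ b : OrthonormalBasis (Fin 3) ℝ Space, ⇑b = ![e₁, e₂, e₃] := by
  have h' : Orthonormal ℝ ![e₁, e₂, e₃] := h
  refine ⟨(basisOfOrthonormalOfCardEqFinrank h' (by simp)).toOrthonormalBasis (by simpa using h'),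
    by simp⟩

theorem exists_isFrame {θ : Space} (hθ : ‖θ‖ = 1) : ∃ e₁ e₂, IsFrame e₁ e₂ θ := by
  -- Only the vector at index `2` is prescribed; the other two entries are placeholders.
  have hn : Orthonormal ℝ (Set.domRestrict {2} ![θ, θ, θ]) := by
    rw [orthonormal_iff_ite]
    intro i j
    have : i = j := Subsingleton.elim _ _
    subst this
    obtain ⟨i, hi⟩ := i
    have : i = 2 := hi
    subst this
    simp [hθ]
  obtain ⟨b, hb⟩ := hn.exists_orthonormalBasis_extension_of_card_eq (ι := Fin 3) (by simp)
  have h2 : b 2 = θ := by simpa using hb 2 rfl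
  refine ⟨b 0, b 1, ?_⟩
  have : ![b 0, b 1, θ] = ⇑b := by
    funext i; fin_cases i <;> simp [h2]
  rw [IsFrame, this]
  exact b.orthonormal

/-- The point with coordinates `p` in a frame. -/
def framePoint (e₁ e₂ e₃ : Space) (p : ℝ × ℝ × ℝ) : Space :=
  p.1 • e₁ + p.2.1 • e₂ + p.2.2 • e₃

theorem continuous_framePoint (e₁ e₂ e₃ : Space) : Continuous (framePoint e₁ e₂ e₃) := by
  unfold framePoint; fun_prop

/-- The coordinate map is a chain of measure-preserving equivalences. The measurable embedding is
recorded as well, so that integrals can be transported without any measurability assumption on the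
integrand. -/
theorem measurePreserving_basis_three {E : Type*} [NormedAddCommGroup E] [InnerProductSpace ℝ E]
    [FiniteDimensional ℝ E] [MeasurableSpace E] [BorelSpace E] (b : OrthonormalBasis (Fin 3) ℝ E) :
    MeasurePreserving (fun p : ℝ × ℝ × ℝ => p.1 • b 0 + p.2.1 • b 1 + p.2.2 • b 2) ∧
    MeasurableEmbedding (fun p : ℝ × ℝ × ℝ => p.1 • b 0 + p.2.1 • b 1 + p.2.2 • b 2) := by
  let e1 : ℝ × ℝ × ℝ ≃ᵐ ℝ × (Fin 2 → ℝ) :=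
    (MeasurableEquiv.refl ℝ).prodCongr (MeasurableEquiv.finTwoArrow (α := ℝ)).symm
  have h1 : MeasurePreserving e1 :=
    (MeasurePreserving.id volume).prod (volume_preserving_finTwoArrow ℝ).symm
  let e2 : ℝ × (Fin 2 → ℝ) ≃ᵐ (Fin 3 → ℝ) :=
    (MeasurableEquiv.piFinSuccAbove (fun _ : Fin 3 => ℝ) 0).symm
  have h2 : MeasurePreserving e2 := (volume_preserving_piFinSuccAbove (fun _ : Fin 3 => ℝ) 0).symm
  let e3 : (Fin 3 → ℝ) ≃ᵐ EuclideanSpace ℝ (Fin 3) := MeasurableEquiv.toLp 2 (Fin 3 → ℝ)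
  have h3 : MeasurePreserving e3 := PiLp.volume_preserving_toLp (Fin 3)
  let e4 := b.repr.symm.toMeasurableEquiv
  have h4 : MeasurePreserving e4 := b.measurePreserving_repr_symm
  have key : (fun p : ℝ × ℝ × ℝ => p.1 • b 0 + p.2.1 • b 1 + p.2.2 • b 2) =
      e1.trans (e2.trans (e3.trans e4)) := by
    funext p
    have : (e1.trans (e2.trans (e3.trans e4))) p = b.repr.symm (WithLp.toLp 2 ![p.1, p.2.1, p.2.2]) := by
      simp only [MeasurableEquiv.coe_trans, Function.comp_apply]
      have : e2 (e1 p) = ![p.1, p.2.1, p.2.2] := by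
        funext i; fin_cases i <;> rfl
      rw [this]; rfl
    rw [this, ← OrthonormalBasis.sum_repr_symm]
    simp [Fin.sum_univ_three]
  rw [key]
  exact ⟨(h4.comp h3).comp (h2.comp h1), (e1.trans (e2.trans (e3.trans e4))).measurableEmbedding⟩

theorem measurePreserving_basis_two {E : Type*} [NormedAddCommGroup E] [InnerProductSpace ℝ E]
    [FiniteDimensional ℝ E] [MeasurableSpace E] [BorelSpace E] (b : OrthonormalBasis (Fin 2) ℝ E) :
    MeasurePreserving (fun p : ℝ × ℝ => p.1 • b 0 + p.2 • b 1) ∧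
    MeasurableEmbedding (fun p : ℝ × ℝ => p.1 • b 0 + p.2 • b 1) := by
  let e1 : ℝ × ℝ ≃ᵐ (Fin 2 → ℝ) := (MeasurableEquiv.finTwoArrow (α := ℝ)).symm
  have h1 : MeasurePreserving e1 := (volume_preserving_finTwoArrow ℝ).symm
  let e3 : (Fin 2 → ℝ) ≃ᵐ EuclideanSpace ℝ (Fin 2) := MeasurableEquiv.toLp 2 (Fin 2 → ℝ)
  have h3 : MeasurePreserving e3 := PiLp.volume_preserving_toLp (Fin 2)
  let e4 := b.repr.symm.toMeasurableEquiv
  have h4 : MeasurePreserving e4 := b.measurePreserving_repr_symm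
  have key : (fun p : ℝ × ℝ => p.1 • b 0 + p.2 • b 1) = e1.trans (e3.trans e4) := by
    funext p
    have : (e1.trans (e3.trans e4)) p = b.repr.symm (WithLp.toLp 2 ![p.1, p.2]) := by
      simp only [MeasurableEquiv.coe_trans, Function.comp_apply]
      have : e1 p = ![p.1, p.2] := by
        funext i; fin_cases i <;> rfl
      rw [this]; rfl
    rw [this, ← OrthonormalBasis.sum_repr_symm]
    simp [Fin.sum_univ_two]
  rw [key]
  exact ⟨h4.comp (h3.comp h1), (e1.trans (e3.trans e4)).measurableEmbedding⟩

theorem IsFrame.measurePreserving {e₁ e₂ e₃ : Space} (h : IsFrame e₁ e₂ e₃) :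
    MeasurePreserving (framePoint e₁ e₂ e₃) ∧ MeasurableEmbedding (framePoint e₁ e₂ e₃) := by
  obtain ⟨b, hb⟩ := h.exists_basis
  have := measurePreserving_basis_three b
  rw [hb] at this
  exact this

theorem IsFrame.mem_orthogonal {e₁ e₂ κ : Space} (h : IsFrame e₁ e₂ κ) (a b : ℝ) :
    a • e₁ + b • e₂ ∈ (Submodule.span ℝ {κ})ᗮ := by
  rw [Submodule.mem_orthogonal_singleton_iff_inner_left]
  obtain ⟨-, -, h13, h23⟩ := isFrame_iff.1 h
  simp [inner_add_left, inner_smul_left, h13, h23]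

/-- The point of the plane `κ^⊥` with coordinates `p` in a frame `e₁, e₂, κ`. -/
def IsFrame.planePoint {e₁ e₂ κ : Space} (h : IsFrame e₁ e₂ κ) (p : ℝ × ℝ) :
    (Submodule.span ℝ {κ})ᗮ :=
  ⟨p.1 • e₁ + p.2 • e₂, h.mem_orthogonal p.1 p.2⟩

theorem finrank_plane {κ : Space} (hκ : ‖κ‖ = 1) :
    Module.finrank ℝ (Submodule.span ℝ {κ})ᗮ = 2 := by
  have : Fact (Module.finrank ℝ Space = 2 + 1) := ⟨by simp⟩
  exact Submodule.finrank_orthogonal_span_singleton (n := 2) (v := κ)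
    (fun h0 => by simp [h0] at hκ)

theorem IsFrame.exists_planeBasis {e₁ e₂ κ : Space} (h : IsFrame e₁ e₂ κ) :
    ∃ b : OrthonormalBasis (Fin 2) ℝ (Submodule.span ℝ {κ})ᗮ,
      (b 0 : Space) = e₁ ∧ (b 1 : Space) = e₂ := by
  obtain ⟨⟨h1, h2, h3⟩, h12, h13, h23⟩ := isFrame_iff.1 h
  have m1 : e₁ ∈ (Submodule.span ℝ {κ})ᗮ := by simpa using h.mem_orthogonal 1 0
  have m2 : e₂ ∈ (Submodule.span ℝ {κ})ᗮ := by simpa using h.mem_orthogonal 0 1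
  have ho : Orthonormal ℝ ![(⟨e₁, m1⟩ : (Submodule.span ℝ {κ})ᗮ), ⟨e₂, m2⟩] := by
    have h21 := h12
    rw [real_inner_comm] at h21
    refine ⟨fun i => ?_, fun i j hij => ?_⟩
    · fin_cases i <;> simpa
    · fin_cases i <;> fin_cases j <;> first | exact absurd rfl hij | simpa
  refine ⟨(basisOfOrthonormalOfCardEqFinrank ho (by simp [finrank_plane h3])).toOrthonormalBasis
    (by simpa using ho), ?_, ?_⟩ <;> simp

theorem IsFrame.measurePreserving_plane {e₁ e₂ κ : Space} (h : IsFrame e₁ e₂ κ) :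
    MeasurePreserving h.planePoint ∧ MeasurableEmbedding h.planePoint := by
  obtain ⟨b, hb0, hb1⟩ := h.exists_planeBasis
  have := measurePreserving_basis_two b
  have e : (fun p : ℝ × ℝ => p.1 • b 0 + p.2 • b 1) = h.planePoint := by
    funext p
    apply Subtype.ext
    simp [IsFrame.planePoint, hb0, hb1]
  rwa [e] at this

theorem IsFrame.integral_plane {e₁ e₂ κ : Space} (h : IsFrame e₁ e₂ κ) {G : Type*}
    [NormedAddCommGroup G] [NormedSpace ℝ G] (f : (Submodule.span ℝ {κ})ᗮ → G) :
    ∫ y, f y = ∫ p, f (h.planePoint p) :=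
  (h.measurePreserving_plane.1.integral_comp h.measurePreserving_plane.2 f).symm

theorem IsFrame.integrable_plane {e₁ e₂ κ : Space} (h : IsFrame e₁ e₂ κ) {G : Type*}
    [NormedAddCommGroup G] (f : (Submodule.span ℝ {κ})ᗮ → G) :
    Integrable f ↔ Integrable (fun p => f (h.planePoint p)) :=
  (h.measurePreserving_plane.1.integrable_comp_emb h.measurePreserving_plane.2).symm

theorem IsFrame.integral_frame {e₁ e₂ e₃ : Space} (h : IsFrame e₁ e₂ e₃) {G : Type*}
    [NormedAddCommGroup G] [NormedSpace ℝ G] (f : Space → G) :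
    ∫ y, f y = ∫ p, f (framePoint e₁ e₂ e₃ p) :=
  (h.measurePreserving.1.integral_comp h.measurePreserving.2 f).symm

theorem IsFrame.integrable_frame {e₁ e₂ e₃ : Space} (h : IsFrame e₁ e₂ e₃) {G : Type*}
    [NormedAddCommGroup G] (f : Space → G) :
    Integrable f ↔ Integrable (fun p => f (framePoint e₁ e₂ e₃ p)) :=
  (h.measurePreserving.1.integrable_comp_emb h.measurePreserving.2).symm

theorem IsFrame.lintegral_frame {e₁ e₂ e₃ : Space} (h : IsFrame e₁ e₂ e₃) (f : Space → ENNReal) :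
    ∫⁻ y, f y = ∫⁻ p, f (framePoint e₁ e₂ e₃ p) :=
  (h.measurePreserving.1.lintegral_comp_emb h.measurePreserving.2 f).symm

theorem IsFrame.lintegral_plane {e₁ e₂ κ : Space} (h : IsFrame e₁ e₂ κ)
    (f : (Submodule.span ℝ {κ})ᗮ → ENNReal) :
    ∫⁻ y, f y = ∫⁻ p, f (h.planePoint p) :=
  (h.measurePreserving_plane.1.lintegral_comp_emb h.measurePreserving_plane.2 f).symm

theorem IsFrame.norm_sq {e₁ e₂ e₃ : Space} (h : IsFrame e₁ e₂ e₃) (a b c : ℝ) :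
    ‖a • e₁ + b • e₂ + c • e₃‖ ^ 2 = a ^ 2 + b ^ 2 + c ^ 2 := by
  obtain ⟨⟨h1, h2, h3⟩, h12, h13, h23⟩ := isFrame_iff.1 h
  rw [← real_inner_self_eq_norm_sq]
  simp only [inner_add_left, inner_add_right, inner_smul_left, inner_smul_right,
    real_inner_self_eq_norm_sq, h1, h2, h3, h12, h13, h23, real_inner_comm e₁, real_inner_comm e₂]
  simp
  ring

theorem IsFrame.norm_plane_sq {e₁ e₂ e₃ : Space} (h : IsFrame e₁ e₂ e₃) (a b : ℝ) :
    ‖a • e₁ + b • e₂‖ ^ 2 = a ^ 2 + b ^ 2 := by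
  simpa using h.norm_sq a b 0

theorem IsFrame.norm_planePoint_sq {e₁ e₂ κ : Space} (h : IsFrame e₁ e₂ κ) (p : ℝ × ℝ) :
    ‖h.planePoint p‖ ^ 2 = p.1 ^ 2 + p.2 ^ 2 :=
  h.norm_plane_sq p.1 p.2

/-- The unit vector at the angle `φ` in the plane of `e₁` and `e₂`. -/
def circlePoint (e₁ e₂ : Space) (φ : ℝ) : Space := Real.cos φ • e₁ + Real.sin φ • e₂

/-- The rotated frame. -/
theorem IsFrame.rotate {e₁ e₂ θ : Space} (h : IsFrame e₁ e₂ θ) (φ : ℝ) :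
    IsFrame (circlePoint e₁ e₂ φ) (circlePoint e₁ e₂ (φ + Real.pi / 2)) θ := by
  have hn := h.norm_plane_sq
  obtain ⟨⟨h1, h2, h3⟩, h12, h13, h23⟩ := isFrame_iff.1 h
  rw [isFrame_iff]
  have key : ∀ ψ, ‖circlePoint e₁ e₂ ψ‖ = 1 := by
    intro ψ
    have := hn (Real.cos ψ) (Real.sin ψ)
    rw [Real.cos_sq_add_sin_sq] at this
    exact (pow_eq_one_iff_of_nonneg (norm_nonneg _) two_ne_zero).1 this
  refine ⟨⟨key _, key _, h3⟩, ?_, ?_, ?_⟩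
  · simp only [circlePoint, inner_add_left, inner_add_right, inner_smul_left, inner_smul_right,
      real_inner_self_eq_norm_sq, h1, h2, h12, real_inner_comm e₁, Real.cos_add_pi_div_two,
      Real.sin_add_pi_div_two]
    simp; ring
  · simp [circlePoint, inner_add_left, inner_smul_left, h13, h23]
  · simp [circlePoint, inner_add_left, inner_smul_left, h13, h23]

theorem IsFrame.cycle {e₁ e₂ e₃ : Space} (h : IsFrame e₁ e₂ e₃) : IsFrame e₂ e₃ e₁ := by
  obtain ⟨⟨h1, h2, h3⟩, h12, h13, h23⟩ := isFrame_iff.1 h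
  exact isFrame_iff.2 ⟨⟨h2, h3, h1⟩, h23, by rwa [real_inner_comm], by rwa [real_inner_comm]⟩

theorem continuous_circlePoint (e₁ e₂ : Space) : Continuous (circlePoint e₁ e₂) := by
  unfold circlePoint; fun_prop

/-! ### Polar coordinates on the circle and on the sphere -/

open scoped Pointwise in
theorem smul_mem_cone_iff {E : Type*} [NormedAddCommGroup E] [NormedSpace ℝ E]
    (s : Set (Metric.sphere (0 : E) 1)) {r : ℝ} (hr : 0 < r) (u : Metric.sphere (0 : E) 1) :
    r • (u : E) ∈ Set.Ioo (0 : ℝ) 1 • ((↑) '' s : Set E) ↔ r < 1 ∧ u ∈ s := by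
  constructor
  · rintro ⟨t, ht, _, ⟨v, hv, rfl⟩, h⟩
    have h' : t • (v : E) = r • (u : E) := h
    have hn := congrArg norm h'
    rw [norm_smul, norm_smul, norm_eq_of_mem_sphere, norm_eq_of_mem_sphere, mul_one, mul_one,
      Real.norm_of_nonneg ht.1.le, Real.norm_of_nonneg hr.le] at hn
    subst hn
    refine ⟨ht.2, ?_⟩
    have : v = u := Subtype.ext (smul_right_injective E hr.ne' h')
    rwa [← this]
  · rintro ⟨h1, h2⟩
    exact ⟨r, ⟨hr, h1⟩, u, ⟨u, h2, rfl⟩, rfl⟩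

/-- The radial mass of a unit cone. It cancels the factor `dim E` in the definition of `toSphere`.
-/
theorem lintegral_Ioo_pow (n : ℕ) :
    ∫⁻ r in Set.Ioi (0 : ℝ), ENNReal.ofReal (r ^ n) * (Set.Iio (1 : ℝ)).indicator 1 r =
      (n + 1 : ENNReal)⁻¹ := by
  have h1 : ∀ r : ℝ, ENNReal.ofReal (r ^ n) * (Set.Iio (1 : ℝ)).indicator 1 r =
      (Set.Iio (1 : ℝ)).indicator (fun r => ENNReal.ofReal (r ^ n)) r := by
    intro r; by_cases h : r ∈ Set.Iio (1 : ℝ) <;> simp [h]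
  simp_rw [h1]
  rw [lintegral_indicator measurableSet_Iio, Measure.restrict_restrict measurableSet_Iio,
    Set.inter_comm, Set.Ioi_inter_Iio, ← Measure.restrict_congr_set Ioo_ae_eq_Ioc.symm,
    ← ofReal_integral_eq_lintegral_ofReal, ← intervalIntegral.integral_of_le zero_le_one]
  · rw [integral_pow]
    simp only [one_pow, ne_eq, Nat.add_eq_zero_iff, one_ne_zero, and_false, not_false_eq_true,
      zero_pow, sub_zero, one_div]
    rw [ENNReal.ofReal_inv_of_pos (by positivity), ENNReal.ofReal_add (by positivity) (by simp)]
    simp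
  · exact (intervalIntegral.intervalIntegrable_pow n (a := 0) (b := 1)).1
  · filter_upwards [ae_restrict_mem measurableSet_Ioc] with r hr
    exact pow_nonneg hr.1.le n

open scoped Pointwise in
/-- A polar decomposition of Lebesgue measure identifies the surface measure of the sphere. -/
theorem toSphere_eq_map {E : Type*} [NormedAddCommGroup E] [NormedSpace ℝ E]
    [MeasurableSpace E] [BorelSpace E] [FiniteDimensional ℝ E] (μ : Measure E)
    {α : Type*} [MeasurableSpace α] (ν : Measure α) (γ : α → Metric.sphere (0 : E) 1)
    (hγ : Measurable γ) (n : ℕ) (hn : Module.finrank ℝ E = n + 1)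
    (hpolar : ∀ f : E → ENNReal, Measurable f → ∫⁻ x, f x ∂μ =
      ∫⁻ a, (∫⁻ r in Set.Ioi (0 : ℝ), ENNReal.ofReal (r ^ n) * f (r • (γ a : E))) ∂ν) :
    μ.toSphere = Measure.map γ ν := by
  have hnt : Nontrivial E := Module.nontrivial_of_finrank_pos (R := ℝ) (by omega)
  refine Measure.ext fun s hs => ?_
  -- By definition, `toSphere` gives `s` the mass `dim E` times the volume of the cone `A` over `s`.
  rw [Measure.toSphere_apply' _ hs, Measure.map_apply hγ hs, hn]
  set A : Set E := Set.Ioo (0 : ℝ) 1 • ((↑) '' s : Set E)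
  -- Away from the origin the cone is the preimage of the product of `s` and an interval under the
  -- polar homeomorphism.
  have hA : MeasurableSet A := by
    have : A = (fun x : ({(0 : E)}ᶜ : Set E) => (x : E)) ''
        (homeomorphUnitSphereProd E ⁻¹' s ×ˢ Set.Iio ⟨1, Set.mem_Ioi.2 one_pos⟩) := by
      ext x
      constructor
      · rintro ⟨t, ht, _, ⟨v, hv, rfl⟩, rfl⟩
        have hne : t • (v : E) ≠ 0 := by
          refine smul_ne_zero ht.1.ne' ?_
          intro h0; have := norm_eq_of_mem_sphere v; simp [h0] at this
        have e : (⟨t • (v : E), hne⟩ : ({(0 : E)}ᶜ : Set E)) =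
            (homeomorphUnitSphereProd E).symm (v, ⟨t, ht.1⟩) := by
          apply Subtype.ext; simp
        refine ⟨⟨t • (v : E), hne⟩, ?_, rfl⟩
        rw [e]
        simp only [Set.mem_preimage, Homeomorph.apply_symm_apply]
        exact ⟨hv, ht.2⟩
      · rintro ⟨y, hy, rfl⟩
        obtain ⟨⟨v, t⟩, rfl⟩ := (homeomorphUnitSphereProd E).symm.surjective y
        simp only [Set.mem_preimage, Homeomorph.apply_symm_apply] at hy
        refine ⟨t, ⟨t.2, hy.2⟩, v, ⟨v, hy.1, rfl⟩, ?_⟩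
        simp
    rw [this]
    refine (MeasurableEmbedding.subtype_coe (measurableSet_singleton _).compl).measurableSet_image.2 ?_
    exact (homeomorphUnitSphereProd E).continuous.measurable (hs.prod measurableSet_Iio)
  have h1 : μ A = ∫⁻ a, (∫⁻ r in Set.Ioi (0 : ℝ),
      ENNReal.ofReal (r ^ n) * A.indicator 1 (r • (γ a : E))) ∂ν := by
    rw [← hpolar _ (measurable_one.indicator hA), lintegral_indicator_one hA]
  have h2 : ∀ a, ∫⁻ r in Set.Ioi (0 : ℝ),
      ENNReal.ofReal (r ^ n) * A.indicator 1 (r • (γ a : E)) =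
      (n + 1 : ENNReal)⁻¹ * (γ ⁻¹' s).indicator 1 a := by
    intro a
    rw [← lintegral_Ioo_pow n, ← lintegral_mul_const'']
    · refine setLIntegral_congr_fun measurableSet_Ioi fun r hr => ?_
      have := smul_mem_cone_iff s hr (γ a)
      change r • (γ a : E) ∈ A ↔ _ at this
      by_cases h3 : r < 1 <;> by_cases h4 : γ a ∈ s <;> simp [Set.indicator, h3, h4, this]
    · exact (Measurable.mul (by fun_prop) (measurable_one.indicator measurableSet_Iio)).aemeasurable
  simp_rw [h2] at h1
  rw [lintegral_const_mul _ (measurable_one.indicator (hγ hs)), lintegral_indicator_one (hγ hs)]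
    at h1
  rw [h1, ← mul_assoc]
  push_cast
  rw [ENNReal.mul_inv_cancel (by simp) (by finiteness), one_mul]

theorem lintegral_mul_left_real (f : ℝ → ENNReal) {a : ℝ} (ha : 0 < a) :
    ∫⁻ x, f x = ENNReal.ofReal a * ∫⁻ x, f (a * x) := by
  have h := Real.smul_map_volume_mul_left ha.ne'
  rw [abs_of_pos ha] at h
  conv_lhs => rw [← h]
  rw [lintegral_smul_measure, smul_eq_mul]
  congr 1
  exact (Homeomorph.mulLeft₀ a ha.ne').measurableEmbedding.lintegral_map _

theorem lintegral_Ioi_mul_left (f : ℝ → ENNReal) {a : ℝ} (ha : 0 < a) :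
    ∫⁻ x in Set.Ioi 0, f x = ENNReal.ofReal a * ∫⁻ x in Set.Ioi 0, f (a * x) := by
  rw [← lintegral_indicator measurableSet_Ioi, lintegral_mul_left_real _ ha,
    ← lintegral_indicator measurableSet_Ioi]
  congr 2
  funext x
  simp [Set.indicator, ha]

theorem lintegral_polar (f : ℝ × ℝ → ENNReal) (hf : Measurable f) :
    ∫⁻ p, f p = ∫⁻ φ in Set.Ioo (-Real.pi) Real.pi, ∫⁻ r in Set.Ioi (0 : ℝ),
      ENNReal.ofReal r * f (r * Real.cos φ, r * Real.sin φ) := by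
  rw [← lintegral_comp_polarCoord_symm, polarCoord_target, Measure.volume_eq_prod,
    ← Measure.prod_restrict, lintegral_prod_symm]
  · rfl
  · apply Measurable.aemeasurable
    have : Measurable (polarCoord.symm : ℝ × ℝ → ℝ × ℝ) := continuous_polarCoord_symm.measurable
    simp only [smul_eq_mul]
    fun_prop

/-- Arc length on the great circle orthogonal to `θ`. -/
theorem IsFrame.map_toSphere_plane {e₁ e₂ θ : Space} (h : IsFrame e₁ e₂ θ) :
    Measure.map (fun κ : Metric.sphere (0 : (Submodule.span ℝ {θ})ᗮ) 1 =>
      ((κ : (Submodule.span ℝ {θ})ᗮ) : Space))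
      (volume : Measure (Submodule.span ℝ {θ})ᗮ).toSphere =
    Measure.map (circlePoint e₁ e₂) (volume.restrict (Set.Ioo (-Real.pi) Real.pi)) := by
  have hnorm : ∀ φ : ℝ, h.planePoint (Real.cos φ, Real.sin φ) ∈
      Metric.sphere (0 : (Submodule.span ℝ {θ})ᗮ) 1 := by
    intro φ
    rw [mem_sphere_zero_iff_norm]
    refine (pow_eq_one_iff_of_nonneg (norm_nonneg _) two_ne_zero).1 ?_
    rw [h.norm_planePoint_sq]; simp
  let γ : ℝ → Metric.sphere (0 : (Submodule.span ℝ {θ})ᗮ) 1 := fun φ => ⟨_, hnorm φ⟩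
  have hγ : Measurable γ := by
    refine Measurable.subtype_mk ?_
    exact h.measurePreserving_plane.2.measurable.comp
      (Real.measurable_cos.prodMk Real.measurable_sin)
  have := toSphere_eq_map (volume : Measure (Submodule.span ℝ {θ})ᗮ)
    (volume.restrict (Set.Ioo (-Real.pi) Real.pi)) γ hγ 1
    (finrank_plane (isFrame_iff.1 h).1.2.2) (by
      intro f hf
      rw [h.lintegral_plane, lintegral_polar (fun p => f (h.planePoint p))
        (hf.comp h.measurePreserving_plane.2.measurable)]
      simp only [pow_one]
      congr 1; funext φ; congr 1; funext r; congr 2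
      apply Subtype.ext
      simp [IsFrame.planePoint, γ, mul_smul])
  rw [this, Measure.map_map (by fun_prop) hγ]
  rfl

/-- The point of the unit sphere whose direction is `κ_φ + c θ`. -/
def slopePoint (e₁ e₂ θ : Space) (p : ℝ × ℝ) : Space :=
  (√(1 + p.2 ^ 2))⁻¹ • (circlePoint e₁ e₂ p.1 + p.2 • θ)

theorem continuous_slopePoint (e₁ e₂ θ : Space) : Continuous (slopePoint e₁ e₂ θ) := by
  unfold slopePoint circlePoint
  have : ∀ p : ℝ × ℝ, √(1 + p.2 ^ 2) ≠ 0 := fun p => (Real.sqrt_pos.2 (by positivity)).ne'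
  fun_prop (disch := exact this _)

theorem IsFrame.norm_slopePoint {e₁ e₂ θ : Space} (h : IsFrame e₁ e₂ θ) (p : ℝ × ℝ) :
    ‖slopePoint e₁ e₂ θ p‖ = 1 := by
  have h1 : ‖circlePoint e₁ e₂ p.1 + p.2 • θ‖ ^ 2 = 1 + p.2 ^ 2 := by
    rw [circlePoint, h.norm_sq, Real.cos_sq_add_sin_sq]
  have h2 : ‖circlePoint e₁ e₂ p.1 + p.2 • θ‖ = √(1 + p.2 ^ 2) := by
    rw [← h1, Real.sqrt_sq (norm_nonneg _)]
  have h3 : 0 < √(1 + p.2 ^ 2) := Real.sqrt_pos.2 (by positivity)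
  rw [slopePoint, norm_smul, h2, norm_inv, Real.norm_of_nonneg h3.le, inv_mul_cancel₀ h3.ne']

/-- The density of the surface measure in the slope. -/
def slopeMeasure : Measure ℝ :=
  volume.withDensity fun c => ENNReal.ofReal ((√(1 + c ^ 2))⁻¹ ^ 3)

theorem IsFrame.lintegral_cylinder {e₁ e₂ θ : Space} (h : IsFrame e₁ e₂ θ) (f : Space → ENNReal)
    (hf : Measurable f) :
    ∫⁻ x, f x = ∫⁻ φ in Set.Ioo (-Real.pi) Real.pi, ∫⁻ r in Set.Ioi (0 : ℝ),
      ENNReal.ofReal r * ∫⁻ z : ℝ, f (r • circlePoint e₁ e₂ φ + z • θ) := by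
  have hm : Measurable fun q : (ℝ × ℝ) × ℝ =>
      f (framePoint e₁ e₂ θ (MeasurableEquiv.prodAssoc q)) :=
    hf.comp (h.measurePreserving.2.measurable.comp MeasurableEquiv.prodAssoc.measurable)
  rw [h.lintegral_frame, ← volume_preserving_prodAssoc.lintegral_comp_emb
    MeasurableEquiv.prodAssoc.measurableEmbedding, Measure.volume_eq_prod, lintegral_prod _
    hm.aemeasurable, lintegral_polar _ hm.lintegral_prod_right']
  congr 1; funext φ; congr 1; funext r; congr 2; funext z
  simp [framePoint, circlePoint, MeasurableEquiv.prodAssoc, mul_smul]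

instance : SFinite slopeMeasure := by unfold slopeMeasure; infer_instance

/-- In cylindrical coordinates put `z = rc`, which costs a factor `r`, and then rescale the radius
by `(1 + c²)^(-1/2)`. The point `r(κ_φ + cθ)` becomes `r` times `slopePoint`, and `r²` acquires the
factor `(1 + c²)^(-3/2)`. In the slope `c` both substitutions are mere dilations. -/
theorem IsFrame.map_toSphere {e₁ e₂ θ : Space} (h : IsFrame e₁ e₂ θ) :
    Measure.map (fun κ : Metric.sphere (0 : Space) 1 => (κ : Space))
      (volume : Measure Space).toSphere =
    Measure.map (slopePoint e₁ e₂ θ)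
      ((volume.restrict (Set.Ioo (-Real.pi) Real.pi)).prod slopeMeasure) := by
  let γ : ℝ × ℝ → Metric.sphere (0 : Space) 1 :=
    fun p => ⟨slopePoint e₁ e₂ θ p, by simp [h.norm_slopePoint]⟩
  have hγ : Measurable γ := (continuous_slopePoint e₁ e₂ θ).measurable.subtype_mk
  have := toSphere_eq_map (volume : Measure Space)
    ((volume.restrict (Set.Ioo (-Real.pi) Real.pi)).prod slopeMeasure) γ hγ 2 (by simp) (by
      intro f hf
      rw [h.lintegral_cylinder f hf, lintegral_prod]
      · congr 1; funext φ
        have hcp := continuous_circlePoint e₁ e₂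
        have e1 : ∀ r ∈ Set.Ioi (0 : ℝ), ENNReal.ofReal r *
            ∫⁻ z : ℝ, f (r • circlePoint e₁ e₂ φ + z • θ) =
            ∫⁻ c : ℝ, ENNReal.ofReal (r ^ 2) * f (r • (circlePoint e₁ e₂ φ + c • θ)) := by
          intro r hr
          rw [lintegral_mul_left_real _ hr, ← mul_assoc, ← ENNReal.ofReal_mul (le_of_lt hr), ← sq,
            ← lintegral_const_mul]
          · simp only [smul_add, smul_smul]
          · fun_prop
        rw [setLIntegral_congr_fun measurableSet_Ioi e1, lintegral_lintegral_swap]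
        · rw [slopeMeasure, lintegral_withDensity_eq_lintegral_mul]
          · congr 1; funext c
            have hc : 0 < (√(1 + c ^ 2))⁻¹ := inv_pos.2 (Real.sqrt_pos.2 (by positivity))
            rw [lintegral_Ioi_mul_left _ hc, Pi.mul_apply, ← lintegral_const_mul, ← lintegral_const_mul]
            · refine lintegral_congr fun r => ?_
              rw [← mul_assoc, ← mul_assoc, ← ENNReal.ofReal_mul (by positivity),
                ← ENNReal.ofReal_mul (by positivity)]
              congr 2
              · ring
              · simp only [γ, slopePoint, smul_smul]
                rw [mul_comm]
            · simp only [γ]; fun_prop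
            · fun_prop
          · fun_prop
          · have : Measurable fun q : ℝ × ℝ =>
                ENNReal.ofReal (q.2 ^ 2) * f (q.2 • (γ (φ, q.1) : Space)) := by
              have := hγ.comp ((measurable_const (a := φ)).prodMk
                (measurable_fst : Measurable (Prod.fst : ℝ × ℝ → ℝ)))
              fun_prop
            exact this.lintegral_prod_right'
        · fun_prop
      · have : Measurable fun q : (ℝ × ℝ) × ℝ =>
            ENNReal.ofReal (q.2 ^ 2) * f (q.2 • (γ q.1 : Space)) := by fun_prop
        exact this.lintegral_prod_right'.aemeasurable)
  rw [this, Measure.map_map (by fun_prop) hγ]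
  rfl

/-- The height on the unit sphere as a function of the slope. -/
def slopeHeight (c : ℝ) : ℝ := c / √(1 + c ^ 2)

theorem hasDerivAt_slopeHeight (c : ℝ) :
    HasDerivAt slopeHeight ((√(1 + c ^ 2))⁻¹ ^ 3) c := by
  have hpos : 0 < 1 + c ^ 2 := by positivity
  have hs : 0 < √(1 + c ^ 2) := Real.sqrt_pos.2 hpos
  have h1 : HasDerivAt (fun c : ℝ => 1 + c ^ 2) (2 * c) c := by
    simpa using (hasDerivAt_pow 2 c).const_add 1
  have h2 := (hasDerivAt_id c).fun_div (h1.sqrt hpos.ne') hs.ne'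
  refine h2.congr_deriv ?_
  have h3 : √(1 + c ^ 2) ^ 2 = 1 + c ^ 2 := Real.sq_sqrt hpos.le
  simp only [id]
  field_simp
  rw [h3]; ring

theorem sq_slopeHeight (c : ℝ) : slopeHeight c ^ 2 = 1 - (1 + c ^ 2)⁻¹ := by
  rw [slopeHeight, div_pow, Real.sq_sqrt (by positivity)]
  field_simp; ring

theorem slopeHeight_mem (c : ℝ) : slopeHeight c ∈ Set.Ioo (-1 : ℝ) 1 := by
  have : slopeHeight c ^ 2 < 1 := by
    rw [sq_slopeHeight]
    have : 0 < (1 + c ^ 2)⁻¹ := by positivity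
    linarith
  exact abs_lt.1 ((sq_lt_one_iff_abs_lt_one _).1 this)

theorem slopeHeight_injective : Function.Injective slopeHeight := by
  refine (strictMono_of_deriv_pos fun c => ?_).injective
  rw [(hasDerivAt_slopeHeight c).deriv]
  have : 0 < √(1 + c ^ 2) := Real.sqrt_pos.2 (by positivity)
  positivity

theorem range_slopeHeight : Set.range slopeHeight = Set.Ioo (-1) 1 := by
  refine Set.Subset.antisymm (Set.range_subset_iff.2 slopeHeight_mem) fun u hu => ?_
  have h1 : 0 < 1 - u ^ 2 := by nlinarith [hu.1, hu.2]
  refine ⟨u / √(1 - u ^ 2), ?_⟩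
  have h2 : 1 + (u / √(1 - u ^ 2)) ^ 2 = (1 - u ^ 2)⁻¹ := by
    rw [div_pow, Real.sq_sqrt h1.le]; field_simp; ring
  have h3 : √(1 - u ^ 2) ≠ 0 := (Real.sqrt_pos.2 h1).ne'
  rw [slopeHeight, h2, Real.sqrt_inv]
  field_simp

theorem measurable_slopeHeight : Measurable slopeHeight := by
  unfold slopeHeight; fun_prop

/-- The derivative of the height in the slope is exactly the density of `slopeMeasure`. -/
theorem map_slopeHeight :
    Measure.map slopeHeight slopeMeasure = volume.restrict (Set.Ioo (-1) 1) := by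
  refine Measure.ext fun s hs => ?_
  rw [Measure.map_apply measurable_slopeHeight hs, slopeMeasure,
    withDensity_apply _ (measurable_slopeHeight hs), Measure.restrict_apply hs,
    ← lintegral_indicator (measurable_slopeHeight hs),
    ← Measure.restrict_apply' measurableSet_Ioo, ← lintegral_indicator_one hs, ← range_slopeHeight,
    ← Set.image_univ, lintegral_image_eq_lintegral_abs_deriv_mul MeasurableSet.univ
      (fun c _ => (hasDerivAt_slopeHeight c).hasDerivWithinAt) slopeHeight_injective.injOn]
  simp only [Measure.restrict_univ]
  congr 1; funext c
  rw [abs_of_nonneg (by positivity)]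
  by_cases h : slopeHeight c ∈ s <;> simp [Set.indicator, h]

/-- The point of the unit sphere at the height `u` and the longitude `φ`. -/
def heightPoint (e₁ e₂ θ : Space) (p : ℝ × ℝ) : Space :=
  √(1 - p.2 ^ 2) • circlePoint e₁ e₂ p.1 + p.2 • θ

theorem continuous_heightPoint (e₁ e₂ θ : Space) : Continuous (heightPoint e₁ e₂ θ) := by
  unfold heightPoint circlePoint
  fun_prop

theorem slopePoint_eq_heightPoint (e₁ e₂ θ : Space) (φ c : ℝ) :
    slopePoint e₁ e₂ θ (φ, c) = heightPoint e₁ e₂ θ (φ, slopeHeight c) := by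
  rw [slopePoint, heightPoint, sq_slopeHeight, sub_sub_cancel, Real.sqrt_inv, smul_add,
    smul_smul, slopeHeight, inv_mul_eq_div]

/-- Archimedes: the area of the sphere is uniform in longitude and height. Every sphere integral
below is taken in these coordinates. -/
theorem IsFrame.map_toSphere_height {e₁ e₂ θ : Space} (h : IsFrame e₁ e₂ θ) :
    Measure.map (fun κ : Metric.sphere (0 : Space) 1 => (κ : Space))
      (volume : Measure Space).toSphere =
    Measure.map (heightPoint e₁ e₂ θ)
      ((volume.restrict (Set.Ioo (-Real.pi) Real.pi)).prod (volume.restrict (Set.Ioo (-1) 1))) := by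
  have hmp : MeasurePreserving slopeHeight slopeMeasure (volume.restrict (Set.Ioo (-1) 1)) :=
    ⟨measurable_slopeHeight, map_slopeHeight⟩
  have hp := (MeasurePreserving.id (volume.restrict (Set.Ioo (-Real.pi) Real.pi))).prod hmp
  rw [h.map_toSphere, ← hp.map_eq, Measure.map_map (continuous_heightPoint e₁ e₂ θ).measurable
    hp.measurable]
  congr 1
  funext p
  exact slopePoint_eq_heightPoint e₁ e₂ θ p.1 p.2

theorem measurableEmbedding_coe_sphere (E : Type*) [NormedAddCommGroup E] [MeasurableSpace E]
    [BorelSpace E] :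
    MeasurableEmbedding fun κ : Metric.sphere (0 : E) 1 => (κ : E) :=
  MeasurableEmbedding.subtype_coe Metric.isClosed_sphere.measurableSet

theorem measurableEmbedding_coe_greatCircle (θ : Space) :
    MeasurableEmbedding fun κ : Metric.sphere (0 : (Submodule.span ℝ {θ})ᗮ) 1 =>
      ((κ : (Submodule.span ℝ {θ})ᗮ) : Space) :=
  (MeasurableEmbedding.subtype_coe
    (Submodule.closed_of_finiteDimensional _).measurableSet).comp
    (measurableEmbedding_coe_sphere (Submodule.span ℝ {θ})ᗮ)

theorem IsFrame.funkIntegrable_iff {e₁ e₂ θ : Space} (h : IsFrame e₁ e₂ θ) {f : Space → Vec}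
    (hf : StronglyMeasurable f) : FunkIntegrable f θ ↔
      IntegrableOn (fun φ => f (circlePoint e₁ e₂ φ)) (Set.Ioo (-Real.pi) Real.pi) := by
  have h1 := (measurableEmbedding_coe_greatCircle θ).integrable_map_iff
    (μ := (volume : Measure (Submodule.span ℝ {θ})ᗮ).toSphere) (g := f)
  rw [h.map_toSphere_plane, integrable_map_measure hf.aestronglyMeasurable
    (continuous_circlePoint e₁ e₂).aemeasurable] at h1
  exact h1.symm

theorem IsFrame.funk_eq {e₁ e₂ θ : Space} (h : IsFrame e₁ e₂ θ) {f : Space → Vec}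
    (hf : StronglyMeasurable f) :
    funk f θ = ∫ φ in Set.Ioo (-Real.pi) Real.pi, f (circlePoint e₁ e₂ φ) := by
  have h1 := (measurableEmbedding_coe_greatCircle θ).integral_map
    (μ := (volume : Measure (Submodule.span ℝ {θ})ᗮ).toSphere) f
  rw [h.map_toSphere_plane, integral_map (continuous_circlePoint e₁ e₂).aemeasurable
    hf.aestronglyMeasurable] at h1
  exact h1.symm

theorem coe_greatCircle {θ : Space} (κ : Metric.sphere (0 : (Submodule.span ℝ {θ})ᗮ) 1) :
    ‖((κ : (Submodule.span ℝ {θ})ᗮ) : Space)‖ = 1 :=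
  norm_eq_of_mem_sphere κ

theorem funk_congr {f g : Space → Vec} (θ : Space) (hfg : ∀ κ : Space, ‖κ‖ = 1 → f κ = g κ) :
    funk f θ = funk g θ := by
  unfold funk
  congr 1; funext κ
  exact hfg _ (coe_greatCircle κ)

theorem funkIntegrable_congr {f g : Space → Vec} (θ : Space)
    (hfg : ∀ κ : Space, ‖κ‖ = 1 → f κ = g κ) : FunkIntegrable f θ ↔ FunkIntegrable g θ := by
  unfold FunkIntegrable
  have : (fun κ : Metric.sphere (0 : (Submodule.span ℝ {θ})ᗮ) 1 =>
      f ((κ : (Submodule.span ℝ {θ})ᗮ) : Space)) =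
      fun κ : Metric.sphere (0 : (Submodule.span ℝ {θ})ᗮ) 1 => g ((κ : (Submodule.span ℝ {θ})ᗮ) : Space) := by
    funext κ
    exact hfg _ (coe_greatCircle κ)
  rw [this]

section SphereIntegrals

variable {G : Type*} [NormedAddCommGroup G] {e₁ e₂ θ : Space}

theorem IsFrame.integral_sphere_height [NormedSpace ℝ G] (h : IsFrame e₁ e₂ θ) {f : Space → G}
    (hf : StronglyMeasurable f) :
    ∫ κ : Metric.sphere (0 : Space) 1, f κ ∂(volume : Measure Space).toSphere =
      ∫ p, f (heightPoint e₁ e₂ θ p)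
        ∂((volume.restrict (Set.Ioo (-Real.pi) Real.pi)).prod
          (volume.restrict (Set.Ioo (-1) 1))) := by
  have h1 := (measurableEmbedding_coe_sphere Space).integral_map
    (μ := (volume : Measure Space).toSphere) f
  rw [h.map_toSphere_height, integral_map (continuous_heightPoint e₁ e₂ θ).aemeasurable
    hf.aestronglyMeasurable] at h1
  exact h1.symm

end SphereIntegrals

/-! ### The cross product and the curl -/

theorem cross_apply (κ : Space) (v : Vec) :
    cross κ v = ![κ 1 * v 2 - κ 2 * v 1, κ 2 * v 0 - κ 0 * v 2, κ 0 * v 1 - κ 1 * v 0] := by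
  rw [cross, crossProduct]
  rfl

theorem abs_coord_le (κ : Space) (i : Fin 3) : |κ i| ≤ ‖κ‖ := PiLp.norm_apply_le κ i

theorem norm_cross_le (κ : Space) (v : Vec) : ‖cross κ v‖ ≤ 2 * ‖κ‖ * ‖v‖ := by
  have key : ∀ i j k l : Fin 3, ‖(κ i : ℂ) * v j - κ k * v l‖ ≤ 2 * ‖κ‖ * ‖v‖ := by
    intro i j k l
    have h : ∀ i j : Fin 3, ‖(κ i : ℂ) * v j‖ ≤ ‖κ‖ * ‖v‖ := by
      intro i j
      rw [norm_mul, Complex.norm_real]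
      exact mul_le_mul (abs_coord_le κ i) (norm_le_pi_norm v j) (norm_nonneg _) (norm_nonneg _)
    refine (norm_sub_le _ _).trans ?_
    linarith [h i j, h k l]
  rw [cross_apply, pi_norm_le_iff_of_nonneg (by positivity)]
  intro i
  fin_cases i <;> exact key _ _ _ _

/-- The cross product as a continuous bilinear map. -/
def crossL : Space →L[ℝ] Vec →L[ℝ] Vec :=
  LinearMap.mkContinuous₂
    (LinearMap.mk₂ ℝ cross
      (by intro a b v; simp only [cross_apply]; funext i; fin_cases i <;> simp <;> ring)
      (by intro c a v; simp only [cross_apply]; funext i; fin_cases i <;> simp <;> ring)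
      (by intro a v w; simp only [cross_apply]; funext i; fin_cases i <;> simp <;> ring)
      (by intro c a v; simp only [cross_apply]; funext i; fin_cases i <;> simp <;> ring))
    2 norm_cross_le

@[simp]
theorem crossL_apply (κ : Space) (v : Vec) : crossL κ v = cross κ v := rfl

theorem cross_smul_left (c : ℝ) (κ : Space) (v : Vec) : cross (c • κ) v = c • cross κ v := by
  simp [← crossL_apply]

theorem cross_smul_right (c : ℝ) (κ : Space) (v : Vec) : cross κ (c • v) = c • cross κ v := by
  simp [← crossL_apply]

theorem cross_neg_left (κ : Space) (v : Vec) : cross (-κ) v = -cross κ v := by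
  simp [← crossL_apply]

theorem cross_neg (κ : Space) (v : Vec) : cross κ (-v) = -cross κ v := by
  simp [← crossL_apply]

theorem continuous_cross {α : Type*} [TopologicalSpace α] {f : α → Space} {g : α → Vec}
    (hf : Continuous f) (hg : Continuous g) : Continuous fun a => cross (f a) (g a) :=
  (crossL.continuous₂).comp (hf.prodMk hg)

theorem integral_cross {α : Type*} [MeasurableSpace α] {μ : Measure α} (κ : Space) {f : α → Vec}
    (hf : Integrable f μ) : ∫ a, cross κ (f a) ∂μ = cross κ (∫ a, f a ∂μ) :=
  (crossL κ).integral_comp_comm hf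

theorem integral_cross_left {α : Type*} [MeasurableSpace α] {μ : Measure α} (v : Vec)
    {f : α → Space} (hf : Integrable f μ) :
    ∫ a, cross (f a) v ∂μ = cross (∫ a, f a ∂μ) v :=
  (crossL.flip v).integral_comp_comm hf

/-- The Cartesian basis vectors. -/
def cartesian (j : Fin 3) : Space := EuclideanSpace.single j 1

theorem norm_cartesian (j : Fin 3) : ‖cartesian j‖ = 1 := by simp [cartesian]

/-- In this form the curl is a sum of constant linear maps applied to directional derivatives, so
that integrations by parts and differentiations under the integral apply term by term. -/
theorem curl_eq_sum (F : Space → Vec) (x : Space) :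
    curl F x = ∑ j, cross (cartesian j) (fderiv ℝ F x (cartesian j)) := by
  simp only [curl, partialD, cross_apply, Fin.sum_univ_three, cartesian]
  funext i
  fin_cases i <;> simp <;> ring

/-! ### Integration by parts against a cut-off -/

/-- Dilates of a single bump function; the dilation by `n + 1` divides the gradient by `n + 1`. -/
theorem exists_cutoff : ∃ χ : ℕ → Space → ℝ, ∃ C : ℝ, (∀ n, ContDiff ℝ 1 (χ n)) ∧
    (∀ n, HasCompactSupport (χ n)) ∧ (∀ n y, |χ n y| ≤ 1) ∧
    (∀ y, Tendsto (fun n => χ n y) atTop (𝓝 1)) ∧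
    (∀ n y, ‖fderiv ℝ (χ n) y‖ ≤ C * ((n : ℝ) + 1)⁻¹) := by
  obtain ⟨ψ, hψ, hψc, h0, h1, hψ1⟩ : ∃ ψ : Space → ℝ, ContDiff ℝ 1 ψ ∧ HasCompactSupport ψ ∧
      (∀ y, 0 ≤ ψ y) ∧ (∀ y, ψ y ≤ 1) ∧ ψ 0 = 1 := by
    let ψ : ContDiffBump (0 : Space) := ⟨1, 2, one_pos, one_lt_two⟩
    exact ⟨ψ, ψ.contDiff, ψ.hasCompactSupport, fun _ => ψ.nonneg, fun _ => ψ.le_one,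
      ψ.one_of_mem_closedBall (by simp [ψ])⟩
  obtain ⟨C, hC⟩ := (hψ.continuous_fderiv one_ne_zero).bounded_above_of_compact_support
    (hψc.fderiv ℝ)
  have hpos : ∀ n : ℕ, (0 : ℝ) < ((n : ℝ) + 1)⁻¹ := fun n => by positivity
  refine ⟨fun n y => ψ (((n : ℝ) + 1)⁻¹ • y), C, fun n => ?_, fun n => ?_, fun n y => ?_,
    fun y => ?_, fun n y => ?_⟩
  · exact hψ.comp (contDiff_const_smul _)
  · exact hψc.comp_homeomorph (Homeomorph.smulOfNeZero _ (hpos n).ne')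
  · rw [abs_of_nonneg (h0 _)]; exact h1 _
  · have h1 : Tendsto (fun n : ℕ => ((n : ℝ) + 1)⁻¹ • y) atTop (𝓝 ((0 : ℝ) • y)) := by
      refine Tendsto.smul_const ?_ y
      simpa using tendsto_one_div_add_atTop_nhds_zero_nat (𝕜 := ℝ)
    rw [zero_smul] at h1
    have h2 := (hψ.continuous.tendsto (0 : Space)).comp h1
    rwa [hψ1] at h2
  · have h1 : HasFDerivAt (fun y : Space => ψ (((n : ℝ) + 1)⁻¹ • y))
        ((fderiv ℝ ψ (((n : ℝ) + 1)⁻¹ • y)).comp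
          (((n : ℝ) + 1)⁻¹ • ContinuousLinearMap.id ℝ Space)) y :=
      HasFDerivAt.comp (g := ψ) y
        (hψ.differentiable one_ne_zero).differentiableAt.hasFDerivAt
        (((n : ℝ) + 1)⁻¹ • ContinuousLinearMap.id ℝ Space).hasFDerivAt
    rw [h1.fderiv, ContinuousLinearMap.comp_smul, norm_smul, Real.norm_of_nonneg (hpos n).le,
      ContinuousLinearMap.comp_id, mul_comm]
    exact mul_le_mul_of_nonneg_right (hC _) (hpos n).le

theorem integrable_smul_of_hasCompactSupport {a : Space → ℝ} {f : Space → Vec}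
    (ha : Continuous a) (hc : HasCompactSupport a) (hf : Continuous f) :
    Integrable fun y => a y • f y :=
  (ha.smul hf).integrable_of_hasCompactSupport hc.smul_right

/-- Integration by parts for the curl, with a compactly supported weight. -/
theorem integral_smul_curl_of_hasCompactSupport {H : Space → Vec} (hH : ContDiff ℝ 1 H)
    {a : Space → ℝ} (ha : ContDiff ℝ 1 a) (hc : HasCompactSupport a) :
    ∫ y, a y • curl H y = -∑ j, cross (cartesian j) (∫ y, fderiv ℝ a y (cartesian j) • H y) := by
  have dH := hH.differentiable one_ne_zero
  have cDH := hH.continuous_fderiv one_ne_zero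
  have cDa := ha.continuous_fderiv one_ne_zero
  have i1 : ∀ j, Integrable fun y => a y • fderiv ℝ H y (cartesian j) := fun j =>
    integrable_smul_of_hasCompactSupport ha.continuous hc (by fun_prop)
  have i2 : ∀ j, Integrable fun y => fderiv ℝ a y (cartesian j) • H y := fun j =>
    integrable_smul_of_hasCompactSupport (by fun_prop) (hc.fderiv_apply ℝ _) hH.continuous
  have i3 := integrable_smul_of_hasCompactSupport ha.continuous hc hH.continuous
  calc ∫ y, a y • curl H y
      = ∫ y, ∑ j, cross (cartesian j) (a y • fderiv ℝ H y (cartesian j)) := by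
        congr 1; funext y
        rw [curl_eq_sum, Finset.smul_sum]
        simp only [cross_smul_right]
    _ = ∑ j, cross (cartesian j) (∫ y, a y • fderiv ℝ H y (cartesian j)) := by
        exact (integral_finsetSum _ fun j _ => (crossL (cartesian j)).integrable_comp (i1 j)).trans
          (Finset.sum_congr rfl fun j _ => integral_cross _ (i1 j))
    _ = _ := by
        rw [← Finset.sum_neg_distrib]
        refine Finset.sum_congr rfl fun j _ => ?_
        rw [integral_smul_fderiv_eq_neg_fderiv_smul_of_integrable (i2 j) (i1 j) i3
          (fun y _ => ha.differentiable one_ne_zero y) (fun y _ => dH y), ← crossL_apply, map_neg,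
          crossL_apply]

/-- Integration by parts for the curl against a scalar weight. -/
theorem integral_smul_curl {H : Space → Vec} (hH : ContDiff ℝ 1 H) {φ : Space → ℝ}
    (hφ : ContDiff ℝ 1 φ) (hc : Integrable fun y => φ y • curl H y)
    (hi : Integrable fun y => φ y • H y)
    (hd : ∀ j, Integrable fun y => fderiv ℝ φ y (cartesian j) • H y) :
    ∫ y, φ y • curl H y = -∑ j, cross (cartesian j) (∫ y, fderiv ℝ φ y (cartesian j) • H y) := by
  -- The compactly supported formula is applied to `χ n * φ`. The gradient of the cut-off is
  -- `O(1/n)` against the integrable `φ • H` and disappears in the limit.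
  obtain ⟨χ, C, hχ, hχc, hχ1, hχt, hχd⟩ := exists_cutoff
  have dφ := hφ.differentiable one_ne_zero
  have hprod : ∀ n y j, fderiv ℝ (fun y => χ n y * φ y) y (cartesian j) =
      χ n y * fderiv ℝ φ y (cartesian j) + φ y * fderiv ℝ (χ n) y (cartesian j) := by
    intro n y j
    rw [fderiv_fun_mul ((hχ n).differentiable one_ne_zero y) (dφ y)]
    simp
  have step : ∀ n, ∫ y, χ n y • (φ y • curl H y) = -∑ j, cross (cartesian j)
      (∫ y, χ n y • (fderiv ℝ φ y (cartesian j) • H y) +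
        fderiv ℝ (χ n) y (cartesian j) • (φ y • H y)) := by
    intro n
    simp_rw [smul_smul]
    rw [integral_smul_curl_of_hasCompactSupport hH ((hχ n).mul hφ) (hχc n).mul_right]
    simp only [hprod, add_smul, mul_comm (φ _)]
  have l1 : Tendsto (fun n => ∫ y, χ n y • (φ y • curl H y)) atTop (𝓝 (∫ y, φ y • curl H y)) := by
    refine tendsto_integral_of_dominated_convergence (fun y => ‖φ y • curl H y‖) (fun n => ?_)
      hc.norm (fun n => ?_) ?_
    · exact (hχ n).continuous.aestronglyMeasurable.smul hc.aestronglyMeasurable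
    · refine Eventually.of_forall fun y => ?_
      rw [norm_smul]
      exact mul_le_of_le_one_left (norm_nonneg _) (hχ1 n y)
    · refine Eventually.of_forall fun y => ?_
      simpa using (hχt y).smul_const (φ y • curl H y)
  have l2 : ∀ j, Tendsto (fun n => ∫ y, χ n y • (fderiv ℝ φ y (cartesian j) • H y) +
        fderiv ℝ (χ n) y (cartesian j) • (φ y • H y)) atTop
      (𝓝 (∫ y, fderiv ℝ φ y (cartesian j) • H y)) := by
    intro j
    have hb : ∀ n y, ‖fderiv ℝ (χ n) y (cartesian j)‖ ≤ C * ((n : ℝ) + 1)⁻¹ := fun n y => by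
      refine ((fderiv ℝ (χ n) y).le_opNorm _).trans ?_
      rw [norm_cartesian, mul_one]; exact hχd n y
    have hC : 0 ≤ C := by simpa using (norm_nonneg _).trans (hb 0 0)
    refine tendsto_integral_of_dominated_convergence
      (fun y => ‖fderiv ℝ φ y (cartesian j) • H y‖ + C * ‖φ y • H y‖) (fun n => ?_)
      ((hd j).norm.add (hi.norm.const_mul C)) (fun n => ?_) ?_
    · have cDχ := (hχ n).continuous_fderiv one_ne_zero
      have : Continuous fun y => fderiv ℝ (χ n) y (cartesian j) := by fun_prop
      exact ((hχ n).continuous.aestronglyMeasurable.smul (hd j).aestronglyMeasurable).add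
        (this.aestronglyMeasurable.smul hi.aestronglyMeasurable)
    · refine Eventually.of_forall fun y => ?_
      refine (norm_add_le _ _).trans (add_le_add ?_ ?_)
      · rw [norm_smul]
        exact mul_le_of_le_one_left (norm_nonneg _) (hχ1 n y)
      · rw [norm_smul]
        refine mul_le_mul_of_nonneg_right ((hb n y).trans ?_) (norm_nonneg _)
        refine mul_le_of_le_one_right hC (inv_le_one_of_one_le₀ ?_)
        have : (0 : ℝ) ≤ n := n.cast_nonneg
        linarith
    · refine Eventually.of_forall fun y => ?_
      have h0 : Tendsto (fun n => fderiv ℝ (χ n) y (cartesian j)) atTop (𝓝 0) := by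
        refine squeeze_zero_norm (fun n => hb n y) ?_
        simpa using (tendsto_one_div_add_atTop_nhds_zero_nat (𝕜 := ℝ)).const_mul C
      simpa using ((hχt y).smul_const (fderiv ℝ φ y (cartesian j) • H y)).add
        (h0.smul_const (φ y • H y))
  refine tendsto_nhds_unique l1 ?_
  simp_rw [step]
  refine Tendsto.neg (tendsto_finsetSum _ fun j _ => ?_)
  exact ((crossL (cartesian j)).continuous.tendsto _).comp (l2 j)

/-! ### Gaussian averages of Trkalian fields -/

theorem integrableOn_inv_one_add_sq_Ioi :
    IntegrableOn (fun r : ℝ => (1 + r ^ 2)⁻¹) (Set.Ioi 0) :=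
  integrable_inv_one_add_sq.integrableOn

/-- In polar coordinates the Jacobian `r²` absorbs the singularity `r⁻ʲ`, and the fourth power
leaves an integrable tail `r⁻²`. -/
theorem integrable_inv_norm_pow {j : ℕ} (hj : j ≤ 2) :
    Integrable fun y : Space => (‖y‖ ^ j)⁻¹ * ((1 + ‖y‖) ^ 4)⁻¹ := by
  refine (integrable_fun_norm_addHaar (volume : Measure Space)
    (f := fun r : ℝ => (r ^ j)⁻¹ * ((1 + r) ^ 4)⁻¹)).2 ?_
  rw [finrank_space]
  refine Integrable.mono' integrableOn_inv_one_add_sq_Ioi (by fun_prop) ?_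
  filter_upwards [ae_restrict_mem measurableSet_Ioi] with r hr
  have hr : 0 < r := hr
  rw [Real.norm_of_nonneg (by positivity), smul_eq_mul, ← mul_assoc, ← div_eq_mul_inv,
    ← div_eq_mul_inv, inv_eq_one_div, div_div, div_le_div_iff₀ (by positivity) (by positivity)]
  have h1 : r ^ (3 - 1) ≤ r ^ j * (1 + r) ^ 2 := by
    interval_cases j <;> norm_num <;> nlinarith [mul_pos hr hr, mul_pos hr (mul_pos hr hr)]
  have h2 : 1 + r ^ 2 ≤ (1 + r) ^ 2 := by nlinarith
  calc r ^ (3 - 1) * (1 + r ^ 2) ≤ r ^ j * (1 + r) ^ 2 * (1 + r) ^ 2 := by gcongr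
    _ = 1 * (r ^ j * (1 + r) ^ 4) := by ring

theorem exp_neg_mul_sq_mul_pow_le {t : ℝ} (ht : 0 < t) (k : ℕ) :
    ∃ C, 0 ≤ C ∧ ∀ r : ℝ, 0 ≤ r → Real.exp (-t * r ^ 2) * (1 + r) ^ k ≤ C := by
  -- The constant comes from `(1 + r)^k ≤ k! exp(1 + r)` and from completing the square: `r - t r² ≤
  -- 1/(4t)`.
  refine ⟨(k.factorial : ℝ) * Real.exp (1 + (4 * t)⁻¹), by positivity, fun r hr => ?_⟩
  have h1 : (1 + r) ^ k ≤ k.factorial * Real.exp (1 + r) := by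
    have := Real.pow_div_factorial_le_exp (1 + r) (by linarith) k
    rwa [div_le_iff₀ (by positivity), mul_comm] at this
  calc Real.exp (-t * r ^ 2) * (1 + r) ^ k
      ≤ Real.exp (-t * r ^ 2) * (k.factorial * Real.exp (1 + r)) := by gcongr
    _ = k.factorial * Real.exp (-t * r ^ 2 + (1 + r)) := by rw [Real.exp_add (-t * r ^ 2) (1 + r)]; ring
    _ ≤ _ := by
      refine mul_le_mul_of_nonneg_left (Real.exp_le_exp.2 ?_) (by positivity)
      have h2 : (4 * t)⁻¹ - (r - t * r ^ 2) = (4 * t)⁻¹ * (1 - 2 * t * r) ^ 2 := by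
        field_simp; ring
      have h3 : 0 ≤ (4 * t)⁻¹ * (1 - 2 * t * r) ^ 2 := by positivity
      linarith

/-- Polynomially bounded fields are integrable against a Gaussian, even with a factor `1 / |y|`. -/
theorem integrable_gaussian_smul {H : Space → Vec} (hH : AEStronglyMeasurable H) {C : ℝ} {N : ℕ}
    (hb : ∀ y, ‖H y‖ ≤ C * (1 + ‖y‖) ^ N) {t : ℝ} (ht : 0 < t) {j : ℕ} (hj : j ≤ 2) :
    Integrable fun y => (Real.exp (-t * ‖y‖ ^ 2) * (‖y‖ ^ j)⁻¹) • H y := by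
  obtain ⟨D, hD0, hD⟩ := exp_neg_mul_sq_mul_pow_le ht (N + 4)
  have hC : 0 ≤ C := by simpa using (norm_nonneg _).trans (hb 0)
  refine ((integrable_inv_norm_pow hj).const_mul (C * D)).mono' ?_ (Eventually.of_forall fun y => ?_)
  · have hm : Measurable fun y : Space => Real.exp (-t * ‖y‖ ^ 2) * (‖y‖ ^ j)⁻¹ := by fun_prop
    exact hm.aestronglyMeasurable.smul hH
  · rw [norm_smul, Real.norm_of_nonneg (by positivity)]
    have h1 := hD ‖y‖ (norm_nonneg y)
    have h2 : Real.exp (-t * ‖y‖ ^ 2) * (1 + ‖y‖) ^ N ≤ D * ((1 + ‖y‖) ^ 4)⁻¹ := by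
      rw [← div_eq_mul_inv, le_div_iff₀ (by positivity), mul_assoc, ← pow_add]
      exact h1
    calc Real.exp (-t * ‖y‖ ^ 2) * (‖y‖ ^ j)⁻¹ * ‖H y‖
        ≤ Real.exp (-t * ‖y‖ ^ 2) * (‖y‖ ^ j)⁻¹ * (C * (1 + ‖y‖) ^ N) := by gcongr; exact hb y
      _ = C * (‖y‖ ^ j)⁻¹ * (Real.exp (-t * ‖y‖ ^ 2) * (1 + ‖y‖) ^ N) := by ring
      _ ≤ C * (‖y‖ ^ j)⁻¹ * (D * ((1 + ‖y‖) ^ 4)⁻¹) := by gcongr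
      _ = _ := by ring

theorem integrable_polynomial_gaussian_smul {H : Space → Vec} (hH : AEStronglyMeasurable H) {C : ℝ}
    {N : ℕ} (hb : ∀ y, ‖H y‖ ≤ C * (1 + ‖y‖) ^ N) {t : ℝ} (ht : 0 < t) {p : Space → ℝ}
    (hp : Measurable p) {A : ℝ} {k : ℕ} (hpb : ∀ y, |p y| ≤ A * (1 + ‖y‖) ^ k) :
    Integrable fun y => (p y * Real.exp (-t * ‖y‖ ^ 2)) • H y := by
  have := integrable_gaussian_smul (H := fun y => p y • H y) (C := A * C) (N := k + N)
    (hp.aestronglyMeasurable.smul hH) (fun y => ?_) ht (Nat.zero_le 2)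
  · simpa [smul_smul, mul_comm] using this
  · rw [norm_smul, Real.norm_eq_abs, pow_add]
    calc |p y| * ‖H y‖ ≤ (A * (1 + ‖y‖) ^ k) * (C * (1 + ‖y‖) ^ N) :=
          mul_le_mul (hpb y) (hb y) (norm_nonneg _) ((abs_nonneg _).trans (hpb y))
      _ = _ := by ring

theorem hasFDerivAt_gaussian (t : ℝ) (y : Space) :
    HasFDerivAt (fun y : Space => Real.exp (-t * ‖y‖ ^ 2))
      (Real.exp (-t * ‖y‖ ^ 2) • (-t) • (2 • innerSL ℝ y)) y :=
  (((hasStrictFDerivAt_norm_sq y).hasFDerivAt).const_mul (-t)).exp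

theorem inner_cartesian (y : Space) (j : Fin 3) : inner ℝ y (cartesian j) = y j := by
  simp [cartesian, EuclideanSpace.inner_single_right]

theorem abs_coord_le_one_add (y : Space) (i : Fin 3) : |y i| ≤ 1 + ‖y‖ :=
  (abs_coord_le y i).trans (by linarith)

section GaussianMoments

variable {H : Space → Vec} {μ : ℝ} {C : ℝ} {N : ℕ} {t : ℝ}

/-- The curl equation tested against a polynomial times a Gaussian. Differentiating the Gaussian
raises the degree of the moment by one, with the factor `-2t`; differentiating `p` lowers it. -/
theorem smul_integral_polynomial_gaussian (hH : ContDiff ℝ 1 H) (hc : ∀ y, curl H y = μ • H y)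
    (hb : ∀ y, ‖H y‖ ≤ C * (1 + ‖y‖) ^ N) (ht : 0 < t) {p : Space → ℝ} (hp : ContDiff ℝ 1 p)
    {A : ℝ} {k : ℕ} (hpb : ∀ y, |p y| ≤ A * (1 + ‖y‖) ^ k)
    (hpd : ∀ y j, |fderiv ℝ p y (cartesian j)| ≤ A * (1 + ‖y‖) ^ k) :
    μ • ∫ y, (p y * Real.exp (-t * ‖y‖ ^ 2)) • H y =
      ∑ j, cross (cartesian j)
        ((2 * t) • (∫ y, (y j * p y * Real.exp (-t * ‖y‖ ^ 2)) • H y) -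
          ∫ y, (fderiv ℝ p y (cartesian j) * Real.exp (-t * ‖y‖ ^ 2)) • H y) := by
  have mH : AEStronglyMeasurable H := hH.continuous.aestronglyMeasurable
  have cD := hp.continuous_fderiv one_ne_zero
  have hd : ∀ y j, fderiv ℝ (fun y => p y * Real.exp (-t * ‖y‖ ^ 2)) y (cartesian j) =
      fderiv ℝ p y (cartesian j) * Real.exp (-t * ‖y‖ ^ 2) -
        2 * t * (y j * p y * Real.exp (-t * ‖y‖ ^ 2)) := by
    intro y j
    rw [(((hp.differentiable one_ne_zero y).hasFDerivAt).fun_mul (hasFDerivAt_gaussian t y)).fderiv]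
    simp [inner_cartesian]
    ring
  have i0 := integrable_polynomial_gaussian_smul mH hb ht hp.continuous.measurable hpb
  have i1 : ∀ j, Integrable fun y =>
      (fderiv ℝ p y (cartesian j) * Real.exp (-t * ‖y‖ ^ 2)) • H y := fun j =>
    integrable_polynomial_gaussian_smul mH hb ht
      (Continuous.measurable (by fun_prop)) (fun y => hpd y j)
  have i2 : ∀ j, Integrable fun y : Space =>
      (y j * p y * Real.exp (-t * ‖y‖ ^ 2)) • H y := fun j => by
    have hpm := hp.continuous
    refine integrable_polynomial_gaussian_smul mH hb ht (A := A) (k := k + 1)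
      (Continuous.measurable (by fun_prop)) (fun y => ?_)
    rw [abs_mul, pow_succ]
    calc |y j| * |p y| ≤ (1 + ‖y‖) * (A * (1 + ‖y‖) ^ k) :=
          mul_le_mul (abs_coord_le_one_add y j) (hpb y) (abs_nonneg _) (by positivity)
      _ = _ := by ring
  have hsplit : ∀ j, (fun y => fderiv ℝ (fun y => p y * Real.exp (-t * ‖y‖ ^ 2)) y (cartesian j) • H y)
      = fun y => (fderiv ℝ p y (cartesian j) * Real.exp (-t * ‖y‖ ^ 2)) • H y -
        (2 * t) • ((y j * p y * Real.exp (-t * ‖y‖ ^ 2)) • H y) := by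
    intro j; funext y
    rw [hd, sub_smul, mul_smul (2 * t)]
  have key := integral_smul_curl hH (φ := fun y => p y * Real.exp (-t * ‖y‖ ^ 2))
    (hp.mul (Real.contDiff_exp.comp (contDiff_const.mul (contDiff_norm_sq ℝ))))
    (by simp only [hc, smul_comm _ μ]; exact i0.smul μ) i0
    (fun j => by rw [hsplit]; exact (i1 j).sub ((i2 j).smul (2 * t)))
  simp only [hc, smul_comm _ μ] at key
  rw [integral_smul] at key
  rw [key, ← Finset.sum_neg_distrib]
  refine Finset.sum_congr rfl fun j _ => ?_
  have i3 : Integrable fun y : Space =>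
      (2 * t) • ((y j * p y * Real.exp (-t * ‖y‖ ^ 2)) • H y) := (i2 j).smul (2 * t)
  rw [hsplit, integral_sub (i1 j) i3, integral_smul, ← cross_neg, neg_sub]

theorem fderiv_coord (a j : Fin 3) (y : Space) :
    fderiv ℝ (fun y : Space => y a) y (cartesian j) = if a = j then 1 else 0 := by
  have : HasFDerivAt (fun y : Space => y a) (EuclideanSpace.proj a : Space →L[ℝ] ℝ) y :=
    (EuclideanSpace.proj a : Space →L[ℝ] ℝ).hasFDerivAt
  rw [this.fderiv]
  simp [cartesian]

theorem fderiv_coord_mul (a b j : Fin 3) (y : Space) :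
    fderiv ℝ (fun y : Space => y a * y b) y (cartesian j) =
      (if a = j then y b else 0) + if b = j then y a else 0 := by
  rw [fderiv_fun_mul (by fun_prop) (by fun_prop)]
  simp only [add_apply, smul_apply, fderiv_coord, smul_eq_mul]
  rw [add_comm]
  split_ifs <;> simp

/-- This is `ΔH = -μ² H` paired with the Gaussian, whose Laplacian is `(4t²|y|² - 6t) exp(-t|y|²)`.
Only first derivatives of `H` are available, so the identity is assembled from the curl equation
tested against Gaussian weights of degree `0`, `1` and `2`. -/
theorem moment_algebra (hμ : μ ≠ 0) {M0 : Vec} {M1 : Fin 3 → Vec} {M2 : Fin 3 → Fin 3 → Vec}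
    {M3 : Fin 3 → Fin 3 → Fin 3 → Vec}
    (E0 : μ • M0 = ∑ j, cross (cartesian j) ((2 * t) • M1 j))
    (E1 : ∀ a, μ • M1 a = ∑ j, cross (cartesian j)
      ((2 * t) • M2 j a - if a = j then M0 else 0))
    (E2 : ∀ a b, μ • M2 a b = ∑ j, cross (cartesian j)
      ((2 * t) • M3 j a b - ((if a = j then M1 b else 0) + if b = j then M1 a else 0)))
    (s3 : ∀ a b c, M3 a b c = M3 c b a) :
    (4 * t ^ 2) • (M2 0 0 + M2 1 1 + M2 2 2) = (6 * t - μ ^ 2) • M0 := by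
  have hμ' : (μ : ℂ) ≠ 0 := by exact_mod_cast hμ
  have f0 := fun i => congrFun E0 i
  have f1 := fun a i => congrFun (E1 a) i
  have f2 := fun a b i => congrFun (E2 a b) i
  -- The weak form of `div H = 0`, tested against `y_i exp(-t|y|²)`: the divergence of the curl of
  -- the field vanishes because the cubic moments are symmetric in their indices. The factor `μ` is
  -- kept until it can be cancelled.
  have hdiv : ∀ i, (μ : ℂ) * M0 i = μ * (2 * t * (M2 i 0 0 + M2 i 1 1 + M2 i 2 2)) := by
    intro i
    have a0 := f0 i
    have b0 := f2 i 0 0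
    have b1 := f2 i 1 1
    have b2 := f2 i 2 2
    have r1 := congrFun (s3 1 i 0) 2
    have r2 := congrFun (s3 2 i 0) 1
    have r3 := congrFun (s3 2 i 1) 0
    simp only [Fin.sum_univ_three, cross_apply, cartesian] at a0 b0 b1 b2
    obtain rfl | rfl | rfl : i = 0 ∨ i = 1 ∨ i = 2 := by fin_cases i <;> simp
    all_goals
      simp at a0 b0 b1 b2 r1 r2 r3
      linear_combination a0 - 2 * t * (b0 + b1 + b2) - 4 * t ^ 2 * (r1 - r2 + r3)
  have hdiv' := fun i => mul_left_cancel₀ hμ' (hdiv i)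
  funext i
  have d := hdiv' i
  -- The curl of the curl: the first-moment equations are inserted into `μ` times the zeroth one,
  -- and the mixed second moments are removed by the divergence identity.
  have a0 := f0 i
  fin_cases i
  · have c1 := f1 1 2
    have c2 := f1 2 1
    simp [Fin.sum_univ_three, cross_apply, cartesian] at a0 c1 c2 d ⊢
    linear_combination (μ : ℂ) * a0 + 2 * t * (c1 - c2) - 2 * t * d
  · have c1 := f1 2 0
    have c2 := f1 0 2
    simp [Fin.sum_univ_three, cross_apply, cartesian] at a0 c1 c2 d ⊢
    linear_combination (μ : ℂ) * a0 + 2 * t * (c1 - c2) - 2 * t * d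
  · have c1 := f1 0 1
    have c2 := f1 1 0
    simp [Fin.sum_univ_three, cross_apply, cartesian] at a0 c1 c2 d ⊢
    linear_combination (μ : ℂ) * a0 + 2 * t * (c1 - c2) - 2 * t * d

/-- The weighted moments of a Trkalian field satisfy the Helmholtz equation. -/
theorem gaussian_helmholtz (hμ : μ ≠ 0) (hH : ContDiff ℝ 1 H) (hc : ∀ y, curl H y = μ • H y)
    (hb : ∀ y, ‖H y‖ ≤ C * (1 + ‖y‖) ^ N) (ht : 0 < t) :
    (4 * t ^ 2) • ∫ y, (‖y‖ ^ 2 * Real.exp (-t * ‖y‖ ^ 2)) • H y =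
      (6 * t - μ ^ 2) • ∫ y, Real.exp (-t * ‖y‖ ^ 2) • H y := by
  have mH : AEStronglyMeasurable H := hH.continuous.aestronglyMeasurable
  set M0 : Vec := ∫ y : Space, Real.exp (-t * ‖y‖ ^ 2) • H y with hM0
  set M1 : Fin 3 → Vec := fun a => ∫ y : Space, (y a * Real.exp (-t * ‖y‖ ^ 2)) • H y with hM1
  set M2 : Fin 3 → Fin 3 → Vec := fun a b =>
    ∫ y : Space, (y a * y b * Real.exp (-t * ‖y‖ ^ 2)) • H y with hM2
  set M3 : Fin 3 → Fin 3 → Fin 3 → Vec := fun a b c =>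
    ∫ y : Space, (y a * (y b * y c) * Real.exp (-t * ‖y‖ ^ 2)) • H y with hM3
  have s3 : ∀ a b c, M3 a b c = M3 c b a := fun a b c => by
    simp only [hM3]; congr 1; funext y; congr 2; ring
  have q1 : ∀ (a : Fin 3) (y : Space), |y a| ≤ 1 * (1 + ‖y‖) ^ 1 := fun a y => by
    simpa using abs_coord_le_one_add y a
  have q2 : ∀ (a b : Fin 3) (y : Space), |y a * y b| ≤ 1 * (1 + ‖y‖) ^ 2 := fun a b y => by
    rw [abs_mul, one_mul, sq]
    exact mul_le_mul (abs_coord_le_one_add y a) (abs_coord_le_one_add y b) (abs_nonneg _)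
      (by positivity)
  have E0 : μ • M0 = ∑ j, cross (cartesian j) ((2 * t) • M1 j) := by
    have := smul_integral_polynomial_gaussian hH hc hb ht (p := fun _ => 1) contDiff_const
      (A := 1) (k := 0) (by simp) (by simp)
    simpa [hM0, hM1] using this
  have E1 : ∀ a, μ • M1 a = ∑ j, cross (cartesian j)
      ((2 * t) • M2 j a - if a = j then M0 else 0) := by
    intro a
    have := smul_integral_polynomial_gaussian hH hc hb ht (p := fun y => y a) (by fun_prop)
      (A := 1) (k := 1) (q1 a) (by
        intro y j
        rw [fderiv_coord]
        have := norm_nonneg y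
        split_ifs
        · simp
        · simp; linarith)
    simp only [fderiv_coord] at this
    rw [hM1, this]
    refine Finset.sum_congr rfl fun j _ => ?_
    congr 2
    split_ifs <;> simp [hM0]
  have E2 : ∀ a b, μ • M2 a b = ∑ j, cross (cartesian j)
      ((2 * t) • M3 j a b - ((if a = j then M1 b else 0) + if b = j then M1 a else 0)) := by
    intro a b
    have := smul_integral_polynomial_gaussian hH hc hb ht (p := fun y => y a * y b) (by fun_prop)
      (A := 2) (k := 2) (fun y => (q2 a b y).trans (by gcongr; norm_num)) (by
        intro y j
        rw [fderiv_coord_mul]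
        have h1 := abs_coord_le_one_add y a
        have h2 := abs_coord_le_one_add y b
        have h3 := norm_nonneg y
        have h4 : (1 + ‖y‖) ≤ (1 + ‖y‖) ^ 2 := by nlinarith
        refine (abs_add_le _ _).trans ?_
        have h5 : |if a = j then y b else 0| ≤ (1 + ‖y‖) ^ 2 := by
          split_ifs
          · linarith
          · simp; positivity
        have h6 : |if b = j then y a else 0| ≤ (1 + ‖y‖) ^ 2 := by
          split_ifs
          · linarith
          · simp; positivity
        linarith)
    simp only [fderiv_coord_mul] at this
    simp only [hM2]
    rw [this]
    refine Finset.sum_congr rfl fun j _ => ?_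
    congr 2
    have i1 : ∀ c, Integrable fun y : Space => (y c * Real.exp (-t * ‖y‖ ^ 2)) • H y := fun c =>
      integrable_polynomial_gaussian_smul mH hb ht (Continuous.measurable (by fun_prop)) (q1 c)
    simp only [add_mul, add_smul]
    rw [integral_add]
    · congr 1 <;> split_ifs <;> simp [hM1]
    · split_ifs
      · exact i1 b
      · simp
    · split_ifs
      · exact i1 a
      · simp
  have hnorm : ∫ y, (‖y‖ ^ 2 * Real.exp (-t * ‖y‖ ^ 2)) • H y = M2 0 0 + M2 1 1 + M2 2 2 := by
    have i2 : ∀ a b, Integrable fun y : Space =>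
        (y a * y b * Real.exp (-t * ‖y‖ ^ 2)) • H y := fun a b =>
      integrable_polynomial_gaussian_smul mH hb ht (Continuous.measurable (by fun_prop)) (q2 a b)
    simp only [hM2]
    have i3 : Integrable fun y : Space => (y 0 * y 0 * Real.exp (-t * ‖y‖ ^ 2)) • H y +
        (y 1 * y 1 * Real.exp (-t * ‖y‖ ^ 2)) • H y := (i2 0 0).add (i2 1 1)
    rw [← integral_add (i2 0 0) (i2 1 1), ← integral_add i3 (i2 2 2)]
    congr 1; funext y
    simp only [← add_smul, EuclideanSpace.real_norm_sq_eq, Fin.sum_univ_three]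
    congr 1; ring
  rw [hnorm]
  exact moment_algebra hμ E0 E1 E2 s3

end GaussianMoments

/-! ### Closed form of the Gaussian averages and the Riesz potential of a Trkalian field -/

section GaussianAverage

variable {H : Space → Vec} {μ : ℝ} {C : ℝ} {N : ℕ}

theorem hasDerivAt_gaussian_integral (hH : Continuous H)
    (hb : ∀ y, ‖H y‖ ≤ C * (1 + ‖y‖) ^ N) {t : ℝ} (ht : 0 < t) :
    HasDerivAt (fun t : ℝ => ∫ y, Real.exp (-t * ‖y‖ ^ 2) • H y)
      (-∫ y, (‖y‖ ^ 2 * Real.exp (-t * ‖y‖ ^ 2)) • H y) t := by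
  have mH : AEStronglyMeasurable H := hH.aestronglyMeasurable
  have ht2 : 0 < t / 2 := half_pos ht
  have hq : ∀ y : Space, |‖y‖ ^ 2| ≤ 1 * (1 + ‖y‖) ^ 2 := fun y => by
    rw [abs_of_nonneg (by positivity), one_mul]
    have := norm_nonneg y
    gcongr; linarith
  have key := hasDerivAt_integral_of_dominated_loc_of_deriv_le
    (F := fun (t : ℝ) (y : Space) => Real.exp (-t * ‖y‖ ^ 2) • H y)
    (F' := fun (t : ℝ) (y : Space) => -((‖y‖ ^ 2 * Real.exp (-t * ‖y‖ ^ 2)) • H y))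
    (bound := fun y => ‖(‖y‖ ^ 2 * Real.exp (-(t / 2) * ‖y‖ ^ 2)) • H y‖)
    (s := Set.Ioi (t / 2)) (x₀ := t) (μ := volume) (Ioi_mem_nhds (by linarith))
    (Eventually.of_forall fun s => Continuous.aestronglyMeasurable (by fun_prop))
    (by simpa using integrable_gaussian_smul mH hb ht (Nat.zero_le 2))
    (Continuous.aestronglyMeasurable (by fun_prop))
    (Eventually.of_forall fun y s hs => ?_)
    (integrable_polynomial_gaussian_smul mH hb ht2 (by fun_prop) hq).norm
    (Eventually.of_forall fun y s hs => ?_)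
  · rw [← integral_neg]; exact key.2
  · rw [norm_neg, norm_smul, norm_smul]
    have hs : t / 2 < s := hs
    refine mul_le_mul_of_nonneg_right ?_ (norm_nonneg _)
    rw [Real.norm_of_nonneg (by positivity), Real.norm_of_nonneg (by positivity)]
    gcongr
  · have h1 : HasDerivAt (fun s : ℝ => Real.exp (-s * ‖y‖ ^ 2))
        (Real.exp (-s * ‖y‖ ^ 2) * (-1 * ‖y‖ ^ 2)) s :=
      (((hasDerivAt_id s).neg).mul_const _).exp
    refine (h1.smul_const (H y)).congr_deriv ?_
    rw [← neg_smul]; congr 1; ring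

/-- The substitution `y ↦ y/√t` fixes the Gaussian and moves the argument of `H` to the origin. This
supplies the constant of integration for the differential equation in `t`. -/
theorem tendsto_scaled_gaussian_integral (hH : Continuous H)
    (hb : ∀ y, ‖H y‖ ≤ C * (1 + ‖y‖) ^ N) :
    Tendsto (fun t : ℝ => √t ^ 3 • ∫ y, Real.exp (-t * ‖y‖ ^ 2) • H y) atTop
      (𝓝 (√Real.pi ^ 3 • H 0)) := by
  have mH : AEStronglyMeasurable H := hH.aestronglyMeasurable
  have hC : 0 ≤ C := by simpa using (norm_nonneg _).trans (hb 0)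
  have e1 : ∀ t : ℝ, 0 < t → √t ^ 3 • ∫ y, Real.exp (-t * ‖y‖ ^ 2) • H y =
      ∫ y, Real.exp (-1 * ‖y‖ ^ 2) • H ((√t)⁻¹ • y) := by
    intro t ht
    have hs : 0 < √t := Real.sqrt_pos.2 ht
    have := Measure.integral_comp_smul (volume : Measure Space)
      (fun y => Real.exp (-t * ‖y‖ ^ 2) • H y) (√t)⁻¹
    rw [finrank_space, ← inv_pow, inv_inv, abs_of_pos (by positivity)] at this
    rw [← this]
    congr 1; funext y
    rw [norm_smul, Real.norm_of_nonneg (by positivity), mul_pow, inv_pow, Real.sq_sqrt ht.le]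
    congr 2; field_simp
  have e2 : ∫ y : Space, Real.exp (-1 * ‖y‖ ^ 2) • H 0 = √Real.pi ^ 3 • H 0 := by
    rw [integral_smul_const, GaussianFourier.integral_rexp_neg_mul_sq_norm one_pos, finrank_space,
      Real.sqrt_eq_rpow, ← Real.rpow_natCast, ← Real.rpow_mul Real.pi_pos.le]
    norm_num
  rw [← e2]
  have h1v : ‖(fun _ => 1 : Vec)‖ = 1 := by rw [pi_norm_const]; simp
  refine Tendsto.congr' (Filter.EventuallyEq.symm ?_)
    (tendsto_integral_filter_of_dominated_convergence
    (F := fun t y => Real.exp (-1 * ‖y‖ ^ 2) • H ((√t)⁻¹ • y))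
    (fun y => Real.exp (-1 * ‖y‖ ^ 2) * (C * (1 + ‖y‖) ^ N)) ?_ ?_ ?_ ?_)
  · filter_upwards [eventually_gt_atTop 0] with t ht using e1 t ht
  · exact Eventually.of_forall fun t => Continuous.aestronglyMeasurable (by fun_prop)
  · filter_upwards [eventually_ge_atTop 1] with t ht
    refine Eventually.of_forall fun y => ?_
    rw [norm_smul, Real.norm_of_nonneg (by positivity)]
    refine mul_le_mul_of_nonneg_left ((hb _).trans ?_) (by positivity)
    have h1 : 1 ≤ √t := Real.one_le_sqrt.2 ht
    have h2 : ‖(√t)⁻¹ • y‖ ≤ ‖y‖ := by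
      rw [norm_smul, Real.norm_of_nonneg (by positivity)]
      exact mul_le_of_le_one_left (norm_nonneg _) (inv_le_one_of_one_le₀ h1)
    gcongr
  -- Integrability of the scalar majorant is read off from the vector-valued lemma by multiplying it
  -- with a constant vector of norm one.
  · have := (integrable_gaussian_smul (H := fun y => ((C * (1 + ‖y‖) ^ N : ℝ) : ℂ) • (fun _ => 1))
      (C := C) (N := N) (Continuous.aestronglyMeasurable (by fun_prop)) (fun y => ?_) one_pos
      (Nat.zero_le 2)).norm
    · refine this.congr (Eventually.of_forall fun y => ?_)
      simp only [pow_zero, inv_one, mul_one, norm_smul, Complex.norm_real]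
      rw [Real.norm_of_nonneg (by positivity), Real.norm_of_nonneg (by positivity)]
      rw [h1v]; simp
    · rw [norm_smul, Complex.norm_real, Real.norm_of_nonneg (by positivity)]
      rw [h1v]; simp
  · refine Eventually.of_forall fun y => Tendsto.const_smul ?_ _
    have h1 : Tendsto (fun t : ℝ => (√t)⁻¹ • y) atTop (𝓝 0) := by
      have := (tendsto_inv_atTop_zero.comp Real.tendsto_sqrt_atTop).smul_const y
      simpa using this
    exact (hH.tendsto 0).comp h1

/-- The Gaussian average of a Trkalian field. -/
theorem gaussian_integral_of_curl_eq (hμ : μ ≠ 0) (hH : ContDiff ℝ 1 H)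
    (hc : ∀ y, curl H y = μ • H y) (hb : ∀ y, ‖H y‖ ≤ C * (1 + ‖y‖) ^ N) {t : ℝ} (ht : 0 < t) :
    ∫ y, Real.exp (-t * ‖y‖ ^ 2) • H y =
      ((√Real.pi) ^ 3 * ((√t)⁻¹ ^ 3 * Real.exp (-μ ^ 2 / (4 * t)))) • H 0 := by
  set Q : ℝ → Vec := fun t => ∫ y, Real.exp (-t * ‖y‖ ^ 2) • H y with hQ
  -- The Helmholtz identity says `Q' = (μ²/(4t²) - 3/(2t)) Q`; `w` is the reciprocal of a solution,
  -- so that `w • Q` is constant.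
  let w : ℝ → ℝ := fun t => √t ^ 3 * Real.exp (μ ^ 2 / (4 * t))
  have hw : ∀ t, 0 < t → HasDerivAt w ((3 / (2 * t) - μ ^ 2 / (4 * t ^ 2)) * w t) t := by
    intro t ht
    have hs : 0 < √t := Real.sqrt_pos.2 ht
    have hsq : √t ^ 2 = t := Real.sq_sqrt ht.le
    have h1 := ((hasDerivAt_id t).sqrt ht.ne').pow 3
    have h2 := (((hasDerivAt_id t).const_mul 4).inv (by simp; exact ht.ne')).const_mul (μ ^ 2)
    have h3 := h1.mul h2.exp
    refine h3.congr_deriv ?_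
    simp only [id, w, div_eq_mul_inv, Pi.pow_apply, Pi.inv_apply]
    field_simp
    linear_combination -12 * t * √t ^ 2 * hsq
  have hR : ∀ t, 0 < t → HasDerivAt (fun t => w t • Q t) 0 t := by
    intro t ht
    refine ((hw t ht).fun_smul (hasDerivAt_gaussian_integral hH.continuous hb ht)).congr_deriv ?_
    have hh := gaussian_helmholtz hμ hH hc hb ht
    have h4 : (4 * t ^ 2) ≠ 0 := by positivity
    have : ∫ y, (‖y‖ ^ 2 * Real.exp (-t * ‖y‖ ^ 2)) • H y =
        ((4 * t ^ 2)⁻¹ * (6 * t - μ ^ 2)) • Q t := by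
      rw [mul_smul, ← hh, inv_smul_smul₀ h4]
    rw [this, smul_neg, smul_smul, ← neg_smul, ← add_smul]
    convert zero_smul ℝ (Q t) using 2
    field_simp
    ring
  have hconst : ∀ a, 0 < a → w a • Q a = √Real.pi ^ 3 • H 0 := by
    intro a ha
    have hev : ∀ b ∈ Set.Ioi (0 : ℝ), w b • Q b = w a • Q a := fun b hb =>
      (convex_Ioi (0 : ℝ)).is_const_of_fderivWithin_eq_zero (𝕜 := ℝ) (f := fun t => w t • Q t)
        (fun x hx => (hR x hx).differentiableAt.differentiableWithinAt)
        (fun x hx => by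
          rw [(hR x hx).hasFDerivAt.hasFDerivWithinAt.fderivWithin
            (isOpen_Ioi.uniqueDiffWithinAt hx)]
          ext; simp) hb ha
    have hlim : Tendsto (fun t => w t • Q t) atTop (𝓝 (√Real.pi ^ 3 • H 0)) := by
      have h1 : Tendsto (fun t : ℝ => Real.exp (μ ^ 2 / (4 * t))) atTop (𝓝 1) := by
        have : Tendsto (fun t : ℝ => μ ^ 2 / (4 * t)) atTop (𝓝 0) :=
          tendsto_const_nhds.div_atTop (tendsto_id.const_mul_atTop four_pos)
        simpa [Function.comp_def] using (Real.continuous_exp.tendsto 0).comp this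
      have := h1.smul (tendsto_scaled_gaussian_integral hH.continuous hb)
      rw [one_smul] at this
      refine this.congr fun t => ?_
      rw [smul_smul, mul_comm]
    refine tendsto_nhds_unique (Tendsto.congr' ?_ tendsto_const_nhds) hlim
    filter_upwards [eventually_gt_atTop 0] with b hb using (hev b hb).symm
  have hs : 0 < √t := Real.sqrt_pos.2 ht
  have := hconst t ht
  have h5 : √Real.pi ^ 3 * ((√t)⁻¹ ^ 3 * Real.exp (-μ ^ 2 / (4 * t))) = (w t)⁻¹ * √Real.pi ^ 3 := by
    simp only [w]
    rw [neg_div, Real.exp_neg]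
    field_simp
  rw [h5, mul_smul, ← this, inv_smul_smul₀]
  simp only [w]; positivity

/-- `1 / |y|` as a superposition of Gaussians. -/
theorem integral_gaussian_eq_inv_norm (ε : ℝ) (y : Space) :
    ∫ s in Set.Ioi (0 : ℝ), (2 * Real.pi * √Real.pi)⁻¹ * Real.exp (-(s ^ 2 + ε) * ‖y‖ ^ 2) =
      Real.exp (-ε * ‖y‖ ^ 2) * (4 * Real.pi * ‖y‖)⁻¹ := by
  have h1 : ∀ s : ℝ, (2 * Real.pi * √Real.pi)⁻¹ * Real.exp (-(s ^ 2 + ε) * ‖y‖ ^ 2) =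
      ((2 * Real.pi * √Real.pi)⁻¹ * Real.exp (-ε * ‖y‖ ^ 2)) * Real.exp (-‖y‖ ^ 2 * s ^ 2) := by
    intro s
    rw [mul_assoc _ (Real.exp _) (Real.exp _), ← Real.exp_add]; congr 2; ring
  simp_rw [h1]
  rw [integral_const_mul, integral_gaussian_Ioi, Real.sqrt_div Real.pi_pos.le,
    Real.sqrt_sq (norm_nonneg y)]
  have : 0 < √Real.pi := Real.sqrt_pos.2 Real.pi_pos
  field_simp
  ring

theorem integrable_riesz_kernel_smul (hH : AEStronglyMeasurable H)
    (hb : ∀ y, ‖H y‖ ≤ C * (1 + ‖y‖) ^ N) {ε : ℝ} (hε : 0 < ε) :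
    Integrable fun y => (Real.exp (-ε * ‖y‖ ^ 2) * (4 * Real.pi * ‖y‖)⁻¹) • H y := by
  have := (integrable_gaussian_smul hH hb hε one_le_two).smul (4 * Real.pi)⁻¹
  refine this.congr (Eventually.of_forall fun y => ?_)
  simp only [Pi.smul_apply, smul_smul, mul_inv, pow_one]
  congr 1; ring

/-- Fubini for the superposition of Gaussians: the average with rate `s² + ε` is known in closed
form, and the constants combine to `π^(3/2) / (2π√π) = 1/2`. -/
theorem integral_riesz_kernel_smul (hμ : μ ≠ 0) (hH : ContDiff ℝ 1 H)
    (hc : ∀ y, curl H y = μ • H y) (hb : ∀ y, ‖H y‖ ≤ C * (1 + ‖y‖) ^ N) {ε : ℝ} (hε : 0 < ε) :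
    ∫ y, (Real.exp (-ε * ‖y‖ ^ 2) * (4 * Real.pi * ‖y‖)⁻¹) • H y =
      (∫ s in Set.Ioi (0 : ℝ), 2⁻¹ * ((√(s ^ 2 + ε))⁻¹ ^ 3 *
        Real.exp (-μ ^ 2 / (4 * (s ^ 2 + ε))))) • H 0 := by
  set c := (2 * Real.pi * √Real.pi)⁻¹ with hcdef
  have hc0 : 0 < c := by positivity
  have mH := hH.continuous
  have hint : Integrable (Function.uncurry fun (y : Space) (s : ℝ) =>
      (c * Real.exp (-(s ^ 2 + ε) * ‖y‖ ^ 2)) • H y)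
      (volume.prod (volume.restrict (Set.Ioi (0 : ℝ)))) := by
    rw [integrable_prod_iff (Continuous.aestronglyMeasurable (by fun_prop))]
    constructor
    · filter_upwards [Measure.ae_ne volume (0 : Space)] with y hy
      have hy : 0 < ‖y‖ ^ 2 := by positivity
      refine Integrable.smul_const (f := fun s : ℝ => c * Real.exp (-(s ^ 2 + ε) * ‖y‖ ^ 2)) ?_ (H y)
      have := ((integrable_exp_neg_mul_sq hy).integrableOn (s := Set.Ioi 0)).const_mul
        (c * Real.exp (-ε * ‖y‖ ^ 2))
      refine this.congr (Eventually.of_forall fun s => ?_)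
      simp only [mul_assoc, ← Real.exp_add]
      congr 2; ring
    · refine (integrable_riesz_kernel_smul hH.continuous.aestronglyMeasurable hb hε).norm.congr
        (Eventually.of_forall fun y => ?_)
      simp only [Function.uncurry_apply_pair, norm_smul]
      rw [integral_mul_const, ← integral_gaussian_eq_inv_norm]
      congr 1
      rw [Real.norm_of_nonneg (integral_nonneg fun s => by positivity)]
      congr 1; funext s
      rw [norm_mul, Real.norm_of_nonneg hc0.le, Real.norm_of_nonneg (by positivity)]
  calc ∫ y, (Real.exp (-ε * ‖y‖ ^ 2) * (4 * Real.pi * ‖y‖)⁻¹) • H y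
      = ∫ y, ∫ s in Set.Ioi (0 : ℝ), (c * Real.exp (-(s ^ 2 + ε) * ‖y‖ ^ 2)) • H y := by
        congr 1; funext y
        rw [integral_smul_const, integral_gaussian_eq_inv_norm]
    _ = ∫ s in Set.Ioi (0 : ℝ), ∫ y, (c * Real.exp (-(s ^ 2 + ε) * ‖y‖ ^ 2)) • H y :=
        integral_integral_swap hint
    _ = ∫ s in Set.Ioi (0 : ℝ), (2⁻¹ * ((√(s ^ 2 + ε))⁻¹ ^ 3 *
        Real.exp (-μ ^ 2 / (4 * (s ^ 2 + ε))))) • H 0 := by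
        congr 1; funext s
        simp_rw [mul_smul c]
        rw [integral_smul, gaussian_integral_of_curl_eq hμ hH hc hb (by positivity), smul_smul]
        congr 1
        have : √Real.pi ^ 2 = Real.pi := Real.sq_sqrt Real.pi_pos.le
        have h0 : 0 < √Real.pi := Real.sqrt_pos.2 Real.pi_pos
        rw [← mul_assoc]
        congr 1
        rw [hcdef]; field_simp; exact this
    _ = _ := integral_smul_const _ _

/-- A majorant for the weight that is uniform in the regularization. For `m ≥ 1` the power
`m^(-3/2)` suffices; for `m < 1` it is absorbed by `exp(-a/m) ≤ 2(m/a)²`. -/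
theorem inv_sqrt_pow_mul_exp_le {a m : ℝ} (ha : 0 < a) (hm : 0 < m) :
    (√m)⁻¹ ^ 3 * Real.exp (-a / m) ≤ (4 / a ^ 2 + 2) * (1 + m)⁻¹ := by
  have hs : 0 < √m := Real.sqrt_pos.2 hm
  have hsq : √m ^ 2 = m := Real.sq_sqrt hm.le
  have hexp : Real.exp (-a / m) ≤ 1 := Real.exp_le_one_iff.2 (by
    rw [neg_div]; exact neg_nonpos.2 (by positivity))
  rw [← div_eq_mul_inv, le_div_iff₀ (by positivity)]
  rcases le_or_gt 1 m with h | h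
  · have h1 : 1 ≤ √m := Real.one_le_sqrt.2 h
    have h2 : (√m)⁻¹ ^ 3 * (1 + m) ≤ 2 := by
      rw [inv_pow, inv_mul_le_iff₀ (by positivity)]
      nlinarith
    calc (√m)⁻¹ ^ 3 * Real.exp (-a / m) * (1 + m)
        = ((√m)⁻¹ ^ 3 * (1 + m)) * Real.exp (-a / m) := by ring
      _ ≤ 2 * 1 := by gcongr
      _ ≤ _ := by have : 0 ≤ 4 / a ^ 2 := by positivity
                  linarith
  · have h1 : Real.exp (-a / m) ≤ 2 * (m / a) ^ 2 := by
      have h2 := Real.quadratic_le_exp_of_nonneg (x := a / m) (by positivity)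
      have h3 : (a / m) ^ 2 / 2 ≤ Real.exp (a / m) := by
        have : 0 ≤ a / m := by positivity
        linarith
      rw [neg_div, Real.exp_neg, inv_le_comm₀ (Real.exp_pos _) (by positivity)]
      refine le_trans (le_of_eq ?_) h3
      field_simp
    have h4 : √m ≤ 1 := Real.sqrt_le_one.2 h.le
    calc (√m)⁻¹ ^ 3 * Real.exp (-a / m) * (1 + m)
        ≤ (√m)⁻¹ ^ 3 * (2 * (m / a) ^ 2) * (1 + m) := by gcongr
      _ = 2 / a ^ 2 * (√m * (1 + m)) := by
        have : m = √m ^ 2 := hsq.symm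
        rw [div_pow]
        have h5 : (√m)⁻¹ ^ 3 * m ^ 2 = √m := by
          nth_rewrite 2 [this]
          field_simp
        linear_combination (2 * (1 + m) / a ^ 2) * h5
      _ ≤ 2 / a ^ 2 * (1 * (1 + 1)) := by gcongr
      _ ≤ _ := by ring_nf; linarith

/-- The integrand is the derivative of `exp(-a/s²) / (4a)`, which rises from `0` at `s = 0+` to
`1/(4a)` at infinity. -/
theorem integral_inv_pow_mul_exp {a : ℝ} (ha : 0 < a) :
    ∫ s in Set.Ioi (0 : ℝ), 2⁻¹ * (s⁻¹ ^ 3 * Real.exp (-a / s ^ 2)) = (4 * a)⁻¹ := by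
  let f : ℝ → ℝ := fun s => (4 * a)⁻¹ * Real.exp (-a / s ^ 2)
  have hlim0 : Tendsto f (𝓝[>] 0) (𝓝 0) := by
    have h1 : Tendsto (fun s : ℝ => a * (s⁻¹) ^ 2) (𝓝[>] 0) atTop :=
      ((tendsto_pow_atTop two_ne_zero).comp tendsto_inv_nhdsGT_zero).const_mul_atTop ha
    have h2 := (Real.tendsto_exp_neg_atTop_nhds_zero.comp h1).const_mul (4 * a)⁻¹
    rw [mul_zero] at h2
    refine h2.congr fun s => ?_
    simp only [f, Function.comp_apply]
    congr 2; rw [inv_pow, neg_div, div_eq_mul_inv]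
  have hlim : Tendsto f atTop (𝓝 (4 * a)⁻¹) := by
    have h1 : Tendsto (fun s : ℝ => -a / s ^ 2) atTop (𝓝 0) :=
      tendsto_const_nhds.div_atTop (tendsto_pow_atTop two_ne_zero)
    simpa [Function.comp_def, f] using ((Real.continuous_exp.tendsto 0).comp h1).const_mul (4 * a)⁻¹
  -- Division by zero gives `f 0 = (4 * a)⁻¹` instead of the limit `0`, hence the update at `0`.
  have hderiv : ∀ s ∈ Set.Ioi (0 : ℝ), HasDerivAt (Function.update f 0 0)
      (2⁻¹ * (s⁻¹ ^ 3 * Real.exp (-a / s ^ 2))) s := by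
    intro s hs
    have hs' : s ≠ 0 := ne_of_gt hs
    have h1 : HasDerivAt f (2⁻¹ * (s⁻¹ ^ 3 * Real.exp (-a / s ^ 2))) s := by
      have h2 : HasDerivAt (fun s : ℝ => -a / s ^ 2) (2 * a / s ^ 3) s := by
        have := ((hasDerivAt_pow 2 s).inv (pow_ne_zero 2 hs')).const_mul (-a)
        refine this.congr_deriv ?_
        simp only [Nat.cast_ofNat, Nat.add_one_sub_one, pow_one]
        field_simp
      refine (h2.exp.const_mul (4 * a)⁻¹).congr_deriv ?_
      field_simp
      ring
    refine h1.congr_of_eventuallyEq ?_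
    filter_upwards [isOpen_ne.mem_nhds hs'] with y hy
    exact Function.update_of_ne hy _ _
  have := integral_Ioi_of_hasDerivAt_of_nonneg (g := Function.update f 0 0) (a := 0)
    (l := (4 * a)⁻¹) ?_ hderiv (fun s hs => ?_) ?_
  · rw [this]; simp
  · rw [← continuousWithinAt_Ioi_iff_Ici]
    have := continuousWithinAt_update_same (f := f) (s := Set.Ioi 0) (x := (0 : ℝ)) (y := 0)
    rw [this]
    simpa using hlim0
  · have : (0 : ℝ) < s := hs
    positivity
  · refine hlim.congr' ?_
    filter_upwards [eventually_gt_atTop 0] with s hs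
    exact (Function.update_of_ne hs.ne' _ _).symm

theorem tendsto_integral_riesz_weight (hμ : μ ≠ 0) :
    Tendsto (fun ε : ℝ => ∫ s in Set.Ioi (0 : ℝ), 2⁻¹ * ((√(s ^ 2 + ε))⁻¹ ^ 3 *
        Real.exp (-μ ^ 2 / (4 * (s ^ 2 + ε))))) (𝓝[>] 0) (𝓝 (1 / μ ^ 2)) := by
  have ha : 0 < μ ^ 2 / 4 := by positivity
  have hval : 1 / μ ^ 2 = (4 * (μ ^ 2 / 4))⁻¹ := by field_simp
  have hrw : ∀ m : ℝ, -μ ^ 2 / (4 * m) = -(μ ^ 2 / 4) / m := fun m => by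
    rw [neg_div, neg_div, div_div]
  rw [hval, ← integral_inv_pow_mul_exp ha]
  refine tendsto_integral_filter_of_dominated_convergence
    (fun s => 2⁻¹ * ((4 / (μ ^ 2 / 4) ^ 2 + 2) * (1 + s ^ 2)⁻¹)) ?_ ?_ ?_ ?_
  · exact Eventually.of_forall fun ε => Measurable.aestronglyMeasurable (by fun_prop)
  · filter_upwards [self_mem_nhdsWithin] with ε hε
    have hε : 0 < ε := hε
    refine Eventually.of_forall fun s => ?_
    rw [Real.norm_of_nonneg (by positivity), hrw]
    refine mul_le_mul_of_nonneg_left ?_ (by norm_num)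
    refine (inv_sqrt_pow_mul_exp_le ha (by positivity)).trans ?_
    gcongr
    linarith
  · exact ((integrable_inv_one_add_sq.const_mul _).const_mul _).integrableOn
  · filter_upwards [ae_restrict_mem measurableSet_Ioi] with s hs
    have hs : 0 < s := hs
    have h1 : Tendsto (fun ε : ℝ => s ^ 2 + ε) (𝓝[>] 0) (𝓝 (s ^ 2)) := by
      have : Continuous fun ε : ℝ => s ^ 2 + ε := by fun_prop
      simpa using (this.tendsto 0).mono_left nhdsWithin_le_nhds
    have h2 : ContinuousAt (fun m : ℝ => 2⁻¹ * ((√m)⁻¹ ^ 3 * Real.exp (-(μ ^ 2 / 4) / m)))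
        (s ^ 2) := by
      have : √(s ^ 2) ≠ 0 := by rw [Real.sqrt_sq hs.le]; exact hs.ne'
      have : s ^ 2 ≠ 0 := by positivity
      fun_prop (disch := assumption)
    have h3 := h2.tendsto.comp h1
    rw [Real.sqrt_sq hs.le] at h3
    refine h3.congr fun ε => ?_
    simp only [Function.comp_apply, hrw]

/-- The Riesz potential of a Trkalian field of polynomial growth. -/
theorem tendsto_rieszReg_of_isTrkalian {ν : ℝ} (hν : ν ≠ 0) {F : Space → Vec}
    (hF : IsTrkalian ν F) (hg : PolynomialGrowth F) (x : Space) :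
    (∀ ε > 0, Integrable fun y : Space =>
      (Real.exp (-ε * ‖y‖ ^ 2) * (4 * Real.pi * ‖y‖)⁻¹) • F (x - y)) ∧
    Tendsto (rieszReg F x) (𝓝[>] 0) (𝓝 ((1 / ν ^ 2) • F x)) := by
  obtain ⟨C, N, hb⟩ := hg
  have hC : 0 ≤ C := by simpa using (norm_nonneg _).trans (hb 0)
  set H : Space → Vec := fun y => F (x - y) with hHdef
  have hH : ContDiff ℝ 1 H := hF.1.comp (contDiff_const.sub contDiff_id)
  have hbH : ∀ y, ‖H y‖ ≤ (C * (1 + ‖x‖) ^ N) * (1 + ‖y‖) ^ N := by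
    intro y
    refine (hb _).trans ?_
    rw [mul_assoc, ← mul_pow]
    have h1 := norm_sub_le x y
    have h2 : 1 + ‖x - y‖ ≤ (1 + ‖x‖) * (1 + ‖y‖) := by
      nlinarith [norm_nonneg x, norm_nonneg y, mul_nonneg (norm_nonneg x) (norm_nonneg y)]
    gcongr
  -- The reflection `y ↦ x - y` reverses the sign of the curl, so the eigenvalue becomes `-ν`; only
  -- its square survives.
  have hcH : ∀ y, curl H y = (-ν) • H y := by
    intro y
    have h1 : fderiv ℝ H y = -fderiv ℝ F (x - y) := by
      have h2 : HasFDerivAt H ((fderiv ℝ F (x - y)).comp (-ContinuousLinearMap.id ℝ Space)) y :=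
        HasFDerivAt.comp y ((hF.1.differentiable one_ne_zero) _).hasFDerivAt
          ((hasFDerivAt_id y).const_sub x)
      rw [h2.fderiv]; ext; simp
    rw [curl_eq_sum, h1]
    simp only [neg_apply, cross_neg, Finset.sum_neg_distrib]
    rw [← curl_eq_sum, hF.2, neg_smul]
  refine ⟨fun ε hε => integrable_riesz_kernel_smul hH.continuous.aestronglyMeasurable hbH hε, ?_⟩
  have h1 := (tendsto_integral_riesz_weight (neg_ne_zero.2 hν)).smul_const (H 0)
  have h2 : H 0 = F x := by simp [hHdef]
  rw [neg_sq, h2] at h1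
  refine h1.congr' ?_
  filter_upwards [self_mem_nhdsWithin] with ε hε
  rw [rieszReg, ← h2]
  have := integral_riesz_kernel_smul (neg_ne_zero.2 hν) hH hcH hbH hε
  rw [neg_sq] at this
  exact this.symm

end GaussianAverage

theorem rieszPotential_of_isTrkalian {ν : ℝ} (hν : ν ≠ 0) {F : Space → Vec}
    (hF : IsTrkalian ν F) (hg : PolynomialGrowth F) :
    rieszPotential F = fun x => (1 / ν ^ 2) • F x :=
  funext fun x => (tendsto_rieszReg_of_isTrkalian hν hF hg x).2.limUnder_eq

theorem biotSavart_of_isTrkalian {ν : ℝ} (hν : ν ≠ 0) {F : Space → Vec}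
    (hF : IsTrkalian ν F) (hg : PolynomialGrowth F) :
    biotSavart F = fun x => (1 / ν) • F x := by
  funext x
  rw [biotSavart, rieszPotential_of_isTrkalian hν hF hg, curl_eq_sum,
    fderiv_fun_const_smul ((hF.1.differentiable one_ne_zero) x)]
  simp only [smul_apply, cross_smul_right]
  rw [← Finset.smul_sum, ← curl_eq_sum, hF.2, smul_smul]
  congr 1
  field_simp

/-! ### Linearity of the line transforms -/

theorem xrayTrunc_const_smul (c : ℝ) (F : Space → Vec) (θ x : Space) :
    xrayTrunc (fun x => c • F x) θ x = fun T => c • xrayTrunc F θ x T := by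
  funext T
  exact intervalIntegral.integral_smul c _

theorem signedTrunc_const_smul (c : ℝ) (F : Space → Vec) (θ x : Space) :
    signedTrunc (fun x => c • F x) θ x = fun T => c • signedTrunc F θ x T := by
  funext T
  simp only [signedTrunc, smul_comm _ c]
  exact intervalIntegral.integral_smul c _

theorem exists_tendsto_const_smul_iff {c : ℝ} (hc : c ≠ 0) {α : Type*} {l : Filter α} {f : α → Vec} :
    (∃ v, Tendsto (fun a => c • f a) l (𝓝 v)) ↔ ∃ v, Tendsto f l (𝓝 v) := by
  constructor
  · rintro ⟨v, hv⟩
    exact ⟨c⁻¹ • v, by simpa [smul_smul, hc] using hv.const_smul c⁻¹⟩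
  · rintro ⟨v, hv⟩
    exact ⟨c • v, hv.const_smul c⟩

theorem intervalIntegrable_const_smul_iff {c : ℝ} (hc : c ≠ 0) {f : ℝ → Vec} {a b : ℝ} :
    IntervalIntegrable (fun s => c • f s) volume a b ↔ IntervalIntegrable f volume a b := by
  constructor
  · intro h
    have h1 := h.smul c⁻¹
    have h2 : (c⁻¹ • fun s => c • f s) = f := by funext s; simp [smul_smul, hc]
    rwa [h2] at h1
  · exact fun h => h.smul c

theorem xrayExists_const_smul_iff {c : ℝ} (hc : c ≠ 0) (F : Space → Vec) (θ x : Space) :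
    XrayExists (fun x => c • F x) θ x ↔ XrayExists F θ x := by
  unfold XrayExists
  rw [xrayTrunc_const_smul, exists_tendsto_const_smul_iff hc]
  simp only [intervalIntegrable_const_smul_iff hc]

theorem signedExists_const_smul_iff {c : ℝ} (hc : c ≠ 0) (F : Space → Vec) (θ x : Space) :
    SignedExists (fun x => c • F x) θ x ↔ SignedExists F θ x := by
  unfold SignedExists
  rw [signedTrunc_const_smul, exists_tendsto_const_smul_iff hc]
  simp only [intervalIntegrable_const_smul_iff hc]

theorem xray_const_smul {F : Space → Vec} {θ x : Space} (h : XrayExists F θ x) (c : ℝ) :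
    xray (fun x => c • F x) θ x = c • xray F θ x := by
  obtain ⟨-, v, hv⟩ := h
  rw [xray, xray, xrayTrunc_const_smul, hv.limUnder_eq]
  exact (hv.const_smul c).limUnder_eq

theorem signedXray_const_smul {F : Space → Vec} {θ x : Space} (h : SignedExists F θ x) (c : ℝ) :
    signedXray (fun x => c • F x) θ x = c • signedXray F θ x := by
  obtain ⟨-, v, hv⟩ := h
  rw [signedXray, signedXray, signedTrunc_const_smul, hv.limUnder_eq]
  exact (hv.const_smul c).limUnder_eq

/-- The transforms of the Biot–Savart field of a Trkalian field of polynomial growth. -/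
theorem trkalian_transforms {ν : ℝ} (hν : ν ≠ 0) {F : Space → Vec}
    (hF : IsTrkalian ν F) (hg : PolynomialGrowth F) :
    (∀ x, RieszExists F x) ∧ Differentiable ℝ (rieszPotential F) ∧
      (∀ x, biotSavart F x = (1 / ν) • F x) ∧
      (∀ θ x : Space, ‖θ‖ = 1 →
        (XrayExists (biotSavart F) θ x ↔ XrayExists F θ x) ∧
        (XrayExists F θ x → xray (biotSavart F) θ x = (1 / ν) • xray F θ x) ∧
        (SignedExists (biotSavart F) θ x ↔ SignedExists F θ x) ∧
        (SignedExists F θ x →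
          signedXray (biotSavart F) θ x = (1 / ν) • signedXray F θ x)) := by
  have hc : 1 / ν ≠ 0 := one_div_ne_zero hν
  have hBS := biotSavart_of_isTrkalian hν hF hg
  refine ⟨fun x => ?_, ?_, fun x => congrFun hBS x, fun θ x _ => ?_⟩
  · obtain ⟨h1, h2⟩ := tendsto_rieszReg_of_isTrkalian hν hF hg x
    exact ⟨h1, _, h2⟩
  · rw [rieszPotential_of_isTrkalian hν hF hg]
    exact (hF.1.differentiable one_ne_zero).const_smul (1 / ν ^ 2)
  · rw [hBS]
    exact ⟨xrayExists_const_smul_iff hc F θ x, fun h => xray_const_smul h _,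
      signedExists_const_smul_iff hc F θ x, fun h => signedXray_const_smul h _⟩

/-! ### The Dirichlet integral and the characters of the line -/

theorem integral_sin_mul_exp (s A : ℝ) :
    ∫ x in (0 : ℝ)..A, Real.sin x * Real.exp (-x * s) =
      (1 - Real.exp (-A * s) * (Real.cos A + s * Real.sin A)) * (1 + s ^ 2)⁻¹ := by
  have hs : 1 + s ^ 2 ≠ 0 := by positivity
  have hd : ∀ x : ℝ, HasDerivAt
      (fun x => -(Real.exp (-x * s) * (Real.cos x + s * Real.sin x)) * (1 + s ^ 2)⁻¹)
      (Real.sin x * Real.exp (-x * s)) x := by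
    intro x
    have h1 : HasDerivAt (fun x : ℝ => Real.exp (-x * s)) (Real.exp (-x * s) * (-1 * s)) x :=
      (((hasDerivAt_id x).fun_neg).mul_const s).exp
    have h2 : HasDerivAt (fun x : ℝ => Real.cos x + s * Real.sin x)
        (-Real.sin x + s * Real.cos x) x :=
      (Real.hasDerivAt_cos x).add ((Real.hasDerivAt_sin x).const_mul s)
    refine (((h1.fun_mul h2).fun_neg).mul_const (1 + s ^ 2)⁻¹).congr_deriv ?_
    rw [← div_eq_mul_inv, div_eq_iff hs]
    ring
  rw [intervalIntegral.integral_eq_sub_of_hasDerivAt (fun x _ => hd x)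
    (Continuous.intervalIntegrable (by fun_prop) _ _)]
  simp
  ring

/-- Integrating the modulus in `s` leaves `|sin x|/x ≤ 1` on a bounded interval. This justifies
Fubini after `1/x` has been written as the integral of `exp(-xs)` over `s > 0`. -/
theorem integrable_sin_mul_exp {A : ℝ} :
    Integrable (fun q : ℝ × ℝ => Real.sin q.1 * Real.exp (-q.1 * q.2))
      ((volume.restrict (Set.Ioc 0 A)).prod (volume.restrict (Set.Ioi 0))) := by
  have hm : AEStronglyMeasurable (fun q : ℝ × ℝ => Real.sin q.1 * Real.exp (-q.1 * q.2))
      ((volume.restrict (Set.Ioc 0 A)).prod (volume.restrict (Set.Ioi 0))) :=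
    Continuous.aestronglyMeasurable (by fun_prop)
  rw [integrable_prod_iff hm]
  constructor
  · filter_upwards [ae_restrict_mem measurableSet_Ioc] with x hx
    exact (integrableOn_exp_mul_Ioi (by linarith [hx.1] : -x < 0) 0).const_mul _
  · refine Integrable.mono' (g := fun _ => (1 : ℝ)) (integrable_const _)
      hm.norm.integral_prod_right' ?_
    filter_upwards [ae_restrict_mem measurableSet_Ioc] with x hx
    have h1 : ∫ s in Set.Ioi (0 : ℝ), ‖Real.sin x * Real.exp (-x * s)‖ = |Real.sin x| * x⁻¹ := by
      simp_rw [norm_mul, Real.norm_eq_abs, Real.abs_exp]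
      rw [integral_const_mul, integral_exp_mul_Ioi (by linarith [hx.1] : -x < 0)]
      simp [neg_div_neg_eq]
    rw [h1, Real.norm_eq_abs, abs_mul, abs_abs, abs_of_pos (inv_pos.2 hx.1), ← div_eq_mul_inv,
      div_le_one hx.1]
    exact (Real.abs_sin_le_abs).trans_eq (abs_of_pos hx.1)

theorem integral_sinc_eq {A : ℝ} (hA : 0 ≤ A) :
    ∫ x in (0 : ℝ)..A, Real.sinc x = ∫ s in Set.Ioi (0 : ℝ),
      (1 - Real.exp (-A * s) * (Real.cos A + s * Real.sin A)) * (1 + s ^ 2)⁻¹ := by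
  rw [intervalIntegral.integral_of_le hA]
  calc ∫ x in Set.Ioc 0 A, Real.sinc x
      = ∫ x in Set.Ioc 0 A, ∫ s in Set.Ioi (0 : ℝ), Real.sin x * Real.exp (-x * s) := by
        refine setIntegral_congr_fun measurableSet_Ioc fun x hx => ?_
        rw [integral_const_mul, integral_exp_mul_Ioi (by linarith [hx.1] : -x < 0),
          Real.sinc_of_ne_zero hx.1.ne']
        simp [div_eq_mul_inv]
    _ = ∫ s in Set.Ioi (0 : ℝ), ∫ x in Set.Ioc 0 A, Real.sin x * Real.exp (-x * s) :=
        integral_integral_swap integrable_sin_mul_exp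
    _ = _ := by
        refine setIntegral_congr_fun measurableSet_Ioi fun s _ => ?_
        rw [← intervalIntegral.integral_of_le hA, integral_sin_mul_exp]

/-- The Dirichlet integral. -/
theorem tendsto_integral_sinc :
    Tendsto (fun A : ℝ => ∫ x in (0 : ℝ)..A, Real.sinc x) atTop (𝓝 (Real.pi / 2)) := by
  have h0 : ∫ s in Set.Ioi (0 : ℝ), (1 + s ^ 2)⁻¹ = Real.pi / 2 := by
    simp
  rw [← h0]
  have key : ∀ A s : ℝ, 1 ≤ A → 0 < s →
      |Real.exp (-A * s) * (Real.cos A + s * Real.sin A)| ≤ Real.exp (-A * s) * (1 + s) := by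
    intro A s hA hs
    rw [abs_mul, Real.abs_exp]
    refine mul_le_mul_of_nonneg_left ((abs_add_le _ _).trans ?_) (Real.exp_pos _).le
    rw [abs_mul, abs_of_pos hs]
    exact add_le_add (Real.abs_cos_le_one _) (mul_le_of_le_one_right hs.le (Real.abs_sin_le_one _))
  have hlim : Tendsto (fun A : ℝ => ∫ s in Set.Ioi (0 : ℝ),
      (1 - Real.exp (-A * s) * (Real.cos A + s * Real.sin A)) * (1 + s ^ 2)⁻¹) atTop
      (𝓝 (∫ s in Set.Ioi (0 : ℝ), (1 + s ^ 2)⁻¹)) := by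
    refine tendsto_integral_filter_of_dominated_convergence (fun s => 2 * (1 + s ^ 2)⁻¹) ?_ ?_ ?_ ?_
    · refine Eventually.of_forall fun A => Continuous.aestronglyMeasurable ?_
      have : ∀ s : ℝ, 1 + s ^ 2 ≠ 0 := fun s => by positivity
      fun_prop (disch := exact this _)
    · filter_upwards [eventually_ge_atTop 1] with A hA
      filter_upwards [ae_restrict_mem measurableSet_Ioi] with s hs
      have hs : 0 < s := hs
      rw [Real.norm_eq_abs, abs_mul, abs_of_pos (by positivity : 0 < (1 + s ^ 2)⁻¹)]
      refine mul_le_mul_of_nonneg_right ?_ (by positivity)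
      have h1 := key A s hA hs
      -- For `A ≥ 1` the factor `1 + s` is at most `exp(As)`, which makes the majorant independent
      -- of `A`.
      have h2 : Real.exp (-A * s) * (1 + s) ≤ 1 := by
        have h3 : 1 + s ≤ Real.exp (A * s) := by
          have := Real.add_one_le_exp (A * s)
          nlinarith
        calc _ ≤ Real.exp (-A * s) * Real.exp (A * s) :=
              mul_le_mul_of_nonneg_left h3 (Real.exp_pos _).le
          _ = 1 := by rw [← Real.exp_add]; simp
      calc _ ≤ |(1 : ℝ)| + |Real.exp (-A * s) * (Real.cos A + s * Real.sin A)| := abs_sub _ _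
        _ ≤ 2 := by rw [abs_one]; linarith
    · exact (integrable_inv_one_add_sq.integrableOn).const_mul 2
    · filter_upwards [ae_restrict_mem measurableSet_Ioi] with s hs
      have hs : 0 < s := hs
      have h1 : Tendsto (fun A : ℝ => Real.exp (-A * s) * (1 + s)) atTop (𝓝 0) := by
        have : Tendsto (fun A : ℝ => Real.exp (-(A * s))) atTop (𝓝 0) :=
          Real.tendsto_exp_neg_atTop_nhds_zero.comp (tendsto_id.atTop_mul_const hs)
        simpa using this.mul_const (1 + s)
      have h2 : Tendsto (fun A : ℝ => Real.exp (-A * s) * (Real.cos A + s * Real.sin A)) atTop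
          (𝓝 0) := by
        refine squeeze_zero_norm' ?_ h1
        filter_upwards [eventually_ge_atTop 1] with A hA
        exact key A s hA hs
      simpa using (h2.const_sub 1).mul_const (1 + s ^ 2)⁻¹
  refine hlim.congr' ?_
  filter_upwards [eventually_ge_atTop 0] with A hA
  exact (integral_sinc_eq hA).symm

theorem integral_sinc_neg (A : ℝ) :
    ∫ x in (0 : ℝ)..(-A), Real.sinc x = -∫ x in (0 : ℝ)..A, Real.sinc x := by
  have h := intervalIntegral.integral_comp_neg (a := 0) (b := A) Real.sinc
  simp only [Real.sinc_neg, neg_zero] at h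
  rw [h, intervalIntegral.integral_symm]

theorem tendsto_integral_sinc_mul {ν : ℝ} (hν : ν ≠ 0) :
    Tendsto (fun A : ℝ => ∫ x in (0 : ℝ)..(ν * A), Real.sinc x) atTop
      (𝓝 (Real.pi / 2 * Real.sign ν)) := by
  rcases lt_or_gt_of_ne hν with h | h
  · rw [Real.sign_of_neg h]
    have h1 := (tendsto_integral_sinc.comp (tendsto_id.const_mul_atTop (neg_pos.2 h))).neg
    simp only [Function.comp_def, id, neg_mul, integral_sinc_neg] at h1
    simpa using h1
  · rw [Real.sign_of_pos h]
    simpa [Function.comp_def] using tendsto_integral_sinc.comp (tendsto_id.const_mul_atTop h)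

theorem tendsto_integral_inv_mul_sin {ν : ℝ} (hν : ν ≠ 0) :
    Tendsto (fun ε : ℝ => ∫ t in ε..ε⁻¹, t⁻¹ * Real.sin (ν * t)) (𝓝[>] 0)
      (𝓝 (Real.pi / 2 * Real.sign ν)) := by
  have hc : ∀ a b : ℝ, IntervalIntegrable Real.sinc volume a b := fun a b =>
    Real.continuous_sinc.intervalIntegrable a b
  have h1 : Tendsto (fun ε : ℝ => ∫ x in (0 : ℝ)..(ν * ε⁻¹), Real.sinc x) (𝓝[>] 0)
      (𝓝 (Real.pi / 2 * Real.sign ν)) :=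
    (tendsto_integral_sinc_mul hν).comp tendsto_inv_nhdsGT_zero
  have h2 : Tendsto (fun ε : ℝ => ∫ x in (0 : ℝ)..(ν * ε), Real.sinc x) (𝓝[>] 0) (𝓝 0) := by
    have h3 : Continuous fun y : ℝ => ∫ x in (0 : ℝ)..y, Real.sinc x :=
      intervalIntegral.continuous_primitive hc 0
    have h4 := (h3.comp (continuous_const_mul ν)).tendsto 0
    simp only [Function.comp_def, mul_zero, intervalIntegral.integral_same] at h4
    exact h4.mono_left nhdsWithin_le_nhds
  have h5 := h1.sub h2
  rw [sub_zero] at h5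
  refine h5.congr' ?_
  filter_upwards [self_mem_nhdsWithin] with ε hε
  have hε : 0 < ε := hε
  rw [intervalIntegral.integral_interval_sub_left (hc _ _) (hc _ _),
    ← intervalIntegral.smul_integral_comp_mul_left, ← intervalIntegral.integral_smul]
  refine intervalIntegral.integral_congr fun t ht => ?_
  have ht0 : t ≠ 0 := by
    rintro rfl
    exact (lt_irrefl _ (lt_of_lt_of_le (lt_min hε (inv_pos.2 hε)) ht.1)).elim
  simp only [smul_eq_mul]
  rw [Real.sinc_of_ne_zero (mul_ne_zero hν ht0)]
  field_simp

/-- The character `exp (i y)`. -/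
def wave (y : ℝ) : ℂ := Complex.exp (Complex.I * (y : ℂ))

theorem continuous_wave : Continuous wave := by unfold wave; fun_prop

theorem norm_wave (y : ℝ) : ‖wave y‖ = 1 := by
  rw [wave, mul_comm, Complex.norm_exp_ofReal_mul_I]

theorem wave_zero : wave 0 = 1 := by simp [wave]

theorem wave_add (a b : ℝ) : wave (a + b) = wave a * wave b := by
  simp [wave, mul_add, Complex.exp_add]

theorem wave_eq (y : ℝ) : wave y = Real.cos y + Real.sin y * Complex.I := by
  rw [wave, mul_comm, Complex.exp_mul_I, Complex.ofReal_cos, Complex.ofReal_sin]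

theorem wave_add_wave_neg (y : ℝ) : wave y + wave (-y) = ((2 * Real.cos y : ℝ) : ℂ) := by
  rw [wave_eq, wave_eq]; push_cast [Real.cos_neg, Real.sin_neg]; ring

theorem wave_sub_wave_neg (y : ℝ) :
    wave y - wave (-y) = ((2 * Real.sin y : ℝ) : ℂ) * Complex.I := by
  rw [wave_eq, wave_eq]; push_cast [Real.cos_neg, Real.sin_neg]; ring

theorem hasDerivAt_wave (y : ℝ) : HasDerivAt wave (Complex.I * wave y) y := by
  have h1 : HasDerivAt (fun y : ℝ => Complex.I * (y : ℂ)) (Complex.I * 1) y :=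
    (Complex.ofRealCLM.hasDerivAt (x := y)).const_mul Complex.I
  refine h1.cexp.congr_deriv ?_
  rw [wave]; ring

theorem contDiff_wave {n : WithTop ℕ∞} : ContDiff ℝ n wave := by
  unfold wave
  exact (contDiff_const.mul Complex.ofRealCLM.contDiff).cexp

/-! ### The Hilbert transform of a plane wave -/

theorem setOf_hilbert {ε : ℝ} (hε : 0 < ε) :
    {t : ℝ | ε < |t| ∧ |t| < ε⁻¹} = Set.Ioo ε ε⁻¹ ∪ Set.Ioo (-ε⁻¹) (-ε) := by
  ext t
  simp only [Set.mem_ofPred_eq, Set.mem_union, Set.mem_Ioo]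
  rcases le_total 0 t with ht | ht
  · rw [abs_of_nonneg ht]
    constructor
    · exact Or.inl
    · rintro (h | h)
      · exact h
      · linarith [h.2]
  · rw [abs_of_nonpos ht]
    constructor
    · rintro ⟨h1, h2⟩; right; constructor <;> linarith
    · rintro (h | h)
      · linarith [h.1]
      · constructor <;> linarith [h.1, h.2]

theorem integrableOn_inv_smul_Ioo {f : ℝ → Vec} (hf : Continuous f) {ε : ℝ} (hε : 0 < ε) (R : ℝ) :
    IntegrableOn (fun t => t⁻¹ • f t) (Set.Ioo ε R) := by
  refine IntegrableOn.mono_set ?_ Set.Ioo_subset_Icc_self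
  refine ContinuousOn.integrableOn_compact isCompact_Icc ?_
  refine ContinuousOn.smul (continuousOn_inv₀.mono fun t ht => ?_) hf.continuousOn
  exact (hε.trans_le ht.1).ne'

theorem integrableOn_inv_smul_Ioo_neg {f : ℝ → Vec} (hf : Continuous f) {ε : ℝ} (hε : 0 < ε)
    (R : ℝ) : IntegrableOn (fun t => t⁻¹ • f t) (Set.Ioo (-R) (-ε)) := by
  refine IntegrableOn.mono_set ?_ Set.Ioo_subset_Icc_self
  refine ContinuousOn.integrableOn_compact isCompact_Icc ?_
  refine ContinuousOn.smul (continuousOn_inv₀.mono fun t ht => ?_) hf.continuousOn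
  exact (lt_of_le_of_lt ht.2 (neg_neg_of_pos hε)).ne

theorem integrableOn_hilbert {r : ℝ → Vec} (hr : Continuous r) (x : ℝ) {ε : ℝ} (hε : 0 < ε) :
    IntegrableOn (fun t : ℝ => t⁻¹ • r (x - t)) {t : ℝ | ε < |t| ∧ |t| < ε⁻¹} := by
  rw [setOf_hilbert hε]
  have hc : Continuous fun t : ℝ => r (x - t) := by fun_prop
  exact (integrableOn_inv_smul_Ioo hc hε _).union (integrableOn_inv_smul_Ioo_neg hc hε _)

/-- Folding `t` onto `-t` replaces the principal value by a one-sided integral in which the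
cancellation at `t = 0` is visible in the integrand. -/
theorem hilbertTrunc_eq {r : ℝ → Vec} (hr : Continuous r) (x : ℝ) {ε : ℝ} (hε : 0 < ε) :
    hilbertTrunc r x ε =
      Real.pi⁻¹ • ∫ t in Set.Ioo ε ε⁻¹, t⁻¹ • (r (x - t) - r (x + t)) := by
  have hc : Continuous fun t : ℝ => r (x - t) := by fun_prop
  have hc' : Continuous fun t : ℝ => r (x + t) := by fun_prop
  have hd : Disjoint (Set.Ioo ε ε⁻¹) (Set.Ioo (-ε⁻¹) (-ε)) :=
    Set.disjoint_left.2 fun t h1 h2 => by linarith [h1.1, h2.2]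
  have h2 : ∫ t in Set.Ioo (-ε⁻¹) (-ε), t⁻¹ • r (x - t) =
      ∫ t in Set.Ioo ε ε⁻¹, -(t⁻¹ • r (x + t)) := by
    have := (Measure.measurePreserving_neg (volume : Measure ℝ)).setIntegral_preimage_emb
      (Homeomorph.neg ℝ).measurableEmbedding (fun t : ℝ => t⁻¹ • r (x - t)) (Set.Ioo (-ε⁻¹) (-ε))
    rw [← this]
    have hs : (fun t : ℝ => -t) ⁻¹' Set.Ioo (-ε⁻¹) (-ε) = Set.Ioo ε ε⁻¹ := by simp
    refine Eq.trans (by rw [← hs]) (integral_congr_ae (Eventually.of_forall fun t => ?_))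
    simp only [inv_neg, neg_smul, sub_neg_eq_add]
  rw [hilbertTrunc, setOf_hilbert hε, setIntegral_union hd measurableSet_Ioo
    (integrableOn_inv_smul_Ioo hc hε _) (integrableOn_inv_smul_Ioo_neg hc hε _), h2,
    integral_neg, ← sub_eq_add_neg, ← integral_sub (integrableOn_inv_smul_Ioo hc hε _)
      (integrableOn_inv_smul_Ioo hc' hε _)]
  simp only [smul_sub]

theorem hilbertTrunc_add {r₁ r₂ : ℝ → Vec} (h₁ : Continuous r₁) (h₂ : Continuous r₂) (x : ℝ) {ε : ℝ}
    (hε : 0 < ε) : hilbertTrunc (fun q => r₁ q + r₂ q) x ε =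
      hilbertTrunc r₁ x ε + hilbertTrunc r₂ x ε := by
  simp only [hilbertTrunc, smul_add]
  rw [integral_add (integrableOn_hilbert h₁ x hε) (integrableOn_hilbert h₂ x hε), smul_add]

/-- After folding, the difference of the waves is `-2i sin(νt) exp(iνp)`, and the Dirichlet integral
yields the multiplier `-i sgn ν`. -/
theorem tendsto_hilbertTrunc_wave {ν : ℝ} (hν : ν ≠ 0) (v : Vec) (p : ℝ) :
    Tendsto (hilbertTrunc (fun q => wave (ν * q) • v) p) (𝓝[>] 0)
      (𝓝 ((-(Real.sign ν : ℂ) * Complex.I) • wave (ν * p) • v)) := by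
  have hc : Continuous fun q => wave (ν * q) • v := by
    have := continuous_wave
    fun_prop
  have h1 := (tendsto_integral_inv_mul_sin hν).smul_const
    ((-(2 / Real.pi : ℝ) * Complex.I) • wave (ν * p) • v)
  have h2 : (Real.pi / 2 * Real.sign ν) • ((-(2 / Real.pi : ℝ) * Complex.I) • wave (ν * p) • v) =
      (-(Real.sign ν : ℂ) * Complex.I) • wave (ν * p) • v := by
    rw [← Complex.coe_smul, smul_smul]
    congr 1
    push_cast
    have : (Real.pi : ℂ) ≠ 0 := by exact_mod_cast Real.pi_ne_zero
    field_simp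
  rw [h2] at h1
  refine h1.congr' ?_
  filter_upwards [self_mem_nhdsWithin, mem_nhdsWithin_of_mem_nhds (Iio_mem_nhds one_pos)]
    with ε hε hε1
  have hε : 0 < ε := hε
  have hε1 : ε < 1 := hε1
  have hle : ε ≤ ε⁻¹ := hε1.le.trans (one_le_inv_iff₀.2 ⟨hε, hε1.le⟩)
  rw [hilbertTrunc_eq hc p hε, intervalIntegral.integral_of_le hle, integral_Ioc_eq_integral_Ioo,
    ← integral_smul_const, ← integral_smul]
  refine integral_congr_ae (Eventually.of_forall fun t => ?_)
  simp only
  rw [← sub_smul, show ν * (p - t) = ν * p + -(ν * t) by ring,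
    show ν * (p + t) = ν * p + ν * t by ring, wave_add, wave_add, ← mul_sub,
    ← neg_sub (wave (ν * t)), wave_sub_wave_neg]
  simp only [← Complex.coe_smul, smul_smul]
  congr 1
  push_cast
  have : (Real.pi : ℂ) ≠ 0 := by exact_mod_cast Real.pi_ne_zero
  field_simp

/-- Riemann–Lebesgue lemma for `exp (i λ T u)` as `T → ∞`. -/
theorem tendsto_integral_wave_smul {l : ℝ} (hl : l ≠ 0) (Q : ℝ → Vec) (a b : ℝ) :
    Tendsto (fun T : ℝ => ∫ u in a..b, wave (l * T * u) • Q u) atTop (𝓝 0) := by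
  have key : ∀ S : Set ℝ, MeasurableSet S →
      Tendsto (fun T : ℝ => ∫ u in S, wave (l * T * u) • Q u) atTop (𝓝 0) := by
    intro S hS
    -- The frequency `-lT/(2π)` in the normalization of the Fourier character leaves every compact
    -- set as `T → ∞`.
    have h1 := Real.tendsto_integral_exp_smul_cocompact (S.indicator Q)
    have h2 : Tendsto (fun T : ℝ => -(l / (2 * Real.pi)) * T) atTop (cocompact ℝ) := by
      have : -(l / (2 * Real.pi)) ≠ 0 := by
        rw [neg_ne_zero]; exact div_ne_zero hl (by positivity)
      exact (Homeomorph.mulLeft₀ _ this).isClosedEmbedding.tendsto_cocompact.comp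
        (tendsto_id.mono_right atTop_le_cocompact)
    refine (h1.comp h2).congr fun T => ?_
    rw [← integral_indicator hS]
    refine integral_congr_ae (Eventually.of_forall fun u => ?_)
    by_cases hu : u ∈ S
    · simp only [Set.indicator_of_mem hu]
      have : ((Real.fourierChar (-(u * (-(l / (2 * Real.pi)) * T))) : Circle) : ℂ) =
          wave (l * T * u) := by
        rw [Real.fourierChar_apply, wave]
        congr 1
        push_cast
        have : (Real.pi : ℂ) ≠ 0 := by exact_mod_cast Real.pi_ne_zero
        field_simp
      rw [← this]; rfl
    · simp only [Set.indicator_of_notMem hu]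
      exact smul_zero (Real.fourierChar _)
  have := (key _ (measurableSet_Ioc (a := a) (b := b))).sub
    (key _ (measurableSet_Ioc (a := b) (b := a)))
  simpa [intervalIntegral] using this

theorem tendsto_integral_cos_smul {l : ℝ} (hl : l ≠ 0) {Q : ℝ → Vec} {a b : ℝ}
    (hQ : IntervalIntegrable Q volume a b) :
    Tendsto (fun T : ℝ => ∫ u in a..b, Real.cos (l * T * u) • Q u) atTop (𝓝 0) ∧
    Tendsto (fun T : ℝ => ∫ u in a..b, Real.sin (l * T * u) • Q u) atTop (𝓝 0) := by
  have h1 := tendsto_integral_wave_smul hl Q a b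
  have h2 := tendsto_integral_wave_smul (neg_ne_zero.2 hl) Q a b
  have hi : ∀ m T : ℝ, IntervalIntegrable (fun u => wave (m * T * u) • Q u) volume a b := by
    intro m T
    exact hQ.continuousOn_smul (f := fun u => wave (m * T * u)) (continuous_wave.comp (by fun_prop)).continuousOn
  constructor
  · have h3 := (h1.add h2).const_smul (1 / 2 : ℂ)
    rw [add_zero, smul_zero] at h3
    refine h3.congr fun T => ?_
    rw [← intervalIntegral.integral_add (hi _ _) (hi _ _), ← intervalIntegral.integral_smul]
    congr 1; funext u
    rw [← add_smul, neg_mul, neg_mul, wave_add_wave_neg, smul_smul, ← Complex.coe_smul]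
    congr 1; push_cast; ring
  · have h3 := (h1.sub h2).const_smul (1 / (2 * Complex.I) : ℂ)
    rw [sub_zero, smul_zero] at h3
    refine h3.congr fun T => ?_
    rw [← intervalIntegral.integral_sub (hi _ _) (hi _ _), ← intervalIntegral.integral_smul]
    congr 1; funext u
    rw [← sub_smul, neg_mul, neg_mul, wave_sub_wave_neg, smul_smul, ← Complex.coe_smul]
    congr 1; push_cast
    field_simp

theorem intervalIntegral_swap_of_continuous {f : ℝ → ℝ → Vec} (hf : Continuous fun q : ℝ × ℝ => f q.1 q.2)
    (a b c d : ℝ) :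
    ∫ x in a..b, ∫ y in c..d, f x y = ∫ y in c..d, ∫ x in a..b, f x y := by
  refine intervalIntegral_intervalIntegral_swap ?_
  refine IntegrableOn.mono_set ?_ (Set.prod_mono Set.uIoc_subset_uIcc Set.uIoc_subset_uIcc)
  exact hf.continuousOn.integrableOn_compact (isCompact_uIcc.prod isCompact_uIcc)

theorem intervalIntegral_symm_eq {f : ℝ → Vec} (hf : Continuous f) (T : ℝ) :
    ∫ s in (-T)..T, f s = ∫ s in (0 : ℝ)..T, (f s + f (-s)) := by
  have hi : ∀ a b, IntervalIntegrable f volume a b := fun a b => hf.intervalIntegrable a b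
  have hi' : ∀ a b, IntervalIntegrable (fun s => f (-s)) volume a b :=
    fun a b => (hf.comp continuous_neg).intervalIntegrable a b
  rw [intervalIntegral.integral_add (hi _ _) (hi' _ _), intervalIntegral.integral_comp_neg,
    neg_zero, add_comm, intervalIntegral.integral_add_adjacent_intervals (hi _ _) (hi _ _)]

theorem intervalIntegral_sign_eq {f : ℝ → Vec} (hf : Continuous f) {T : ℝ} (hT : 0 ≤ T) :
    ∫ s in (-T)..T, Real.sign s • f s = ∫ s in (0 : ℝ)..T, (f s - f (-s)) := by
  have hi : ∀ a b, IntervalIntegrable f volume a b := fun a b => hf.intervalIntegrable a b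
  have hi' : ∀ a b, IntervalIntegrable (fun s => f (-s)) volume a b :=
    fun a b => (hf.comp continuous_neg).intervalIntegrable a b
  have h1 : Set.EqOn (fun s => Real.sign s • f s) f (Set.uIoc 0 T) := by
    intro s hs
    rw [Set.uIoc_of_le hT] at hs
    simp [Real.sign_of_pos hs.1]
  have h2 : ∀ᵐ s : ℝ, s ∈ Set.uIoc (-T) 0 → Real.sign s • f s = -f s := by
    filter_upwards [Measure.ae_ne volume (0 : ℝ)] with s hs0 hs
    rw [Set.uIoc_of_le (by linarith)] at hs
    simp [Real.sign_of_neg (lt_of_le_of_ne hs.2 hs0)]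
  have j1 : IntervalIntegrable (fun s => Real.sign s • f s) volume 0 T :=
    (hi 0 T).congr fun s hs => (h1 hs).symm
  have j2 : IntervalIntegrable (fun s => Real.sign s • f s) volume (-T) 0 := by
    refine IntervalIntegrable.congr_ae (f := fun s => -f s) (hi _ _).neg ?_
    rw [EventuallyEq, ae_restrict_iff' measurableSet_uIoc]
    filter_upwards [h2] with s hs hs'
    exact (hs hs').symm
  rw [intervalIntegral.integral_sub (hi _ _) (hi' _ _), intervalIntegral.integral_comp_neg,
    neg_zero, ← intervalIntegral.integral_add_adjacent_intervals j2 j1,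
    intervalIntegral.integral_congr_ae h2, intervalIntegral.integral_neg,
    intervalIntegral.integral_congr_ae (ae_of_all _ fun s hs => h1 hs)]
  abel

theorem integral_cos_mul {l : ℝ} (hl : l ≠ 0) (T : ℝ) :
    ∫ s in (0 : ℝ)..T, Real.cos (l * s) = l⁻¹ * Real.sin (l * T) := by
  rw [intervalIntegral.integral_comp_mul_left Real.cos hl]
  simp

theorem integral_sin_mul {l : ℝ} (hl : l ≠ 0) (T : ℝ) :
    ∫ s in (0 : ℝ)..T, Real.sin (l * s) = l⁻¹ * (1 - Real.cos (l * T)) := by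
  rw [intervalIntegral.integral_comp_mul_left Real.sin hl]
  simp

/-- The difference quotient at `0` of a function with `‖G u - G 0‖ ≤ K |u|` is integrable. -/
theorem intervalIntegrable_diffQuotient {G : ℝ → Vec} (hG : Continuous G) {K : ℝ}
    (hK : ∀ u, |u| ≤ 1 → ‖G u - G 0‖ ≤ K * |u|) :
    IntervalIntegrable (fun u => u⁻¹ • (G u - G 0)) volume (-1) 1 := by
  rw [intervalIntegrable_iff, Set.uIoc_of_le (by norm_num)]
  refine Integrable.mono' (g := fun _ => K) (integrable_const _) ?_ ?_
  · exact (measurable_inv.aestronglyMeasurable).smul (hG.sub continuous_const).aestronglyMeasurable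
  · filter_upwards [ae_restrict_mem measurableSet_Ioc] with u hu
    have h1 : |u| ≤ 1 := abs_le.2 ⟨hu.1.le, hu.2⟩
    rw [norm_smul, norm_inv, Real.norm_eq_abs]
    rcases eq_or_ne u 0 with rfl | h0
    · have := hK 1 (by simp)
      simp only [abs_zero, inv_zero, zero_mul]
      exact (norm_nonneg _).trans (this.trans_eq (by simp))
    · rw [inv_mul_le_iff₀ (abs_pos.2 h0), mul_comm]
      exact hK u h1

theorem integral_wave_sum_eq {G : ℝ → Vec} (hG : Continuous G) (ν s : ℝ) :
    (∫ u in (-1 : ℝ)..1, wave (ν * (s * u)) • G u) + ∫ u in (-1 : ℝ)..1, wave (ν * (-s * u)) • G u =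
      ∫ u in (-1 : ℝ)..1, (2 * Real.cos (ν * u * s)) • G u := by
  have hc : ∀ s, Continuous fun u => wave (ν * (s * u)) • G u := fun s =>
    (continuous_wave.comp (by fun_prop)).smul hG
  rw [← intervalIntegral.integral_add ((hc _).intervalIntegrable _ _)
    ((hc _).intervalIntegrable _ _)]
  congr 1; funext u
  rw [← add_smul, show ν * (-s * u) = -(ν * (s * u)) by ring, wave_add_wave_neg, Complex.coe_smul,
    show ν * (s * u) = ν * u * s by ring]

theorem integral_wave_diff_eq {G : ℝ → Vec} (hG : Continuous G) (ν s : ℝ) :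
    (∫ u in (-1 : ℝ)..1, wave (ν * (s * u)) • G u) - ∫ u in (-1 : ℝ)..1, wave (ν * (-s * u)) • G u =
      Complex.I • ∫ u in (-1 : ℝ)..1, (2 * Real.sin (ν * u * s)) • G u := by
  have hc : ∀ s, Continuous fun u => wave (ν * (s * u)) • G u := fun s =>
    (continuous_wave.comp (by fun_prop)).smul hG
  rw [← intervalIntegral.integral_sub ((hc _).intervalIntegrable _ _)
    ((hc _).intervalIntegrable _ _), ← intervalIntegral.integral_smul]
  congr 1; funext u
  rw [← sub_smul, show ν * (-s * u) = -(ν * (s * u)) by ring, wave_sub_wave_neg,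
    show ν * (s * u) = ν * u * s by ring, ← Complex.coe_smul, smul_smul, mul_comm]

theorem continuous_integral_wave {G : ℝ → Vec} (hG : Continuous G) (ν : ℝ) :
    Continuous fun s : ℝ => ∫ u in (-1 : ℝ)..1, wave (ν * (s * u)) • G u := by
  have := continuous_wave
  exact intervalIntegral.continuous_parametric_intervalIntegral_of_continuous' (by fun_prop) _ _

/-- Fourier inversion at `u = 0`. Integrating in `s` first gives the Dirichlet kernel `2
sin(νuT)/(νu)`. Splitting `G` into `G 0` and `u` times the difference quotient, the first part is a
Dirichlet integral and the second tends to `0` by Riemann–Lebesgue, the quotient being integrable.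
-/
theorem tendsto_integral_wave {G : ℝ → Vec} (hG : Continuous G) {K : ℝ}
    (hK : ∀ u, |u| ≤ 1 → ‖G u - G 0‖ ≤ K * |u|) {ν : ℝ} (hν : ν ≠ 0) :
    Tendsto (fun T : ℝ => ∫ s in (-T)..T, ∫ u in (-1 : ℝ)..1, wave (ν * (s * u)) • G u) atTop
      (𝓝 ((2 * Real.pi * Real.sign ν / ν) • G 0)) := by
  have hQ := intervalIntegrable_diffQuotient hG hK
  have h1 := ((tendsto_integral_cos_smul hν hQ).2).const_smul (2 / ν)
  have h2 := ((tendsto_integral_sinc_mul hν).const_mul (4 / ν)).smul_const (G 0)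
  have h3 := h2.add h1
  rw [smul_zero, add_zero, show 4 / ν * (Real.pi / 2 * Real.sign ν) =
    2 * Real.pi * Real.sign ν / ν by ring] at h3
  refine h3.congr fun T => ?_
  rw [intervalIntegral_symm_eq (continuous_integral_wave hG ν)]
  simp_rw [integral_wave_sum_eq hG]
  rw [intervalIntegral_swap_of_continuous (by fun_prop)]
  -- The Dirichlet kernel is written as `2T sinc(νTu)`, which is continuous at `u = 0`; rescaling
  -- `u` produces the integral of `sinc` up to `νT`.
  have hs : 4 / ν * ∫ x in (0 : ℝ)..(ν * T), Real.sinc x =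
      ∫ u in (-1 : ℝ)..1, 2 * T * Real.sinc (ν * T * u) := by
    rw [intervalIntegral.integral_const_mul]
    rcases eq_or_ne T 0 with rfl | hT
    · simp
    have hn : ν * T ≠ 0 := mul_ne_zero hν hT
    rw [intervalIntegral.integral_comp_mul_left Real.sinc hn, mul_one, mul_neg_one,
      ← intervalIntegral.integral_add_adjacent_intervals
        (Real.continuous_sinc.intervalIntegrable (-(ν * T)) 0)
        (Real.continuous_sinc.intervalIntegrable 0 (ν * T)),
      intervalIntegral.integral_symm (0 : ℝ) (-(ν * T)), integral_sinc_neg, smul_eq_mul]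
    field_simp; ring
  have i1 : IntervalIntegrable (fun u => (2 * T * Real.sinc (ν * T * u)) • G 0) volume (-1) 1 := by
    have := Real.continuous_sinc
    exact Continuous.intervalIntegrable (by fun_prop) _ _
  have i2 : IntervalIntegrable
      (fun u => (2 / ν) • (Real.sin (ν * T * u) • u⁻¹ • (G u - G 0))) volume (-1) 1 :=
    (hQ.continuousOn_smul (f := fun u => Real.sin (ν * T * u)) (by fun_prop)).smul (2 / ν)
  rw [hs, ← intervalIntegral.integral_smul_const, ← intervalIntegral.integral_smul,
    ← intervalIntegral.integral_add i1 i2]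
  refine intervalIntegral.integral_congr_ae ?_
  filter_upwards [Measure.ae_ne volume (0 : ℝ)] with u hu _
  have hn : ν * u ≠ 0 := mul_ne_zero hν hu
  rw [intervalIntegral.integral_smul_const, intervalIntegral.integral_const_mul,
    integral_cos_mul hn]
  have hsc : 2 * T * Real.sinc (ν * T * u) = 2 * ((ν * u)⁻¹ * Real.sin (ν * u * T)) := by
    rcases eq_or_ne T 0 with rfl | hT
    · simp
    rw [Real.sinc_of_ne_zero (by positivity), show ν * T * u = ν * u * T by ring]
    field_simp
  rw [hsc, smul_smul, smul_smul, show ν * T * u = ν * u * T by ring,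
    show 2 / ν * Real.sin (ν * u * T) * u⁻¹ = 2 * ((ν * u)⁻¹ * Real.sin (ν * u * T)) by
      field_simp, ← smul_add, add_sub_cancel]

/-- Here the `s`-integral gives the conjugate kernel `2(1 - cos(νuT))/(νu)`. It is odd in `u`, so `G
0` may be subtracted; the cosine then dies by Riemann–Lebesgue and leaves the principal value of
`G(u)/u` in its subtracted form. -/
theorem tendsto_integral_sign_wave {G : ℝ → Vec} (hG : Continuous G) {K : ℝ}
    (hK : ∀ u, |u| ≤ 1 → ‖G u - G 0‖ ≤ K * |u|) {ν : ℝ} (hν : ν ≠ 0) :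
    Tendsto (fun T : ℝ => ∫ s in (-T)..T,
        Real.sign s • ∫ u in (-1 : ℝ)..1, wave (ν * (s * u)) • G u) atTop
      (𝓝 ((Complex.I * (2 / ν : ℝ)) • ∫ u in (-1 : ℝ)..1, u⁻¹ • (G u - G 0))) := by
  have hQ := intervalIntegrable_diffQuotient hG hK
  have h1 := (((tendsto_integral_cos_smul hν hQ).1).const_sub
    (∫ u in (-1 : ℝ)..1, u⁻¹ • (G u - G 0))).const_smul (Complex.I * (2 / ν : ℝ))
  rw [sub_zero] at h1
  refine h1.congr' ?_
  filter_upwards [eventually_ge_atTop 0] with T hT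
  rw [intervalIntegral_sign_eq (continuous_integral_wave hG ν) hT]
  simp_rw [integral_wave_diff_eq hG]
  rw [intervalIntegral.integral_smul, intervalIntegral_swap_of_continuous (by fun_prop),
    mul_smul, Complex.coe_smul]
  congr 1
  have hsin : Continuous fun u : ℝ => ∫ s in (0 : ℝ)..T, 2 * Real.sin (ν * u * s) :=
    intervalIntegral.continuous_parametric_intervalIntegral_of_continuous' (by fun_prop) _ _
  have hodd : ∫ u in (-1 : ℝ)..1, (∫ s in (0 : ℝ)..T, 2 * Real.sin (ν * u * s)) • G 0 = 0 := by
    rw [intervalIntegral_symm_eq (f := fun u => (∫ s in (0 : ℝ)..T, 2 * Real.sin (ν * u * s)) • G 0)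
      (by fun_prop)]
    simp
  have i1 : IntervalIntegrable (fun u =>
      (∫ s in (0 : ℝ)..T, 2 * Real.sin (ν * u * s)) • G u) volume (-1) 1 :=
    (hsin.smul hG).intervalIntegrable _ _
  have i2 : IntervalIntegrable (fun u =>
      (∫ s in (0 : ℝ)..T, 2 * Real.sin (ν * u * s)) • G 0) volume (-1) 1 :=
    (hsin.smul continuous_const).intervalIntegrable _ _
  rw [← intervalIntegral.integral_sub hQ
    (hQ.continuousOn_smul (f := fun u => Real.cos (ν * T * u)) (by fun_prop)),
    ← intervalIntegral.integral_smul]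
  simp_rw [intervalIntegral.integral_smul_const]
  rw [← sub_zero (∫ u in (-1 : ℝ)..1, (∫ s in (0 : ℝ)..T, 2 * Real.sin (ν * u * s)) • G u),
    ← hodd, ← intervalIntegral.integral_sub i1 i2]
  refine intervalIntegral.integral_congr_ae ?_
  filter_upwards [Measure.ae_ne volume (0 : ℝ)] with u hu _
  have hn : ν * u ≠ 0 := mul_ne_zero hν hu
  rw [intervalIntegral.integral_const_mul, integral_sin_mul hn, ← smul_sub,
    show ν * T * u = ν * u * T by ring, smul_smul (Real.cos _), ← sub_smul, smul_smul]
  congr 1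
  field_simp

/-! ### Circles of latitude and principal values over the sphere -/

/-- The integral of `f` over the circle of latitude at height `u` above the equator `θ^⊥`. -/
def latitudeIntegral (e₁ e₂ θ : Space) (f : Space → Vec) (u : ℝ) : Vec :=
  ∫ φ in (-Real.pi)..Real.pi, f (heightPoint e₁ e₂ θ (φ, u))

theorem heightPoint_zero (e₁ e₂ θ : Space) (φ : ℝ) :
    heightPoint e₁ e₂ θ (φ, 0) = circlePoint e₁ e₂ φ := by
  simp [heightPoint]

theorem IsFrame.inner_heightPoint {e₁ e₂ θ : Space} (h : IsFrame e₁ e₂ θ) (p : ℝ × ℝ) :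
    inner ℝ (heightPoint e₁ e₂ θ p) θ = p.2 := by
  obtain ⟨⟨h1, h2, h3⟩, h12, h13, h23⟩ := isFrame_iff.1 h
  simp [heightPoint, circlePoint, inner_add_left, inner_smul_left, h13, h23, h3]

theorem IsFrame.norm_heightPoint {e₁ e₂ θ : Space} (h : IsFrame e₁ e₂ θ) {p : ℝ × ℝ}
    (hp : |p.2| ≤ 1) : ‖heightPoint e₁ e₂ θ p‖ = 1 := by
  have h0 : 0 ≤ 1 - p.2 ^ 2 := by nlinarith [(sq_le_one_iff_abs_le_one p.2).2 hp]
  have h1 : ‖heightPoint e₁ e₂ θ p‖ ^ 2 = 1 := by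
    rw [heightPoint, circlePoint, smul_add, smul_smul, smul_smul, h.norm_sq, mul_pow, mul_pow,
      Real.sq_sqrt h0]
    linear_combination (1 - p.2 ^ 2) * Real.sin_sq_add_cos_sq p.1
  exact (pow_eq_one_iff_of_nonneg (norm_nonneg _) two_ne_zero).1 h1

theorem IsFrame.norm_circlePoint {e₁ e₂ θ : Space} (h : IsFrame e₁ e₂ θ) (φ : ℝ) :
    ‖circlePoint e₁ e₂ φ‖ = 1 :=
  (isFrame_iff.1 (h.rotate φ)).1.1

theorem integrable_sphere {f : Space → Vec} (hf : Continuous f) :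
    Integrable (fun κ : Metric.sphere (0 : Space) 1 => f κ) (volume : Measure Space).toSphere :=
  Continuous.integrable_of_hasCompactSupport (hf.comp continuous_subtype_val)
    (HasCompactSupport.of_compactSpace _)

theorem continuous_latitudeIntegral (e₁ e₂ θ : Space) {f : Space → Vec} (hf : Continuous f) :
    Continuous (latitudeIntegral e₁ e₂ θ f) := by
  refine intervalIntegral.continuous_parametric_intervalIntegral_of_continuous' ?_ _ _
  exact hf.comp ((continuous_heightPoint e₁ e₂ θ).comp (by fun_prop))

theorem intervalIntegrable_latitude (e₁ e₂ θ : Space) {f : Space → Vec} (hf : Continuous f)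
    (u a b : ℝ) : IntervalIntegrable (fun φ => f (heightPoint e₁ e₂ θ (φ, u))) volume a b :=
  (hf.comp ((continuous_heightPoint e₁ e₂ θ).comp (by fun_prop))).intervalIntegrable _ _

/-- At fixed longitude the point at height `u` moves by at most `1 - √(1 - u²) + |u| ≤ 2|u|` from
the equator, because `1 - √(1 - u²) ≤ u² ≤ |u|`. This Lipschitz bound is all that the principal
values and the line integrals require of the amplitude. -/
theorem IsFrame.latitudeIntegral_sub_le {e₁ e₂ θ : Space} (h : IsFrame e₁ e₂ θ) {f : Space → Vec}
    (hf : ContDiff ℝ 1 f) : ∃ K, ∀ u, |u| ≤ 1 →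
      ‖latitudeIntegral e₁ e₂ θ f u - latitudeIntegral e₁ e₂ θ f 0‖ ≤ K * |u| := by
  -- The derivative is bounded on the closed ball and not merely on the sphere, since the mean value
  -- inequality runs along a chord.
  obtain ⟨C, hC⟩ := (isCompact_closedBall (0 : Space) 1).exists_bound_of_continuousOn
    (hf.continuous_fderiv one_ne_zero).continuousOn
  have hC0 : 0 ≤ C := (norm_nonneg _).trans (hC 0 (by simp))
  refine ⟨C * 2 * |Real.pi - -Real.pi|, fun u hu => ?_⟩
  rw [latitudeIntegral, latitudeIntegral,
    ← intervalIntegral.integral_sub (intervalIntegrable_latitude _ _ _ hf.continuous _ _ _)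
      (intervalIntegrable_latitude _ _ _ hf.continuous _ _ _), mul_right_comm]
  refine intervalIntegral.norm_integral_le_of_norm_le_const fun φ _ => ?_
  have h1 : ‖f (heightPoint e₁ e₂ θ (φ, u)) - f (heightPoint e₁ e₂ θ (φ, 0))‖ ≤
      C * ‖heightPoint e₁ e₂ θ (φ, u) - heightPoint e₁ e₂ θ (φ, 0)‖ := by
    refine (convex_closedBall (0 : Space) 1).norm_image_sub_le_of_norm_fderiv_le (𝕜 := ℝ)
      (fun y _ => (hf.differentiable one_ne_zero) y) hC ?_ ?_
    · simp [h.norm_heightPoint (p := (φ, 0)) (by simp)]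
    · simp [h.norm_heightPoint (p := (φ, u)) hu]
  refine h1.trans (mul_assoc C 2 |u| ▸ mul_le_mul_of_nonneg_left ?_ hC0)
  have h2 : heightPoint e₁ e₂ θ (φ, u) - heightPoint e₁ e₂ θ (φ, 0) =
      (√(1 - u ^ 2) - 1) • circlePoint e₁ e₂ φ + u • θ := by
    simp only [heightPoint]; simp; module
  rw [h2]
  refine (norm_add_le _ _).trans ?_
  rw [norm_smul, norm_smul, h.norm_circlePoint, (isFrame_iff.1 h).1.2.2, mul_one, mul_one,
    Real.norm_eq_abs, Real.norm_eq_abs, two_mul]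
  refine add_le_add_left ?_ _
  have hsq : u ^ 2 ≤ 1 := (sq_le_one_iff_abs_le_one u).2 hu
  have h3 : √(1 - u ^ 2) ≤ 1 := Real.sqrt_le_one.2 (by nlinarith [sq_nonneg u])
  have h4 : 1 - u ^ 2 ≤ √(1 - u ^ 2) := by
    have := Real.sq_sqrt (by linarith : 0 ≤ 1 - u ^ 2)
    nlinarith [Real.sqrt_nonneg (1 - u ^ 2)]
  rw [abs_of_nonpos (by linarith)]
  have : u ^ 2 ≤ |u| := by rw [← sq_abs]; nlinarith [abs_nonneg u]
  linarith

/-- Integration over the sphere by circles of latitude, with a weight in the height. -/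
theorem IsFrame.integral_sphere_latitude {e₁ e₂ θ : Space} (h : IsFrame e₁ e₂ θ) {f : Space → Vec}
    (hf : Continuous f) {w : ℝ → ℝ} (hw : Measurable w) {B : ℝ} (hB : ∀ u, |w u| ≤ B) :
    ∫ κ : Metric.sphere (0 : Space) 1, w (inner ℝ (κ : Space) θ) • f κ
        ∂(volume : Measure Space).toSphere =
      ∫ u in (-1 : ℝ)..1, w u • latitudeIntegral e₁ e₂ θ f u := by
  have hm : StronglyMeasurable fun κ : Space => w (inner ℝ κ θ) • f κ :=
    (hw.comp (by fun_prop : Measurable fun κ : Space => inner ℝ κ θ)).stronglyMeasurable.smul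
      hf.stronglyMeasurable
  obtain ⟨C, hC⟩ := (isCompact_sphere (0 : Space) 1).exists_bound_of_continuousOn hf.continuousOn
  have hB0 : 0 ≤ B := (abs_nonneg _).trans (hB 0)
  have hI : Integrable (fun p => w p.2 • f (heightPoint e₁ e₂ θ p))
      ((volume.restrict (Set.Ioo (-Real.pi) Real.pi)).prod (volume.restrict (Set.Ioo (-1 : ℝ) 1))) := by
    refine Integrable.mono' (g := fun _ => B * C) (integrable_const _) ?_ ?_
    · exact ((hw.comp measurable_snd).stronglyMeasurable.smul
        (hf.comp (continuous_heightPoint e₁ e₂ θ)).stronglyMeasurable).aestronglyMeasurable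
    · rw [Measure.prod_restrict]
      filter_upwards [ae_restrict_mem (measurableSet_Ioo.prod measurableSet_Ioo)] with p hp
      rw [norm_smul]
      refine mul_le_mul (hB _) (hC _ ?_) (norm_nonneg _) hB0
      simp [h.norm_heightPoint (p := p) (abs_le.2 ⟨hp.2.1.le, hp.2.2.le⟩)]
  rw [h.integral_sphere_height hm]
  simp_rw [h.inner_heightPoint]
  rw [integral_prod_symm _ hI, intervalIntegral.integral_of_le (by norm_num),
    integral_Ioc_eq_integral_Ioo]
  congr 1; funext u
  simp only
  rw [integral_smul, latitudeIntegral, intervalIntegral.integral_of_le (by linarith [Real.pi_pos]),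
    integral_Ioc_eq_integral_Ioo]

theorem IsFrame.funkIntegrable_of_continuous {e₁ e₂ θ : Space} (h : IsFrame e₁ e₂ θ)
    {f : Space → Vec} (hf : Continuous f) : FunkIntegrable f θ := by
  rw [h.funkIntegrable_iff hf.stronglyMeasurable]
  exact ((hf.comp (continuous_circlePoint e₁ e₂)).continuousOn.integrableOn_compact
    isCompact_Icc).mono_set Set.Ioo_subset_Icc_self

theorem IsFrame.funk_eq_latitudeIntegral {e₁ e₂ θ : Space} (h : IsFrame e₁ e₂ θ)
    {f : Space → Vec} (hf : Continuous f) : funk f θ = latitudeIntegral e₁ e₂ θ f 0 := by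
  rw [h.funk_eq hf.stronglyMeasurable, latitudeIntegral,
    intervalIntegral.integral_of_le (by linarith [Real.pi_pos]), integral_Ioc_eq_integral_Ioo]
  simp_rw [heightPoint_zero]

/-- The antipodal map sends height `u` to `-u` and shifts the longitude by `π`, which does not
matter over a full period. -/
theorem IsFrame.latitudeIntegral_comp_neg {e₁ e₂ θ : Space} (f : Space → Vec) (u : ℝ) :
    latitudeIntegral e₁ e₂ θ (fun κ => f (-κ)) u = latitudeIntegral e₁ e₂ θ f (-u) := by
  have hp : Function.Periodic (fun φ => f (heightPoint e₁ e₂ θ (φ, -u))) (2 * Real.pi) := by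
    intro φ
    simp [heightPoint, circlePoint]
  have h1 : ∀ φ : ℝ, f (-heightPoint e₁ e₂ θ (φ, u)) =
      f (heightPoint e₁ e₂ θ (φ + Real.pi, -u)) := by
    intro φ
    congr 1
    simp [heightPoint, circlePoint, Real.cos_add_pi, Real.sin_add_pi]
    module
  rw [latitudeIntegral, latitudeIntegral]
  simp_rw [h1]
  rw [intervalIntegral.integral_comp_add_right (fun φ => f (heightPoint e₁ e₂ θ (φ, -u)))]
  have := hp.intervalIntegral_add_eq (-Real.pi + Real.pi) (-Real.pi)
  rw [show -Real.pi + Real.pi + 2 * Real.pi = Real.pi + Real.pi by ring,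
    show -Real.pi + 2 * Real.pi = Real.pi by ring] at this
  exact this

/-- The principal value over the sphere of a continuously differentiable field. -/
theorem IsFrame.pvSphere_of_contDiff {e₁ e₂ θ : Space} (h : IsFrame e₁ e₂ θ) {f : Space → Vec}
    (hf : ContDiff ℝ 1 f) : PvSphereExists f θ ∧ pvSphere f θ =
      ∫ u in (-1 : ℝ)..1, u⁻¹ • (latitudeIntegral e₁ e₂ θ f u - latitudeIntegral e₁ e₂ θ f 0) := by
  obtain ⟨K, hK⟩ := h.latitudeIntegral_sub_le hf
  have hL := continuous_latitudeIntegral e₁ e₂ θ hf.continuous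
  set L := latitudeIntegral e₁ e₂ θ f with hLdef
  have hQ := intervalIntegrable_diffQuotient hL hK
  have hmeas : Measurable fun κ : Metric.sphere (0 : Space) 1 => inner ℝ (κ : Space) θ := by
    fun_prop
  have hset : ∀ ε : ℝ, MeasurableSet {κ : Metric.sphere (0 : Space) 1 | ε < |inner ℝ (κ : Space) θ|} :=
    fun ε => measurableSet_lt measurable_const hmeas.abs
  let w : ℝ → ℝ → ℝ := fun ε u => {u : ℝ | ε < |u|}.indicator (fun u => u⁻¹) u
  have hw : ∀ ε, Measurable (w ε) := fun ε =>
    measurable_inv.indicator (measurableSet_lt measurable_const measurable_id.abs)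
  have hwB : ∀ ε > 0, ∀ u, |w ε u| ≤ ε⁻¹ := by
    intro ε hε u
    by_cases hu : ε < |u|
    · simp only [w, Set.indicator_of_mem (show u ∈ {u : ℝ | ε < |u|} from hu), abs_inv]
      exact inv_anti₀ hε hu.le
    · simp only [w, Set.indicator_of_notMem (show u ∉ {u : ℝ | ε < |u|} from hu), abs_zero]
      positivity
  have htrunc : ∀ ε > 0, pvSphereTrunc f θ ε = ∫ u in (-1 : ℝ)..1, w ε u • (L u - L 0) := by
    intro ε hε
    have h1 : pvSphereTrunc f θ ε = ∫ u in (-1 : ℝ)..1, w ε u • L u := by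
      rw [← h.integral_sphere_latitude hf.continuous (hw ε) (hwB ε hε), pvSphereTrunc,
        ← integral_indicator (hset ε)]
      congr 1; funext κ
      by_cases hu : ε < |inner ℝ (κ : Space) θ| <;> simp [Set.indicator, w, hu]
    have hi : ∀ g : ℝ → Vec, Continuous g → ∀ a b : ℝ,
        IntervalIntegrable (fun u => w ε u • g u) volume a b := by
      intro g hg a b
      refine IntervalIntegrable.mono_fun' (g := fun u => ε⁻¹ * ‖g u‖) ?_ ?_ ?_
      · exact (hg.norm.const_smul ε⁻¹).intervalIntegrable _ _
      · exact ((hw ε).stronglyMeasurable.smul hg.stronglyMeasurable).aestronglyMeasurable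
      · refine Eventually.of_forall fun u => ?_
        simp only [norm_smul]
        exact mul_le_mul_of_nonneg_right (hwB ε hε u) (norm_nonneg _)
    -- The truncated kernel is odd, so subtracting the constant `L 0` changes nothing; afterwards
    -- the integrand is dominated uniformly in `ε`.
    have h2 : ∫ u in (-1 : ℝ)..1, w ε u • L 0 = 0 := by
      have h3 := intervalIntegral.integral_comp_neg (a := -1) (b := 1) (fun u => w ε u • L 0)
      have h4 : ∀ u, w ε (-u) • L 0 = -(w ε u • L 0) := by
        intro u
        by_cases hu : ε < |u| <;> simp [w, Set.indicator, hu]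
      simp only [h4, neg_neg, intervalIntegral.integral_neg] at h3
      exact self_eq_neg.1 h3.symm
    rw [h1, ← sub_zero (∫ u in (-1 : ℝ)..1, w ε u • L u), ← h2,
      ← intervalIntegral.integral_sub (hi _ hL _ _) (hi _ continuous_const _ _)]
    simp only [smul_sub]
  have hlim : Tendsto (pvSphereTrunc f θ) (𝓝[>] 0)
      (𝓝 (∫ u in (-1 : ℝ)..1, u⁻¹ • (L u - L 0))) := by
    have : Tendsto (fun ε => ∫ u in (-1 : ℝ)..1, w ε u • (L u - L 0)) (𝓝[>] 0)
        (𝓝 (∫ u in (-1 : ℝ)..1, u⁻¹ • (L u - L 0))) := by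
      refine intervalIntegral.tendsto_integral_filter_of_dominated_convergence
        (fun u => ‖u⁻¹ • (L u - L 0)‖) ?_ ?_ hQ.norm ?_
      · exact Eventually.of_forall fun ε => ((hw ε).stronglyMeasurable.smul
          (hL.sub continuous_const).stronglyMeasurable).aestronglyMeasurable
      · refine Eventually.of_forall fun ε => Eventually.of_forall fun u _ => ?_
        by_cases hu : ε < |u| <;> simp [w, Set.indicator, hu, norm_smul]
        positivity
      · filter_upwards [Measure.ae_ne volume (0 : ℝ)] with u hu _
        refine tendsto_const_nhds.congr' ?_
        filter_upwards [mem_nhdsWithin_of_mem_nhds (Iio_mem_nhds (abs_pos.2 hu))] with ε hε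
        have hε : ε < |u| := hε
        simp [w, Set.indicator, hε]
    refine this.congr' ?_
    filter_upwards [self_mem_nhdsWithin] with ε hε
    exact (htrunc ε hε).symm
  refine ⟨⟨fun ε hε => ?_, _, hlim⟩, hlim.limUnder_eq⟩
  refine Integrable.mono' (g := fun κ => ε⁻¹ * ‖f κ‖)
    ((integrable_sphere hf.continuous).norm.const_mul _).integrableOn ?_ ?_
  · exact (hmeas.inv.stronglyMeasurable.smul
      (hf.continuous.comp continuous_subtype_val).stronglyMeasurable).aestronglyMeasurable
  · filter_upwards [ae_restrict_mem (hset ε)] with κ hκ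
    rw [norm_smul, norm_inv, Real.norm_eq_abs]
    exact mul_le_mul_of_nonneg_right (inv_anti₀ hε (le_of_lt hκ)) (norm_nonneg _)

theorem IsFrame.integral_sphere {e₁ e₂ θ : Space} (h : IsFrame e₁ e₂ θ) {f : Space → Vec}
    (hf : Continuous f) : ∫ κ : Metric.sphere (0 : Space) 1, f κ ∂(volume : Measure Space).toSphere =
      ∫ u in (-1 : ℝ)..1, latitudeIntegral e₁ e₂ θ f u := by
  simpa using h.integral_sphere_latitude hf (w := fun _ => 1) measurable_const (B := 1) (by simp)

theorem IsFrame.latitudeIntegral_smul {e₁ e₂ θ : Space} (h : IsFrame e₁ e₂ θ) (c : ℝ → ℂ)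
    (f : Space → Vec) (u : ℝ) :
    latitudeIntegral e₁ e₂ θ (fun κ => c (inner ℝ κ θ) • f κ) u =
      c u • latitudeIntegral e₁ e₂ θ f u := by
  simp only [latitudeIntegral, h.inner_heightPoint, intervalIntegral.integral_smul]

/-- The plane waves through `x`. -/
def phased (ν : ℝ) (g : Space → Vec) (x κ : Space) : Vec := wave (ν * inner ℝ κ x) • g κ

theorem sphereSuperposition_eq (ν : ℝ) (g : Space → Vec) (x : Space) :
    sphereSuperposition ν g x = ∫ κ : Metric.sphere (0 : Space) 1, phased ν g x κ
      ∂(volume : Measure Space).toSphere := rfl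

theorem continuous_phased (ν : ℝ) {g : Space → Vec} (hg : Continuous g) (x : Space) :
    Continuous (phased ν g x) :=
  (continuous_wave.comp (by fun_prop)).smul hg

theorem contDiff_phased (ν : ℝ) {g : Space → Vec} (hg : ContDiff ℝ 1 g) (x : Space) :
    ContDiff ℝ 1 (phased ν g x) :=
  (contDiff_wave.comp (contDiff_const.mul (contDiff_id.inner ℝ contDiff_const))).smul hg

theorem phased_add (ν : ℝ) (g : Space → Vec) (x y κ : Space) :
    phased ν g (x + y) κ = wave (ν * inner ℝ κ y) • phased ν g x κ := by
  rw [phased, phased, inner_add_right, mul_add, wave_add, smul_smul, mul_comm]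

/-! ### Line integrals of a superposition of plane waves -/

section Line

variable {e₁ e₂ θ : Space} {ν : ℝ} {g : Space → Vec}

/-- Along the line the additional phase of a wave depends on its normal only through the height over
`θ^⊥`, so the field is a one-dimensional Fourier integral of the latitude profile. -/
theorem IsFrame.sphereSuperposition_line (h : IsFrame e₁ e₂ θ) (hg : Continuous g) (x : Space)
    (s : ℝ) : sphereSuperposition ν g (x + s • θ) =
      ∫ u in (-1 : ℝ)..1, wave (ν * (s * u)) • latitudeIntegral e₁ e₂ θ (phased ν g x) u := by
  rw [sphereSuperposition_eq, h.integral_sphere (continuous_phased ν hg _)]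
  congr 1; funext u
  rw [← h.latitudeIntegral_smul (fun u => wave (ν * (s * u)))]
  congr 1; funext κ
  rw [phased_add, inner_smul_right]

theorem IsFrame.tendsto_xrayTrunc_sphereSuperposition (h : IsFrame e₁ e₂ θ) (hν : ν ≠ 0)
    (hg : ContDiff ℝ 1 g) (x : Space) :
    Tendsto (xrayTrunc (sphereSuperposition ν g) θ x) atTop
      (𝓝 ((2 * Real.pi * Real.sign ν / ν) • latitudeIntegral e₁ e₂ θ (phased ν g x) 0)) := by
  obtain ⟨K, hK⟩ := h.latitudeIntegral_sub_le (contDiff_phased ν hg x)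
  have := tendsto_integral_wave
    (continuous_latitudeIntegral e₁ e₂ θ (continuous_phased ν hg.continuous x)) hK hν
  simp only [← h.sphereSuperposition_line hg.continuous] at this
  exact this

theorem IsFrame.tendsto_signedTrunc_sphereSuperposition (h : IsFrame e₁ e₂ θ) (hν : ν ≠ 0)
    (hg : ContDiff ℝ 1 g) (x : Space) :
    Tendsto (signedTrunc (sphereSuperposition ν g) θ x) atTop
      (𝓝 ((Complex.I * (2 / ν : ℝ)) • ∫ u in (-1 : ℝ)..1,
        u⁻¹ • (latitudeIntegral e₁ e₂ θ (phased ν g x) u -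
          latitudeIntegral e₁ e₂ θ (phased ν g x) 0))) := by
  obtain ⟨K, hK⟩ := h.latitudeIntegral_sub_le (contDiff_phased ν hg x)
  have := tendsto_integral_sign_wave
    (continuous_latitudeIntegral e₁ e₂ θ (continuous_phased ν hg.continuous x)) hK hν
  simp only [← h.sphereSuperposition_line hg.continuous] at this
  exact this

end Line

/-! ### Radon transform of a superposition of plane waves -/

theorem norm_orthogonalProjection_sq {κ η : Space} (hκ : ‖κ‖ = 1) (hη : ‖η‖ = 1) :
    ‖(Submodule.span ℝ {κ})ᗮ.orthogonalProjectionOnto η‖ ^ 2 = 1 - (inner ℝ η κ) ^ 2 := by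
  have h1 := Submodule.norm_sq_eq_add_norm_sq_projection η (Submodule.span ℝ {κ})
  have h2 : ‖(Submodule.span ℝ {κ}).orthogonalProjectionOnto η‖ ^ 2 = (inner ℝ η κ) ^ 2 := by
    rw [Submodule.coe_norm, Submodule.coe_orthogonalProjectionOnto_apply,
      Submodule.starProjection_unit_singleton ℝ hκ, norm_smul, hκ, mul_one, Real.norm_eq_abs, sq_abs, real_inner_comm]
  rw [h2, hη] at h1
  linarith

/-- The Fourier transform of a Gaussian on the plane. Only the projection of `η` to the plane
enters, and its squared length is `1 - (η·κ)²`. -/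
theorem integral_gaussian_wave_plane {κ η : Space} (hκ : ‖κ‖ = 1) (hη : ‖η‖ = 1) (ν : ℝ) {ε : ℝ}
    (hε : 0 < ε) :
    ∫ y : (Submodule.span ℝ {κ})ᗮ,
        (Real.exp (-ε * ‖y‖ ^ 2) : ℂ) * wave (ν * inner ℝ η (y : Space)) =
      ((Real.pi / ε * Real.exp (-(ν ^ 2 / 4 * (1 - inner ℝ η κ ^ 2) / ε)) : ℝ) : ℂ) := by
  have h1 := GaussianFourier.integral_cexp_neg_mul_sq_norm_add (V := (Submodule.span ℝ {κ})ᗮ)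
    (b := (ε : ℂ)) (by simpa using hε) (Complex.I * ν)
    ((Submodule.span ℝ {κ})ᗮ.orthogonalProjectionOnto η)
  rw [finrank_plane hκ] at h1
  have hn : ((‖(Submodule.span ℝ {κ})ᗮ.orthogonalProjectionOnto η‖ : ℝ) : ℂ) ^ 2 =
      ((1 - (inner ℝ η κ) ^ 2 : ℝ) : ℂ) := by
    rw [← norm_orthogonalProjection_sq hκ hη]; push_cast; rfl
  rw [hn] at h1
  convert h1 using 1
  · congr 1; funext y
    rw [Submodule.inner_orthogonalProjectionOnto_eq_of_mem_right, wave, Complex.ofReal_exp, ← Complex.exp_add]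
    congr 1; push_cast; ring
  · rw [show ((2 : ℕ) / 2 : ℂ) = 1 by norm_num, Complex.cpow_one, Complex.ofReal_mul,
      Complex.ofReal_exp, Complex.ofReal_div]
    congr 2
    push_cast
    rw [mul_pow, Complex.I_sq]
    have : (ε : ℂ) ≠ 0 := by exact_mod_cast hε.ne'
    field_simp

/-- Laplace's method at the endpoint `u = 1`. With `u = 1 - εv` the exponent becomes `-av(2 - εv)`,
which tends to `-2av`; as `εv ≤ 1` it is at most `-av`, which gives the majorant. -/
theorem tendsto_integral_endpoint {a : ℝ} (ha : 0 < a) {H : ℝ → Vec} (hH : Continuous H) :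
    Tendsto (fun ε : ℝ => ∫ u in (0 : ℝ)..1, (ε⁻¹ * Real.exp (-(a * (1 - u ^ 2) / ε))) • H u)
      (𝓝[>] 0) (𝓝 ((2 * a)⁻¹ • H 1)) := by
  obtain ⟨C, hC⟩ := (isCompact_Icc (a := (0 : ℝ)) (b := 1)).exists_bound_of_continuousOn
    hH.continuousOn
  have hC0 : 0 ≤ C := (norm_nonneg _).trans (hC 0 (by simp))
  have hval : ∫ v in Set.Ioi (0 : ℝ), Real.exp (-(2 * a) * v) • H 1 = (2 * a)⁻¹ • H 1 := by
    rw [integral_smul_const, integral_exp_mul_Ioi (by linarith)]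
    simp [neg_div_neg_eq]
  rw [← hval]
  have hlim : Tendsto (fun ε : ℝ => ∫ v in Set.Ioi (0 : ℝ), (Set.Ioc 0 ε⁻¹).indicator
      (fun v => Real.exp (-(a * v * (2 - ε * v))) • H (1 - ε * v)) v) (𝓝[>] 0)
      (𝓝 (∫ v in Set.Ioi (0 : ℝ), Real.exp (-(2 * a) * v) • H 1)) := by
    refine tendsto_integral_filter_of_dominated_convergence
      (fun v => Real.exp (-a * v) * C) ?_ ?_ ?_ ?_
    · refine Eventually.of_forall fun ε => ?_
      refine (Continuous.aestronglyMeasurable ?_).indicator measurableSet_Ioc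
      fun_prop
    · filter_upwards [self_mem_nhdsWithin] with ε hε
      have hε : 0 < ε := hε
      refine Eventually.of_forall fun v => ?_
      by_cases hv : v ∈ Set.Ioc 0 ε⁻¹
      · rw [Set.indicator_of_mem hv, norm_smul, Real.norm_eq_abs, Real.abs_exp]
        have h1 : ε * v ≤ 1 := by
          have := mul_le_mul_of_nonneg_left hv.2 hε.le
          rwa [mul_inv_cancel₀ hε.ne'] at this
        have h2 : 0 ≤ ε * v := mul_nonneg hε.le hv.1.le
        refine mul_le_mul (Real.exp_le_exp.2 ?_) (hC _ ⟨by linarith, by linarith⟩) (norm_nonneg _)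
          (Real.exp_pos _).le
        nlinarith [mul_pos ha hv.1]
      · rw [Set.indicator_of_notMem hv, norm_zero]
        positivity
    · exact (integrableOn_exp_mul_Ioi (by linarith : -a < 0) 0).mul_const C
    · filter_upwards [ae_restrict_mem measurableSet_Ioi] with v hv
      have hv : 0 < v := hv
      have h1 : Continuous fun ε : ℝ => Real.exp (-(a * v * (2 - ε * v))) • H (1 - ε * v) := by
        fun_prop
      have h2 := (h1.tendsto 0).mono_left (nhdsWithin_le_nhds (s := Set.Ioi (0 : ℝ)))
      simp only [zero_mul, sub_zero] at h2
      rw [show -(a * v * 2) = -(2 * a) * v by ring] at h2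
      refine h2.congr' ?_
      filter_upwards [self_mem_nhdsWithin,
        mem_nhdsWithin_of_mem_nhds (Iio_mem_nhds (inv_pos.2 hv))] with ε hε hε'
      have hε' : ε < v⁻¹ := hε'
      rw [Set.indicator_of_mem (show v ∈ Set.Ioc 0 ε⁻¹ from ⟨hv, ((lt_inv_comm₀ hε hv).1 hε').le⟩)]
  refine hlim.congr' ?_
  filter_upwards [self_mem_nhdsWithin] with ε hε
  have hε : 0 < ε := hε
  have h1 := intervalIntegral.integral_comp_sub_mul (a := 0) (b := ε⁻¹)
    (fun u => Real.exp (-(a * (1 - u ^ 2) / ε)) • H u) hε.ne' 1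
  rw [mul_inv_cancel₀ hε.ne', mul_zero, sub_self, sub_zero] at h1
  simp only [mul_smul]
  rw [intervalIntegral.integral_smul, ← h1, intervalIntegral.integral_of_le (inv_pos.2 hε).le,
    integral_indicator measurableSet_Ioc, Measure.restrict_restrict measurableSet_Ioc,
    Set.inter_eq_left.2 Set.Ioc_subset_Ioi_self]
  congr 1; funext v
  congr 2
  field_simp; ring

theorem tendsto_integral_poles {a : ℝ} (ha : 0 < a) {G : ℝ → Vec} (hG : Continuous G) :
    Tendsto (fun ε : ℝ => ∫ u in (-1 : ℝ)..1, (ε⁻¹ * Real.exp (-(a * (1 - u ^ 2) / ε))) • G u)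
      (𝓝[>] 0) (𝓝 ((2 * a)⁻¹ • (G 1 + G (-1)))) := by
  refine (tendsto_integral_endpoint ha (H := fun u => G u + G (-u)) (by fun_prop)).congr fun ε => ?_
  rw [intervalIntegral_symm_eq (by fun_prop)]
  simp only [neg_sq, smul_add]

theorem latitudeIntegral_one (e₁ e₂ θ : Space) (f : Space → Vec) :
    latitudeIntegral e₁ e₂ θ f 1 = (2 * Real.pi) • f θ ∧
      latitudeIntegral e₁ e₂ θ f (-1) = (2 * Real.pi) • f (-θ) := by
  constructor <;> simp [latitudeIntegral, heightPoint, two_mul]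

theorem integrable_gaussian_plane {κ : Space} (hκ : ‖κ‖ = 1) {ε : ℝ} (hε : 0 < ε) :
    Integrable fun y : (Submodule.span ℝ {κ})ᗮ => Real.exp (-ε * ‖y‖ ^ 2) := by
  obtain ⟨e₁, e₂, h⟩ := exists_isFrame hκ
  rw [h.integrable_plane]
  refine ((integrable_exp_neg_mul_sq hε).mul_prod (integrable_exp_neg_mul_sq hε)).congr
    (Eventually.of_forall fun p => ?_)
  simp only
  rw [← Real.exp_add, h.norm_planePoint_sq]
  congr 1; ring

theorem radonReg_sphereSuperposition {e₁ e₂ κ : Space} (h : IsFrame e₁ e₂ κ) (ν : ℝ)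
    {g : Space → Vec} (hg : Continuous g) (p : ℝ) {ε : ℝ} (hε : 0 < ε) :
    radonReg (sphereSuperposition ν g) p κ ε = Real.pi • ∫ u in (-1 : ℝ)..1,
      (ε⁻¹ * Real.exp (-(ν ^ 2 / 4 * (1 - u ^ 2) / ε))) •
        wave (ν * p * u) • latitudeIntegral e₁ e₂ κ g u := by
  have hκ : ‖κ‖ = 1 := (isFrame_iff.1 h).1.2.2
  obtain ⟨C, hC⟩ := (isCompact_sphere (0 : Space) 1).exists_bound_of_continuousOn hg.continuousOn
  have hI : Integrable (fun q : (Submodule.span ℝ {κ})ᗮ × Metric.sphere (0 : Space) 1 =>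
      Real.exp (-ε * ‖q.1‖ ^ 2) • phased ν g (p • κ + q.1) q.2)
      (volume.prod (volume : Measure Space).toSphere) := by
    refine Integrable.mono' (g := fun q : (Submodule.span ℝ {κ})ᗮ × Metric.sphere (0 : Space) 1 =>
      Real.exp (-ε * ‖q.1‖ ^ 2) * C)
      ((integrable_gaussian_plane hκ hε).mul_prod (integrable_const C)) ?_ ?_
    · refine Continuous.aestronglyMeasurable ?_
      have := continuous_wave
      unfold phased
      fun_prop
    · refine Eventually.of_forall fun q => ?_
      rw [norm_smul, phased, norm_smul, norm_wave, one_mul, Real.norm_eq_abs, Real.abs_exp]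
      exact mul_le_mul_of_nonneg_left (hC _ q.2.2) (Real.exp_pos _).le
  have hinner : ∀ η : Metric.sphere (0 : Space) 1,
      ∫ y : (Submodule.span ℝ {κ})ᗮ, Real.exp (-ε * ‖y‖ ^ 2) • phased ν g (p • κ + y) η =
        (((Real.pi * (ε⁻¹ * Real.exp (-(ν ^ 2 / 4 * (1 - inner ℝ (η : Space) κ ^ 2) / ε))) : ℝ) : ℂ) *
          wave (ν * p * inner ℝ (η : Space) κ)) • g η := by
    intro η
    have hη : ‖(η : Space)‖ = 1 := norm_eq_of_mem_sphere η
    have h1 := integral_gaussian_wave_plane hκ hη ν hε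
    rw [← mul_assoc, ← div_eq_mul_inv, ← h1, ← integral_mul_const, ← integral_smul_const]
    congr 1; funext y
    rw [phased_add, phased, smul_smul, ← Complex.coe_smul, smul_smul, inner_smul_right]
    congr 1
    rw [show ν * (p * inner ℝ (η : Space) κ) = ν * p * inner ℝ (η : Space) κ by ring]
    ring
  have e1 : radonReg (sphereSuperposition ν g) p κ ε = ∫ y : (Submodule.span ℝ {κ})ᗮ,
      ∫ η : Metric.sphere (0 : Space) 1, Real.exp (-ε * ‖y‖ ^ 2) • phased ν g (p • κ + y) η
        ∂(volume : Measure Space).toSphere := by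
    simp only [radonReg, sphereSuperposition_eq, integral_smul]
  rw [e1, integral_integral_swap hI]
  simp_rw [hinner]
  have hc : Continuous fun η : Space =>
      (((Real.pi * (ε⁻¹ * Real.exp (-(ν ^ 2 / 4 * (1 - inner ℝ η κ ^ 2) / ε))) : ℝ) : ℂ) *
          wave (ν * p * inner ℝ η κ)) • g η := by
    have := continuous_wave
    fun_prop
  rw [h.integral_sphere hc, ← intervalIntegral.integral_smul]
  congr 1; funext u
  rw [h.latitudeIntegral_smul (fun u =>
    ((Real.pi * (ε⁻¹ * Real.exp (-(ν ^ 2 / 4 * (1 - u ^ 2) / ε))) : ℝ) : ℂ) * wave (ν * p * u)),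
    mul_smul, Complex.coe_smul, mul_smul]

/-- The weight in the height concentrates at `u = ±1`, that is on the two waves with normals `±κ`,
which are constant on the plane. The constant is `π · (2 · ν²/4)⁻¹ · 2π`. -/
theorem tendsto_radonReg_sphereSuperposition {κ : Space} (hκ : ‖κ‖ = 1) {ν : ℝ} (hν : ν ≠ 0)
    {g : Space → Vec} (hg : Continuous g) (p : ℝ) :
    Tendsto (radonReg (sphereSuperposition ν g) p κ) (𝓝[>] 0)
      (𝓝 ((4 * Real.pi ^ 2 / ν ^ 2) • (wave (ν * p) • g κ + wave (-(ν * p)) • g (-κ)))) := by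
  obtain ⟨e₁, e₂, h⟩ := exists_isFrame hκ
  have ha : 0 < ν ^ 2 / 4 := by positivity
  have hG : Continuous fun u => wave (ν * p * u) • latitudeIntegral e₁ e₂ κ g u := by
    have := continuous_wave
    have := continuous_latitudeIntegral e₁ e₂ κ hg
    fun_prop
  have h1 := (tendsto_integral_poles ha hG).const_smul Real.pi
  have h2 : Real.pi • (2 * (ν ^ 2 / 4))⁻¹ • (wave (ν * p * 1) • latitudeIntegral e₁ e₂ κ g 1 +
      wave (ν * p * -1) • latitudeIntegral e₁ e₂ κ g (-1)) =
      (4 * Real.pi ^ 2 / ν ^ 2) • (wave (ν * p) • g κ + wave (-(ν * p)) • g (-κ)) := by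
    rw [(latitudeIntegral_one e₁ e₂ κ g).1, (latitudeIntegral_one e₁ e₂ κ g).2, mul_one,
      mul_neg_one, smul_comm (wave (ν * p)), smul_comm (wave (-(ν * p))), ← smul_add, smul_smul,
      smul_smul]
    congr 1
    field_simp
  rw [h2] at h1
  refine h1.congr' ?_
  filter_upwards [self_mem_nhdsWithin] with ε hε
  exact (radonReg_sphereSuperposition h ν hg p hε).symm

theorem cross_csmul (κ : Space) (c : ℂ) (v : Vec) : cross κ (c • v) = c • cross κ v :=
  map_smul (crossProduct fun i => (κ i : ℂ)) c v

theorem cross_add (κ : Space) (v w : Vec) : cross κ (v + w) = cross κ v + cross κ w :=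
  map_add (crossL κ) v w

theorem sum_coord_smul_cross (κ : Space) (v : Vec) :
    ∑ j, cross (cartesian j) ((κ j : ℂ) • v) = cross κ v := by
  simp only [cross_apply, Fin.sum_univ_three, cartesian]
  funext i
  fin_cases i <;> simp <;> ring

/-! ### Polarization of the amplitude; Radon and Hilbert transforms of a superposition -/

section Superposition

variable {ν : ℝ} {g : Space → Vec}

theorem norm_sphereSuperposition_le (ν : ℝ) (g : Space → Vec) :
    ∃ C, ∀ x, ‖sphereSuperposition ν g x‖ ≤ C := by
  refine ⟨∫ κ : Metric.sphere (0 : Space) 1, ‖g κ‖ ∂(volume : Measure Space).toSphere, fun x => ?_⟩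
  refine (norm_integral_le_integral_norm _).trans_eq ?_
  congr 1; funext κ
  change ‖wave (ν * inner ℝ (κ : Space) x) • g κ‖ = _
  rw [norm_smul, norm_wave, one_mul]

theorem hasDerivAt_sphereSuperposition (hg : Continuous g) (x e : Space) :
    HasDerivAt (fun t : ℝ => sphereSuperposition ν g (x + t • e))
      (∫ κ : Metric.sphere (0 : Space) 1, (Complex.I * (ν * inner ℝ (κ : Space) e : ℝ)) •
        phased ν g x κ ∂(volume : Measure Space).toSphere) 0 := by
  have hp := continuous_phased ν hg x
  have hw := continuous_wave
  obtain ⟨C, hC⟩ := (isCompact_sphere (0 : Space) 1).exists_bound_of_continuousOn hp.continuousOn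
  have key := hasDerivAt_integral_of_dominated_loc_of_deriv_le
    (μ := (volume : Measure Space).toSphere) (s := Set.univ) (x₀ := (0 : ℝ))
    (F := fun (t : ℝ) (κ : Metric.sphere (0 : Space) 1) => phased ν g (x + t • e) κ)
    (F' := fun t κ => (wave (ν * (t * inner ℝ (κ : Space) e)) *
      (Complex.I * (ν * inner ℝ (κ : Space) e : ℝ))) • phased ν g x κ)
    (bound := fun _ => |ν| * ‖e‖ * C) Filter.univ_mem
    (Eventually.of_forall fun t => (integrable_sphere (continuous_phased ν hg _)).aestronglyMeasurable)
    (integrable_sphere (continuous_phased ν hg _)) ?_ ?_ (integrable_const _) ?_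
  · have := key.2
    simp only [zero_mul, mul_zero, wave_zero, one_mul] at this
    exact this
  · refine Continuous.aestronglyMeasurable ?_
    fun_prop
  · refine Eventually.of_forall fun κ t _ => ?_
    rw [norm_smul, norm_mul, norm_mul, norm_wave, one_mul, Complex.norm_I, one_mul,
      Complex.norm_real, norm_mul]
    refine mul_le_mul ?_ (hC _ κ.2) (norm_nonneg _) (by positivity)
    refine mul_le_mul_of_nonneg_left ?_ (abs_nonneg _)
    have := norm_inner_le_norm (𝕜 := ℝ) (κ : Space) e
    rwa [norm_eq_of_mem_sphere κ, one_mul] at this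
  · refine Eventually.of_forall fun κ t _ => ?_
    simp only [phased_add, inner_smul_right]
    have h1 : HasDerivAt (fun t : ℝ => ν * (t * inner ℝ (κ : Space) e))
        (ν * inner ℝ (κ : Space) e) t :=
      (((hasDerivAt_id t).mul_const _).const_mul ν).congr_deriv (by simp)
    have h2 := ((hasDerivAt_wave _).scomp t h1).smul_const (phased ν g x κ)
    refine h2.congr_deriv ?_
    congr 1
    rw [Complex.real_smul]; ring

/-- The amplitude of a Trkalian superposition of plane waves is circularly polarized. -/
theorem cross_amplitude (hν : ν ≠ 0) (hg : Continuous g)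
    (hF : IsTrkalian ν (sphereSuperposition ν g)) {κ : Space} (hκ : ‖κ‖ = 1) :
    cross κ (g κ) = -Complex.I • g κ := by
  -- The defect of polarization. Differentiating under the integral, `curl F - νF` is `ν` times the
  -- superposition with amplitude `g'`.
  set g' : Space → Vec := fun κ => Complex.I • cross κ (g κ) - g κ with hg'
  have cg' : Continuous g' := by
    have := continuous_cross continuous_id hg
    simp only [id] at this
    rw [hg']
    fun_prop
  have hzero : ∀ x, sphereSuperposition ν g' x = 0 := by
    intro x
    have hp := continuous_phased ν hg x
    have hd : ∀ e, fderiv ℝ (sphereSuperposition ν g) x e =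
        ∫ κ : Metric.sphere (0 : Space) 1, (Complex.I * (ν * inner ℝ (κ : Space) e : ℝ)) •
          phased ν g x κ ∂(volume : Measure Space).toSphere := by
      intro e
      have h1 := (hF.1.differentiable one_ne_zero) x
      exact h1.hasFDerivAt.hasLineDerivAt e |>.unique (hasDerivAt_sphereSuperposition hg x e)
    have h1 := hF.2 x
    rw [curl_eq_sum] at h1
    have hi : ∀ j, Integrable (fun κ : Metric.sphere (0 : Space) 1 =>
        (Complex.I * (ν * inner ℝ (κ : Space) (cartesian j) : ℝ)) • phased ν g x κ)
        (volume : Measure Space).toSphere := fun j =>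
      integrable_sphere (f := fun κ => (Complex.I * (ν * inner ℝ κ (cartesian j) : ℝ)) •
        phased ν g x κ) (by fun_prop)
    have hi' : ∀ j ∈ (Finset.univ : Finset (Fin 3)), Integrable (fun κ : Metric.sphere (0 : Space) 1 =>
        cross (cartesian j) ((Complex.I * (ν * inner ℝ (κ : Space) (cartesian j) : ℝ)) •
          phased ν g x κ)) (volume : Measure Space).toSphere := fun j _ =>
      (crossL (cartesian j)).integrable_comp (hi j)
    simp_rw [hd] at h1
    simp_rw [← integral_cross _ (hi _)] at h1
    rw [← integral_finsetSum _ hi', sphereSuperposition_eq, ← integral_smul] at h1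
    have i1 : Integrable (fun κ : Metric.sphere (0 : Space) 1 =>
        (Complex.I * ν) • cross (κ : Space) (phased ν g x κ)) (volume : Measure Space).toSphere :=
      integrable_sphere (f := fun κ => (Complex.I * ν) • cross κ (phased ν g x κ))
        (by have := continuous_cross continuous_id hp; simp only [id] at this; fun_prop)
    have i2 : Integrable (fun κ : Metric.sphere (0 : Space) 1 => ν • phased ν g x κ)
        (volume : Measure Space).toSphere :=
      integrable_sphere (f := fun κ => ν • phased ν g x κ) (hp.const_smul ν)
    have h2 : ∀ κ : Metric.sphere (0 : Space) 1, ∑ j, cross (cartesian j)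
        ((Complex.I * (ν * inner ℝ (κ : Space) (cartesian j) : ℝ)) • phased ν g x κ) =
        (Complex.I * ν) • cross (κ : Space) (phased ν g x κ) := by
      intro κ
      rw [← sum_coord_smul_cross (κ : Space), Finset.smul_sum]
      refine Finset.sum_congr rfl fun j _ => ?_
      rw [← cross_csmul, smul_smul, inner_cartesian]
      push_cast
      rw [mul_assoc]
    simp_rw [h2] at h1
    have h3 : (ν : ℂ) • sphereSuperposition ν g' x = 0 := by
      rw [sphereSuperposition_eq, ← integral_smul, ← sub_eq_zero.2 h1, ← integral_sub i1 i2]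
      congr 1; funext κ
      rw [phased, phased, cross_csmul, hg', ← Complex.coe_smul]
      module
    exact (smul_eq_zero.1 h3).resolve_left (by exact_mod_cast hν)
  -- The superposition of `g'` vanishes, hence so does its Radon transform. The values at `p = 0`
  -- and at the quarter period `π/(2ν)` separate `g' κ` from `g' (-κ)`.
  have hR : ∀ p, (wave (ν * p) • g' κ + wave (-(ν * p)) • g' (-κ)) = 0 := by
    intro p
    have h1 := tendsto_radonReg_sphereSuperposition hκ hν cg' p
    have h2 : radonReg (sphereSuperposition ν g') p κ = fun _ => 0 := by
      funext ε
      simp [radonReg, hzero]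
    rw [h2] at h1
    have h3 := tendsto_nhds_unique h1 tendsto_const_nhds
    exact (smul_eq_zero.1 h3).resolve_left (by positivity)
  have h0 := hR 0
  have h1 := hR (Real.pi / 2 / ν)
  rw [mul_div_cancel₀ _ hν] at h1
  have hI : wave (Real.pi / 2) = Complex.I := by rw [wave_eq]; simp
  have hI' : wave (-(Real.pi / 2)) = -Complex.I := by rw [wave_eq]; simp
  rw [hI, hI'] at h1
  simp only [mul_zero, neg_zero, wave_zero, one_smul] at h0
  have h2 : (2 * Complex.I) • g' κ = 0 := by
    rw [neg_smul, ← sub_eq_add_neg] at h1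
    have : g' (-κ) = -g' κ := (neg_eq_of_add_eq_zero_right h0).symm
    rw [this] at h1
    rw [← h1]; module
  have h3 : g' κ = 0 := (smul_eq_zero.1 h2).resolve_left (by simp)
  have h4 : Complex.I • cross κ (g κ) = g κ := sub_eq_zero.1 h3
  calc cross κ (g κ) = -Complex.I • Complex.I • cross κ (g κ) := by
        rw [smul_smul, neg_mul, Complex.I_mul_I, neg_neg, one_smul]
    _ = -Complex.I • g κ := by rw [h4]

theorem cross_amplitude_neg (hν : ν ≠ 0) (hg : Continuous g)
    (hF : IsTrkalian ν (sphereSuperposition ν g)) {κ : Space} (hκ : ‖κ‖ = 1) :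
    cross κ (g (-κ)) = Complex.I • g (-κ) := by
  have := cross_amplitude hν hg hF (κ := -κ) (by simpa using hκ)
  rw [cross_neg_left, neg_smul] at this
  exact neg_inj.1 this

theorem tendsto_hilbertTrunc_standing (hν : ν ≠ 0) (v w : Vec) (p : ℝ) :
    HilbertExists (fun q => wave (ν * q) • v + wave (-(ν * q)) • w) p ∧
    hilbert (fun q => wave (ν * q) • v + wave (-(ν * q)) • w) p =
      ((Real.sign ν : ℂ) * Complex.I) • (wave (-(ν * p)) • w - wave (ν * p) • v) := by
  have hw := continuous_wave
  have c1 : Continuous fun q => wave (ν * q) • v := by fun_prop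
  have c2 : Continuous fun q => wave (-ν * q) • w := by fun_prop
  have h1 := (tendsto_hilbertTrunc_wave hν v p).add
    (tendsto_hilbertTrunc_wave (neg_ne_zero.2 hν) w p)
  have h2 : (-(Real.sign ν : ℂ) * Complex.I) • wave (ν * p) • v +
      (-(Real.sign (-ν) : ℂ) * Complex.I) • wave (-ν * p) • w =
      ((Real.sign ν : ℂ) * Complex.I) • (wave (-(ν * p)) • w - wave (ν * p) • v) := by
    rw [Real.sign_neg, neg_mul ν]; push_cast; module
  rw [h2] at h1
  simp only [← neg_mul ν]
  have h3 : Tendsto (hilbertTrunc (fun q => wave (ν * q) • v + wave (-ν * q) • w) p) (𝓝[>] 0)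
      (𝓝 (((Real.sign ν : ℂ) * Complex.I) • (wave (-(ν * p)) • w - wave (ν * p) • v))) := by
    refine h1.congr' ?_
    filter_upwards [self_mem_nhdsWithin] with ε hε
    exact (hilbertTrunc_add c1 c2 p hε).symm
  simp only [← neg_mul ν] at h3
  exact ⟨⟨fun ε hε => integrableOn_hilbert (c1.add c2) p hε, _, h3⟩, h3.limUnder_eq⟩

theorem latitudeIntegral_combination (e₁ e₂ θ : Space) {f : Space → Vec} (hf : Continuous f)
    (c d : ℂ) (u : ℝ) :
    latitudeIntegral e₁ e₂ θ (fun κ => c • f κ + d • f (-κ)) u =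
      c • latitudeIntegral e₁ e₂ θ f u + d • latitudeIntegral e₁ e₂ θ f (-u) := by
  rw [← IsFrame.latitudeIntegral_comp_neg f u, latitudeIntegral, latitudeIntegral, latitudeIntegral,
    intervalIntegral.integral_add (f := fun φ => c • f (heightPoint e₁ e₂ θ (φ, u)))
      (g := fun φ => d • f (-heightPoint e₁ e₂ θ (φ, u))),
    intervalIntegral.integral_smul, intervalIntegral.integral_smul]
  · exact (intervalIntegrable_latitude _ _ _ hf _ _ _).smul c
  · exact (intervalIntegrable_latitude _ _ _ (f := fun κ => f (-κ)) (by fun_prop) _ _ _).smul d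

/-- The Radon transform is a pair of counter-propagating waves in `p`. The cross product with `κ`
acts on them by `-i` and `i`, the Hilbert transform by `-i sgn ν` and `i sgn ν`, and the derivative
by `iν` and `-iν`. At `p = κ·x` everything is thus a scalar combination of the phased amplitude at
`κ` and at `-κ`. -/
theorem sphereSuperposition_transforms (hν : ν ≠ 0) (hF : IsTrkalian ν (sphereSuperposition ν g))
    (hg : ContDiff ℝ 1 g) :
    (∀ (κ : Space) (p : ℝ), ‖κ‖ = 1 →
      RadonExists (sphereSuperposition ν g) p κ ∧
      HasDerivAt (fun q => radon (sphereSuperposition ν g) q κ)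
        (-(ν • cross κ (radon (sphereSuperposition ν g) p κ))) p ∧
      HilbertExists (fun q => radon (sphereSuperposition ν g) q κ) p ∧
      HilbertExists (deriv fun q => radon (sphereSuperposition ν g) q κ) p ∧
      (∀ x : Space, p = inner ℝ κ x →
        cross κ (radon (sphereSuperposition ν g) p κ) =
          (-(4 * Real.pi ^ 2 / ν ^ 2 : ℝ) * Complex.I) • phased ν g x κ +
            ((4 * Real.pi ^ 2 / ν ^ 2 : ℝ) * Complex.I) • phased ν g x (-κ) ∧
        cross κ (hilbert (fun q => radon (sphereSuperposition ν g) q κ) p) =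
          (-(4 * Real.pi ^ 2 / ν ^ 2 * Real.sign ν : ℝ) : ℂ) • phased ν g x κ +
            (-(4 * Real.pi ^ 2 / ν ^ 2 * Real.sign ν : ℝ) : ℂ) • phased ν g x (-κ) ∧
        hilbert (deriv fun q => radon (sphereSuperposition ν g) q κ) p =
          (ν * (4 * Real.pi ^ 2 / ν ^ 2 * Real.sign ν : ℝ) : ℂ) • phased ν g x κ +
            (ν * (4 * Real.pi ^ 2 / ν ^ 2 * Real.sign ν : ℝ) : ℂ) • phased ν g x (-κ))) := by
  intro κ p hκ
  obtain ⟨C, hC⟩ := norm_sphereSuperposition_le ν g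
  set A : ℝ := 4 * Real.pi ^ 2 / ν ^ 2 with hA
  have hlim := tendsto_radonReg_sphereSuperposition hκ hν hg.continuous
  have hR : (fun q => radon (sphereSuperposition ν g) q κ) = fun q =>
      wave (ν * q) • (A : ℂ) • g κ + wave (-(ν * q)) • (A : ℂ) • g (-κ) := by
    funext q
    rw [radon, (hlim q).limUnder_eq, ← hA, ← Complex.coe_smul]
    module
  have hRp : radon (sphereSuperposition ν g) p κ =
      wave (ν * p) • (A : ℂ) • g κ + wave (-(ν * p)) • (A : ℂ) • g (-κ) := congrFun hR p
  have c1 := cross_amplitude hν hg.continuous hF hκ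
  have c2 := cross_amplitude_neg hν hg.continuous hF hκ
  have hD : ∀ p, HasDerivAt (fun q => radon (sphereSuperposition ν g) q κ)
      (wave (ν * p) • ((ν * A : ℝ) * Complex.I : ℂ) • g κ +
        wave (-(ν * p)) • (-((ν * A : ℝ) * Complex.I) : ℂ) • g (-κ)) p := by
    intro p
    rw [hR]
    have l1 : HasDerivAt (fun q : ℝ => ν * q) ν p := by
      simpa using (hasDerivAt_id p).const_mul ν
    have d1 := ((hasDerivAt_wave _).scomp p l1).smul_const ((A : ℂ) • g κ)
    have d2 := ((hasDerivAt_wave _).scomp p l1.fun_neg).smul_const ((A : ℂ) • g (-κ))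
    refine (d1.add d2).congr_deriv ?_
    simp only [Complex.real_smul]
    push_cast
    module
  have hD' : (deriv fun q => radon (sphereSuperposition ν g) q κ) = fun q =>
      wave (ν * q) • ((ν * A : ℝ) * Complex.I : ℂ) • g κ +
        wave (-(ν * q)) • (-((ν * A : ℝ) * Complex.I) : ℂ) • g (-κ) :=
    funext fun q => (hD q).deriv
  have hX : cross κ (radon (sphereSuperposition ν g) p κ) =
      (-A * Complex.I) • wave (ν * p) • g κ + (A * Complex.I) • wave (-(ν * p)) • g (-κ) := by
    rw [hRp, cross_add, cross_csmul, cross_csmul, cross_csmul, cross_csmul, c1, c2]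
    module
  have H1 := tendsto_hilbertTrunc_standing hν ((A : ℂ) • g κ) ((A : ℂ) • g (-κ)) p
  have H2 := tendsto_hilbertTrunc_standing hν (((ν * A : ℝ) * Complex.I : ℂ) • g κ)
    ((-((ν * A : ℝ) * Complex.I) : ℂ) • g (-κ)) p
  refine ⟨⟨fun ε hε => ?_, _, hlim p⟩, ?_, hR ▸ H1.1, hD' ▸ H2.1, ?_⟩
  · refine Integrable.mono' ((integrable_gaussian_plane hκ hε).mul_const C) ?_
      (Eventually.of_forall fun y => ?_)
    · refine Continuous.aestronglyMeasurable ?_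
      have := hF.1.continuous
      fun_prop
    · rw [norm_smul, Real.norm_eq_abs, Real.abs_exp]
      exact mul_le_mul_of_nonneg_left (hC _) (Real.exp_pos _).le
  · refine (hD p).congr_deriv ?_
    rw [hX, ← Complex.coe_smul]
    push_cast
    module
  · intro x hx
    have hw1 : phased ν g x κ = wave (ν * p) • g κ := by rw [phased, hx]
    have hw2 : phased ν g x (-κ) = wave (-(ν * p)) • g (-κ) := by
      rw [phased, hx, inner_neg_left, mul_neg]
    rw [hw1, hw2]
    refine ⟨hX, ?_, ?_⟩
    · rw [hR, H1.2, cross_csmul, sub_eq_add_neg, cross_add, cross_neg, cross_csmul, cross_csmul,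
        cross_csmul, cross_csmul, c1, c2]
      simp only [smul_smul, ← neg_smul, smul_add]
      rw [add_comm]
      congr 2
      · push_cast
        linear_combination (A * Real.sign ν * wave (ν * p)) * Complex.I_sq
      · push_cast
        linear_combination (A * Real.sign ν * wave (-(ν * p))) * Complex.I_sq
    · rw [hD', H2.2, smul_sub, sub_eq_add_neg, add_comm]
      simp only [smul_smul, ← neg_smul]
      congr 2
      · push_cast
        linear_combination (-ν * A * Real.sign ν * wave (ν * p)) * Complex.I_sq
      · push_cast
        linear_combination (-ν * A * Real.sign ν * wave (-(ν * p))) * Complex.I_sq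

end Superposition

theorem pvSphere_congr {f g : Space → Vec} (θ : Space) (hfg : ∀ κ : Space, ‖κ‖ = 1 → f κ = g κ) :
    (PvSphereExists f θ ↔ PvSphereExists g θ) ∧ pvSphere f θ = pvSphere g θ := by
  have h1 : (fun κ : Metric.sphere (0 : Space) 1 => (inner ℝ (κ : Space) θ)⁻¹ • f κ) =
      fun κ : Metric.sphere (0 : Space) 1 => (inner ℝ (κ : Space) θ)⁻¹ • g κ := by
    funext κ
    rw [hfg _ (norm_eq_of_mem_sphere κ)]
  have h2 : pvSphereTrunc f θ = pvSphereTrunc g θ := by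
    funext ε
    simp only [pvSphereTrunc, h1]
  simp only [PvSphereExists, pvSphere, h1, h2, and_self]

/-- The transforms of a Trkalian superposition of plane waves with a continuously differentiable
amplitude. -/
theorem trkalian_superposition_transforms {ν : ℝ} {g : Space → Vec} (hν : ν ≠ 0)
    (hF : IsTrkalian ν (sphereSuperposition ν g)) (hg : ContDiff ℝ 1 g) {θ : Space} (hθ : ‖θ‖ = 1)
    (x : Space) :
    let F := sphereSuperposition ν g
    XrayExists F θ x ∧ XrayExists (biotSavart F) θ x ∧
      FunkIntegrable (fun κ => cross κ (hilbert (fun q => radon F q κ) (inner ℝ κ x))) θ ∧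
      FunkIntegrable (fun κ => hilbert (deriv fun q => radon F q κ) (inner ℝ κ x)) θ ∧
      xray (biotSavart F) θ x =
        -(1 / (4 * Real.pi)) • funk (fun κ =>
          cross κ (hilbert (fun q => radon F q κ) (inner ℝ κ x))) θ ∧
      xray (biotSavart F) θ x =
        (1 / (4 * Real.pi) * (1 / ν)) • funk (fun κ =>
          hilbert (deriv fun q => radon F q κ) (inner ℝ κ x)) θ ∧
      xray (biotSavart F) θ x = (1 / ν) • xray F θ x ∧
      SignedExists F θ x ∧ SignedExists (biotSavart F) θ x ∧
      PvSphereExists (fun κ => cross κ (radon F (inner ℝ κ x) κ)) θ ∧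
      signedXray (biotSavart F) θ x =
        -(1 / (2 * Real.pi) ^ 2) • pvSphere (fun κ => cross κ (radon F (inner ℝ κ x) κ)) θ ∧
      signedXray (biotSavart F) θ x = (1 / ν) • signedXray F θ x := by
  intro F
  obtain ⟨e₁, e₂, h⟩ := exists_isFrame hθ
  obtain ⟨C, hC⟩ := norm_sphereSuperposition_le ν g
  have hgrow : PolynomialGrowth F := ⟨C, 0, fun x => by simpa using hC x⟩
  obtain ⟨-, -, -, hT⟩ := trkalian_transforms hν hF hgrow
  obtain ⟨t1, t2, t3, t4⟩ := hT θ x hθ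
  have hline : ∀ T : ℝ, IntervalIntegrable (fun s : ℝ => F (x + s • θ)) volume (-T) T := by
    intro T
    have := hF.1.continuous
    exact Continuous.intervalIntegrable (by fun_prop) _ _
  have limX := h.tendsto_xrayTrunc_sphereSuperposition hν hg x
  have limY := h.tendsto_signedTrunc_sphereSuperposition hν hg x
  have hX : XrayExists F θ x := ⟨hline, _, limX⟩
  have hY : SignedExists F θ x := ⟨hline, _, limY⟩
  have eX : xray F θ x = _ := limX.limUnder_eq
  have eY : signedXray F θ x = _ := limY.limUnder_eq
  have hL := continuous_latitudeIntegral e₁ e₂ θ (continuous_phased ν hg.continuous x)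
  obtain ⟨K, hK⟩ := h.latitudeIntegral_sub_le (contDiff_phased ν hg x)
  have hphi := contDiff_phased ν hg x
  have hlat := latitudeIntegral_combination e₁ e₂ θ hphi.continuous
  set L := latitudeIntegral e₁ e₂ θ (phased ν g x) with hLdef
  set A : ℝ := 4 * Real.pi ^ 2 / ν ^ 2 with hA
  have hcomb : ∀ c d : ℂ, ContDiff ℝ 1 fun κ => c • phased ν g x κ + d • phased ν g x (-κ) :=
    fun c d => (hphi.const_smul c).add ((hphi.comp contDiff_neg).const_smul d)
  have key := sphereSuperposition_transforms hν hF hg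
  have k1 : ∀ κ : Space, ‖κ‖ = 1 → cross κ (radon F (inner ℝ κ x) κ) =
      (-(A : ℂ) * Complex.I) • phased ν g x κ + ((A : ℂ) * Complex.I) • phased ν g x (-κ) :=
    fun κ hκ => ((key κ _ hκ).2.2.2.2 x rfl).1
  have k2 : ∀ κ : Space, ‖κ‖ = 1 → cross κ (hilbert (fun q => radon F q κ) (inner ℝ κ x)) =
      (-(A * Real.sign ν : ℝ) : ℂ) • phased ν g x κ +
        (-(A * Real.sign ν : ℝ) : ℂ) • phased ν g x (-κ) :=
    fun κ hκ => ((key κ _ hκ).2.2.2.2 x rfl).2.1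
  have k3 : ∀ κ : Space, ‖κ‖ = 1 → hilbert (deriv fun q => radon F q κ) (inner ℝ κ x) =
      (ν * (A * Real.sign ν : ℝ) : ℂ) • phased ν g x κ +
        (ν * (A * Real.sign ν : ℝ) : ℂ) • phased ν g x (-κ) :=
    fun κ hκ => ((key κ _ hκ).2.2.2.2 x rfl).2.2
  have hπ : (Real.pi : ℂ) ≠ 0 := by exact_mod_cast Real.pi_ne_zero
  have hνc : (ν : ℂ) ≠ 0 := by exact_mod_cast hν
  have eXB := t2 hX
  have eYB := t4 hY
  have pv := h.pvSphere_of_contDiff (hcomb (-(A : ℂ) * Complex.I) ((A : ℂ) * Complex.I))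
  refine ⟨hX, t1.2 hX, ?_, ?_, ?_, ?_, eXB, hY, t3.2 hY, ?_, ?_, eYB⟩
  · rw [funkIntegrable_congr θ k2]
    exact h.funkIntegrable_of_continuous (hcomb _ _).continuous
  · rw [funkIntegrable_congr θ k3]
    exact h.funkIntegrable_of_continuous (hcomb _ _).continuous
  -- The great circle is the latitude `u = 0 = -u`, so the two antipodal terms agree and both sides
  -- are multiples of `L 0`.
  · rw [eXB, eX, funk_congr θ k2, h.funk_eq_latitudeIntegral (hcomb _ _).continuous, hlat, neg_zero,
      ← add_smul]
    simp only [← Complex.coe_smul, smul_smul]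
    congr 1
    rw [hA]
    push_cast
    field_simp
    ring
  · rw [eXB, eX, funk_congr θ k3, h.funk_eq_latitudeIntegral (hcomb _ _).continuous, hlat, neg_zero,
      ← add_smul]
    simp only [← Complex.coe_smul, smul_smul]
    congr 1
    rw [hA]
    push_cast
    field_simp
    ring
  · rw [(pvSphere_congr θ k1).1]
    exact pv.1
  · rw [eYB, eY, (pvSphere_congr θ k1).2, pv.2]
    -- `L 0` is inserted between `L u` and `L (-u)`; the two resulting integrals coincide after `u ↦
    -- -u`.
    have hsplit : ∫ u in (-1 : ℝ)..1, u⁻¹ • (L u - L (-u)) =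
        (2 : ℂ) • ∫ u in (-1 : ℝ)..1, u⁻¹ • (L u - L 0) := by
      have hQ := intervalIntegrable_diffQuotient hL hK
      have hQ' : IntervalIntegrable (fun u => u⁻¹ • (L (-u) - L 0)) volume (-1) 1 := by
        have := intervalIntegrable_diffQuotient (G := fun u => L (-u)) (by fun_prop) (K := K)
          (fun u hu => by simpa using hK (-u) (by simpa using hu))
        simpa using this
      have h1 : ∫ u in (-1 : ℝ)..1, u⁻¹ • (L (-u) - L 0) =
          -∫ u in (-1 : ℝ)..1, u⁻¹ • (L u - L 0) := by
        have := intervalIntegral.integral_comp_neg (a := -1) (b := 1)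
          (fun u => -(u⁻¹ • (L u - L 0)))
        simpa using this
      rw [two_smul]
      nth_rewrite 2 [← neg_neg (∫ u in (-1 : ℝ)..1, u⁻¹ • (L u - L 0))]
      rw [← h1, ← sub_eq_add_neg, ← intervalIntegral.integral_sub hQ hQ']
      congr 1; funext u
      rw [← smul_sub, sub_sub_sub_cancel_right]
    have hint : ∀ u : ℝ, u⁻¹ • (latitudeIntegral e₁ e₂ θ (fun κ =>
        (-(A : ℂ) * Complex.I) • phased ν g x κ + ((A : ℂ) * Complex.I) • phased ν g x (-κ)) u -
        latitudeIntegral e₁ e₂ θ (fun κ =>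
        (-(A : ℂ) * Complex.I) • phased ν g x κ + ((A : ℂ) * Complex.I) • phased ν g x (-κ)) 0) =
        (-(A : ℂ) * Complex.I) • u⁻¹ • (L u - L (-u)) := by
      intro u
      rw [hlat, hlat, neg_zero, smul_comm (-(A : ℂ) * Complex.I)]
      congr 1
      module
    simp_rw [hint]
    rw [intervalIntegral.integral_smul, hsplit]
    simp only [← Complex.coe_smul, smul_smul]
    congr 1
    rw [hA]
    push_cast
    field_simp
    ring

/-! ### Decaying fields and their Radon transform -/

/-- Continuously differentiable fields that decay, with their derivative, like `(1 + |y|)⁻⁶`. -/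
structure Decaying (F : Space → Vec) (C : ℝ) : Prop where
  contDiff : ContDiff ℝ 1 F
  norm_le : ∀ y, ‖F y‖ ≤ C * ((1 + ‖y‖) ^ 6)⁻¹
  norm_fderiv_le : ∀ y, ‖fderiv ℝ F y‖ ≤ C * ((1 + ‖y‖) ^ 6)⁻¹

/-- All that is used of a Schwartz field from here on. -/
theorem exists_decaying (F : 𝓢(Space, Vec)) : ∃ C, Decaying F C := by
  let S := 2 ^ 6 * (Finset.Iic (6, 1)).sup (fun m => SchwartzMap.seminorm ℝ m.1 m.2) F
  have key : ∀ n ≤ 1, ∀ y : Space, ‖iteratedFDeriv ℝ n F y‖ ≤ S * ((1 + ‖y‖) ^ 6)⁻¹ := by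
    intro n hn y
    have h := SchwartzMap.one_add_le_sup_seminorm_apply (𝕜 := ℝ) (m := (6, 1)) (k := 6) (n := n)
      le_rfl hn F y
    rw [← div_eq_mul_inv, le_div_iff₀ (by positivity), mul_comm]
    exact h
  refine ⟨S, F.smooth 1, fun y => ?_, fun y => ?_⟩
  · simpa using key 0 zero_le_one y
  · have := key 1 le_rfl y
    rwa [norm_iteratedFDeriv_one] at this

/-- Six is two powers for each coordinate: `1 + t² ≤ (1 + s)²` whenever `t² ≤ s²`. The bound is a
product of integrable functions of one variable, hence integrable over planes and over space. -/
theorem inv_pow_six_le {s a b c : ℝ} (hs : 0 ≤ s) (h : s ^ 2 = a ^ 2 + b ^ 2 + c ^ 2) :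
    ((1 + s) ^ 6)⁻¹ ≤ (1 + a ^ 2)⁻¹ * ((1 + b ^ 2)⁻¹ * (1 + c ^ 2)⁻¹) := by
  rw [← mul_inv, ← mul_inv]
  refine inv_anti₀ (by positivity) ?_
  have key : ∀ t : ℝ, t ^ 2 ≤ s ^ 2 → 1 + t ^ 2 ≤ (1 + s) ^ 2 := fun t ht => by nlinarith
  have ha := key a (by nlinarith [sq_nonneg b, sq_nonneg c])
  have hb := key b (by nlinarith [sq_nonneg a, sq_nonneg c])
  have hc := key c (by nlinarith [sq_nonneg a, sq_nonneg b])
  calc (1 + a ^ 2) * ((1 + b ^ 2) * (1 + c ^ 2))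
      ≤ (1 + s) ^ 2 * ((1 + s) ^ 2 * (1 + s) ^ 2) := by gcongr
    _ = _ := by ring

theorem integrable_inv_one_add_sq_prod :
    Integrable fun q : ℝ × ℝ => (1 + q.1 ^ 2)⁻¹ * (1 + q.2 ^ 2)⁻¹ :=
  integrable_inv_one_add_sq.mul_prod integrable_inv_one_add_sq

theorem integral_inv_one_add_sq_prod :
    ∫ q : ℝ × ℝ, (1 + q.1 ^ 2)⁻¹ * (1 + q.2 ^ 2)⁻¹ = Real.pi ^ 2 := by
  rw [Measure.volume_eq_prod, integral_prod_mul (fun a : ℝ => (1 + a ^ 2)⁻¹)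
    (fun a : ℝ => (1 + a ^ 2)⁻¹), integral_univ_inv_one_add_sq, sq]

theorem IsFrame.norm_plane_point_sq {e₁ e₂ κ : Space} (h : IsFrame e₁ e₂ κ) (p a b : ℝ) :
    ‖p • κ + (a • e₁ + b • e₂)‖ ^ 2 = p ^ 2 + a ^ 2 + b ^ 2 := by
  rw [add_comm, h.norm_sq]; ring

section Radon

variable {F : Space → Vec} {C : ℝ} {e₁ e₂ κ : Space}

theorem Decaying.nonneg (hF : Decaying F C) : 0 ≤ C := by
  have := (norm_nonneg _).trans (hF.norm_le 0)
  simpa using this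

theorem Decaying.norm_plane_le (hF : Decaying F C) (h : IsFrame e₁ e₂ κ) (p : ℝ) (q : ℝ × ℝ) :
    ‖F (p • κ + (q.1 • e₁ + q.2 • e₂))‖ ≤
      C * ((1 + p ^ 2)⁻¹ * ((1 + q.1 ^ 2)⁻¹ * (1 + q.2 ^ 2)⁻¹)) :=
  (hF.norm_le _).trans (mul_le_mul_of_nonneg_left
    (inv_pow_six_le (norm_nonneg _) (h.norm_plane_point_sq p q.1 q.2)) hF.nonneg)

theorem Decaying.continuous (hF : Decaying F C) : Continuous F := hF.contDiff.continuous

theorem Decaying.integrable_plane_coord (hF : Decaying F C) (h : IsFrame e₁ e₂ κ) (p : ℝ) :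
    Integrable fun q : ℝ × ℝ => F (p • κ + (q.1 • e₁ + q.2 • e₂)) := by
  have := hF.continuous
  exact ((integrable_inv_one_add_sq_prod.const_mul (1 + p ^ 2)⁻¹).const_mul C).mono'
    (by fun_prop) (Eventually.of_forall fun q => hF.norm_plane_le h p q)

theorem Decaying.integrable_plane (hF : Decaying F C) (hκ : ‖κ‖ = 1) (p : ℝ) :
    Integrable fun y : (Submodule.span ℝ {κ})ᗮ => F (p • κ + (y : Space)) := by
  obtain ⟨e₁, e₂, h⟩ := exists_isFrame hκ
  exact (h.integrable_plane _).2 (hF.integrable_plane_coord h p)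

theorem Decaying.radon_eq (hF : Decaying F C) (h : IsFrame e₁ e₂ κ) (p : ℝ) :
    radon F p κ = ∫ q : ℝ × ℝ, F (p • κ + (q.1 • e₁ + q.2 • e₂)) := by
  rw [radon_eq_integral F p κ (hF.integrable_plane (isFrame_iff.1 h).1.2.2 p), h.integral_plane]
  rfl

theorem Decaying.norm_radon_le (hF : Decaying F C) (hκ : ‖κ‖ = 1) (p : ℝ) :
    ‖radon F p κ‖ ≤ C * Real.pi ^ 2 * (1 + p ^ 2)⁻¹ := by
  obtain ⟨e₁, e₂, h⟩ := exists_isFrame hκ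
  rw [hF.radon_eq h]
  refine (norm_integral_le_of_norm_le
    ((integrable_inv_one_add_sq_prod.const_mul (1 + p ^ 2)⁻¹).const_mul C)
    (Eventually.of_forall fun q => hF.norm_plane_le h p q)).trans_eq ?_
  rw [integral_const_mul, integral_const_mul, integral_inv_one_add_sq_prod]
  ring

/-- The mean value inequality in `p` at each point of the plane, integrated. A Lipschitz bound
uniform in `κ` is what the Hilbert transform needs at its singularity. -/
theorem Decaying.norm_radon_sub_le (hF : Decaying F C) (hκ : ‖κ‖ = 1) (p p' : ℝ) :
    ‖radon F p κ - radon F p' κ‖ ≤ C * Real.pi ^ 2 * |p - p'| := by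
  obtain ⟨e₁, e₂, h⟩ := exists_isFrame hκ
  have hpt : ∀ q : ℝ × ℝ, ‖F (p • κ + (q.1 • e₁ + q.2 • e₂)) - F (p' • κ + (q.1 • e₁ + q.2 • e₂))‖ ≤
      C * |p - p'| * ((1 + q.1 ^ 2)⁻¹ * (1 + q.2 ^ 2)⁻¹) := by
    intro q
    have hd : ∀ t ∈ (Set.univ : Set ℝ), HasDerivWithinAt
        (fun t : ℝ => F (t • κ + (q.1 • e₁ + q.2 • e₂)))
        (fderiv ℝ F (t • κ + (q.1 • e₁ + q.2 • e₂)) κ) Set.univ t := by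
      intro t _
      have h1 : HasDerivAt (fun t : ℝ => t • κ + (q.1 • e₁ + q.2 • e₂)) κ t := by
        simpa using ((hasDerivAt_id t).smul_const κ).add_const (q.1 • e₁ + q.2 • e₂)
      exact (((hF.contDiff.differentiable one_ne_zero) _).hasFDerivAt.comp_hasDerivAt t
        h1).hasDerivWithinAt
    have hb : ∀ t ∈ (Set.univ : Set ℝ), ‖fderiv ℝ F (t • κ + (q.1 • e₁ + q.2 • e₂)) κ‖ ≤
        C * ((1 + q.1 ^ 2)⁻¹ * (1 + q.2 ^ 2)⁻¹) := by
      intro t _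
      refine (ContinuousLinearMap.le_opNorm _ _).trans ?_
      rw [hκ, mul_one]
      refine (hF.norm_fderiv_le _).trans (mul_le_mul_of_nonneg_left ?_ hF.nonneg)
      refine (inv_pow_six_le (norm_nonneg _) (h.norm_plane_point_sq t q.1 q.2)).trans ?_
      refine mul_le_of_le_one_left (by positivity) (inv_le_one_of_one_le₀ ?_)
      nlinarith [sq_nonneg t]
    have := convex_univ.norm_image_sub_le_of_norm_hasDerivWithin_le hd hb (Set.mem_univ p')
      (Set.mem_univ p)
    rw [Real.norm_eq_abs] at this
    linarith
  rw [hF.radon_eq h, hF.radon_eq h, ← integral_sub (hF.integrable_plane_coord h p)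
    (hF.integrable_plane_coord h p')]
  refine (norm_integral_le_of_norm_le (integrable_inv_one_add_sq_prod.const_mul _)
    (Eventually.of_forall hpt)).trans_eq ?_
  rw [integral_const_mul, integral_inv_one_add_sq_prod]
  ring

theorem Decaying.continuous_radon (hF : Decaying F C) (hκ : ‖κ‖ = 1) :
    Continuous fun p => radon F p κ := by
  have : LipschitzWith (Real.toNNReal (C * Real.pi ^ 2)) fun p => radon F p κ :=
    LipschitzWith.of_dist_le_mul fun p p' => by
      rw [dist_eq_norm, Real.dist_eq, Real.coe_toNNReal _ (by have := hF.nonneg; positivity)]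
      exact hF.norm_radon_sub_le hκ p p'
  exact this.continuous

theorem Decaying.integrable_radon (hF : Decaying F C) (hκ : ‖κ‖ = 1) :
    Integrable fun p => radon F p κ :=
  (integrable_inv_one_add_sq.const_mul _).mono' (hF.continuous_radon hκ).aestronglyMeasurable
    (Eventually.of_forall fun p => hF.norm_radon_le hκ p)

theorem Decaying.integrable (hF : Decaying F C) : Integrable F := by
  refine ((integrable_inv_norm_pow (j := 0) (by norm_num)).const_mul C).mono'
    hF.continuous.aestronglyMeasurable (Eventually.of_forall fun y => (hF.norm_le y).trans ?_)
  refine mul_le_mul_of_nonneg_left ?_ hF.nonneg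
  rw [pow_zero, inv_one, one_mul]
  exact inv_anti₀ (by positivity) (pow_le_pow_right₀ (by linarith [norm_nonneg y]) (by norm_num))

theorem integrable_bounded_smul {f : Space → Vec} (hf : Integrable f) {w : Space → ℝ}
    (hw : Measurable w) {B : ℝ} (hB : ∀ z, |w z| ≤ B) : Integrable fun z => w z • f z :=
  hf.bdd_smul B hw.aestronglyMeasurable (Eventually.of_forall hB)

/-- Integration by planes perpendicular to `κ`. -/
theorem Decaying.integral_smul_eq_integral_radon (hF : Decaying F C) (hκ : ‖κ‖ = 1) (x : Space)
    {w : ℝ → ℝ} (hw : Measurable w) {B : ℝ} (hB : ∀ t, |w t| ≤ B) :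
    ∫ z, w (inner ℝ κ z) • F (x - z) = ∫ t, w t • radon F (inner ℝ κ x - t) κ := by
  obtain ⟨e₁, e₂, h⟩ := exists_isFrame hκ
  have h' : IsFrame κ e₁ e₂ := h.cycle.cycle
  obtain ⟨b, hb⟩ := h'.exists_basis
  -- The components of `x` tangential to the plane only translate the plane integral; the normal
  -- component shifts `p`.
  have hx : x = inner ℝ κ x • κ + (inner ℝ e₁ x • e₁ + inner ℝ e₂ x • e₂) := by
    have := b.sum_repr' x
    rw [Fin.sum_univ_three, hb] at this
    simpa [add_assoc] using this.symm
  obtain ⟨⟨h1, h2, h3⟩, h12, h13, h23⟩ := isFrame_iff.1 h'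
  have hI : Integrable fun z => w (inner ℝ κ z) • F (x - z) :=
    integrable_bounded_smul (hF.integrable.comp_sub_left x)
      (w := fun z => w (inner ℝ κ z)) (hw.comp (by fun_prop)) (fun z => hB _)
  have hI' := (h'.integrable_frame _).1 hI
  rw [h'.integral_frame, Measure.volume_eq_prod, integral_prod _ hI']
  congr 1; funext t
  have e1 : ∀ q : ℝ × ℝ, w (inner ℝ κ (framePoint κ e₁ e₂ (t, q))) • F (x - framePoint κ e₁ e₂ (t, q)) =
      w t • F ((inner ℝ κ x - t) • κ + (((inner ℝ e₁ x, inner ℝ e₂ x) - q).1 • e₁ +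
        ((inner ℝ e₁ x, inner ℝ e₂ x) - q).2 • e₂)) := by
    intro q
    congr 2
    · simp [framePoint, inner_add_right, inner_smul_right, h12, h13, h1]
    · conv_lhs => rw [hx]
      simp only [framePoint, Prod.fst_sub, Prod.snd_sub]
      module
  simp_rw [e1]
  rw [integral_smul, hF.radon_eq h, integral_sub_left_eq_self
    (fun q : ℝ × ℝ => F ((inner ℝ κ x - t) • κ + (q.1 • e₁ + q.2 • e₂)))]

end Radon

/-! ### The Hilbert transform of an integrable Lipschitz function -/

section HilbertLipschitz

variable {r : ℝ → Vec} {L : ℝ}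

/-- For `t ≤ 1` the Lipschitz bound cancels the singularity; for `t > 1` the factor `1/t` is
dropped. -/
theorem norm_inv_smul_sub_le (hL : ∀ p q, ‖r p - r q‖ ≤ L * |p - q|) (x : ℝ) {t : ℝ} (ht : 0 < t) :
    ‖t⁻¹ • (r (x - t) - r (x + t))‖ ≤
      (Set.Ioc (0 : ℝ) 1).indicator (fun _ => 2 * L) t + (‖r (x - t)‖ + ‖r (x + t)‖) := by
  rw [norm_smul, norm_inv, Real.norm_eq_abs, abs_of_pos ht, inv_mul_le_iff₀ ht]
  by_cases h1 : t ≤ 1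
  · rw [Set.indicator_of_mem (show t ∈ Set.Ioc (0 : ℝ) 1 from ⟨ht, h1⟩)]
    have := hL (x - t) (x + t)
    rw [show x - t - (x + t) = -(2 * t) by ring, abs_neg, abs_of_pos (by linarith)] at this
    nlinarith [norm_nonneg (r (x - t)), norm_nonneg (r (x + t))]
  · have := norm_sub_le (r (x - t)) (r (x + t))
    rw [Set.indicator_of_notMem (fun h => h1 h.2), zero_add]
    nlinarith [norm_nonneg (r (x - t)), norm_nonneg (r (x + t))]

theorem integrable_hilbert_bound (hi : Integrable r) (L x : ℝ) :
    Integrable fun t => (Set.Ioc (0 : ℝ) 1).indicator (fun _ => 2 * L) t +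
      (‖r (x - t)‖ + ‖r (x + t)‖) :=
  ((integrableOn_const (by simp)).integrable_indicator measurableSet_Ioc).add
    ((hi.comp_sub_left x).norm.add (hi.comp_add_left x).norm)

theorem integral_hilbert_bound_le (hL : ∀ p q, ‖r p - r q‖ ≤ L * |p - q|) (hi : Integrable r)
    (x : ℝ) : ∫ t in Set.Ioi (0 : ℝ), ((Set.Ioc (0 : ℝ) 1).indicator (fun _ => 2 * L) t +
      (‖r (x - t)‖ + ‖r (x + t)‖)) ≤ 2 * L + 2 * ∫ t, ‖r t‖ := by
  have hL0 : 0 ≤ L := by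
    have := (norm_nonneg _).trans (hL 1 0)
    simpa using this
  have hb := integrable_hilbert_bound hi L x
  refine (setIntegral_le_integral hb (Eventually.of_forall fun t => ?_)).trans_eq ?_
  · have : 0 ≤ (Set.Ioc (0 : ℝ) 1).indicator (fun _ => 2 * L) t :=
      Set.indicator_nonneg (fun _ _ => by positivity) t
    simp only [Pi.zero_apply]
    positivity
  · have i1 : Integrable fun t => (Set.Ioc (0 : ℝ) 1).indicator (fun _ => 2 * L) t :=
      (integrableOn_const (by simp)).integrable_indicator measurableSet_Ioc
    have i2 : Integrable fun t => ‖r (x - t)‖ := (hi.comp_sub_left x).norm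
    have i3 : Integrable fun t => ‖r (x + t)‖ := (hi.comp_add_left x).norm
    have i4 : Integrable fun t => ‖r (x - t)‖ + ‖r (x + t)‖ := i2.add i3
    rw [integral_add i1 i4, integral_add i2 i3,
      integral_sub_left_eq_self (fun t => ‖r t‖), integral_add_left_eq_self (fun t => ‖r t‖),
      integral_indicator measurableSet_Ioc]
    simp
    ring

/-- Dominated convergence for the folded integral. The bound on the truncations depends neither on
`ε` nor on `x`, so that the limit may later be taken under an integral over a great circle. -/
theorem hilbert_of_lipschitz (hc : Continuous r) (hL : ∀ p q, ‖r p - r q‖ ≤ L * |p - q|)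
    (hi : Integrable r) (x : ℝ) : HilbertExists r x ∧
      Tendsto (hilbertTrunc r x) (𝓝[>] 0) (𝓝 (hilbert r x)) ∧
      ∀ ε > 0, ‖hilbertTrunc r x ε‖ ≤ Real.pi⁻¹ * (2 * L + 2 * ∫ t, ‖r t‖) := by
  let f : ℝ → Vec := fun t => t⁻¹ • (r (x - t) - r (x + t))
  have hm : ∀ μ : Measure ℝ, AEStronglyMeasurable f μ := fun μ =>
    (measurable_inv.stronglyMeasurable.smul
      (Continuous.stronglyMeasurable (by fun_prop : Continuous fun t => r (x - t) - r (x + t))))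
      |>.aestronglyMeasurable
  have hb := integrable_hilbert_bound hi L x
  have hle : ∀ t : ℝ, 0 < t → ‖f t‖ ≤ _ := fun t ht => norm_inv_smul_sub_le hL x ht
  have htr : ∀ ε > 0, hilbertTrunc r x ε =
      Real.pi⁻¹ • ∫ t in Set.Ioi (0 : ℝ), (Set.Ioo ε ε⁻¹).indicator f t := by
    intro ε hε
    rw [hilbertTrunc_eq hc x hε, integral_indicator measurableSet_Ioo,
      Measure.restrict_restrict measurableSet_Ioo,
      Set.inter_eq_left.2 (show Set.Ioo ε ε⁻¹ ⊆ Set.Ioi 0 from fun t ht => hε.trans ht.1)]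
  have hindle : ∀ ε : ℝ, ∀ᵐ t ∂(volume.restrict (Set.Ioi (0 : ℝ))),
      ‖(Set.Ioo ε ε⁻¹).indicator f t‖ ≤ (Set.Ioc (0 : ℝ) 1).indicator (fun _ => 2 * L) t +
        (‖r (x - t)‖ + ‖r (x + t)‖) := by
    intro ε
    filter_upwards [ae_restrict_mem measurableSet_Ioi] with t ht
    exact (norm_indicator_le_norm_self _ _).trans (hle t ht)
  have hlim : Tendsto (hilbertTrunc r x) (𝓝[>] 0)
      (𝓝 (Real.pi⁻¹ • ∫ t in Set.Ioi (0 : ℝ), f t)) := by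
    have h1 : Tendsto (fun ε : ℝ => ∫ t in Set.Ioi (0 : ℝ), (Set.Ioo ε ε⁻¹).indicator f t)
        (𝓝[>] 0) (𝓝 (∫ t in Set.Ioi (0 : ℝ), f t)) := by
      refine tendsto_integral_filter_of_dominated_convergence _
        (Eventually.of_forall fun ε => (hm _).indicator measurableSet_Ioo)
        (Eventually.of_forall hindle) hb.integrableOn ?_
      filter_upwards [ae_restrict_mem measurableSet_Ioi] with t ht
      have ht : 0 < t := ht
      refine tendsto_const_nhds.congr' ?_
      filter_upwards [self_mem_nhdsWithin, mem_nhdsWithin_of_mem_nhds (Iio_mem_nhds ht),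
        mem_nhdsWithin_of_mem_nhds (Iio_mem_nhds (inv_pos.2 ht))] with ε h0 h1 h2
      rw [Set.indicator_of_mem (show t ∈ Set.Ioo ε ε⁻¹ from ⟨h1, (lt_inv_comm₀ h0 ht).1 h2⟩)]
    refine (h1.const_smul Real.pi⁻¹).congr' ?_
    filter_upwards [self_mem_nhdsWithin] with ε hε
    exact (htr ε hε).symm
  have hex : HilbertExists r x := ⟨fun ε hε => integrableOn_hilbert hc x hε, _, hlim⟩
  refine ⟨hex, ?_, fun ε hε => ?_⟩
  · rwa [hilbert, hlim.limUnder_eq]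
  · rw [htr ε hε, norm_smul, Real.norm_eq_abs, abs_of_pos (inv_pos.2 Real.pi_pos)]
    refine mul_le_mul_of_nonneg_left ?_ (inv_pos.2 Real.pi_pos).le
    exact (norm_integral_le_of_norm_le hb.integrableOn (hindle ε)).trans
      (integral_hilbert_bound_le hL hi x)

end HilbertLipschitz

/-! ### Truncated Hilbert transforms as volume integrals -/

section HilbertRadon

variable {F : Space → Vec} {C : ℝ} {κ : Space}

theorem Decaying.hilbert_radon (hF : Decaying F C) (hκ : ‖κ‖ = 1) (p : ℝ) :
    HilbertExists (fun q => radon F q κ) p ∧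
      Tendsto (hilbertTrunc (fun q => radon F q κ) p) (𝓝[>] 0)
        (𝓝 (hilbert (fun q => radon F q κ) p)) ∧
      ∀ ε > 0, ‖hilbertTrunc (fun q => radon F q κ) p ε‖ ≤
        Real.pi⁻¹ * (2 * (C * Real.pi ^ 2) + 2 * (C * Real.pi ^ 3)) := by
  obtain ⟨h1, h2, h3⟩ := hilbert_of_lipschitz (hF.continuous_radon hκ) (hF.norm_radon_sub_le hκ)
    (hF.integrable_radon hκ) p
  refine ⟨h1, h2, fun ε hε => (h3 ε hε).trans ?_⟩
  have : ∫ t, ‖radon F t κ‖ ≤ C * Real.pi ^ 3 := by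
    refine (integral_mono (hF.integrable_radon hκ).norm (integrable_inv_one_add_sq.const_mul _)
      (fun p => hF.norm_radon_le hκ p)).trans_eq ?_
    rw [integral_const_mul, integral_univ_inv_one_add_sq]; ring
  gcongr

/-- The truncated Hilbert kernel. -/
def hilbertKernel (ε t : ℝ) : ℝ := {t : ℝ | ε < |t| ∧ |t| < ε⁻¹}.indicator (fun t => t⁻¹) t

theorem measurableSet_hilbert (ε : ℝ) : MeasurableSet {t : ℝ | ε < |t| ∧ |t| < ε⁻¹} :=
  (measurableSet_lt measurable_const measurable_id.abs).inter
    (measurableSet_lt measurable_id.abs measurable_const)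

theorem measurable_hilbertKernel (ε : ℝ) : Measurable (hilbertKernel ε) :=
  measurable_inv.indicator (measurableSet_hilbert ε)

theorem abs_hilbertKernel_le {ε : ℝ} (hε : 0 < ε) (t : ℝ) : |hilbertKernel ε t| ≤ ε⁻¹ := by
  by_cases ht : t ∈ {t : ℝ | ε < |t| ∧ |t| < ε⁻¹}
  · rw [hilbertKernel, Set.indicator_of_mem ht, abs_inv]
    exact inv_anti₀ hε ht.1.le
  · rw [hilbertKernel, Set.indicator_of_notMem ht, abs_zero]
    positivity

/-- The truncated kernel is bounded, so integration by planes turns the one-dimensional convolution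
with `1/t` into a volume integral against `1/(κ·z)`. In this form the dependence on `κ` is visibly
measurable. -/
theorem Decaying.hilbertTrunc_radon_eq (hF : Decaying F C) (hκ : ‖κ‖ = 1) (x : Space) {ε : ℝ}
    (hε : 0 < ε) : hilbertTrunc (fun q => radon F q κ) (inner ℝ κ x) ε =
      Real.pi⁻¹ • ∫ z, hilbertKernel ε (inner ℝ κ z) • F (x - z) := by
  rw [hF.integral_smul_eq_integral_radon hκ x (measurable_hilbertKernel ε)
    (abs_hilbertKernel_le hε), hilbertTrunc, ← integral_indicator (measurableSet_hilbert ε)]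
  congr 2; funext t
  by_cases ht : t ∈ {t : ℝ | ε < |t| ∧ |t| < ε⁻¹}
  · rw [hilbertKernel, Set.indicator_of_mem ht, Set.indicator_of_mem ht]
  · rw [hilbertKernel, Set.indicator_of_notMem ht, Set.indicator_of_notMem ht, zero_smul]

/-- A function on the unit sphere that is a pointwise limit of strongly measurable functions. -/
theorem exists_stronglyMeasurable_of_tendsto {f : ℕ → Space → Vec} {g : Space → Vec}
    (hf : ∀ n, StronglyMeasurable (f n))
    (hlim : ∀ κ : Space, ‖κ‖ = 1 → Tendsto (fun n => f n κ) atTop (𝓝 (g κ))) :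
    ∃ g' : Space → Vec, StronglyMeasurable g' ∧ ∀ κ : Space, ‖κ‖ = 1 → g κ = g' κ := by
  -- Convergence is known only on the unit sphere, so all functions are cut off to it.
  refine ⟨(Metric.sphere (0 : Space) 1).indicator g, ?_, fun κ hκ => ?_⟩
  · refine stronglyMeasurable_of_tendsto atTop
      (f := fun n => (Metric.sphere (0 : Space) 1).indicator (f n))
      (fun n => (hf n).indicator Metric.isClosed_sphere.measurableSet) ?_
    rw [tendsto_pi_nhds]
    intro κ
    by_cases hκ : κ ∈ Metric.sphere (0 : Space) 1
    · simp only [Set.indicator_of_mem hκ]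
      exact hlim κ (by simpa using hκ)
    · simp only [Set.indicator_of_notMem hκ]
      exact tendsto_const_nhds
  · rw [Set.indicator_of_mem (by simpa using hκ)]

theorem stronglyMeasurable_integral_inner {F : Space → Vec} (hF : Continuous F) (x : Space)
    {w : ℝ → ℝ} (hw : Measurable w) :
    StronglyMeasurable fun κ : Space => ∫ z, w (inner ℝ κ z) • F (x - z) := by
  refine StronglyMeasurable.integral_prod_right' (ν := volume)
    (f := fun q : Space × Space => w (inner ℝ q.1 q.2) • F (x - q.2)) ?_
  exact (hw.comp (by fun_prop : Measurable fun q : Space × Space => inner ℝ q.1 q.2)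
    ).stronglyMeasurable.smul (Continuous.stronglyMeasurable (by fun_prop))

theorem stronglyMeasurable_cross {α : Type*} [MeasurableSpace α] {f : α → Space} {g : α → Vec}
    (hf : Measurable f)
    (hg : StronglyMeasurable g) : StronglyMeasurable fun κ => cross (f κ) (g κ) :=
  crossL.continuous₂.comp_stronglyMeasurable (hf.stronglyMeasurable.prodMk hg)

end HilbertRadon

/-! ### Integrals over great circles -/

theorem IsFrame.eq_plane_of_inner_eq_zero {e₁ e₂ ω n : Space} (h : IsFrame e₁ e₂ ω)
    (hn : inner ℝ n ω = 0) : n = inner ℝ e₁ n • e₁ + inner ℝ e₂ n • e₂ := by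
  obtain ⟨b, hb⟩ := h.exists_basis
  have := b.sum_repr' n
  rw [Fin.sum_univ_three, hb] at this
  simp only [Matrix.cons_val_zero, Matrix.cons_val_one, Matrix.cons_val_two, Matrix.head_cons,
    Matrix.tail_cons, real_inner_comm n ω, hn, zero_smul, add_zero] at this
  exact this.symm

theorem IsFrame.exists_isFrame_of_inner_eq_zero {e₁ e₂ ω n : Space} (h : IsFrame e₁ e₂ ω)
    (hn : ‖n‖ = 1) (hnω : inner ℝ n ω = 0) : ∃ n', IsFrame n n' ω := by
  have hpl := h.eq_plane_of_inner_eq_zero hnω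
  set α := inner ℝ e₁ n
  set β := inner ℝ e₂ n
  have hαβ : α ^ 2 + β ^ 2 = 1 := by
    rw [← h.norm_plane_sq, ← hpl, hn, one_pow]
  have hnorm : ‖(-β) • e₁ + α • e₂‖ = 1 := by
    refine (pow_eq_one_iff_of_nonneg (norm_nonneg _) two_ne_zero).1 ?_
    rw [h.norm_plane_sq]; linarith
  obtain ⟨⟨h1, h2, h3⟩, h12, h13, h23⟩ := isFrame_iff.1 h
  refine ⟨(-β) • e₁ + α • e₂, isFrame_iff.2 ⟨⟨hn, hnorm, h3⟩, ?_, hnω, ?_⟩⟩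
  · rw [hpl]
    simp only [inner_add_left, inner_add_right, inner_smul_left, inner_smul_right, h12,
      real_inner_comm e₁ e₂, real_inner_self_eq_norm_sq, h1, h2]
    simp
    ring
  · simp [inner_add_left, inner_smul_left, h13, h23]

/-- Integrals over a great circle do not depend on the frame. -/
theorem IsFrame.integral_circle_eq {e₁ e₂ n n' ω : Space} (h : IsFrame e₁ e₂ ω)
    (h' : IsFrame n n' ω) {G : Type*} [NormedAddCommGroup G] [NormedSpace ℝ G] {f : Space → G}
    (hf : StronglyMeasurable f) :
    ∫ φ in Set.Ioo (-Real.pi) Real.pi, f (circlePoint e₁ e₂ φ) =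
      ∫ φ in Set.Ioo (-Real.pi) Real.pi, f (circlePoint n n' φ) := by
  have h1 := h.map_toSphere_plane.symm.trans h'.map_toSphere_plane
  have h2 := integral_map (μ := volume.restrict (Set.Ioo (-Real.pi) Real.pi))
    (continuous_circlePoint e₁ e₂).aemeasurable hf.aestronglyMeasurable
  have h3 := integral_map (μ := volume.restrict (Set.Ioo (-Real.pi) Real.pi))
    (continuous_circlePoint n n').aemeasurable hf.aestronglyMeasurable
  rw [← h2, ← h3, h1]

theorem ae_cos_ne (k : ℝ) :
    ∀ᵐ φ ∂(volume.restrict (Set.Ioo (-Real.pi) Real.pi)), Real.cos φ ≠ k := by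
  have hfin : ({Real.arccos k, -Real.arccos k} : Set ℝ).Finite := by simp
  have h0 : ∀ᵐ φ : ℝ, φ ∉ ({Real.arccos k, -Real.arccos k} : Set ℝ) :=
    measure_eq_zero_iff_ae_notMem.1 (hfin.measure_zero volume)
  filter_upwards [ae_restrict_mem measurableSet_Ioo, ae_restrict_of_ae h0] with φ hφ hφ' hk
  refine hφ' ?_
  rw [← hk]
  rcases le_total 0 φ with h | h
  · left; exact (Real.arccos_cos h hφ.2.le).symm
  · right
    rw [Set.mem_singleton_iff, ← Real.cos_neg, Real.arccos_cos (by linarith) (by linarith [hφ.1]),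
      neg_neg]

theorem integral_Ioo_symm_of_odd {G : Type*} [NormedAddCommGroup G] [NormedSpace ℝ G] {f : ℝ → G}
    (hf : ∀ φ, f (-φ) = -f φ) (a : ℝ) : ∫ φ in Set.Ioo (-a) a, f φ = 0 := by
  rcases le_or_gt a 0 with ha | ha
  · rw [Set.Ioo_eq_empty (by linarith)]; simp
  rw [← integral_Ioc_eq_integral_Ioo, ← intervalIntegral.integral_of_le (by linarith)]
  have h := intervalIntegral.integral_comp_neg (a := -a) (b := a) f
  simp only [hf, neg_neg, intervalIntegral.integral_neg] at h
  have h2 : (2 : ℝ) • ∫ φ in (-a)..a, f φ = 0 := by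
    rw [two_smul]
    nth_rewrite 1 [← h]
    exact neg_add_cancel _
  exact (smul_eq_zero.1 h2).resolve_left two_ne_zero

/-- The angular measure of `{φ | ρ cos φ ∈ S}`. -/
def circleMass (S : Set ℝ) (ρ : ℝ) : ℝ :=
  ∫ φ in Set.Ioo (-Real.pi) Real.pi, S.indicator (fun _ => (1 : ℝ)) (ρ * Real.cos φ)

theorem circleMass_mem (S : Set ℝ) (ρ : ℝ) : 0 ≤ circleMass S ρ ∧ circleMass S ρ ≤ 2 * Real.pi := by
  constructor
  · exact integral_nonneg fun φ => Set.indicator_nonneg (fun _ _ => zero_le_one) _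
  · have h : ‖circleMass S ρ‖ ≤ ∫ φ in Set.Ioo (-Real.pi) Real.pi, (1 : ℝ) := by
      refine norm_integral_le_of_norm_le (integrable_const _) (Eventually.of_forall fun φ => ?_)
      by_cases h : ρ * Real.cos φ ∈ S
      · simp [Set.indicator_of_mem h]
      · simp [Set.indicator_of_notMem h]
    have h2 : ∫ φ in Set.Ioo (-Real.pi) Real.pi, (1 : ℝ) = 2 * Real.pi := by
      simp [Real.pi_pos.le]; ring
    rw [h2] at h
    exact (le_abs_self _).trans h

/-- Since `ρ cos φ` vanishes only on a null set of angles, sets that exhaust the nonzero reals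
capture the whole circle. The sets are left abstract so as to cover the truncations of both the
Hilbert transform and the spherical principal value. -/
theorem tendsto_circleMass {S : ℝ → Set ℝ} (hm : ∀ ε, MeasurableSet (S ε))
    (hS : ∀ t ≠ 0, ∀ᶠ ε in 𝓝[>] 0, t ∈ S ε) {ρ : ℝ} (hρ : 0 < ρ) :
    Tendsto (fun ε => circleMass (S ε) ρ) (𝓝[>] 0) (𝓝 (2 * Real.pi)) := by
  have h2 : ∫ φ in Set.Ioo (-Real.pi) Real.pi, (1 : ℝ) = 2 * Real.pi := by
    simp [Real.pi_pos.le]; ring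
  rw [← h2]
  refine tendsto_integral_filter_of_dominated_convergence (fun _ => 1) ?_ ?_ (integrable_const _) ?_
  · refine Eventually.of_forall fun ε => Measurable.aestronglyMeasurable ?_
    exact (measurable_const.indicator (hm ε)).comp (by fun_prop)
  · refine Eventually.of_forall fun ε => Eventually.of_forall fun φ => ?_
    by_cases h : ρ * Real.cos φ ∈ S ε
    · simp [Set.indicator_of_mem h]
    · simp [Set.indicator_of_notMem h]
  · filter_upwards [ae_cos_ne 0] with φ hφ
    refine tendsto_const_nhds.congr' ?_
    filter_upwards [hS _ (mul_ne_zero hρ.ne' hφ)] with ε hε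
    rw [Set.indicator_of_mem hε]

/-- A frame adapted to the component of `b` perpendicular to `ω`. -/
theorem exists_isFrame_of_perp {ω b : Space} (hω : ‖ω‖ = 1) (hb : b - inner ℝ b ω • ω ≠ 0) :
    ∃ n', IsFrame (‖b - inner ℝ b ω • ω‖⁻¹ • (b - inner ℝ b ω • ω)) n' ω ∧ ∀ φ,
      inner ℝ (circlePoint (‖b - inner ℝ b ω • ω‖⁻¹ • (b - inner ℝ b ω • ω)) n' φ) b =
        ‖b - inner ℝ b ω • ω‖ * Real.cos φ := by
  obtain ⟨e₁, e₂, h⟩ := exists_isFrame hω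
  set P := b - inner ℝ b ω • ω with hP
  set ρ := ‖P‖ with hρ
  have hρ0 : 0 < ρ := norm_pos_iff.2 hb
  have hPω : inner ℝ P ω = 0 := by
    rw [hP, inner_sub_left, inner_smul_left, real_inner_self_eq_norm_sq, hω]; simp
  have hnω : inner ℝ (ρ⁻¹ • P) ω = 0 := by rw [inner_smul_left, hPω, mul_zero]
  have hn : ‖ρ⁻¹ • P‖ = 1 := by
    rw [norm_smul, norm_inv, Real.norm_eq_abs, abs_of_pos hρ0, ← hρ, inv_mul_cancel₀ hρ0.ne']
  obtain ⟨n', h'⟩ := h.exists_isFrame_of_inner_eq_zero hn hnω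
  refine ⟨n', h', fun φ => ?_⟩
  set n := ρ⁻¹ • P with hndef
  have hbn : b = ρ • n + inner ℝ b ω • ω := by
    rw [hndef, smul_smul, mul_inv_cancel₀ hρ0.ne', one_smul, hP, sub_add_cancel]
  obtain ⟨⟨h1, h2, h3⟩, h12, h13, h23⟩ := isFrame_iff.1 h'
  rw [hbn]
  simp only [circlePoint, inner_add_left, inner_add_right, inner_smul_left, inner_smul_right,
    real_inner_self_eq_norm_sq, h1, h12, h13, h23, real_inner_comm n n']
  simp

/-- The principal-value kernel `1 / (κ · b)` integrated over the great circle `ω^⊥`. -/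
theorem IsFrame.integral_circle_inv {e₁ e₂ ω : Space} (h : IsFrame e₁ e₂ ω) {S : Set ℝ}
    (hS : MeasurableSet S) (h0 : (0 : ℝ) ∉ S) {B : ℝ}
    (hB : ∀ t, |S.indicator (fun t => t⁻¹) t| ≤ B) {b : Space} (hb : b - inner ℝ b ω • ω ≠ 0) :
    ∫ φ in Set.Ioo (-Real.pi) Real.pi,
        S.indicator (fun t => t⁻¹) (inner ℝ (circlePoint e₁ e₂ φ) b) • circlePoint e₁ e₂ φ =
      (circleMass S ‖b - inner ℝ b ω • ω‖ * (‖b - inner ℝ b ω • ω‖ ^ 2)⁻¹) •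
        (b - inner ℝ b ω • ω) := by
  set P := b - inner ℝ b ω • ω with hP
  set ρ := ‖P‖ with hρ
  have hρ0 : 0 < ρ := norm_pos_iff.2 hb
  have hω : ‖ω‖ = 1 := (isFrame_iff.1 h).1.2.2
  obtain ⟨n', h', hin⟩ := exists_isFrame_of_perp hω hb
  rw [← hP, ← hρ] at h' hin
  set n := ρ⁻¹ • P with hndef
  have hk : Measurable (S.indicator fun t : ℝ => t⁻¹) := measurable_inv.indicator hS
  have hf : StronglyMeasurable fun κ : Space => S.indicator (fun t => t⁻¹) (inner ℝ κ b) • κ :=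
    (hk.comp (by fun_prop : Measurable fun κ : Space => inner ℝ κ b)).stronglyMeasurable.smul
      stronglyMeasurable_id
  -- The frame is rotated so that its first vector points along the component of `b` perpendicular
  -- to `ω`; then `κ·b = ρ cos φ`.
  rw [h.integral_circle_eq h' hf]
  simp_rw [hin]
  have hkc : Measurable fun φ : ℝ => S.indicator (fun t => t⁻¹) (ρ * Real.cos φ) :=
    hk.comp (by fun_prop)
  have hi : ∀ (c : ℝ → ℝ) (v : Space), Continuous c → (∀ φ, |c φ| ≤ 1) →
      IntegrableOn (fun φ => (S.indicator (fun t => t⁻¹) (ρ * Real.cos φ) * c φ) • v)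
        (Set.Ioo (-Real.pi) Real.pi) := by
    intro c v hc hc1
    refine Integrable.smul_const ?_ v
    refine Integrable.mono' (g := fun _ => B) (integrable_const _)
      (hkc.mul hc.measurable).aestronglyMeasurable (Eventually.of_forall fun φ => ?_)
    rw [norm_mul]
    calc _ ≤ B * 1 := mul_le_mul (hB _) (hc1 φ) (abs_nonneg _) ((abs_nonneg _).trans (hB 0))
      _ = B := mul_one B
  have hsplit : ∀ φ, S.indicator (fun t => t⁻¹) (ρ * Real.cos φ) • circlePoint n n' φ =
      (S.indicator (fun t => t⁻¹) (ρ * Real.cos φ) * Real.cos φ) • n +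
        (S.indicator (fun t => t⁻¹) (ρ * Real.cos φ) * Real.sin φ) • n' := by
    intro φ
    rw [circlePoint]; module
  simp_rw [hsplit]
  rw [integral_add (hi _ n Real.continuous_cos Real.abs_cos_le_one)
    (hi _ n' Real.continuous_sin Real.abs_sin_le_one),
    integral_Ioo_symm_of_odd (f := fun φ =>
      (S.indicator (fun t => t⁻¹) (ρ * Real.cos φ) * Real.sin φ) • n')
      (fun φ => by simp [Real.cos_neg, Real.sin_neg]), add_zero, integral_smul_const]
  -- The sine component has dropped out by oddness. In the cosine component the kernel cancels the
  -- cosine, which is nonzero on the truncation set because `0 ∉ S`.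
  have hm : ∀ φ, S.indicator (fun t => t⁻¹) (ρ * Real.cos φ) * Real.cos φ =
      ρ⁻¹ * S.indicator (fun _ => (1 : ℝ)) (ρ * Real.cos φ) := by
    intro φ
    by_cases hφ : ρ * Real.cos φ ∈ S
    · rw [Set.indicator_of_mem hφ, Set.indicator_of_mem hφ]
      have : Real.cos φ ≠ 0 := by
        rintro h; rw [h, mul_zero] at hφ; exact h0 hφ
      field_simp
    · rw [Set.indicator_of_notMem hφ, Set.indicator_of_notMem hφ]; simp
  simp_rw [hm]
  rw [integral_const_mul, hndef, smul_smul, circleMass]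
  congr 1
  field_simp

/-! ### The transverse component and its singular weight -/

/-- The component of `z` perpendicular to the unit vector `θ`. -/
def transverse (θ z : Space) : Space := z - inner ℝ z θ • θ

theorem continuous_transverse (θ : Space) : Continuous (transverse θ) := by
  unfold transverse; fun_prop

theorem IsFrame.transverse_framePoint {e₁ e₂ θ : Space} (h : IsFrame e₁ e₂ θ) (p : ℝ × ℝ × ℝ) :
    transverse θ (framePoint e₁ e₂ θ p) = p.1 • e₁ + p.2.1 • e₂ := by
  obtain ⟨⟨h1, h2, h3⟩, h12, h13, h23⟩ := isFrame_iff.1 h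
  simp [transverse, framePoint, inner_add_left, inner_smul_left, h13, h23, h3]

theorem ae_transverse_ne_zero (θ : Space) : ∀ᵐ z : Space, transverse θ z ≠ 0 := by
  have h : volume ((Submodule.span ℝ {θ} : Submodule ℝ Space) : Set Space) = 0 := by
    refine Measure.addHaar_submodule volume _ fun htop => ?_
    have h1 := finrank_span_le_card (R := ℝ) ({θ} : Set Space)
    rw [htop, finrank_top, finrank_space] at h1
    simp at h1
  filter_upwards [measure_eq_zero_iff_ae_notMem.1 h] with z hz h0
  refine hz ?_
  rw [sub_eq_zero.1 h0]
  exact Submodule.smul_mem _ _ (Submodule.mem_span_singleton_self θ)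

/-- Separates the singularity at `0` from the behaviour at infinity, so that a singular kernel can
be multiplied by a decay centred elsewhere. The constant `16` bounds `(1 + s)^4` for `s ≤ 1`. -/
theorem inv_le_one_add_inv_mul {s : ℝ} (hs : 0 ≤ s) (j : ℕ) :
    (s ^ j)⁻¹ ≤ 1 + 16 * ((s ^ j)⁻¹ * ((1 + s) ^ 4)⁻¹) := by
  rcases le_or_gt 1 s with h | h
  · have h1 : (s ^ j)⁻¹ ≤ 1 := inv_le_one_of_one_le₀ (one_le_pow₀ h)
    have : 0 ≤ 16 * ((s ^ j)⁻¹ * ((1 + s) ^ 4)⁻¹) := by positivity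
    linarith
  · have h1 : (16 : ℝ)⁻¹ ≤ ((1 + s) ^ 4)⁻¹ := by
      refine inv_anti₀ (by positivity) ?_
      calc (1 + s) ^ 4 ≤ 2 ^ 4 := by gcongr; linarith
        _ = 16 := by norm_num
    have h2 : (s ^ j)⁻¹ * 16⁻¹ ≤ (s ^ j)⁻¹ * ((1 + s) ^ 4)⁻¹ :=
      mul_le_mul_of_nonneg_left h1 (by positivity)
    linarith

theorem IsFrame.integrable_inv_norm_plane {e₁ e₂ θ : Space} (h : IsFrame e₁ e₂ θ) :
    Integrable fun q : ℝ × ℝ =>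
      ‖q.1 • e₁ + q.2 • e₂‖⁻¹ * ((1 + ‖q.1 • e₁ + q.2 • e₂‖) ^ 4)⁻¹ := by
  refine (h.integrable_plane (fun y => ‖y‖⁻¹ * ((1 + ‖y‖) ^ 4)⁻¹)).1 ?_
  have hdim := finrank_plane (isFrame_iff.1 h).1.2.2
  have : Nontrivial (Submodule.span ℝ {θ})ᗮ := Module.nontrivial_of_finrank_pos (R := ℝ) (by omega)
  refine (integrable_fun_norm_addHaar (volume : Measure (Submodule.span ℝ {θ})ᗮ)
    (f := fun r : ℝ => r⁻¹ * ((1 + r) ^ 4)⁻¹)).2 ?_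
  rw [hdim]
  refine Integrable.mono' integrableOn_inv_one_add_sq_Ioi (by fun_prop) ?_
  filter_upwards [ae_restrict_mem measurableSet_Ioi] with r hr
  have hr : 0 < r := hr
  have : r ^ (2 - 1) • (r⁻¹ * ((1 + r) ^ 4)⁻¹) = ((1 + r) ^ 4)⁻¹ := by
    rw [smul_eq_mul]; norm_num; field_simp
  rw [this, Real.norm_eq_abs, abs_of_pos (by positivity)]
  refine inv_anti₀ (by positivity) ?_
  have := pow_pos hr 3
  have := pow_pos hr 4
  nlinarith [sq_nonneg r]

/-- The singularity on the axis `ℝθ` is of order one in two transverse dimensions, hence locally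
integrable; the decay in all three coordinates does the rest. This is the common majorant for the
X-ray, Funk and principal-value integrals. -/
theorem integrable_inv_transverse {θ : Space} (hθ : ‖θ‖ = 1) (x : Space) :
    Integrable fun z => ‖transverse θ z‖⁻¹ * ((1 + ‖x - z‖) ^ 6)⁻¹ := by
  obtain ⟨e₁, e₂, h⟩ := exists_isFrame hθ
  obtain ⟨b, hb⟩ := h.exists_basis
  have hx : x = inner ℝ e₁ x • e₁ + inner ℝ e₂ x • e₂ + inner ℝ θ x • θ := by
    have := b.sum_repr' x
    rw [Fin.sum_univ_three, hb] at this
    simpa using this.symm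
  set x₁ := inner ℝ e₁ x
  set x₂ := inner ℝ e₂ x
  set x₃ := inner ℝ θ x
  rw [h.integrable_frame]
  have hρ : ∀ c : ℝ, Integrable fun a : ℝ => (1 + (c - a) ^ 2)⁻¹ := fun c =>
    integrable_inv_one_add_sq.comp_sub_left c
  have g1 : Integrable fun q : ℝ × ℝ => (1 + (x₁ - q.1) ^ 2)⁻¹ * (1 + (x₂ - q.2) ^ 2)⁻¹ :=
    (hρ x₁).mul_prod (hρ x₂)
  have g2 := h.integrable_inv_norm_plane.const_mul 16
  have g3 : Integrable fun p : (ℝ × ℝ) × ℝ => ((1 + (x₁ - p.1.1) ^ 2)⁻¹ * (1 + (x₂ - p.1.2) ^ 2)⁻¹ +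
      16 * (‖p.1.1 • e₁ + p.1.2 • e₂‖⁻¹ * ((1 + ‖p.1.1 • e₁ + p.1.2 • e₂‖) ^ 4)⁻¹)) *
        (1 + (x₃ - p.2) ^ 2)⁻¹ := (g1.add g2).mul_prod (hρ x₃)
  have hassoc : MeasurePreserving (MeasurableEquiv.prodAssoc (α := ℝ) (β := ℝ) (γ := ℝ))
      volume volume := volume_preserving_prodAssoc
  rw [← hassoc.integrable_comp_emb MeasurableEquiv.prodAssoc.measurableEmbedding]
  refine g3.mono' ?_ (Eventually.of_forall fun p => ?_)
  · refine Measurable.aestronglyMeasurable ?_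
    have := (continuous_transverse θ).measurable
    have := (continuous_framePoint e₁ e₂ θ).measurable
    fun_prop
  obtain ⟨⟨a, b⟩, c⟩ := p
  simp only [Function.comp, MeasurableEquiv.prodAssoc, MeasurableEquiv.coe_mk, Equiv.prodAssoc_apply,
    h.transverse_framePoint]
  rw [Real.norm_eq_abs, abs_of_nonneg (by positivity)]
  set d := ‖a • e₁ + b • e₂‖
  have hd : 0 ≤ d := norm_nonneg _
  have hxz : ‖x - framePoint e₁ e₂ θ (a, b, c)‖ ^ 2 = (x₁ - a) ^ 2 + (x₂ - b) ^ 2 + (x₃ - c) ^ 2 := by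
    rw [← h.norm_sq]
    congr 2
    conv_lhs => rw [hx]
    simp only [framePoint]
    module
  have h1 := inv_pow_six_le (norm_nonneg _) hxz
  have h2 := inv_le_one_add_inv_mul hd 1
  rw [pow_one] at h2
  have k1 : (1 + (x₁ - a) ^ 2)⁻¹ ≤ 1 := inv_le_one_of_one_le₀ (by nlinarith [sq_nonneg (x₁ - a)])
  have k2 : (1 + (x₂ - b) ^ 2)⁻¹ ≤ 1 := inv_le_one_of_one_le₀ (by nlinarith [sq_nonneg (x₂ - b)])
  have k3 : (1 + (x₁ - a) ^ 2)⁻¹ * (1 + (x₂ - b) ^ 2)⁻¹ ≤ 1 :=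
    mul_le_one₀ k1 (by positivity) k2
  set A := (1 + (x₁ - a) ^ 2)⁻¹ * (1 + (x₂ - b) ^ 2)⁻¹ with hA
  have hA0 : 0 ≤ A := by positivity
  set D := d⁻¹ * ((1 + d) ^ 4)⁻¹
  have hD0 : 0 ≤ D := by positivity
  calc d⁻¹ * ((1 + ‖x - framePoint e₁ e₂ θ (a, b, c)‖) ^ 6)⁻¹
      ≤ d⁻¹ * (A * (1 + (x₃ - c) ^ 2)⁻¹) := by
        rw [hA, mul_assoc]; gcongr
    _ = (d⁻¹ * A) * (1 + (x₃ - c) ^ 2)⁻¹ := by ring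
    _ ≤ (A + 16 * D) * (1 + (x₃ - c) ^ 2)⁻¹ := by
        gcongr
        calc d⁻¹ * A ≤ (1 + 16 * D) * A := by gcongr
          _ ≤ A + 16 * D := by nlinarith

/-! ### The Funk transform of the Hilbert transform as a volume integral -/

section FunkSide

variable {F : Space → Vec} {C : ℝ} {θ : Space}

theorem norm_transverse_kernel (θ z : Space) :
    ‖(‖transverse θ z‖ ^ 2)⁻¹ • transverse θ z‖ = ‖transverse θ z‖⁻¹ := by
  rw [norm_smul, norm_inv, norm_pow, norm_norm]
  rcases eq_or_ne ‖transverse θ z‖ 0 with h | h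
  · rw [h]; simp
  · field_simp

theorem Decaying.norm_cross_le_transverse (hF : Decaying F C) (x : Space) {v z : Space} {B : ℝ}
    (hv : ‖v‖ ≤ B * ‖transverse θ z‖⁻¹) :
    ‖cross v (F (x - z))‖ ≤ 2 * B * C * (‖transverse θ z‖⁻¹ * ((1 + ‖x - z‖) ^ 6)⁻¹) := by
  have hC := hF.nonneg
  calc ‖cross v (F (x - z))‖ ≤ 2 * ‖v‖ * ‖F (x - z)‖ := norm_cross_le _ _
    _ ≤ 2 * (B * ‖transverse θ z‖⁻¹) * (C * ((1 + ‖x - z‖) ^ 6)⁻¹) := by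
        have := hF.norm_le (x - z)
        have : 0 ≤ B * ‖transverse θ z‖⁻¹ := (norm_nonneg _).trans hv
        gcongr
    _ = _ := by ring

/-- The truncated Hilbert transforms integrated over the great circle. -/
theorem Decaying.integral_circle_hilbertTrunc (hF : Decaying F C) {e₁ e₂ : Space}
    (h : IsFrame e₁ e₂ θ) (x : Space) {ε : ℝ} (hε : 0 < ε) :
    ∫ φ in Set.Ioo (-Real.pi) Real.pi, cross (circlePoint e₁ e₂ φ)
        (hilbertTrunc (fun q => radon F q (circlePoint e₁ e₂ φ))
          (inner ℝ (circlePoint e₁ e₂ φ) x) ε) =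
      Real.pi⁻¹ • ∫ z, cross ((circleMass {t : ℝ | ε < |t| ∧ |t| < ε⁻¹} ‖transverse θ z‖ *
        (‖transverse θ z‖ ^ 2)⁻¹) • transverse θ z) (F (x - z)) := by
  have hk := measurable_hilbertKernel ε
  have hc := continuous_circlePoint e₁ e₂
  have hFc := hF.continuous
  have hFi : Integrable fun z => F (x - z) := hF.integrable.comp_sub_left x
  have hFn : Integrable fun z => ‖F (x - z)‖ := hFi.norm
  have hm : Measurable fun q : ℝ × Space =>
      hilbertKernel ε (inner ℝ (circlePoint e₁ e₂ q.1) q.2) := hk.comp (by fun_prop)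
  have hI : Integrable (fun q : ℝ × Space =>
      hilbertKernel ε (inner ℝ (circlePoint e₁ e₂ q.1) q.2) •
        cross (circlePoint e₁ e₂ q.1) (F (x - q.2)))
      ((volume.restrict (Set.Ioo (-Real.pi) Real.pi)).prod volume) := by
    have hg : Integrable (fun q : ℝ × Space => (2 * ε⁻¹) * ‖F (x - q.2)‖)
        ((volume.restrict (Set.Ioo (-Real.pi) Real.pi)).prod volume) :=
      (integrable_const (2 * ε⁻¹)).mul_prod hFn
    refine hg.mono' (hm.stronglyMeasurable.smul (continuous_cross (by fun_prop)
        (by fun_prop)).stronglyMeasurable).aestronglyMeasurable (Eventually.of_forall fun q => ?_)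
    rw [norm_smul]
    have h1 := norm_cross_le (circlePoint e₁ e₂ q.1) (F (x - q.2))
    rw [h.norm_circlePoint] at h1
    calc _ ≤ ε⁻¹ * (2 * 1 * ‖F (x - q.2)‖) :=
          mul_le_mul (abs_hilbertKernel_le hε _) h1 (norm_nonneg _) (by positivity)
      _ = _ := by ring
  have e1 : ∀ φ, cross (circlePoint e₁ e₂ φ) (hilbertTrunc (fun q => radon F q (circlePoint e₁ e₂ φ))
      (inner ℝ (circlePoint e₁ e₂ φ) x) ε) = Real.pi⁻¹ • ∫ z,
        hilbertKernel ε (inner ℝ (circlePoint e₁ e₂ φ) z) •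
          cross (circlePoint e₁ e₂ φ) (F (x - z)) := by
    intro φ
    rw [hF.hilbertTrunc_radon_eq (h.norm_circlePoint φ) x hε, cross_smul_right,
      ← integral_cross _ (integrable_bounded_smul hFi (w := fun z =>
        hilbertKernel ε (inner ℝ (circlePoint e₁ e₂ φ) z)) (hk.comp (by fun_prop))
        (fun z => abs_hilbertKernel_le hε _))]
    simp only [cross_smul_right]
  simp_rw [e1]
  -- With the truncated kernel bounded, the circle integral is done first, at fixed `z`; for `z` off
  -- the axis it has been evaluated in closed form.
  rw [integral_smul, integral_integral_swap hI]
  congr 1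
  refine integral_congr_ae ?_
  filter_upwards [ae_transverse_ne_zero θ] with z hz
  have hS := measurableSet_hilbert ε
  rw [transverse, ← h.integral_circle_inv hS (by simp [hε.not_gt]) (abs_hilbertKernel_le hε) hz,
    ← integral_cross_left]
  · simp only [cross_smul_left]
    rfl
  · refine Integrable.mono' (g := fun _ => ε⁻¹) (integrable_const _) ?_
      (Eventually.of_forall fun φ => ?_)
    · exact ((hk.comp (by fun_prop : Measurable fun φ => inner ℝ (circlePoint e₁ e₂ φ) z)
        ).stronglyMeasurable.smul hc.stronglyMeasurable).aestronglyMeasurable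
    · rw [norm_smul, h.norm_circlePoint, mul_one]
      exact abs_hilbertKernel_le hε _

theorem eventually_mem_hilbert {t : ℝ} (ht : t ≠ 0) :
    ∀ᶠ ε in 𝓝[>] (0 : ℝ), t ∈ {t : ℝ | ε < |t| ∧ |t| < ε⁻¹} := by
  have ht := abs_pos.2 ht
  filter_upwards [self_mem_nhdsWithin, mem_nhdsWithin_of_mem_nhds (Iio_mem_nhds ht),
    mem_nhdsWithin_of_mem_nhds (Iio_mem_nhds (inv_pos.2 ht))] with ε h0 h1 h2
  exact ⟨h1, (lt_inv_comm₀ h0 ht).1 h2⟩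

/-- A weighted mass of the circles of centre `0` perpendicular to `θ`, as the truncation is
removed. -/
theorem Decaying.tendsto_integral_circleMass (hF : Decaying F C) (hθ : ‖θ‖ = 1) (x : Space)
    {S : ℝ → Set ℝ} (hm : ∀ ε, MeasurableSet (S ε)) (hS : ∀ t ≠ 0, ∀ᶠ ε in 𝓝[>] 0, t ∈ S ε)
    {ρ : Space → ℝ} (hρ : ∀ z, transverse θ z ≠ 0 → 0 < ρ z) {v : Space → Space} (hv : Measurable v)
    (hvb : ∀ z, ‖v z‖ ≤ ‖transverse θ z‖⁻¹) (hρm : Measurable ρ) :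
    Tendsto (fun ε => ∫ z, cross (circleMass (S ε) (ρ z) • v z) (F (x - z))) (𝓝[>] 0)
      (𝓝 ((2 * Real.pi) • ∫ z, cross (v z) (F (x - z)))) := by
  have hFc := hF.continuous
  have hcm : ∀ ε, Measurable fun z => circleMass (S ε) (ρ z) := by
    intro ε
    refine (StronglyMeasurable.integral_prod_right' (f := fun q : Space × ℝ =>
      (S ε).indicator (fun _ => (1 : ℝ)) (ρ q.1 * Real.cos q.2)) ?_).measurable
    exact ((measurable_const.indicator (hm ε)).comp (by fun_prop)).stronglyMeasurable
  rw [← integral_smul]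
  refine tendsto_integral_filter_of_dominated_convergence
    (fun z => 2 * (2 * Real.pi) * C * (‖transverse θ z‖⁻¹ * ((1 + ‖x - z‖) ^ 6)⁻¹)) ?_ ?_
    ((integrable_inv_transverse hθ x).const_mul _) ?_
  · refine Eventually.of_forall fun ε => StronglyMeasurable.aestronglyMeasurable ?_
    exact stronglyMeasurable_cross ((hcm ε).smul hv)
      (Continuous.stronglyMeasurable (by fun_prop))
  · refine Eventually.of_forall fun ε => Eventually.of_forall fun z => ?_
    refine hF.norm_cross_le_transverse x ?_
    obtain ⟨h1, h2⟩ := circleMass_mem (S ε) (ρ z)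
    rw [norm_smul, Real.norm_eq_abs, abs_of_nonneg h1]
    exact mul_le_mul h2 (hvb z) (norm_nonneg _) (by positivity)
  · filter_upwards [ae_transverse_ne_zero θ] with z hz
    simp only [cross_smul_left]
    exact (tendsto_circleMass hm hS (hρ z hz)).smul_const _

/-- The Minkowski–Funk transform of the Hilbert transform of the Radon transform. -/
theorem Decaying.funk_hilbert (hF : Decaying F C) (hθ : ‖θ‖ = 1) (x : Space) :
    FunkIntegrable (fun κ => cross κ (hilbert (fun q => radon F q κ) (inner ℝ κ x))) θ ∧
    funk (fun κ => cross κ (hilbert (fun q => radon F q κ) (inner ℝ κ x))) θ =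
      (2 : ℝ) • ∫ z, cross ((‖transverse θ z‖ ^ 2)⁻¹ • transverse θ z) (F (x - z)) := by
  obtain ⟨e₁, e₂, h⟩ := exists_isFrame hθ
  set B := Real.pi⁻¹ * (2 * (C * Real.pi ^ 2) + 2 * (C * Real.pi ^ 3)) with hB
  have hlim := fun κ (hκ : ‖κ‖ = 1) => (hF.hilbert_radon hκ (inner ℝ κ x)).2.1
  have hbd := fun κ (hκ : ‖κ‖ = 1) => (hF.hilbert_radon hκ (inner ℝ κ x)).2.2
  have hseq : Tendsto (fun n : ℕ => ((n : ℝ) + 1)⁻¹) atTop (𝓝[>] 0) :=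
    tendsto_inv_atTop_nhdsGT_zero.comp
      (tendsto_atTop_add_const_right _ _ tendsto_natCast_atTop_atTop)
  have hcross : ∀ κ : Space, Continuous (cross κ) := fun κ => (crossL κ).continuous
  have hsm : ∀ n : ℕ, StronglyMeasurable fun κ : Space => Real.pi⁻¹ • ∫ z,
      hilbertKernel ((n : ℝ) + 1)⁻¹ (inner ℝ κ z) • F (x - z) := fun n =>
    (stronglyMeasurable_integral_inner hF.continuous x
      (measurable_hilbertKernel ((n : ℝ) + 1)⁻¹)).const_smul Real.pi⁻¹
  -- The Hilbert transform is defined by a limit for each `κ` separately; its measurability in `κ`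
  -- comes from the truncations along `ε = 1/(n + 1)`.
  obtain ⟨g, hg, hgeq⟩ := exists_stronglyMeasurable_of_tendsto
    (f := fun (n : ℕ) κ => cross κ (Real.pi⁻¹ • ∫ z,
      hilbertKernel ((n : ℝ) + 1)⁻¹ (inner ℝ κ z) • F (x - z)))
    (g := fun κ => cross κ (hilbert (fun q => radon F q κ) (inner ℝ κ x)))
    (fun n => stronglyMeasurable_cross measurable_id (hsm n))
    (fun κ hκ => by
      refine ((hcross κ).tendsto _).comp (((hlim κ hκ).comp hseq).congr fun n => ?_)
      rw [Function.comp, hF.hilbertTrunc_radon_eq hκ x (by positivity)])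
  have hcirc : ∀ φ, g (circlePoint e₁ e₂ φ) = cross (circlePoint e₁ e₂ φ)
      (hilbert (fun q => radon F q (circlePoint e₁ e₂ φ)) (inner ℝ (circlePoint e₁ e₂ φ) x)) :=
    fun φ => (hgeq _ (h.norm_circlePoint φ)).symm
  have hle : ∀ κ : Space, ‖κ‖ = 1 → ∀ v : Vec, ‖v‖ ≤ B → ‖cross κ v‖ ≤ 2 * B := by
    intro κ hκ v hv
    have := norm_cross_le κ v
    rw [hκ] at this
    linarith
  have hgb : ∀ φ, ‖g (circlePoint e₁ e₂ φ)‖ ≤ 2 * B := by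
    intro φ
    rw [hcirc]
    refine hle _ (h.norm_circlePoint φ) _ (le_of_tendsto (hlim _ (h.norm_circlePoint φ)).norm ?_)
    filter_upwards [self_mem_nhdsWithin] with ε hε
    exact hbd _ (h.norm_circlePoint φ) ε hε
  have hgm : StronglyMeasurable fun φ => g (circlePoint e₁ e₂ φ) :=
    hg.comp_measurable (continuous_circlePoint e₁ e₂).measurable
  constructor
  · rw [funkIntegrable_congr θ hgeq, h.funkIntegrable_iff hg]
    exact Integrable.mono' (integrable_const (2 * B)) hgm.aestronglyMeasurable
      (Eventually.of_forall hgb)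
  · rw [funk_congr θ hgeq, h.funk_eq hg]
    simp_rw [hcirc]
    have hL : Tendsto (fun ε => ∫ φ in Set.Ioo (-Real.pi) Real.pi, cross (circlePoint e₁ e₂ φ)
        (hilbertTrunc (fun q => radon F q (circlePoint e₁ e₂ φ))
          (inner ℝ (circlePoint e₁ e₂ φ) x) ε)) (𝓝[>] 0)
        (𝓝 (∫ φ in Set.Ioo (-Real.pi) Real.pi, cross (circlePoint e₁ e₂ φ)
          (hilbert (fun q => radon F q (circlePoint e₁ e₂ φ))
            (inner ℝ (circlePoint e₁ e₂ φ) x)))) := by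
      refine tendsto_integral_filter_of_dominated_convergence (fun _ => 2 * B) ?_ ?_
        (integrable_const _) ?_
      · filter_upwards [self_mem_nhdsWithin] with ε hε
        have h1 : (fun φ => cross (circlePoint e₁ e₂ φ)
            (hilbertTrunc (fun q => radon F q (circlePoint e₁ e₂ φ))
              (inner ℝ (circlePoint e₁ e₂ φ) x) ε)) = fun φ => cross (circlePoint e₁ e₂ φ)
            (Real.pi⁻¹ • ∫ z, hilbertKernel ε (inner ℝ (circlePoint e₁ e₂ φ) z) • F (x - z)) := by
          funext φ
          rw [hF.hilbertTrunc_radon_eq (h.norm_circlePoint φ) x hε]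
        have h2 : StronglyMeasurable fun κ : Space => Real.pi⁻¹ • ∫ z,
            hilbertKernel ε (inner ℝ κ z) • F (x - z) :=
          (stronglyMeasurable_integral_inner hF.continuous x
            (measurable_hilbertKernel ε)).const_smul Real.pi⁻¹
        have h3 : StronglyMeasurable fun φ => Real.pi⁻¹ • ∫ z,
            hilbertKernel ε (inner ℝ (circlePoint e₁ e₂ φ) z) • F (x - z) :=
          h2.comp_measurable (continuous_circlePoint e₁ e₂).measurable
        rw [h1]
        refine StronglyMeasurable.aestronglyMeasurable ?_
        exact stronglyMeasurable_cross (continuous_circlePoint e₁ e₂).measurable h3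
      · filter_upwards [self_mem_nhdsWithin] with ε hε
        exact Eventually.of_forall fun φ =>
          hle _ (h.norm_circlePoint φ) _ (hbd _ (h.norm_circlePoint φ) ε hε)
      · exact Eventually.of_forall fun φ =>
          ((hcross _).tendsto _).comp (hlim _ (h.norm_circlePoint φ))
    -- The same limit on the volume side, where the circle mass tends to `2π`; together with the
    -- factor `1/π` this gives the constant `2`.
    have hR := (hF.tendsto_integral_circleMass hθ x measurableSet_hilbert
      (fun t ht => eventually_mem_hilbert ht) (ρ := fun z => ‖transverse θ z‖)
      (fun z hz => norm_pos_iff.2 hz) (v := fun z => (‖transverse θ z‖ ^ 2)⁻¹ • transverse θ z)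
      (by have := (continuous_transverse θ).measurable; fun_prop)
      (fun z => (norm_transverse_kernel θ z).le)
      (by have := (continuous_transverse θ).measurable; fun_prop)).const_smul Real.pi⁻¹
    have heq := tendsto_nhds_unique hL (hR.congr' (by
      filter_upwards [self_mem_nhdsWithin] with ε hε
      rw [hF.integral_circle_hilbertTrunc h x hε]
      simp only [smul_smul]))
    rw [heq, smul_smul]
    congr 1
    field_simp

end FunkSide

/-! ### The Poisson kernel as an approximate identity -/

/-- The Poisson kernel of the half-plane. -/
def poissonKernel (δ t : ℝ) : ℝ := δ⁻¹ * (Real.pi⁻¹ * (1 + (δ⁻¹ * t) ^ 2)⁻¹)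

theorem continuous_poissonKernel (δ : ℝ) : Continuous (poissonKernel δ) := by
  unfold poissonKernel
  exact continuous_const.mul (continuous_const.mul
    (Continuous.inv₀ (by fun_prop) fun t => by positivity))

theorem poissonKernel_nonneg {δ : ℝ} (hδ : 0 < δ) (t : ℝ) : 0 ≤ poissonKernel δ t := by
  have := Real.pi_pos
  unfold poissonKernel; positivity

theorem abs_poissonKernel_le {δ : ℝ} (hδ : 0 < δ) (t : ℝ) :
    |poissonKernel δ t| ≤ δ⁻¹ * Real.pi⁻¹ := by
  have := Real.pi_pos
  rw [abs_of_nonneg (poissonKernel_nonneg hδ t), poissonKernel]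
  have : (1 + (δ⁻¹ * t) ^ 2)⁻¹ ≤ 1 := inv_le_one_of_one_le₀ (by nlinarith [sq_nonneg (δ⁻¹ * t)])
  gcongr
  exact mul_le_of_le_one_right (by positivity) this

theorem poissonKernel_mul {r : ℝ} (hr : 0 < r) (δ t : ℝ) :
    poissonKernel δ (r * t) = r⁻¹ * poissonKernel (δ * r⁻¹) t := by
  unfold poissonKernel
  rw [mul_inv, inv_inv]
  field_simp

theorem integral_poissonKernel_smul {G : Type*} [NormedAddCommGroup G] [NormedSpace ℝ G]
    (f : ℝ → G) {δ : ℝ} (hδ : 0 < δ) :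
    ∫ t, poissonKernel δ t • f t = ∫ v, (Real.pi⁻¹ * (1 + v ^ 2)⁻¹) • f (δ * v) := by
  have h := Measure.integral_comp_mul_left (fun t => poissonKernel δ t • f t) δ
  rw [abs_of_pos (inv_pos.2 hδ)] at h
  rw [eq_comm, inv_smul_eq_iff₀ hδ.ne'] at h
  rw [h, ← integral_smul]
  congr 1; funext v
  rw [smul_smul, poissonKernel, inv_mul_cancel_left₀ hδ.ne', mul_inv_cancel_left₀ hδ.ne']

theorem integrable_poissonKernel {δ : ℝ} (hδ : 0 < δ) : Integrable (poissonKernel δ) := by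
  have := (integrable_inv_one_add_sq.const_mul Real.pi⁻¹).comp_mul_left' (inv_ne_zero hδ.ne')
  exact this.const_mul δ⁻¹

theorem integral_poissonKernel {δ : ℝ} (hδ : 0 < δ) : ∫ t, poissonKernel δ t = 1 := by
  have h := integral_poissonKernel_smul (fun _ => (1 : ℝ)) hδ
  simp only [smul_eq_mul, mul_one] at h
  rw [h, integral_const_mul, integral_univ_inv_one_add_sq, inv_mul_cancel₀ Real.pi_pos.ne']

theorem norm_integral_poissonKernel_le {G : Type*} [NormedAddCommGroup G] [NormedSpace ℝ G]
    {f : ℝ → G} {M : ℝ} (hM : ∀ t, ‖f t‖ ≤ M) {δ : ℝ} (hδ : 0 < δ) :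
    ‖∫ t, poissonKernel δ t • f t‖ ≤ M := by
  calc _ ≤ ∫ t, poissonKernel δ t * M :=
        norm_integral_le_of_norm_le ((integrable_poissonKernel hδ).mul_const M)
          (Eventually.of_forall fun t => by
            rw [norm_smul, Real.norm_eq_abs, abs_of_nonneg (poissonKernel_nonneg hδ t)]
            exact mul_le_mul_of_nonneg_left (hM t) (poissonKernel_nonneg hδ t))
    _ = M := by rw [integral_mul_const, integral_poissonKernel hδ, one_mul]

/-- Continuity is required at `0` only: the latitude profiles of the truncated kernels may jump
elsewhere. -/
theorem tendsto_integral_poissonKernel {G : Type*} [NormedAddCommGroup G] [NormedSpace ℝ G]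
    [CompleteSpace G] {f : ℝ → G} (hf : StronglyMeasurable f) {M : ℝ} (hM : ∀ t, ‖f t‖ ≤ M)
    (hc : ContinuousAt f 0) :
    Tendsto (fun δ => ∫ t, poissonKernel δ t • f t) (𝓝[>] 0) (𝓝 (f 0)) := by
  have h1 : ∫ v : ℝ, (Real.pi⁻¹ * (1 + v ^ 2)⁻¹) • f 0 = f 0 := by
    rw [integral_smul_const, integral_const_mul, integral_univ_inv_one_add_sq,
      inv_mul_cancel₀ Real.pi_pos.ne', one_smul]
  have h2 : Tendsto (fun δ : ℝ => ∫ v : ℝ, (Real.pi⁻¹ * (1 + v ^ 2)⁻¹) • f (δ * v)) (𝓝[>] 0)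
      (𝓝 (∫ v : ℝ, (Real.pi⁻¹ * (1 + v ^ 2)⁻¹) • f 0)) := by
    refine tendsto_integral_filter_of_dominated_convergence
      (fun v : ℝ => (Real.pi⁻¹ * (1 + v ^ 2)⁻¹) * M) ?_ ?_
      ((integrable_inv_one_add_sq.const_mul _).mul_const M) ?_
    · refine Eventually.of_forall fun δ => StronglyMeasurable.aestronglyMeasurable ?_
      have h3 : StronglyMeasurable fun v => f (δ * v) := hf.comp_measurable (by fun_prop)
      exact Measurable.stronglyMeasurable (by fun_prop) |>.smul h3
    · refine Eventually.of_forall fun δ => Eventually.of_forall fun v => ?_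
      have := Real.pi_pos
      rw [norm_smul, Real.norm_eq_abs, abs_of_nonneg (by positivity)]
      gcongr
      exact hM _
    · refine Eventually.of_forall fun v => Tendsto.const_smul ?_ _
      have h3 : Tendsto (fun δ : ℝ => δ * v) (𝓝[>] 0) (𝓝 0) := by
        have : Continuous fun δ : ℝ => δ * v := by fun_prop
        have := (this.tendsto 0).mono_left (nhdsWithin_le_nhds (s := Set.Ioi (0 : ℝ)))
        rwa [zero_mul] at this
      exact hc.tendsto.comp h3
  rw [h1] at h2
  refine h2.congr' ?_
  filter_upwards [self_mem_nhdsWithin] with δ hδ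
  rw [integral_poissonKernel_smul f hδ]

/-! ### Sphere integrals concentrating on a great circle -/

section LatitudeMeans

variable {e₁ e₂ ω : Space} {W : Space → Space} {B : ℝ}

/-- The integral of a field over a circle of latitude, extended by zero. -/
def circleOfLatitude (e₁ e₂ ω : Space) (W : Space → Space) : ℝ → Space :=
  (Set.Ioo (-1 : ℝ) 1).indicator fun u =>
    ∫ φ in Set.Ioo (-Real.pi) Real.pi, W (heightPoint e₁ e₂ ω (φ, u))

theorem stronglyMeasurable_circleOfLatitude (hW : StronglyMeasurable W) :
    StronglyMeasurable (circleOfLatitude e₁ e₂ ω W) := by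
  refine StronglyMeasurable.indicator ?_ measurableSet_Ioo
  refine StronglyMeasurable.integral_prod_right'
    (f := fun q : ℝ × ℝ => W (heightPoint e₁ e₂ ω (q.2, q.1))) ?_
  exact hW.comp_measurable ((continuous_heightPoint e₁ e₂ ω).comp (by fun_prop)).measurable

theorem norm_circleOfLatitude_le (hB : ∀ κ, ‖W κ‖ ≤ B) (u : ℝ) :
    ‖circleOfLatitude e₁ e₂ ω W u‖ ≤ 2 * Real.pi * B := by
  refine (norm_indicator_le_norm_self _ _).trans ?_
  calc _ ≤ ∫ φ in Set.Ioo (-Real.pi) Real.pi, B :=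
        norm_integral_le_of_norm_le (integrable_const _) (Eventually.of_forall fun φ => hB _)
    _ = 2 * Real.pi * B := by
        rw [setIntegral_const, Real.volume_real_Ioo_of_le (by linarith [Real.pi_pos]), smul_eq_mul]
        ring

/-- Dominated convergence in the longitude: `W` may be discontinuous, provided almost every point of
the equator is a point of continuity. -/
theorem continuousAt_circleOfLatitude (hW : StronglyMeasurable W) (hB : ∀ κ, ‖W κ‖ ≤ B)
    (hc : ∀ᵐ φ ∂(volume.restrict (Set.Ioo (-Real.pi) Real.pi)),
      ContinuousAt W (circlePoint e₁ e₂ φ)) :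
    ContinuousAt (circleOfLatitude e₁ e₂ ω W) 0 := by
  have h : ContinuousAt (fun u => ∫ φ in Set.Ioo (-Real.pi) Real.pi,
      W (heightPoint e₁ e₂ ω (φ, u))) 0 := by
    refine continuousAt_of_dominated (bound := fun _ => B) ?_ ?_ (integrable_const _) ?_
    · refine Eventually.of_forall fun u => StronglyMeasurable.aestronglyMeasurable ?_
      exact hW.comp_measurable ((continuous_heightPoint e₁ e₂ ω).comp (by fun_prop)).measurable
    · exact Eventually.of_forall fun u => Eventually.of_forall fun φ => hB _
    · filter_upwards [hc] with φ hφ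
      have h1 : Continuous fun u : ℝ => heightPoint e₁ e₂ ω (φ, u) :=
        (continuous_heightPoint e₁ e₂ ω).comp (by fun_prop)
      rw [← heightPoint_zero e₁ e₂ ω φ] at hφ
      exact ContinuousAt.comp (f := fun u : ℝ => heightPoint e₁ e₂ ω (φ, u)) hφ h1.continuousAt
  refine h.congr ?_
  filter_upwards [Ioo_mem_nhds (show (-1 : ℝ) < 0 by norm_num) one_pos] with u hu
  rw [circleOfLatitude, Set.indicator_of_mem hu]

theorem IsFrame.integral_sphere_circleOfLatitude (h : IsFrame e₁ e₂ ω)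
    (hW : StronglyMeasurable W) (hB : ∀ κ, ‖W κ‖ ≤ B) {w : ℝ → ℝ} (hw : Measurable w) {b : ℝ}
    (hb : ∀ t, |w t| ≤ b) :
    ∫ κ : Metric.sphere (0 : Space) 1, w (inner ℝ (κ : Space) ω) • W κ
        ∂(volume : Measure Space).toSphere =
      ∫ u, w u • circleOfLatitude e₁ e₂ ω W u := by
  have hm : StronglyMeasurable fun κ : Space => w (inner ℝ κ ω) • W κ :=
    (hw.comp (by fun_prop : Measurable fun κ : Space => inner ℝ κ ω)).stronglyMeasurable.smul hW
  have hI : Integrable (fun p => w p.2 • W (heightPoint e₁ e₂ ω p))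
      ((volume.restrict (Set.Ioo (-Real.pi) Real.pi)).prod (volume.restrict (Set.Ioo (-1 : ℝ) 1))) := by
    refine Integrable.mono' (g := fun _ => b * B) (integrable_const _) ?_ ?_
    · exact ((hw.comp measurable_snd).stronglyMeasurable.smul
        (hW.comp_measurable (continuous_heightPoint e₁ e₂ ω).measurable)).aestronglyMeasurable
    · refine Eventually.of_forall fun p => ?_
      rw [norm_smul]
      exact mul_le_mul (hb _) (hB _) (norm_nonneg _) ((abs_nonneg _).trans (hb 0))
  rw [h.integral_sphere_height hm]
  simp_rw [h.inner_heightPoint]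
  rw [integral_prod_symm _ hI, ← integral_indicator measurableSet_Ioo]
  congr 1; funext u
  by_cases hu : u ∈ Set.Ioo (-1 : ℝ) 1
  · rw [Set.indicator_of_mem hu, circleOfLatitude, Set.indicator_of_mem hu]
    exact integral_smul (w u) fun φ => W (heightPoint e₁ e₂ ω (φ, u))
  · rw [Set.indicator_of_notMem hu, circleOfLatitude, Set.indicator_of_notMem hu, smul_zero]

theorem IsFrame.integral_sphere_poissonKernel (h : IsFrame e₁ e₂ ω)
    (hW : StronglyMeasurable W) (hB : ∀ κ, ‖W κ‖ ≤ B) {r δ : ℝ} (hr : 0 < r) (hδ : 0 < δ) :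
    ∫ κ : Metric.sphere (0 : Space) 1, poissonKernel δ (r * inner ℝ (κ : Space) ω) • W κ
        ∂(volume : Measure Space).toSphere =
      r⁻¹ • ∫ u, poissonKernel (δ * r⁻¹) u • circleOfLatitude e₁ e₂ ω W u := by
  have hδr : 0 < δ * r⁻¹ := by positivity
  rw [← h.integral_sphere_circleOfLatitude hW hB (continuous_poissonKernel _).measurable
    (abs_poissonKernel_le hδr), ← integral_smul]
  simp only [poissonKernel_mul hr, mul_smul]

/-- The rule `δ(ru) = δ(u)/r`: since the area of the sphere is uniform in the height, the
approximate delta function picks out the mean over the equator. -/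
theorem IsFrame.tendsto_integral_sphere_poissonKernel (h : IsFrame e₁ e₂ ω)
    (hW : StronglyMeasurable W) (hB : ∀ κ, ‖W κ‖ ≤ B)
    (hc : ∀ᵐ φ ∂(volume.restrict (Set.Ioo (-Real.pi) Real.pi)),
      ContinuousAt W (circlePoint e₁ e₂ φ)) {r : ℝ} (hr : 0 < r) :
    Tendsto (fun δ => ∫ κ : Metric.sphere (0 : Space) 1,
        poissonKernel δ (r * inner ℝ (κ : Space) ω) • W κ ∂(volume : Measure Space).toSphere) (𝓝[>] 0)
      (𝓝 (r⁻¹ • ∫ φ in Set.Ioo (-Real.pi) Real.pi, W (circlePoint e₁ e₂ φ))) := by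
  have h1 := tendsto_integral_poissonKernel (stronglyMeasurable_circleOfLatitude hW)
    (norm_circleOfLatitude_le hB) (continuousAt_circleOfLatitude (ω := ω) hW hB hc)
  have h0 : circleOfLatitude e₁ e₂ ω W 0 =
      ∫ φ in Set.Ioo (-Real.pi) Real.pi, W (circlePoint e₁ e₂ φ) := by
    rw [circleOfLatitude, Set.indicator_of_mem (by simp)]
    simp_rw [heightPoint_zero]
  rw [h0] at h1
  have h2 : Tendsto (fun δ : ℝ => δ * r⁻¹) (𝓝[>] 0) (𝓝[>] 0) := by
    refine tendsto_nhdsWithin_iff.2 ⟨?_, ?_⟩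
    · have : Continuous fun δ : ℝ => δ * r⁻¹ := by fun_prop
      have := (this.tendsto 0).mono_left (nhdsWithin_le_nhds (s := Set.Ioi (0 : ℝ)))
      rwa [zero_mul] at this
    · filter_upwards [self_mem_nhdsWithin] with δ hδ
      exact mul_pos hδ (inv_pos.2 hr)
  refine ((h1.comp h2).const_smul r⁻¹).congr' ?_
  filter_upwards [self_mem_nhdsWithin] with δ hδ
  rw [h.integral_sphere_poissonKernel hW hB hr hδ]
  rfl

theorem IsFrame.norm_integral_sphere_poissonKernel_le (h : IsFrame e₁ e₂ ω)
    (hW : StronglyMeasurable W) (hB : ∀ κ, ‖W κ‖ ≤ B) {r δ : ℝ} (hr : 0 < r) (hδ : 0 < δ) :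
    ‖∫ κ : Metric.sphere (0 : Space) 1, poissonKernel δ (r * inner ℝ (κ : Space) ω) • W κ
        ∂(volume : Measure Space).toSphere‖ ≤ r⁻¹ * (2 * Real.pi * B) := by
  rw [h.integral_sphere_poissonKernel hW hB hr hδ, norm_smul, norm_inv, Real.norm_eq_abs,
    abs_of_pos hr]
  have := norm_integral_poissonKernel_le (norm_circleOfLatitude_le (e₁ := e₁) (e₂ := e₂) (ω := ω) hB)
    (δ := δ * r⁻¹) (by positivity)
  gcongr

end LatitudeMeans

/-- The kernel of the signed transform of the Biot–Savart integral. -/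
def perpKernel (θ z : Space) : Space :=
  (‖z‖⁻¹ * (‖θ - inner ℝ θ (‖z‖⁻¹ • z) • (‖z‖⁻¹ • z)‖ ^ 2)⁻¹) •
    (θ - inner ℝ θ (‖z‖⁻¹ • z) • (‖z‖⁻¹ • z))

/-- Both sides are the sine of the angle between `z` and `θ`. -/
theorem norm_perp_sq {θ : Space} (hθ : ‖θ‖ = 1) {z : Space} (hz : z ≠ 0) :
    ‖θ - inner ℝ θ (‖z‖⁻¹ • z) • (‖z‖⁻¹ • z)‖ = ‖z‖⁻¹ * ‖transverse θ z‖ := by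
  have hz' : ‖z‖ ≠ 0 := norm_ne_zero_iff.2 hz
  refine (sq_eq_sq₀ (norm_nonneg _) (by positivity)).1 ?_
  rw [mul_pow, transverse, norm_sub_sq_real, norm_sub_sq_real]
  simp only [inner_smul_right, norm_smul, hθ, norm_inv, abs_norm, Real.norm_eq_abs, mul_pow,
    sq_abs, real_inner_comm θ z]
  field_simp

/-- The definition is adapted to the great circle `z^⊥`; this form, resolved along `θ` and across
it, is the one produced by line integrals. The two are linked by `|z|² = (z·θ)² + |w|²`, with `w`
the transverse component. -/
theorem perpKernel_eq {θ : Space} (hθ : ‖θ‖ = 1) {z : Space} (hz : transverse θ z ≠ 0) :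
    perpKernel θ z = ‖z‖⁻¹ • (θ - (inner ℝ z θ * (‖transverse θ z‖ ^ 2)⁻¹) • transverse θ z) := by
  have hz0 : z ≠ 0 := by rintro rfl; exact hz (by simp [transverse])
  have hz' : ‖z‖ ≠ 0 := norm_ne_zero_iff.2 hz0
  have hd : ‖transverse θ z‖ ≠ 0 := norm_ne_zero_iff.2 hz
  have hsq : ‖z‖ ^ 2 = inner ℝ z θ ^ 2 + ‖transverse θ z‖ ^ 2 := by
    rw [transverse, norm_sub_sq_real]
    simp only [inner_smul_right, norm_smul, hθ, Real.norm_eq_abs, mul_pow, sq_abs]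
    ring
  rw [perpKernel, norm_perp_sq hθ hz0, mul_smul]
  congr 1
  have hzw : z = transverse θ z + inner ℝ z θ • θ := by rw [transverse, sub_add_cancel]
  rw [inner_smul_right, smul_smul, real_inner_comm z θ]
  set a := inner ℝ z θ
  set w := transverse θ z
  set d := ‖w‖
  rw [smul_sub, smul_smul]
  have e1 : ((‖z‖⁻¹ * d) ^ 2)⁻¹ = ‖z‖ ^ 2 * (d ^ 2)⁻¹ := by field_simp
  have e2 : ((‖z‖⁻¹ * d) ^ 2)⁻¹ * (‖z‖⁻¹ * a * ‖z‖⁻¹) = a * (d ^ 2)⁻¹ := by field_simp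
  rw [e2, e1, hsq]
  have e3 : (a ^ 2 + d ^ 2) * (d ^ 2)⁻¹ = a * (d ^ 2)⁻¹ * a + 1 := by field_simp
  rw [e3, hzw]
  module

theorem norm_perpKernel {θ : Space} (hθ : ‖θ‖ = 1) (z : Space) :
    ‖perpKernel θ z‖ ≤ ‖transverse θ z‖⁻¹ := by
  rcases eq_or_ne z 0 with rfl | hz
  · simp [perpKernel]
  · have hz' : ‖z‖ ≠ 0 := norm_ne_zero_iff.2 hz
    rw [perpKernel, norm_smul, norm_perp_sq hθ hz, Real.norm_eq_abs, abs_of_nonneg (by positivity)]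
    rcases eq_or_ne ‖transverse θ z‖ 0 with h | h
    · rw [h]; simp
    · refine le_of_eq ?_
      field_simp

theorem measurable_perpKernel (θ : Space) : Measurable (perpKernel θ) := by
  unfold perpKernel; fun_prop

/-- The kernel `κ / (κ · θ)`, cut off near the great circle, and at infinity. -/
def pvKernel (θ : Space) (ε : ℝ) (κ : Space) : Space :=
  ({t : ℝ | ε < |t|}.indicator (fun t => t⁻¹) (inner ℝ κ θ) * (2 * (1 + ‖κ‖ ^ 2)⁻¹)) • κ

theorem measurableSet_lt_abs (ε : ℝ) : MeasurableSet {t : ℝ | ε < |t|} :=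
  measurableSet_lt measurable_const measurable_id.abs

theorem abs_indicator_inv_le {ε : ℝ} (hε : 0 < ε) (t : ℝ) :
    |{t : ℝ | ε < |t|}.indicator (fun t => t⁻¹) t| ≤ ε⁻¹ := by
  by_cases ht : t ∈ {t : ℝ | ε < |t|}
  · rw [Set.indicator_of_mem ht, abs_inv]
    exact inv_anti₀ hε (le_of_lt ht)
  · rw [Set.indicator_of_notMem ht, abs_zero]
    positivity

/-- The factor `2 * (1 + ‖κ‖ ^ 2)⁻¹` is `1` on the sphere; it serves only to keep the kernel bounded
on the whole space, as the lemmas on sphere integrals ask. -/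
theorem pvKernel_of_norm (θ : Space) (ε : ℝ) {κ : Space} (hκ : ‖κ‖ = 1) :
    pvKernel θ ε κ = {t : ℝ | ε < |t|}.indicator (fun t => t⁻¹) (inner ℝ κ θ) • κ := by
  rw [pvKernel, hκ]; norm_num

theorem norm_pvKernel_le (θ : Space) {ε : ℝ} (hε : 0 < ε) (κ : Space) :
    ‖pvKernel θ ε κ‖ ≤ ε⁻¹ := by
  have h1 : 2 * (1 + ‖κ‖ ^ 2)⁻¹ * ‖κ‖ ≤ 1 := by
    rw [mul_assoc, mul_comm, mul_assoc, inv_mul_le_iff₀ (by positivity)]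
    nlinarith [sq_nonneg (1 - ‖κ‖)]
  rw [pvKernel, norm_smul, norm_mul, mul_assoc, Real.norm_eq_abs (2 * _),
    abs_of_nonneg (by positivity)]
  calc _ ≤ ε⁻¹ * 1 := mul_le_mul (abs_indicator_inv_le hε _) h1 (by positivity) (by positivity)
    _ = ε⁻¹ := mul_one _

theorem stronglyMeasurable_pvKernel (θ : Space) (ε : ℝ) : StronglyMeasurable (pvKernel θ ε) := by
  have h : Measurable ({t : ℝ | ε < |t|}.indicator fun t : ℝ => t⁻¹) :=
    measurable_inv.indicator (measurableSet_lt_abs ε)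
  have h1 : Measurable fun κ : Space =>
    {t : ℝ | ε < |t|}.indicator (fun t => t⁻¹) (inner ℝ κ θ) := h.comp (by fun_prop)
  unfold pvKernel
  exact Measurable.stronglyMeasurable (by fun_prop)

theorem continuousAt_pvKernel (θ : Space) {ε : ℝ} (hε : 0 < ε) {κ : Space}
    (hκ : |inner ℝ κ θ| ≠ ε) : ContinuousAt (pvKernel θ ε) κ := by
  have h : ContinuousAt ({t : ℝ | ε < |t|}.indicator fun t : ℝ => t⁻¹) (inner ℝ κ θ) := by
    rcases lt_or_gt_of_ne hκ with h | h
    · refine (continuousAt_const (y := (0 : ℝ))).congr ?_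
      filter_upwards [(isOpen_lt continuous_abs continuous_const).mem_nhds h] with t ht
      have ht : |t| < ε := ht
      rw [Set.indicator_of_notMem (show t ∉ {t : ℝ | ε < |t|} from fun h' => lt_asymm h' ht)]
    · refine (continuousAt_inv₀ (abs_pos.1 (hε.trans h))).congr ?_
      filter_upwards [(isOpen_lt continuous_const continuous_abs).mem_nhds h] with t ht
      rw [Set.indicator_of_mem (show t ∈ {t : ℝ | ε < |t|} from ht)]
  have h1 : ContinuousAt (fun κ : Space =>
      {t : ℝ | ε < |t|}.indicator (fun t => t⁻¹) (inner ℝ κ θ)) κ :=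
    ContinuousAt.comp (f := fun κ : Space => inner ℝ κ θ) h (by fun_prop)
  have h2 : Continuous fun κ : Space => 2 * (1 + ‖κ‖ ^ 2)⁻¹ :=
    continuous_const.mul (Continuous.inv₀ (by fun_prop) fun κ => by positivity)
  exact (h1.mul h2.continuousAt).smul continuousAt_id

theorem pvSphereTrunc_cross (f : Space → Vec) (θ : Space) (ε : ℝ) :
    pvSphereTrunc (fun κ => cross κ (f κ)) θ ε =
      ∫ κ : Metric.sphere (0 : Space) 1, cross (pvKernel θ ε κ) (f κ)
        ∂(volume : Measure Space).toSphere := by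
  have hm : MeasurableSet {κ : Metric.sphere (0 : Space) 1 | ε < |inner ℝ (κ : Space) θ|} :=
    measurableSet_lt measurable_const (by fun_prop)
  rw [pvSphereTrunc, ← integral_indicator hm]
  congr 1; funext κ
  rw [pvKernel_of_norm θ ε (by simp), cross_smul_left]
  by_cases h : ε < |inner ℝ (κ : Space) θ|
  · rw [Set.indicator_of_mem (show κ ∈ {κ : Metric.sphere (0 : Space) 1 |
      ε < |inner ℝ (κ : Space) θ|} from h), Set.indicator_of_mem (show inner ℝ (κ : Space) θ ∈
      {t : ℝ | ε < |t|} from h)]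
  · rw [Set.indicator_of_notMem (show κ ∉ {κ : Metric.sphere (0 : Space) 1 |
      ε < |inner ℝ (κ : Space) θ|} from h), Set.indicator_of_notMem (show inner ℝ (κ : Space) θ ∉
      {t : ℝ | ε < |t|} from h), zero_smul]

theorem integrable_inv_norm_mul {j : ℕ} (hj : j ≤ 2) (x : Space) :
    Integrable fun z : Space => (‖z‖ ^ j)⁻¹ * ((1 + ‖x - z‖) ^ 6)⁻¹ := by
  have h0 : Integrable fun z : Space => ((1 + ‖x - z‖) ^ 4)⁻¹ := by
    have h := (integrable_inv_norm_pow (j := 0) (by norm_num)).comp_sub_left x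
    simpa using h
  have h1 : Integrable fun z : Space =>
      ((1 + ‖x - z‖) ^ 4)⁻¹ + 16 * ((‖z‖ ^ j)⁻¹ * ((1 + ‖z‖) ^ 4)⁻¹) :=
    h0.add ((integrable_inv_norm_pow hj).const_mul 16)
  refine h1.mono' (Measurable.aestronglyMeasurable (by fun_prop)) (Eventually.of_forall fun z => ?_)
  rw [Real.norm_eq_abs, abs_of_nonneg (by positivity)]
  have e1 : ((1 + ‖x - z‖) ^ 6)⁻¹ ≤ ((1 + ‖x - z‖) ^ 4)⁻¹ :=
    inv_anti₀ (by positivity)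
      (pow_le_pow_right₀ (by linarith [norm_nonneg (x - z)]) (by norm_num))
  have e2 : ((1 + ‖x - z‖) ^ 6)⁻¹ ≤ 1 :=
    inv_le_one_of_one_le₀ (one_le_pow₀ (by linarith [norm_nonneg (x - z)]))
  set K := (‖z‖ ^ j)⁻¹ * ((1 + ‖z‖) ^ 4)⁻¹
  have hK : 0 ≤ K := by positivity
  calc _ ≤ (1 + 16 * K) * ((1 + ‖x - z‖) ^ 6)⁻¹ := by
        gcongr; exact inv_le_one_add_inv_mul (norm_nonneg z) j
    _ = ((1 + ‖x - z‖) ^ 6)⁻¹ + 16 * (K * ((1 + ‖x - z‖) ^ 6)⁻¹) := by ring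
    _ ≤ _ := by
        gcongr
        exact mul_le_of_le_one_right hK e2

/-! ### The principal value of the Radon transform as a volume integral -/

section PvSide

variable {F : Space → Vec} {C : ℝ} {θ : Space}

theorem Decaying.integral_poissonKernel_eq (hF : Decaying F C) {κ : Space} (hκ : ‖κ‖ = 1)
    (x : Space) {δ : ℝ} (hδ : 0 < δ) :
    ∫ z, poissonKernel δ (inner ℝ κ z) • F (x - z) =
      ∫ t, poissonKernel δ t • radon F (inner ℝ κ x - t) κ :=
  hF.integral_smul_eq_integral_radon hκ x (continuous_poissonKernel δ).measurable
    (abs_poissonKernel_le hδ)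

theorem Decaying.norm_radon_le_const (hF : Decaying F C) {κ : Space} (hκ : ‖κ‖ = 1) (p : ℝ) :
    ‖radon F p κ‖ ≤ C * Real.pi ^ 2 := by
  refine (hF.norm_radon_le hκ p).trans (mul_le_of_le_one_right ?_ ?_)
  · have := hF.nonneg; positivity
  · exact inv_le_one_of_one_le₀ (by nlinarith [sq_nonneg p])

theorem Decaying.tendsto_integral_poissonKernel (hF : Decaying F C) {κ : Space} (hκ : ‖κ‖ = 1)
    (x : Space) : Tendsto (fun δ => ∫ z, poissonKernel δ (inner ℝ κ z) • F (x - z)) (𝓝[>] 0)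
      (𝓝 (radon F (inner ℝ κ x) κ)) := by
  have hc := hF.continuous_radon hκ
  have hc' : Continuous fun t => radon F (inner ℝ κ x - t) κ := by fun_prop
  have h := BiotSavartXray.tendsto_integral_poissonKernel hc'.stronglyMeasurable
    (fun t => hF.norm_radon_le_const hκ _) hc'.continuousAt
  rw [sub_zero] at h
  refine h.congr' ?_
  filter_upwards [self_mem_nhdsWithin] with δ hδ
  rw [hF.integral_poissonKernel_eq hκ x hδ]

theorem Decaying.norm_integral_poissonKernel_le (hF : Decaying F C) {κ : Space} (hκ : ‖κ‖ = 1)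
    (x : Space) {δ : ℝ} (hδ : 0 < δ) :
    ‖∫ z, poissonKernel δ (inner ℝ κ z) • F (x - z)‖ ≤ C * Real.pi ^ 2 := by
  rw [hF.integral_poissonKernel_eq hκ x hδ]
  exact BiotSavartXray.norm_integral_poissonKernel_le (fun t => hF.norm_radon_le_const hκ _) hδ

theorem Decaying.stronglyMeasurable_radon (hF : Decaying F C) (x : Space) :
    ∃ g : Space → Vec, StronglyMeasurable g ∧
      ∀ κ : Space, ‖κ‖ = 1 → radon F (inner ℝ κ x) κ = g κ := by
  have hseq : Tendsto (fun n : ℕ => ((n : ℝ) + 1)⁻¹) atTop (𝓝[>] 0) :=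
    tendsto_inv_atTop_nhdsGT_zero.comp
      (tendsto_atTop_add_const_right _ _ tendsto_natCast_atTop_atTop)
  exact exists_stronglyMeasurable_of_tendsto
    (fun n => stronglyMeasurable_integral_inner hF.continuous x
      (continuous_poissonKernel ((n : ℝ) + 1)⁻¹).measurable)
    (fun κ hκ => (hF.tendsto_integral_poissonKernel hκ x).comp hseq)

/-- Interchange of the integral over the sphere with the integrals over the planes through `x`. -/
theorem Decaying.integral_sphere_cross_radon (hF : Decaying F C) (x : Space)
    {W L : Space → Space} {B : ℝ} (hW : StronglyMeasurable W) (hB : ∀ κ, ‖W κ‖ ≤ B)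
    (hL : ∀ᵐ z, Tendsto (fun δ => ∫ κ : Metric.sphere (0 : Space) 1,
      poissonKernel δ (inner ℝ (κ : Space) z) • W κ ∂(volume : Measure Space).toSphere)
        (𝓝[>] 0) (𝓝 (L z)))
    (hb : ∀ᵐ z : Space, ∀ δ > 0, ‖∫ κ : Metric.sphere (0 : Space) 1,
      poissonKernel δ (inner ℝ (κ : Space) z) • W κ ∂(volume : Measure Space).toSphere‖ ≤
        ‖z‖⁻¹ * (2 * Real.pi * B)) :
    ∫ κ : Metric.sphere (0 : Space) 1, cross (W κ) (radon F (inner ℝ (κ : Space) x) κ)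
      ∂(volume : Measure Space).toSphere = ∫ z, cross (L z) (F (x - z)) := by
  have hC := hF.nonneg
  have hB0 : 0 ≤ B := (norm_nonneg _).trans (hB 0)
  have hFc := hF.continuous
  have hFi : Integrable fun z => F (x - z) := hF.integrable.comp_sub_left x
  have hWs : StronglyMeasurable fun κ : Metric.sphere (0 : Space) 1 => W κ :=
    hW.comp_measurable measurable_subtype_coe
  -- The delta function of `κ·z` is replaced by a Poisson kernel of width `δ`. The sphere integral
  -- and the volume integral agree for `δ > 0` by Fubini, and each has its own dominated limit: `h1`
  -- and `h2`.
  have h1 : Tendsto (fun δ => ∫ κ : Metric.sphere (0 : Space) 1,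
      cross (W κ) (∫ z, poissonKernel δ (inner ℝ (κ : Space) z) • F (x - z))
        ∂(volume : Measure Space).toSphere) (𝓝[>] 0)
      (𝓝 (∫ κ : Metric.sphere (0 : Space) 1, cross (W κ) (radon F (inner ℝ (κ : Space) x) κ)
        ∂(volume : Measure Space).toSphere)) := by
    refine tendsto_integral_filter_of_dominated_convergence
      (fun _ => 2 * B * (C * Real.pi ^ 2)) ?_ ?_ (integrable_const _) ?_
    · refine Eventually.of_forall fun δ => StronglyMeasurable.aestronglyMeasurable ?_
      have h2 : StronglyMeasurable fun κ : Metric.sphere (0 : Space) 1 =>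
          ∫ z, poissonKernel δ (inner ℝ (κ : Space) z) • F (x - z) :=
        (stronglyMeasurable_integral_inner hFc x
          (continuous_poissonKernel δ).measurable).comp_measurable measurable_subtype_coe
      exact stronglyMeasurable_cross hWs.measurable h2
    · filter_upwards [self_mem_nhdsWithin] with δ hδ
      refine Eventually.of_forall fun κ => (norm_cross_le _ _).trans ?_
      have := hB κ
      have := hF.norm_integral_poissonKernel_le (κ := κ) (by simp) x hδ
      gcongr
    · exact Eventually.of_forall fun κ => ((crossL (W κ)).continuous.tendsto _).comp
        (hF.tendsto_integral_poissonKernel (κ := κ) (by simp) x)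
  have h2 : Tendsto (fun δ => ∫ z, cross (∫ κ : Metric.sphere (0 : Space) 1,
      poissonKernel δ (inner ℝ (κ : Space) z) • W κ ∂(volume : Measure Space).toSphere)
        (F (x - z))) (𝓝[>] 0) (𝓝 (∫ z, cross (L z) (F (x - z)))) := by
    refine tendsto_integral_filter_of_dominated_convergence
      (fun z => 2 * (2 * Real.pi * B) * C * ((‖z‖ ^ 1)⁻¹ * ((1 + ‖x - z‖) ^ 6)⁻¹)) ?_ ?_
      ((integrable_inv_norm_mul (j := 1) (by norm_num) x).const_mul _) ?_
    · refine Eventually.of_forall fun δ => StronglyMeasurable.aestronglyMeasurable ?_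
      have h3 : StronglyMeasurable fun z : Space => ∫ κ : Metric.sphere (0 : Space) 1,
          poissonKernel δ (inner ℝ (κ : Space) z) • W κ ∂(volume : Measure Space).toSphere := by
        refine StronglyMeasurable.integral_prod_right'
          (f := fun q : Space × Metric.sphere (0 : Space) 1 =>
            poissonKernel δ (inner ℝ (q.2 : Space) q.1) • W q.2) ?_
        exact ((continuous_poissonKernel δ).comp (by fun_prop)).stronglyMeasurable.smul
          (hWs.comp_measurable measurable_snd)
      exact stronglyMeasurable_cross h3.measurable (Continuous.stronglyMeasurable (by fun_prop))
    · filter_upwards [self_mem_nhdsWithin] with δ hδ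
      filter_upwards [hb] with z hz
      calc _ ≤ 2 * (‖z‖⁻¹ * (2 * Real.pi * B)) * (C * ((1 + ‖x - z‖) ^ 6)⁻¹) := by
            refine (norm_cross_le _ _).trans ?_
            have := hz δ hδ
            have := hF.norm_le (x - z)
            gcongr
        _ = _ := by ring
    · filter_upwards [hL] with z hz
      exact (((crossL.flip (F (x - z))).continuous.tendsto _).comp hz)
  refine tendsto_nhds_unique h1 (h2.congr' ?_)
  filter_upwards [self_mem_nhdsWithin] with δ hδ
  have hI : Integrable (fun q : Metric.sphere (0 : Space) 1 × Space =>
      poissonKernel δ (inner ℝ (q.1 : Space) q.2) • cross (W q.1) (F (x - q.2)))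
      ((volume : Measure Space).toSphere.prod volume) := by
    have hg : Integrable (fun q : Metric.sphere (0 : Space) 1 × Space =>
        (δ⁻¹ * Real.pi⁻¹ * (2 * B)) * ‖F (x - q.2)‖) ((volume : Measure Space).toSphere.prod volume) :=
      (integrable_const (δ⁻¹ * Real.pi⁻¹ * (2 * B))).mul_prod hFi.norm
    refine hg.mono' (StronglyMeasurable.aestronglyMeasurable ?_) (Eventually.of_forall fun q => ?_)
    · refine ((continuous_poissonKernel δ).comp (by fun_prop)).stronglyMeasurable.smul ?_
      exact stronglyMeasurable_cross (hWs.measurable.comp measurable_fst)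
        (Continuous.stronglyMeasurable (by fun_prop))
    · rw [norm_smul]
      have e1 : ‖cross (W q.1) (F (x - q.2))‖ ≤ 2 * B * ‖F (x - q.2)‖ := by
        refine (norm_cross_le _ _).trans ?_
        have := hB q.1
        gcongr
      calc _ ≤ δ⁻¹ * Real.pi⁻¹ * (2 * B * ‖F (x - q.2)‖) :=
            mul_le_mul (abs_poissonKernel_le hδ _) e1 (norm_nonneg _) (by
              have := Real.pi_pos; have : (0 : ℝ) < δ := hδ; positivity)
        _ = _ := by ring
  have e1 : ∀ κ : Metric.sphere (0 : Space) 1,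
      cross (W κ) (∫ z, poissonKernel δ (inner ℝ (κ : Space) z) • F (x - z)) =
        ∫ z, poissonKernel δ (inner ℝ (κ : Space) z) • cross (W κ) (F (x - z)) := by
    intro κ
    rw [← integral_cross _ (integrable_bounded_smul hFi (w := fun z =>
      poissonKernel δ (inner ℝ (κ : Space) z))
      ((continuous_poissonKernel δ).comp (by fun_prop)).measurable
      (fun z => abs_poissonKernel_le hδ _))]
    simp only [cross_smul_right]
  simp_rw [e1]
  rw [integral_integral_swap hI]
  congr 1; funext z
  rw [← integral_cross_left]
  · simp only [cross_smul_left]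
  · refine Integrable.mono' (g := fun _ => δ⁻¹ * Real.pi⁻¹ * B) (integrable_const _)
      (StronglyMeasurable.aestronglyMeasurable ?_) (Eventually.of_forall fun κ => ?_)
    · exact ((continuous_poissonKernel δ).comp (by fun_prop)).stronglyMeasurable.smul hWs
    · rw [norm_smul]
      exact mul_le_mul (abs_poissonKernel_le hδ _) (hB κ) (norm_nonneg _) (by
        have := Real.pi_pos; have : (0 : ℝ) < δ := hδ; positivity)

theorem ae_continuousAt_pvKernel {ε : ℝ} (hε : 0 < ε) {ρ : ℝ} (hρ : 0 < ρ) {n n' : Space}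
    (h : ∀ φ, inner ℝ (circlePoint n n' φ) θ = ρ * Real.cos φ) :
    ∀ᵐ φ ∂(volume.restrict (Set.Ioo (-Real.pi) Real.pi)),
      ContinuousAt (pvKernel θ ε) (circlePoint n n' φ) := by
  filter_upwards [ae_cos_ne (ε / ρ), ae_cos_ne (-(ε / ρ))] with φ h1 h2
  refine continuousAt_pvKernel θ hε ?_
  rw [h]
  intro h3
  rcases eq_or_eq_neg_of_abs_eq h3 with h4 | h4
  · exact h1 ((eq_div_iff hρ.ne').2 (by linarith))
  · exact h2 (by rw [← neg_div]; exact (eq_div_iff hρ.ne').2 (by linarith))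

/-- For fixed `z` the sphere integral concentrates on the great circle `z^⊥`, where the integral of
the truncated `κ/(κ·θ)` is already known. The bound blows up with `ε⁻¹`, which is harmless as `ε` is
fixed while `δ → 0`. -/
theorem tendsto_integral_pvKernel (hθ : ‖θ‖ = 1) {ε : ℝ} (hε : 0 < ε) {z : Space}
    (hz : transverse θ z ≠ 0) :
    Tendsto (fun δ => ∫ κ : Metric.sphere (0 : Space) 1,
      poissonKernel δ (inner ℝ (κ : Space) z) • pvKernel θ ε κ ∂(volume : Measure Space).toSphere)
        (𝓝[>] 0) (𝓝 (circleMass {t : ℝ | ε < |t|} (‖z‖⁻¹ * ‖transverse θ z‖) • perpKernel θ z)) ∧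
    ∀ δ > 0, ‖∫ κ : Metric.sphere (0 : Space) 1,
      poissonKernel δ (inner ℝ (κ : Space) z) • pvKernel θ ε κ ∂(volume : Measure Space).toSphere‖ ≤
        ‖z‖⁻¹ * (2 * Real.pi * ε⁻¹) := by
  have hz0 : z ≠ 0 := by rintro rfl; exact hz (by simp [transverse])
  have hr : 0 < ‖z‖ := norm_pos_iff.2 hz0
  have hω : ‖‖z‖⁻¹ • z‖ = 1 := by
    rw [norm_smul, norm_inv, norm_norm, inv_mul_cancel₀ hr.ne']
  have hP := norm_perp_sq hθ hz0
  have hP0 : θ - inner ℝ θ (‖z‖⁻¹ • z) • (‖z‖⁻¹ • z) ≠ 0 := by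
    rw [← norm_ne_zero_iff, hP]
    exact mul_ne_zero (inv_ne_zero hr.ne') (norm_ne_zero_iff.2 hz)
  obtain ⟨n', h, hin⟩ := exists_isFrame_of_perp hω hP0
  have hin' : ∀ κ : Space, inner ℝ κ z = ‖z‖ * inner ℝ κ (‖z‖⁻¹ • z) := by
    intro κ
    rw [inner_smul_right, mul_inv_cancel_left₀ hr.ne']
  have hae := ae_continuousAt_pvKernel hε (norm_pos_iff.2 hP0) hin
  have hm := stronglyMeasurable_pvKernel θ ε
  have hB := norm_pvKernel_le θ hε
  constructor
  · have h1 := h.tendsto_integral_sphere_poissonKernel hm hB hae hr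
    have h2 := h.integral_circle_inv (measurableSet_lt_abs ε) (by simp [hε.le])
      (abs_indicator_inv_le hε) hP0
    simp_rw [pvKernel_of_norm θ ε (h.norm_circlePoint _)] at h1
    rw [h2, ← hP.symm] at h1
    simp_rw [hin']
    convert h1 using 2
    rw [perpKernel, hP]
    module
  · intro δ hδ
    simp_rw [hin']
    exact h.norm_integral_sphere_poissonKernel_le hm hB hr hδ

/-- The principal-value integral over the sphere of the Radon transform. -/
theorem Decaying.pvSphere_radon (hF : Decaying F C) (hθ : ‖θ‖ = 1) (x : Space) :
    PvSphereExists (fun κ => cross κ (radon F (inner ℝ κ x) κ)) θ ∧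
    pvSphere (fun κ => cross κ (radon F (inner ℝ κ x) κ)) θ =
      (2 * Real.pi) • ∫ z, cross (perpKernel θ z) (F (x - z)) := by
  have hlim : Tendsto (pvSphereTrunc (fun κ => cross κ (radon F (inner ℝ κ x) κ)) θ) (𝓝[>] 0)
      (𝓝 ((2 * Real.pi) • ∫ z, cross (perpKernel θ z) (F (x - z)))) := by
    refine (hF.tendsto_integral_circleMass hθ x measurableSet_lt_abs (fun t ht => ?_)
      (ρ := fun z => ‖z‖⁻¹ * ‖transverse θ z‖) (fun z hz => ?_) (measurable_perpKernel θ)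
      (norm_perpKernel hθ)
      (by have := (continuous_transverse θ).measurable; fun_prop)).congr' ?_
    · filter_upwards [mem_nhdsWithin_of_mem_nhds (Iio_mem_nhds (abs_pos.2 ht))] with ε hε
      exact hε
    · have hz0 : z ≠ 0 := by rintro rfl; exact hz (by simp [transverse])
      exact mul_pos (inv_pos.2 (norm_pos_iff.2 hz0)) (norm_pos_iff.2 hz)
    -- At each truncation the sphere integral is converted to a volume integral; the limit in `ε` is
    -- then that of the circle mass.
    · filter_upwards [self_mem_nhdsWithin] with ε hε
      rw [pvSphereTrunc_cross, hF.integral_sphere_cross_radon x (stronglyMeasurable_pvKernel θ ε)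
        (norm_pvKernel_le θ hε)]
      · filter_upwards [ae_transverse_ne_zero θ] with z hz
        exact (tendsto_integral_pvKernel hθ hε hz).1
      · filter_upwards [ae_transverse_ne_zero θ] with z hz
        exact (tendsto_integral_pvKernel hθ hε hz).2
  refine ⟨⟨fun ε hε => ?_, _, hlim⟩, hlim.limUnder_eq⟩
  obtain ⟨g, hg, hgeq⟩ := hF.stronglyMeasurable_radon x
  have hgb : ∀ κ : Metric.sphere (0 : Space) 1, ‖g κ‖ ≤ C * Real.pi ^ 2 := fun κ => by
    rw [← hgeq κ (by simp)]
    exact hF.norm_radon_le_const (by simp) _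
  have hC := hF.nonneg
  have hI : IntegrableOn (fun κ : Metric.sphere (0 : Space) 1 =>
      (inner ℝ (κ : Space) θ)⁻¹ • cross κ (g κ)) {κ | ε < |inner ℝ (κ : Space) θ|}
      (volume : Measure Space).toSphere := by
    have hm : MeasurableSet {κ : Metric.sphere (0 : Space) 1 | ε < |inner ℝ (κ : Space) θ|} :=
      measurableSet_lt measurable_const (by fun_prop)
    refine Integrable.mono' (g := fun _ => ε⁻¹ * (2 * 1 * (C * Real.pi ^ 2))) (integrable_const _)
      (StronglyMeasurable.aestronglyMeasurable ?_) ?_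
    · have h1 : StronglyMeasurable fun κ : Metric.sphere (0 : Space) 1 => g κ :=
        hg.comp_measurable measurable_subtype_coe
      have h2 : Measurable fun κ : Metric.sphere (0 : Space) 1 => (inner ℝ (κ : Space) θ)⁻¹ := by
        fun_prop
      exact h2.stronglyMeasurable.smul (stronglyMeasurable_cross measurable_subtype_coe h1)
    · filter_upwards [ae_restrict_mem hm] with κ hκ
      rw [norm_smul, norm_inv]
      have e1 : ‖cross (κ : Space) (g κ)‖ ≤ 2 * 1 * (C * Real.pi ^ 2) := by
        refine (norm_cross_le _ _).trans ?_
        rw [show ‖(κ : Space)‖ = 1 by simp]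
        have := hgb κ
        gcongr
      exact mul_le_mul (inv_anti₀ hε (le_of_lt hκ)) e1 (norm_nonneg _) (by positivity)
  refine hI.congr_fun_ae (Eventually.of_forall fun κ => ?_)
  simp only [hgeq κ (by simp)]

end PvSide

/-! ### Convolutions with weakly singular kernels -/

section KernelIntegrals

variable {G : Type*} [NormedAddCommGroup G] [NormedSpace ℝ G] {f : Space → G} {C M : ℝ}
  {w : Space → ℝ} {j : ℕ}

theorem norm_kernel_smul_le (hC : ∀ y, ‖f y‖ ≤ C * ((1 + ‖y‖) ^ 6)⁻¹)
    (hb : ∀ z, |w z| ≤ M * (‖z‖ ^ j)⁻¹) (x z : Space) :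
    ‖w z • f (x - z)‖ ≤ M * C * ((‖z‖ ^ j)⁻¹ * ((1 + ‖x - z‖) ^ 6)⁻¹) := by
  rw [norm_smul]
  calc _ ≤ (M * (‖z‖ ^ j)⁻¹) * (C * ((1 + ‖x - z‖) ^ 6)⁻¹) :=
        mul_le_mul (hb z) (hC _) (norm_nonneg _) ((abs_nonneg _).trans (hb z))
    _ = _ := by ring

theorem integrable_kernel_smul (hf : Continuous f) (hC : ∀ y, ‖f y‖ ≤ C * ((1 + ‖y‖) ^ 6)⁻¹)
    (hw : Measurable w) (hj : j ≤ 2) (hb : ∀ z, |w z| ≤ M * (‖z‖ ^ j)⁻¹) (x : Space) :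
    Integrable fun z => w z • f (x - z) :=
  ((integrable_inv_norm_mul hj x).const_mul (M * C)).mono'
    (hw.aestronglyMeasurable.smul (Continuous.aestronglyMeasurable (by fun_prop)))
    (Eventually.of_forall fun z => norm_kernel_smul_le hC hb x z)

/-- Moving the centre by less than one at most doubles `1 + ‖x' - z‖`, and `64 = 2^6`. This makes
the majorants locally uniform in `x`. -/
theorem inv_pow_six_le_of_mem_ball {x x' : Space} (hx : x' ∈ Metric.ball x 1) (z : Space) :
    ((1 + ‖x' - z‖) ^ 6)⁻¹ ≤ 64 * ((1 + ‖x - z‖) ^ 6)⁻¹ := by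
  have h1 : ‖x - z‖ ≤ 1 + ‖x' - z‖ := by
    have h2 : ‖x - x'‖ ≤ 1 := by rw [← dist_eq_norm, dist_comm]; exact (Metric.mem_ball.1 hx).le
    have h3 := norm_add_le (x - x') (x' - z)
    rw [sub_add_sub_cancel] at h3
    linarith
  rw [← inv_mul_le_iff₀ (by norm_num), ← mul_inv]
  refine inv_anti₀ (by positivity) ?_
  have h2 : 1 + ‖x - z‖ ≤ 2 * (1 + ‖x' - z‖) := by linarith [norm_nonneg (x' - z)]
  calc (1 + ‖x - z‖) ^ 6 ≤ (2 * (1 + ‖x' - z‖)) ^ 6 := by gcongr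
    _ = _ := by ring

theorem norm_kernel_smul_le_of_mem_ball (hC : ∀ y, ‖f y‖ ≤ C * ((1 + ‖y‖) ^ 6)⁻¹)
    (hb : ∀ z, |w z| ≤ M * (‖z‖ ^ j)⁻¹) {x x' : Space} (hx : x' ∈ Metric.ball x 1) (z : Space) :
    ‖w z • f (x' - z)‖ ≤ 64 * M * C * ((‖z‖ ^ j)⁻¹ * ((1 + ‖x - z‖) ^ 6)⁻¹) := by
  have hC0 : 0 ≤ C := by simpa using (norm_nonneg _).trans (hC 0)
  rw [norm_smul]
  calc _ ≤ (M * (‖z‖ ^ j)⁻¹) * (C * (64 * ((1 + ‖x - z‖) ^ 6)⁻¹)) :=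
        mul_le_mul (hb z) ((hC _).trans (by gcongr; exact inv_pow_six_le_of_mem_ball hx z))
          (norm_nonneg _) ((abs_nonneg _).trans (hb z))
    _ = _ := by ring

theorem continuous_integral_kernel_smul (hf : Continuous f)
    (hC : ∀ y, ‖f y‖ ≤ C * ((1 + ‖y‖) ^ 6)⁻¹) (hw : Measurable w) (hj : j ≤ 2)
    (hb : ∀ z, |w z| ≤ M * (‖z‖ ^ j)⁻¹) : Continuous fun x => ∫ z, w z • f (x - z) := by
  refine continuous_iff_continuousAt.2 fun x => ?_
  refine continuousAt_of_dominated
    (bound := fun z => 64 * M * C * ((‖z‖ ^ j)⁻¹ * ((1 + ‖x - z‖) ^ 6)⁻¹)) ?_ ?_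
    ((integrable_inv_norm_mul hj x).const_mul _) ?_
  · exact Eventually.of_forall fun x' => (integrable_kernel_smul hf hC hw hj hb x').aestronglyMeasurable
  · filter_upwards [Metric.ball_mem_nhds x one_pos] with x' hx'
    exact Eventually.of_forall fun z => norm_kernel_smul_le_of_mem_ball hC hb hx' z
  · exact Eventually.of_forall fun z => Continuous.continuousAt (by fun_prop)

/-- The convolution is written with the variable in `f`, so the derivative never falls on the
singular kernel. -/
theorem hasFDerivAt_integral_kernel_smul (hf : ContDiff ℝ 1 f)
    (hC : ∀ y, ‖f y‖ ≤ C * ((1 + ‖y‖) ^ 6)⁻¹) (hC' : ∀ y, ‖fderiv ℝ f y‖ ≤ C * ((1 + ‖y‖) ^ 6)⁻¹)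
    (hw : Measurable w) (hj : j ≤ 2) (hb : ∀ z, |w z| ≤ M * (‖z‖ ^ j)⁻¹) (x : Space) :
    HasFDerivAt (fun x => ∫ z, w z • f (x - z)) (∫ z, w z • fderiv ℝ f (x - z)) x := by
  have hc' := hf.continuous_fderiv one_ne_zero
  refine hasFDerivAt_integral_of_dominated_of_fderiv_le (F := fun x z => w z • f (x - z))
    (F' := fun x z => w z • fderiv ℝ f (x - z)) (Metric.ball_mem_nhds x one_pos)
    (bound := fun z => 64 * M * C * ((‖z‖ ^ j)⁻¹ * ((1 + ‖x - z‖) ^ 6)⁻¹)) ?_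
    (integrable_kernel_smul hf.continuous hC hw hj hb x)
    (integrable_kernel_smul hc' hC' hw hj hb x).aestronglyMeasurable
    ?_ ((integrable_inv_norm_mul hj x).const_mul _) ?_
  · exact Eventually.of_forall fun x' =>
      (integrable_kernel_smul hf.continuous hC hw hj hb x').aestronglyMeasurable
  · exact Eventually.of_forall fun z x' hx' => norm_kernel_smul_le_of_mem_ball hC' hb hx' z
  · refine Eventually.of_forall fun z x' _ => HasFDerivAt.const_smul ?_ _
    exact ((hf.differentiable one_ne_zero (x' - z)).hasFDerivAt).comp x'
      ((hasFDerivAt_id x').sub_const z)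

/-- The bound is uniform in `x`. The exponent `k` is free because the asymptotics of the potential
trade powers of the decay for factors `‖x - z‖`. -/
theorem integral_inv_norm_mul_le {j : ℕ} (hj : j ≤ 2) : ∃ K, 0 ≤ K ∧ ∀ x : Space, ∀ k ≥ 4,
    Integrable (fun z : Space => (‖z‖ ^ j)⁻¹ * ((1 + ‖x - z‖) ^ k)⁻¹) ∧
    ∫ z : Space, (‖z‖ ^ j)⁻¹ * ((1 + ‖x - z‖) ^ k)⁻¹ ≤ K := by
  have i0 : Integrable fun z : Space => ((1 + ‖z‖) ^ 4)⁻¹ := by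
    simpa using integrable_inv_norm_pow (j := 0) (by norm_num)
  have i1 := (integrable_inv_norm_pow hj).const_mul 16
  refine ⟨(∫ z : Space, ((1 + ‖z‖) ^ 4)⁻¹) +
    ∫ z : Space, 16 * ((‖z‖ ^ j)⁻¹ * ((1 + ‖z‖) ^ 4)⁻¹), by positivity, fun x k hk => ?_⟩
  have i2 : Integrable fun z : Space => ((1 + ‖x - z‖) ^ 4)⁻¹ := i0.comp_sub_left x
  have hle : ∀ z : Space, (‖z‖ ^ j)⁻¹ * ((1 + ‖x - z‖) ^ k)⁻¹ ≤
      ((1 + ‖x - z‖) ^ 4)⁻¹ + 16 * ((‖z‖ ^ j)⁻¹ * ((1 + ‖z‖) ^ 4)⁻¹) := by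
    intro z
    have e1 : ((1 + ‖x - z‖) ^ k)⁻¹ ≤ ((1 + ‖x - z‖) ^ 4)⁻¹ :=
      inv_anti₀ (by positivity) (pow_le_pow_right₀ (by linarith [norm_nonneg (x - z)]) hk)
    have e2 : ((1 + ‖x - z‖) ^ k)⁻¹ ≤ 1 :=
      inv_le_one_of_one_le₀ (one_le_pow₀ (by linarith [norm_nonneg (x - z)]))
    set L := (‖z‖ ^ j)⁻¹ * ((1 + ‖z‖) ^ 4)⁻¹
    have hL : 0 ≤ L := by positivity
    calc _ ≤ (1 + 16 * L) * ((1 + ‖x - z‖) ^ k)⁻¹ := by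
          gcongr; exact inv_le_one_add_inv_mul (norm_nonneg z) j
      _ = ((1 + ‖x - z‖) ^ k)⁻¹ + 16 * (L * ((1 + ‖x - z‖) ^ k)⁻¹) := by ring
      _ ≤ _ := by
          gcongr
          exact mul_le_of_le_one_right hL e2
  have i3 : Integrable fun z : Space => (‖z‖ ^ j)⁻¹ * ((1 + ‖x - z‖) ^ k)⁻¹ :=
    (i2.add i1).mono' (Measurable.aestronglyMeasurable (by fun_prop)) (Eventually.of_forall fun z => by
      rw [Real.norm_eq_abs, abs_of_nonneg (by positivity)]
      exact hle z)
  refine ⟨i3, (integral_mono i3 (i2.add i1) hle).trans_eq ?_⟩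
  simp only [Pi.add_apply]
  rw [integral_add i2 i1, integral_sub_left_eq_self (fun z : Space => ((1 + ‖z‖) ^ 4)⁻¹)]

end KernelIntegrals

/-! ### The Newtonian potential and its gradient -/

theorem tendsto_rieszReg {F : Space → Vec} {x : Space}
    (hF : Integrable fun y : Space => (4 * Real.pi * ‖y‖)⁻¹ • F (x - y)) : RieszExists F x := by
  have hR : ∀ ε : ℝ, (fun y : Space =>
      (Real.exp (-ε * ‖y‖ ^ 2) * (4 * Real.pi * ‖y‖)⁻¹) • F (x - y)) = fun y : Space =>
      Real.exp (-ε * ‖y‖ ^ 2) • ((4 * Real.pi * ‖y‖)⁻¹ • F (x - y)) := by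
    intro ε
    simp only [mul_smul]
  have hb : ∀ ε > 0, ∀ y : Space, |Real.exp (-ε * ‖y‖ ^ 2)| ≤ 1 := by
    intro ε hε y
    rw [Real.abs_exp, Real.exp_le_one_iff]
    have : 0 ≤ ε * ‖y‖ ^ 2 := by positivity
    linarith
  have hc : ∀ ε : ℝ, Continuous fun y : Space => Real.exp (-ε * ‖y‖ ^ 2) := fun ε => by fun_prop
  refine ⟨fun ε hε => ?_, ∫ y : Space, (4 * Real.pi * ‖y‖)⁻¹ • F (x - y), ?_⟩
  · rw [hR]
    exact hF.bdd_smul 1 (hc ε).aestronglyMeasurable (Eventually.of_forall (hb ε hε))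
  · have h1 : rieszReg F x = fun ε : ℝ => ∫ y : Space,
        Real.exp (-ε * ‖y‖ ^ 2) • ((4 * Real.pi * ‖y‖)⁻¹ • F (x - y)) := by
      funext ε
      rw [rieszReg, hR]
    rw [h1]
    refine tendsto_integral_filter_of_dominated_convergence
      (fun y => ‖(4 * Real.pi * ‖y‖)⁻¹ • F (x - y)‖)
      (Eventually.of_forall fun ε => (hc ε).aestronglyMeasurable.smul hF.aestronglyMeasurable) ?_
      hF.norm (Eventually.of_forall fun y => ?_)
    · filter_upwards [self_mem_nhdsWithin] with ε hε
      refine Eventually.of_forall fun y => ?_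
      rw [norm_smul]
      exact mul_le_of_le_one_left (norm_nonneg _) (hb ε hε y)
    · have h : Continuous fun ε : ℝ =>
          Real.exp (-ε * ‖y‖ ^ 2) • ((4 * Real.pi * ‖y‖)⁻¹ • F (x - y)) := by fun_prop
      simpa using (h.tendsto 0).mono_left (nhdsWithin_le_nhds (s := Set.Ioi (0 : ℝ)))

theorem hasFDerivAt_inv_sqrt_add_norm_sq {δ : ℝ} (hδ : 0 < δ) (y : Space) :
    HasFDerivAt (fun y : Space => (√(δ ^ 2 + ‖y‖ ^ 2))⁻¹)
      (-(√(δ ^ 2 + ‖y‖ ^ 2) ^ 3)⁻¹ • innerSL ℝ y) y := by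
  have h0 : 0 < δ ^ 2 + ‖y‖ ^ 2 := by positivity
  have h1 : HasDerivAt (fun s : ℝ => (√(δ ^ 2 + s))⁻¹)
      (-(2 * √(δ ^ 2 + ‖y‖ ^ 2) ^ 3)⁻¹) (‖y‖ ^ 2) := by
    have := (((hasDerivAt_id (‖y‖ ^ 2)).const_add (δ ^ 2)).sqrt h0.ne').inv
      (Real.sqrt_pos.2 h0).ne'
    refine this.congr_deriv ?_
    have := (Real.sqrt_pos.2 h0).ne'
    simp only [id]
    field_simp
  have h2 := h1.comp_hasFDerivAt y (hasStrictFDerivAt_norm_sq y).hasFDerivAt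
  refine h2.congr_fderiv ?_
  ext v
  simp
  ring

theorem norm_le_sqrt_add (δ : ℝ) (y : Space) : ‖y‖ ≤ √(δ ^ 2 + ‖y‖ ^ 2) :=
  Real.le_sqrt_of_sq_le (by linarith [sq_nonneg δ])

theorem ae_ne_zero : ∀ᵐ z : Space, z ≠ 0 := by
  have h := measure_eq_zero_iff_ae_notMem.1 (measure_singleton (μ := (volume : Measure Space)) 0)
  filter_upwards [h] with z hz using hz

section Potential

variable {F : Space → Vec} {C : ℝ}

theorem abs_inner_mul_inv_le (e z : Space) :
    |inner ℝ z e * (‖z‖ ^ 3)⁻¹| ≤ ‖e‖ * (‖z‖ ^ 2)⁻¹ := by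
  rw [abs_mul, abs_of_nonneg (by positivity : 0 ≤ (‖z‖ ^ 3)⁻¹)]
  rcases eq_or_ne z 0 with rfl | hz
  · simp
  · have hz : 0 < ‖z‖ := norm_pos_iff.2 hz
    calc _ ≤ (‖z‖ * ‖e‖) * (‖z‖ ^ 3)⁻¹ := by gcongr; exact abs_real_inner_le_norm z e
      _ = _ := by field_simp

theorem abs_inv_norm_le (z : Space) : |‖z‖⁻¹| ≤ 1 * (‖z‖ ^ 1)⁻¹ := by
  rw [abs_of_nonneg (by positivity), pow_one, one_mul]

/-- Integration by parts against the Newtonian kernel. -/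
theorem Decaying.integral_inv_norm_smul_fderiv (hF : Decaying F C) (x e : Space) :
    ∫ z, ‖z‖⁻¹ • fderiv ℝ F (x - z) e = -∫ z, (inner ℝ z e * (‖z‖ ^ 3)⁻¹) • F (x - z) := by
  have hC := hF.nonneg
  have hc := hF.continuous
  have hc' := hF.contDiff.continuous_fderiv one_ne_zero
  have hd := hF.contDiff.differentiable one_ne_zero
  have hde : ∀ y, ‖fderiv ℝ F y e‖ ≤ (C * ‖e‖) * ((1 + ‖y‖) ^ 6)⁻¹ := by
    intro y
    calc _ ≤ ‖fderiv ℝ F y‖ * ‖e‖ := ContinuousLinearMap.le_opNorm _ _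
      _ ≤ C * ((1 + ‖y‖) ^ 6)⁻¹ * ‖e‖ := by gcongr; exact hF.norm_fderiv_le y
      _ = _ := by ring
  have hcde : Continuous fun y => fderiv ℝ F y e := by fun_prop
  -- The distance is smoothed to `√(δ² + |y|²)`. The smoothed kernel and its gradient are dominated
  -- by `|z|⁻¹` and `|z|⁻²` uniformly in `δ`, so the identity for `δ > 0` passes to the limit.
  set s : ℝ → Space → ℝ := fun δ y => √(δ ^ 2 + ‖y‖ ^ 2) with hs
  have hspos : ∀ δ > 0, ∀ y, 0 < s δ y := fun δ hδ y => Real.sqrt_pos.2 (by positivity)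
  have hsc : ∀ δ, Continuous (s δ) := fun δ => by simp only [hs]; fun_prop
  have b1 : ∀ δ > 0, ∀ᵐ z : Space, |(s δ z)⁻¹| ≤ (‖z‖ ^ 1)⁻¹ := by
    intro δ hδ
    filter_upwards [ae_ne_zero] with z hz
    rw [abs_of_pos (inv_pos.2 (hspos δ hδ z)), pow_one]
    exact inv_anti₀ (norm_pos_iff.2 hz) (norm_le_sqrt_add δ z)
  have b2 : ∀ δ > 0, ∀ᵐ z : Space, |inner ℝ z e * (s δ z ^ 3)⁻¹| ≤ ‖e‖ * (‖z‖ ^ 2)⁻¹ := by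
    intro δ hδ
    filter_upwards [ae_ne_zero] with z hz
    refine le_trans ?_ (abs_inner_mul_inv_le e z)
    have hz' := norm_pos_iff.2 hz
    have := hspos δ hδ z
    rw [abs_mul, abs_mul, abs_of_pos (by positivity : 0 < (s δ z ^ 3)⁻¹),
      abs_of_pos (by positivity : 0 < (‖z‖ ^ 3)⁻¹)]
    have := norm_le_sqrt_add δ z
    gcongr
  have j1 : ∀ δ > 0, ∀ᵐ z, ‖(s δ z)⁻¹ • fderiv ℝ F (x - z) e‖ ≤
      C * ‖e‖ * ((‖z‖ ^ 1)⁻¹ * ((1 + ‖x - z‖) ^ 6)⁻¹) := by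
    intro δ hδ
    filter_upwards [b1 δ hδ] with z hz
    rw [norm_smul]
    calc _ ≤ (‖z‖ ^ 1)⁻¹ * ((C * ‖e‖) * ((1 + ‖x - z‖) ^ 6)⁻¹) :=
          mul_le_mul hz (hde _) (norm_nonneg _) (by positivity)
      _ = _ := by ring
  have j2 : ∀ δ > 0, ∀ᵐ z, ‖(inner ℝ z e * (s δ z ^ 3)⁻¹) • F (x - z)‖ ≤
      C * ‖e‖ * ((‖z‖ ^ 2)⁻¹ * ((1 + ‖x - z‖) ^ 6)⁻¹) := by
    intro δ hδ
    filter_upwards [b2 δ hδ] with z hz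
    rw [norm_smul]
    calc _ ≤ (‖e‖ * (‖z‖ ^ 2)⁻¹) * (C * ((1 + ‖x - z‖) ^ 6)⁻¹) :=
          mul_le_mul hz (hF.norm_le _) (norm_nonneg _) (by positivity)
      _ = _ := by ring
  have k1 := (integrable_inv_norm_mul (j := 1) (by norm_num) x).const_mul (C * ‖e‖)
  have k2 := (integrable_inv_norm_mul (j := 2) le_rfl x).const_mul (C * ‖e‖)
  have m1 : ∀ δ > 0, AEStronglyMeasurable (fun z => (s δ z)⁻¹ • fderiv ℝ F (x - z) e) := by
    intro δ hδ
    have h1 := (hsc δ).inv₀ fun z => (hspos δ hδ z).ne'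
    have h2 : Continuous fun z => fderiv ℝ F (x - z) e := by fun_prop
    exact (h1.smul h2).aestronglyMeasurable
  have m2 : ∀ δ > 0, AEStronglyMeasurable (fun z => (inner ℝ z e * (s δ z ^ 3)⁻¹) • F (x - z)) := by
    intro δ hδ
    have : Continuous fun z => (s δ z ^ 3)⁻¹ :=
      ((hsc δ).pow 3).inv₀ fun z => (pow_pos (hspos δ hδ z) 3).ne'
    exact Continuous.aestronglyMeasurable (by fun_prop)
  have step : ∀ δ > 0, ∫ z, (s δ z)⁻¹ • fderiv ℝ F (x - z) e =
      -∫ z, (inner ℝ z e * (s δ z ^ 3)⁻¹) • F (x - z) := by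
    intro δ hδ
    have i1 := k1.mono' (m1 δ hδ) (j1 δ hδ)
    have i2 := k2.mono' (m2 δ hδ) (j2 δ hδ)
    have i3 : Integrable fun z => (s δ z)⁻¹ • F (x - z) := by
      refine ((integrable_inv_norm_mul (j := 1) (by norm_num) x).const_mul C).mono' ?_ ?_
      · have h1 := (hsc δ).inv₀ fun z => (hspos δ hδ z).ne'
        have h2 : Continuous fun z => F (x - z) := by fun_prop
        exact (h1.smul h2).aestronglyMeasurable
      · filter_upwards [b1 δ hδ] with z hz
        rw [norm_smul]
        calc _ ≤ (‖z‖ ^ 1)⁻¹ * (C * ((1 + ‖x - z‖) ^ 6)⁻¹) :=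
              mul_le_mul hz (hF.norm_le _) (norm_nonneg _) (by positivity)
          _ = _ := by ring
    have h := integral_bilinear_hasFDerivAt_right_eq_neg_left_of_integrable
      (μ := (volume : Measure Space)) (B := ContinuousLinearMap.lsmul ℝ ℝ)
      (f := fun z => (s δ z)⁻¹) (f' := fun z => -(s δ z ^ 3)⁻¹ • innerSL ℝ z)
      (g := fun z => F (x - z)) (g' := fun z => -fderiv ℝ F (x - z)) (v := e)
      (i2.neg.congr (Eventually.of_forall fun z => by simp [mul_comm]))
      (i1.neg.congr (Eventually.of_forall fun z => by simp))
      (by simpa using i3)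
      (fun z _ => hasFDerivAt_inv_sqrt_add_norm_sq hδ z)
      (fun z _ => ((hd (x - z)).hasFDerivAt.comp z ((hasFDerivAt_id z).const_sub x)).congr_fderiv
        (by ext; simp))
    simp only [ContinuousLinearMap.lsmul_apply, neg_apply, smul_neg, smul_apply, innerSL_apply_apply, neg_smul, smul_eq_mul, integral_neg,
      neg_neg] at h
    rw [neg_eq_iff_eq_neg] at h
    rw [h]
    simp only [mul_comm]
  have hlim1 : Tendsto (fun δ => ∫ z, (s δ z)⁻¹ • fderiv ℝ F (x - z) e) (𝓝[>] 0)
      (𝓝 (∫ z, ‖z‖⁻¹ • fderiv ℝ F (x - z) e)) := by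
    refine tendsto_integral_filter_of_dominated_convergence _ ?_ ?_ k1 ?_
    · filter_upwards [self_mem_nhdsWithin] with δ hδ using m1 δ hδ
    · filter_upwards [self_mem_nhdsWithin] with δ hδ using j1 δ hδ
    · filter_upwards [ae_ne_zero] with z hz
      have h2 : Continuous fun δ => s δ z := by simp only [hs]; fun_prop
      have h1 : ContinuousAt (fun δ => (s δ z)⁻¹) 0 := h2.continuousAt.inv₀ (by simp [hs, hz])
      refine Tendsto.smul_const ?_ _
      simpa [hs] using h1.tendsto.mono_left (nhdsWithin_le_nhds (s := Set.Ioi (0 : ℝ)))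
  have hlim2 : Tendsto (fun δ => ∫ z, (inner ℝ z e * (s δ z ^ 3)⁻¹) • F (x - z)) (𝓝[>] 0)
      (𝓝 (∫ z, (inner ℝ z e * (‖z‖ ^ 3)⁻¹) • F (x - z))) := by
    refine tendsto_integral_filter_of_dominated_convergence _ ?_ ?_ k2 ?_
    · filter_upwards [self_mem_nhdsWithin] with δ hδ using m2 δ hδ
    · filter_upwards [self_mem_nhdsWithin] with δ hδ using j2 δ hδ
    · filter_upwards [ae_ne_zero] with z hz
      have h2 : Continuous fun δ => s δ z ^ 3 := by simp only [hs]; fun_prop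
      have h1 : ContinuousAt (fun δ => (s δ z ^ 3)⁻¹) 0 := h2.continuousAt.inv₀ (by simp [hs, hz])
      refine Tendsto.smul_const (Tendsto.const_mul _ ?_) _
      simpa [hs] using h1.tendsto.mono_left (nhdsWithin_le_nhds (s := Set.Ioi (0 : ℝ)))
  refine tendsto_nhds_unique (hlim1.congr' ?_) hlim2.neg
  filter_upwards [self_mem_nhdsWithin] with δ hδ using step δ hδ

end Potential

theorem IsFrame.cross_expand {e₁ e₂ e₃ : Space} (h : IsFrame e₁ e₂ e₃) (z : Space) (v : Vec) :
    cross z v = inner ℝ z e₁ • cross e₁ v + inner ℝ z e₂ • cross e₂ v +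
      inner ℝ z e₃ • cross e₃ v := by
  obtain ⟨b, hb⟩ := h.exists_basis
  have h1 := b.sum_repr' z
  rw [Fin.sum_univ_three, hb] at h1
  simp only [Matrix.cons_val_zero, Matrix.cons_val_one, Matrix.cons_val_two, Matrix.head_cons,
    Matrix.tail_cons, real_inner_comm z] at h1
  conv_lhs => rw [← h1]
  simp only [← crossL_apply, map_add, map_smul, add_apply, smul_apply]

theorem isFrame_cartesian : IsFrame (cartesian 0) (cartesian 1) (cartesian 2) := by
  rw [isFrame_iff]
  refine ⟨⟨norm_cartesian 0, norm_cartesian 1, norm_cartesian 2⟩, ?_, ?_, ?_⟩ <;>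
    rw [inner_cartesian] <;> simp [cartesian]

section NewtonianPotential

variable {F : Space → Vec} {C : ℝ}

theorem Decaying.integrable_newton (hF : Decaying F C) (x : Space) :
    Integrable fun z => ‖z‖⁻¹ • F (x - z) :=
  integrable_kernel_smul hF.continuous hF.norm_le (by fun_prop) (by norm_num) abs_inv_norm_le x

theorem Decaying.rieszExists (hF : Decaying F C) (x : Space) : RieszExists F x ∧
    rieszPotential F x = (4 * Real.pi)⁻¹ • ∫ z, ‖z‖⁻¹ • F (x - z) := by
  have h : Integrable fun y : Space => (4 * Real.pi * ‖y‖)⁻¹ • F (x - y) := by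
    simp only [mul_inv (4 * Real.pi), mul_smul]
    exact (hF.integrable_newton x).smul ((4 * Real.pi)⁻¹)
  refine ⟨tendsto_rieszReg h, ?_⟩
  rw [rieszPotential_eq_integral F x h, ← integral_smul]
  simp only [mul_inv (4 * Real.pi), mul_smul]

theorem Decaying.hasFDerivAt_rieszPotential (hF : Decaying F C) (x : Space) :
    HasFDerivAt (rieszPotential F)
      ((4 * Real.pi)⁻¹ • ∫ z, ‖z‖⁻¹ • fderiv ℝ F (x - z)) x := by
  have h : rieszPotential F = fun x => (4 * Real.pi)⁻¹ • ∫ z, ‖z‖⁻¹ • F (x - z) :=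
    funext fun x => (hF.rieszExists x).2
  rw [h]
  exact (hasFDerivAt_integral_kernel_smul hF.contDiff hF.norm_le hF.norm_fderiv_le
    (by fun_prop) (by norm_num) abs_inv_norm_le x).const_smul
    ((4 * Real.pi)⁻¹)

theorem Decaying.fderiv_rieszPotential (hF : Decaying F C) (x e : Space) :
    fderiv ℝ (rieszPotential F) x e =
      -(4 * Real.pi)⁻¹ • ∫ z, (inner ℝ z e * (‖z‖ ^ 3)⁻¹) • F (x - z) := by
  have hi : Integrable fun z => ‖z‖⁻¹ • fderiv ℝ F (x - z) :=
    integrable_kernel_smul (hF.contDiff.continuous_fderiv one_ne_zero) hF.norm_fderiv_le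
      (by fun_prop) (by norm_num) abs_inv_norm_le x
  rw [(hF.hasFDerivAt_rieszPotential x).fderiv, smul_apply,
    ContinuousLinearMap.integral_apply hi, neg_smul, ← smul_neg,
    ← hF.integral_inv_norm_smul_fderiv x e]
  rfl

theorem measurable_inner_mul_inv (e : Space) :
    Measurable fun z : Space => inner ℝ z e * (‖z‖ ^ 3)⁻¹ := by fun_prop

theorem Decaying.continuous_fderiv_rieszPotential (hF : Decaying F C) (e : Space) :
    Continuous fun x => fderiv ℝ (rieszPotential F) x e := by
  simp only [hF.fderiv_rieszPotential]
  exact (continuous_integral_kernel_smul hF.continuous hF.norm_le (measurable_inner_mul_inv e)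
    le_rfl (abs_inner_mul_inv_le e)).const_smul (-(4 * Real.pi)⁻¹)

theorem Decaying.continuous_rieszPotential (hF : Decaying F C) : Continuous (rieszPotential F) :=
  continuous_iff_continuousAt.2 fun x => (hF.hasFDerivAt_rieszPotential x).continuousAt

theorem Decaying.norm_fderiv_rieszPotential_le (hF : Decaying F C) (e : Space) :
    ∃ K, ∀ x, ‖fderiv ℝ (rieszPotential F) x e‖ ≤ K := by
  obtain ⟨K, hK, hb⟩ := integral_inv_norm_mul_le (j := 2) le_rfl
  have hC := hF.nonneg
  have hπ := Real.pi_pos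
  refine ⟨(4 * Real.pi)⁻¹ * (‖e‖ * C * K), fun x => ?_⟩
  obtain ⟨i, hi⟩ := hb x 6 (by norm_num)
  rw [hF.fderiv_rieszPotential, norm_smul, norm_neg, Real.norm_eq_abs, abs_of_pos (by positivity)]
  gcongr
  refine (norm_integral_le_of_norm_le (i.const_mul (‖e‖ * C)) (Eventually.of_forall fun z =>
    norm_kernel_smul_le hF.norm_le (abs_inner_mul_inv_le e) x z)).trans ?_
  rw [integral_const_mul]
  gcongr

/-- Expanding `z` in the frame shows that the curl of the potential may be computed in any
orthonormal frame, in particular in one adapted to a plane. -/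
theorem Decaying.integral_cross_kernel (hF : Decaying F C) {e₁ e₂ e₃ : Space}
    (h : IsFrame e₁ e₂ e₃) (x : Space) :
    -(4 * Real.pi)⁻¹ • ∫ z, (‖z‖ ^ 3)⁻¹ • cross z (F (x - z)) =
      cross e₁ (fderiv ℝ (rieszPotential F) x e₁) + cross e₂ (fderiv ℝ (rieszPotential F) x e₂) +
        cross e₃ (fderiv ℝ (rieszPotential F) x e₃) := by
  have hi : ∀ e, Integrable fun z => (inner ℝ z e * (‖z‖ ^ 3)⁻¹) • F (x - z) := fun e =>
    integrable_kernel_smul hF.continuous hF.norm_le (measurable_inner_mul_inv e) le_rfl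
      (abs_inner_mul_inv_le e) x
  have hj : ∀ e, Integrable fun z => cross e ((inner ℝ z e * (‖z‖ ^ 3)⁻¹) • F (x - z)) := fun e =>
    (crossL e).integrable_comp (hi e)
  simp only [cross_smul_right] at hj
  have hk : Integrable fun z => (inner ℝ z e₁ * (‖z‖ ^ 3)⁻¹) • cross e₁ (F (x - z)) +
    (inner ℝ z e₂ * (‖z‖ ^ 3)⁻¹) • cross e₂ (F (x - z)) := (hj e₁).add (hj e₂)
  simp only [hF.fderiv_rieszPotential, cross_smul_right, ← integral_cross _ (hi _), ← smul_add]
  rw [← integral_add (hj e₁) (hj e₂), ← integral_add hk (hj e₃)]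
  congr 2; funext z
  rw [h.cross_expand z (F (x - z))]
  module

theorem Decaying.biotSavart_eq (hF : Decaying F C) (x : Space) :
    biotSavart F x = -(4 * Real.pi)⁻¹ • ∫ z, (‖z‖ ^ 3)⁻¹ • cross z (F (x - z)) := by
  rw [hF.integral_cross_kernel isFrame_cartesian x, biotSavart, curl_eq_sum, Fin.sum_univ_three]

theorem Decaying.biotSavart_eq_frame (hF : Decaying F C) {e₁ e₂ e₃ : Space}
    (h : IsFrame e₁ e₂ e₃) (x : Space) : biotSavart F x =
      cross e₁ (fderiv ℝ (rieszPotential F) x e₁) + cross e₂ (fderiv ℝ (rieszPotential F) x e₂) +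
        cross e₃ (fderiv ℝ (rieszPotential F) x e₃) := by
  rw [hF.biotSavart_eq, hF.integral_cross_kernel h]

/-- The Newtonian potential is asymptotic to that of a point charge. -/
theorem Decaying.rieszPotential_asymptotic (hF : Decaying F C) : ∃ K, 0 ≤ K ∧ ∀ x,
    ‖rieszPotential F x‖ ≤ K ∧ ‖x‖ * ‖rieszPotential F x‖ ≤ K ∧
      ‖x‖ * ‖‖x‖ • rieszPotential F x - (4 * Real.pi)⁻¹ • ∫ z, F z‖ ≤ K := by
  obtain ⟨K₀, hK₀, hb₀⟩ := integral_inv_norm_mul_le (j := 0) (by norm_num)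
  obtain ⟨K₁, hK₁, hb₁⟩ := integral_inv_norm_mul_le (j := 1) (by norm_num)
  have hC := hF.nonneg
  have hπ := Real.pi_pos
  have hπ1 : (4 * Real.pi)⁻¹ ≤ 1 := inv_le_one_of_one_le₀ (by linarith [Real.pi_gt_three])
  have hFi : ∀ x, Integrable fun z => F (x - z) := fun x => hF.integrable.comp_sub_left x
  -- The difference from the point charge is an integral of `|x|/|z| - 1`, which is at most `|x -
  -- z|/|z|`; the factor `|x - z|` costs one power of the decay of `F`.
  have hdiff : ∀ x, ‖x‖ • rieszPotential F x - (4 * Real.pi)⁻¹ • ∫ z, F z =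
      (4 * Real.pi)⁻¹ • ∫ z, (‖x‖ * ‖z‖⁻¹ - 1) • F (x - z) := by
    intro x
    have i1 : Integrable fun z => ‖x‖ • ‖z‖⁻¹ • F (x - z) := (hF.integrable_newton x).smul ‖x‖
    rw [(hF.rieszExists x).2, smul_comm, ← smul_sub, ← integral_smul,
      ← integral_sub_left_eq_self F volume x, ← integral_sub i1 (hFi x)]
    simp only [sub_smul, mul_smul, one_smul]
  have hpt : ∀ x z : Space, z ≠ 0 → |‖x‖ * ‖z‖⁻¹ - 1| ≤ ‖z‖⁻¹ * ‖x - z‖ := by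
    intro x z hz
    have hz := norm_pos_iff.2 hz
    have : ‖x‖ * ‖z‖⁻¹ - 1 = ‖z‖⁻¹ * (‖x‖ - ‖z‖) := by field_simp
    rw [this, abs_mul, abs_of_pos (inv_pos.2 hz)]
    gcongr
    exact abs_norm_sub_norm_le x z
  have hdec : ∀ (x z : Space) (k : ℕ), ‖x - z‖ * ((1 + ‖x - z‖) ^ (k + 1))⁻¹ ≤
      ((1 + ‖x - z‖) ^ k)⁻¹ := by
    intro x z k
    rw [pow_succ, mul_inv, mul_comm, mul_assoc]
    refine mul_le_of_le_one_right (by positivity) ?_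
    rw [inv_mul_le_iff₀ (by positivity)]
    linarith
  have h5 : ∀ x, ∀ᵐ z, ‖(‖x‖ * ‖z‖⁻¹ - 1) • F (x - z)‖ ≤
      C * ((‖z‖ ^ 1)⁻¹ * ((1 + ‖x - z‖) ^ 5)⁻¹) := by
    intro x
    filter_upwards [ae_ne_zero] with z hz
    rw [norm_smul, pow_one]
    calc _ ≤ (‖z‖⁻¹ * ‖x - z‖) * (C * ((1 + ‖x - z‖) ^ 6)⁻¹) :=
          mul_le_mul (hpt x z hz) (hF.norm_le _) (norm_nonneg _) (by positivity)
      _ = C * (‖z‖⁻¹ * (‖x - z‖ * ((1 + ‖x - z‖) ^ (5 + 1))⁻¹)) := by ring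
      _ ≤ _ := by gcongr; exact hdec x z 5
  have hd5 : ∀ x, ‖‖x‖ • rieszPotential F x - (4 * Real.pi)⁻¹ • ∫ z, F z‖ ≤ C * K₁ := by
    intro x
    obtain ⟨i, hi⟩ := hb₁ x 5 (by norm_num)
    rw [hdiff, norm_smul, Real.norm_eq_abs, abs_of_pos (by positivity)]
    refine mul_le_of_le_one_left (norm_nonneg _) hπ1 |>.trans ?_
    refine (norm_integral_le_of_norm_le (i.const_mul C) (h5 x)).trans ?_
    rw [integral_const_mul]
    gcongr
  refine ⟨C * K₁ + ‖(4 * Real.pi)⁻¹ • ∫ z, F z‖ + C * K₀, by positivity, fun x => ⟨?_, ?_, ?_⟩⟩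
  · obtain ⟨i, hi⟩ := hb₁ x 6 (by norm_num)
    have : ‖rieszPotential F x‖ ≤ C * K₁ := by
      rw [(hF.rieszExists x).2, norm_smul, Real.norm_eq_abs, abs_of_pos (by positivity)]
      refine mul_le_of_le_one_left (norm_nonneg _) hπ1 |>.trans ?_
      refine (norm_integral_le_of_norm_le (i.const_mul (1 * C)) (Eventually.of_forall fun z =>
        norm_kernel_smul_le hF.norm_le abs_inv_norm_le x z)).trans ?_
      rw [integral_const_mul, one_mul]
      gcongr
    have h1 : 0 ≤ C * K₀ := by positivity
    linarith [norm_nonneg ((4 * Real.pi)⁻¹ • ∫ z, F z)]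
  · have h1 : ‖x‖ * ‖rieszPotential F x‖ = ‖‖x‖ • rieszPotential F x‖ := by
      rw [norm_smul, norm_norm]
    have h2 := norm_sub_norm_le (‖x‖ • rieszPotential F x) ((4 * Real.pi)⁻¹ • ∫ z, F z)
    have h3 : 0 ≤ C * K₀ := by positivity
    rw [h1]
    linarith [hd5 x]
  · obtain ⟨i0, hi0⟩ := hb₀ x 5 (by norm_num)
    obtain ⟨i1, hi1⟩ := hb₁ x 4 (by norm_num)
    have h1 : ‖x‖ * ‖‖x‖ • rieszPotential F x - (4 * Real.pi)⁻¹ • ∫ z, F z‖ ≤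
        C * (K₀ + K₁) := by
      rw [hdiff, norm_smul, Real.norm_eq_abs, abs_of_pos (by positivity), mul_left_comm]
      refine mul_le_of_le_one_left (by positivity) hπ1 |>.trans ?_
      rw [← norm_norm x, ← norm_smul, ← integral_smul]
      refine (norm_integral_le_of_norm_le ((i0.add i1).const_mul C) ?_).trans ?_
      · filter_upwards [h5 x, ae_ne_zero] with z hz hz0
        have hz0 := norm_pos_iff.2 hz0
        -- The extra factor `|x|` is absorbed in the same way, at the cost of a second power of the
        -- decay.
        have hx : ‖x‖ * ‖z‖⁻¹ ≤ 1 + ‖z‖⁻¹ * ‖x - z‖ := by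
          have := (abs_le.1 (hpt x z (norm_pos_iff.1 hz0))).2
          linarith
        rw [norm_smul, norm_norm, Pi.add_apply, pow_zero, inv_one, one_mul]
        calc _ ≤ ‖x‖ * (C * ((‖z‖ ^ 1)⁻¹ * ((1 + ‖x - z‖) ^ 5)⁻¹)) := by gcongr
          _ = C * ((‖x‖ * ‖z‖⁻¹) * ((1 + ‖x - z‖) ^ 5)⁻¹) := by ring
          _ ≤ C * ((1 + ‖z‖⁻¹ * ‖x - z‖) * ((1 + ‖x - z‖) ^ 5)⁻¹) := by gcongr
          _ = C * (((1 + ‖x - z‖) ^ 5)⁻¹ +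
              ‖z‖⁻¹ * (‖x - z‖ * ((1 + ‖x - z‖) ^ (4 + 1))⁻¹)) := by ring
          _ ≤ _ := by
            rw [pow_one]
            gcongr
            exact hdec x z 4
      · simp only [Pi.add_apply]
        rw [integral_const_mul, integral_add i0 i1]
        gcongr
    linarith [norm_nonneg ((4 * Real.pi)⁻¹ • ∫ z, F z)]

end NewtonianPotential

/-! ### One-variable integrals of the inverse-square kernel -/

theorem measurable_sign : Measurable Real.sign := by
  unfold Real.sign
  exact Measurable.ite measurableSet_Iio measurable_const
    (Measurable.ite measurableSet_Ioi measurable_const measurable_const)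

theorem abs_sign_le_one (u : ℝ) : |Real.sign u| ≤ 1 := by
  rcases Real.sign_apply_eq u with h | h | h <;> simp [h]

section InverseSquare

/-- Splitting at the jump `a` gives `(n - g a) - (g a - m)`. -/
theorem integral_sign_mul_of_hasDerivAt {f g : ℝ → ℝ} {m n : ℝ} (hd : ∀ u, HasDerivAt g (f u) u)
    (hf : Integrable f) (hbot : Tendsto g atBot (𝓝 m)) (htop : Tendsto g atTop (𝓝 n)) (a : ℝ) :
    ∫ u, Real.sign (u - a) * f u = n + m - 2 * g a := by
  have hs : Integrable fun u => Real.sign (u - a) * f u :=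
    hf.bdd_mul (measurable_sign.comp (by fun_prop)).aestronglyMeasurable
      (Eventually.of_forall fun u => abs_sign_le_one _)
  have h1 : ∫ u in Set.Iic a, Real.sign (u - a) * f u = -(g a - m) := by
    rw [← integral_Iic_of_hasDerivAt_of_tendsto' (fun u _ => hd u) hf.integrableOn hbot,
      ← integral_neg, integral_Iic_eq_integral_Iio, integral_Iic_eq_integral_Iio]
    refine setIntegral_congr_fun measurableSet_Iio fun u hu => ?_
    simp only [Real.sign_of_neg (sub_neg.2 hu)]
    ring
  have h2 : ∫ u in Set.Ioi a, Real.sign (u - a) * f u = n - g a := by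
    rw [← integral_Ioi_of_hasDerivAt_of_tendsto' (fun u _ => hd u) hf.integrableOn htop]
    refine setIntegral_congr_fun measurableSet_Ioi fun u hu => ?_
    simp only [Real.sign_of_pos (sub_pos.2 hu), one_mul]
  rw [← integral_add_compl measurableSet_Iic hs, Set.compl_Iic, h1, h2]
  ring

variable {d : ℝ}

theorem integrable_inv_sq_add_sq (hd : 0 < d) : Integrable (fun u : ℝ => (d ^ 2 + u ^ 2)⁻¹) ∧
    ∫ u : ℝ, (d ^ 2 + u ^ 2)⁻¹ = Real.pi * d⁻¹ := by
  have h : ∀ u : ℝ, (d ^ 2 + u ^ 2)⁻¹ = (d ^ 2)⁻¹ * (1 + (d⁻¹ * u) ^ 2)⁻¹ := by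
    intro u
    rw [← mul_inv]
    congr 1
    field_simp
  simp only [h]
  refine ⟨(integrable_inv_one_add_sq.comp_mul_left' (inv_ne_zero hd.ne')).const_mul _, ?_⟩
  rw [integral_const_mul, Measure.integral_comp_mul_left (fun u : ℝ => (1 + u ^ 2)⁻¹),
    integral_univ_inv_one_add_sq, inv_inv, abs_of_pos hd, smul_eq_mul]
  field_simp

theorem sqrt_sq_add_sq_pos (hd : 0 < d) (u : ℝ) : 0 < √(d ^ 2 + u ^ 2) :=
  Real.sqrt_pos.2 (by positivity)

theorem hasDerivAt_sqrt_sq_add_sq (hd : 0 < d) (u : ℝ) :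
    HasDerivAt (fun u : ℝ => √(d ^ 2 + u ^ 2)) (u * (√(d ^ 2 + u ^ 2))⁻¹) u := by
  have h0 : 0 < d ^ 2 + u ^ 2 := by positivity
  refine ((((hasDerivAt_id u).pow 2).const_add (d ^ 2)).sqrt h0.ne').congr_deriv ?_
  have := sqrt_sq_add_sq_pos hd u
  simp only [id]
  field_simp
  norm_num
  exact mul_div_cancel_right₀ _ this.ne'

theorem hasDerivAt_div_sqrt (hd : 0 < d) (u : ℝ) :
    HasDerivAt (fun u : ℝ => (d ^ 2)⁻¹ * (u * (√(d ^ 2 + u ^ 2))⁻¹))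
      ((√(d ^ 2 + u ^ 2) ^ 3)⁻¹) u := by
  have hr := sqrt_sq_add_sq_pos hd u
  refine (((hasDerivAt_id u).mul ((hasDerivAt_sqrt_sq_add_sq hd u).inv hr.ne')).const_mul
    ((d ^ 2)⁻¹)).congr_deriv ?_
  have hsq : √(d ^ 2 + u ^ 2) ^ 2 = d ^ 2 + u ^ 2 := Real.sq_sqrt (by positivity)
  simp only [id, Pi.inv_apply]
  field_simp
  linear_combination hsq

theorem hasDerivAt_neg_inv_sqrt (hd : 0 < d) (u : ℝ) :
    HasDerivAt (fun u : ℝ => -(√(d ^ 2 + u ^ 2))⁻¹) (u * (√(d ^ 2 + u ^ 2) ^ 3)⁻¹) u := by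
  have hr := sqrt_sq_add_sq_pos hd u
  refine ((hasDerivAt_sqrt_sq_add_sq hd u).inv hr.ne').neg.congr_deriv ?_
  field_simp

theorem abs_le_sqrt_sq_add_sq (d u : ℝ) : |u| ≤ √(d ^ 2 + u ^ 2) :=
  Real.abs_le_sqrt (by linarith [sq_nonneg d])

theorem integrable_inv_sqrt_cube (hd : 0 < d) :
    Integrable (fun u : ℝ => (√(d ^ 2 + u ^ 2) ^ 3)⁻¹) ∧
    Integrable (fun u : ℝ => u * (√(d ^ 2 + u ^ 2) ^ 3)⁻¹) := by
  have hsq : ∀ u : ℝ, √(d ^ 2 + u ^ 2) ^ 2 = d ^ 2 + u ^ 2 := fun u => Real.sq_sqrt (by positivity)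
  constructor
  · refine ((integrable_inv_sq_add_sq hd).1.const_mul d⁻¹).mono' (by fun_prop)
      (Eventually.of_forall fun u => ?_)
    have hr := sqrt_sq_add_sq_pos hd u
    rw [Real.norm_eq_abs, abs_of_pos (by positivity), ← mul_inv]
    refine inv_anti₀ (by positivity) ?_
    have : d ≤ √(d ^ 2 + u ^ 2) := Real.le_sqrt_of_sq_le (by linarith [sq_nonneg u])
    calc d * (d ^ 2 + u ^ 2) = d * √(d ^ 2 + u ^ 2) ^ 2 := by rw [hsq]
      _ ≤ √(d ^ 2 + u ^ 2) * √(d ^ 2 + u ^ 2) ^ 2 := by gcongr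
      _ = _ := by ring
  · refine (integrable_inv_sq_add_sq hd).1.mono' (by fun_prop) (Eventually.of_forall fun u => ?_)
    have hr := sqrt_sq_add_sq_pos hd u
    rw [norm_mul, Real.norm_eq_abs, norm_inv, norm_pow, Real.norm_eq_abs, abs_of_pos hr]
    have := abs_le_sqrt_sq_add_sq d u
    calc _ ≤ √(d ^ 2 + u ^ 2) * (√(d ^ 2 + u ^ 2) ^ 3)⁻¹ := by gcongr
      _ = (√(d ^ 2 + u ^ 2) ^ 2)⁻¹ := by field_simp
      _ = _ := by rw [hsq]

theorem tendsto_inv_sqrt_sq_add_sq (d : ℝ) :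
    Tendsto (fun u : ℝ => (√(d ^ 2 + u ^ 2))⁻¹) atTop (𝓝 0) :=
  (tendsto_atTop_mono (fun u => (le_abs_self u).trans (abs_le_sqrt_sq_add_sq d u))
    tendsto_id).inv_tendsto_atTop

theorem tendsto_div_sqrt (hd : 0 < d) :
    Tendsto (fun u : ℝ => (d ^ 2)⁻¹ * (u * (√(d ^ 2 + u ^ 2))⁻¹)) atTop (𝓝 (d ^ 2)⁻¹) := by
  have h1 : Tendsto (fun u : ℝ => √(1 - (d * (√(d ^ 2 + u ^ 2))⁻¹) ^ 2)) atTop (𝓝 1) := by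
    have h2 : Continuous fun v : ℝ => √(1 - (d * v) ^ 2) := by fun_prop
    simpa [Function.comp_def] using (h2.tendsto 0).comp (tendsto_inv_sqrt_sq_add_sq d)
  have h3 : Tendsto (fun u : ℝ => u * (√(d ^ 2 + u ^ 2))⁻¹) atTop (𝓝 1) := by
    refine h1.congr' ?_
    filter_upwards [eventually_gt_atTop 0] with u hu
    have hr := sqrt_sq_add_sq_pos hd u
    have hsq : √(d ^ 2 + u ^ 2) ^ 2 = d ^ 2 + u ^ 2 := Real.sq_sqrt (by positivity)
    rw [Real.sqrt_eq_iff_mul_self_eq_of_pos (by positivity)]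
    field_simp
    linear_combination -hsq
  simpa using h3.const_mul (d ^ 2)⁻¹

theorem tendsto_atBot_of_odd {g : ℝ → ℝ} {n : ℝ} (hg : ∀ u, g (-u) = -g u)
    (h : Tendsto g atTop (𝓝 n)) : Tendsto g atBot (𝓝 (-n)) :=
  ((h.comp tendsto_neg_atBot_atTop).neg).congr fun u => by simp [hg]

theorem tendsto_atBot_of_even {g : ℝ → ℝ} {n : ℝ} (hg : ∀ u, g (-u) = g u)
    (h : Tendsto g atTop (𝓝 n)) : Tendsto g atBot (𝓝 n) :=
  (h.comp tendsto_neg_atBot_atTop).congr fun u => hg u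

theorem integral_inv_sqrt_cube (hd : 0 < d) :
    ∫ u : ℝ, (√(d ^ 2 + u ^ 2) ^ 3)⁻¹ = 2 * (d ^ 2)⁻¹ := by
  rw [integral_of_hasDerivAt_of_tendsto (hasDerivAt_div_sqrt hd) (integrable_inv_sqrt_cube hd).1
    (tendsto_atBot_of_odd (fun u => by rw [neg_sq]; ring) (tendsto_div_sqrt hd))
    (tendsto_div_sqrt hd)]
  ring

theorem tendsto_neg_inv_sqrt (d : ℝ) :
    Tendsto (fun u : ℝ => -(√(d ^ 2 + u ^ 2))⁻¹) atTop (𝓝 0) := by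
  simpa using (tendsto_inv_sqrt_sq_add_sq d).neg

theorem integral_mul_inv_sqrt_cube (hd : 0 < d) :
    ∫ u : ℝ, u * (√(d ^ 2 + u ^ 2) ^ 3)⁻¹ = 0 := by
  rw [integral_of_hasDerivAt_of_tendsto (hasDerivAt_neg_inv_sqrt hd) (integrable_inv_sqrt_cube hd).2
    (tendsto_atBot_of_even (fun u => by rw [neg_sq]) (tendsto_neg_inv_sqrt d))
    (tendsto_neg_inv_sqrt d), sub_zero]

theorem integral_sign_mul_inv_sqrt_cube (hd : 0 < d) (a : ℝ) :
    ∫ u : ℝ, Real.sign (u - a) * (√(d ^ 2 + u ^ 2) ^ 3)⁻¹ =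
      -2 * ((d ^ 2)⁻¹ * (a * (√(d ^ 2 + a ^ 2))⁻¹)) := by
  rw [integral_sign_mul_of_hasDerivAt (hasDerivAt_div_sqrt hd) (integrable_inv_sqrt_cube hd).1
    (tendsto_atBot_of_odd (fun u => by rw [neg_sq]; ring) (tendsto_div_sqrt hd))
    (tendsto_div_sqrt hd)]
  ring

theorem integral_sign_mul_mul_inv_sqrt_cube (hd : 0 < d) (a : ℝ) :
    ∫ u : ℝ, Real.sign (u - a) * (u * (√(d ^ 2 + u ^ 2) ^ 3)⁻¹) = 2 * (√(d ^ 2 + a ^ 2))⁻¹ := by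
  rw [integral_sign_mul_of_hasDerivAt (hasDerivAt_neg_inv_sqrt hd) (integrable_inv_sqrt_cube hd).2
    (tendsto_atBot_of_even (fun u => by rw [neg_sq]) (tendsto_neg_inv_sqrt d))
    (tendsto_neg_inv_sqrt d)]
  ring

end InverseSquare

/-! ### The inverse-square kernel along a line -/

section LineKernel

variable {θ : Space}

theorem norm_add_smul_eq (hθ : ‖θ‖ = 1) (z : Space) (s : ℝ) :
    ‖z + s • θ‖ = √(‖transverse θ z‖ ^ 2 + (inner ℝ z θ + s) ^ 2) := by
  rw [eq_comm, Real.sqrt_eq_iff_mul_self_eq (by positivity) (norm_nonneg _), ← sq, transverse,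
    norm_add_sq_real, norm_sub_sq_real]
  simp only [inner_smul_right, norm_smul, hθ, Real.norm_eq_abs, mul_pow, sq_abs]
  ring

theorem add_smul_eq_transverse (θ z : Space) (s : ℝ) :
    z + s • θ = transverse θ z + (inner ℝ z θ + s) • θ := by
  rw [transverse]; module

/-- The Biot–Savart kernel. -/
def inverseSquare (z : Space) : Space := (‖z‖ ^ 3)⁻¹ • z

theorem norm_inverseSquare (z : Space) : ‖inverseSquare z‖ = (‖z‖ ^ 2)⁻¹ := by
  rw [inverseSquare, norm_smul, norm_inv, norm_pow, norm_norm]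
  rcases eq_or_ne ‖z‖ 0 with h | h
  · rw [h]; simp
  · field_simp

theorem measurable_inverseSquare : Measurable inverseSquare := by
  unfold inverseSquare; fun_prop

theorem integral_inv_norm_sq_line (hθ : ‖θ‖ = 1) {z : Space} (hz : transverse θ z ≠ 0) :
    Integrable (fun s : ℝ => (‖z + s • θ‖ ^ 2)⁻¹) ∧
    ∫ s : ℝ, (‖z + s • θ‖ ^ 2)⁻¹ = Real.pi * ‖transverse θ z‖⁻¹ := by
  obtain ⟨h1, h2⟩ := integrable_inv_sq_add_sq (norm_pos_iff.2 hz)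
  have h : ∀ s : ℝ, ‖z + s • θ‖ ^ 2 = ‖transverse θ z‖ ^ 2 + (inner ℝ z θ + s) ^ 2 := fun s => by
    rw [norm_add_smul_eq hθ, Real.sq_sqrt (by positivity)]
  simp only [h]
  refine ⟨h1.comp_add_left _, ?_⟩
  rw [integral_add_left_eq_self (fun u : ℝ => (‖transverse θ z‖ ^ 2 + u ^ 2)⁻¹), h2]

theorem inverseSquare_line (hθ : ‖θ‖ = 1) (z : Space) (s : ℝ) : inverseSquare (z + s • θ) =
    (√(‖transverse θ z‖ ^ 2 + (inner ℝ z θ + s) ^ 2) ^ 3)⁻¹ • transverse θ z +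
      ((inner ℝ z θ + s) * (√(‖transverse θ z‖ ^ 2 + (inner ℝ z θ + s) ^ 2) ^ 3)⁻¹) • θ := by
  rw [inverseSquare, norm_add_smul_eq hθ, add_smul_eq_transverse]
  module

/-- The longitudinal component is odd about the foot of the perpendicular and integrates to zero;
the transverse one contributes `2/|w|²` times the transverse component `w`. -/
theorem integral_inverseSquare_line (hθ : ‖θ‖ = 1) {z : Space} (hz : transverse θ z ≠ 0) :
    ∫ s : ℝ, inverseSquare (z + s • θ) =
      (2 : ℝ) • (‖transverse θ z‖ ^ 2)⁻¹ • transverse θ z := by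
  have hd := norm_pos_iff.2 hz
  obtain ⟨h1, h2⟩ := integrable_inv_sqrt_cube hd
  simp only [inverseSquare_line hθ]
  rw [integral_add_left_eq_self (fun u : ℝ => (√(‖transverse θ z‖ ^ 2 + u ^ 2) ^ 3)⁻¹ •
    transverse θ z + (u * (√(‖transverse θ z‖ ^ 2 + u ^ 2) ^ 3)⁻¹) • θ),
    integral_add (h1.smul_const _) (h2.smul_const _), integral_smul_const, integral_smul_const,
    integral_inv_sqrt_cube hd, integral_mul_inv_sqrt_cube hd]
  module

/-- In the coordinate centred at the foot of the perpendicular the sign jumps at `z·θ`. The even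
transverse profile and the odd longitudinal one now both contribute, through their antiderivatives
at the jump. -/
theorem integral_sign_inverseSquare_line (hθ : ‖θ‖ = 1) {z : Space} (hz : transverse θ z ≠ 0) :
    ∫ s : ℝ, Real.sign s • inverseSquare (z + s • θ) = (2 : ℝ) • perpKernel θ z := by
  have hd := norm_pos_iff.2 hz
  obtain ⟨h1, h2⟩ := integrable_inv_sqrt_cube hd
  set a := inner ℝ z θ with ha
  have hz2 : ‖z‖ = √(‖transverse θ z‖ ^ 2 + a ^ 2) := by
    have := norm_add_smul_eq hθ z 0
    rwa [zero_smul, add_zero, add_zero] at this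
  have hm : Measurable fun u : ℝ => Real.sign (u - a) := measurable_sign.comp (by fun_prop)
  have e1 : ∀ s : ℝ, Real.sign s • inverseSquare (z + s • θ) =
      (Real.sign (a + s - a) * (√(‖transverse θ z‖ ^ 2 + (a + s) ^ 2) ^ 3)⁻¹) • transverse θ z +
      (Real.sign (a + s - a) * ((a + s) * (√(‖transverse θ z‖ ^ 2 + (a + s) ^ 2) ^ 3)⁻¹)) • θ := by
    intro s
    rw [inverseSquare_line hθ, add_sub_cancel_left]
    module
  have i1 : Integrable fun u : ℝ => Real.sign (u - a) * (√(‖transverse θ z‖ ^ 2 + u ^ 2) ^ 3)⁻¹ :=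
    h1.bdd_mul hm.aestronglyMeasurable (Eventually.of_forall fun u => abs_sign_le_one _)
  have i2 : Integrable fun u : ℝ =>
      Real.sign (u - a) * (u * (√(‖transverse θ z‖ ^ 2 + u ^ 2) ^ 3)⁻¹) :=
    h2.bdd_mul hm.aestronglyMeasurable (Eventually.of_forall fun u => abs_sign_le_one _)
  simp only [e1]
  rw [integral_add_left_eq_self (fun u : ℝ =>
    (Real.sign (u - a) * (√(‖transverse θ z‖ ^ 2 + u ^ 2) ^ 3)⁻¹) • transverse θ z +
      (Real.sign (u - a) * (u * (√(‖transverse θ z‖ ^ 2 + u ^ 2) ^ 3)⁻¹)) • θ),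
    integral_add (i1.smul_const _) (i2.smul_const _), integral_smul_const, integral_smul_const,
    integral_sign_mul_inv_sqrt_cube hd, integral_sign_mul_mul_inv_sqrt_cube hd, ← hz2,
    perpKernel_eq hθ hz, ← ha]
  module

end LineKernel

/-! ### X-ray transforms of the Biot–Savart integral -/

section XraySide

variable {F : Space → Vec} {C : ℝ} {θ : Space}

theorem Decaying.biotSavart_line (hF : Decaying F C) (x : Space) (s : ℝ) :
    biotSavart F (x + s • θ) =
      -(4 * Real.pi)⁻¹ • ∫ z, cross (inverseSquare (z + s • θ)) (F (x - z)) := by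
  rw [hF.biotSavart_eq, ← integral_add_right_eq_self _ (s • θ)]
  simp only [add_sub_add_right_eq_sub, inverseSquare, cross_smul_left]

/-- The integral of `|z + sθ|⁻²` in `s` is `π/|w|`, with `w` the transverse component, and this is
integrable against the decay of `F`. It gives both Fubini and the integrability of the field on the
line. -/
theorem Decaying.integrable_line (hF : Decaying F C) (hθ : ‖θ‖ = 1) (x : Space) :
    Integrable (fun q : ℝ × Space => cross (inverseSquare (q.2 + q.1 • θ)) (F (x - q.2)))
      (volume.prod volume) := by
  have hc := hF.continuous
  have hC := hF.nonneg
  have hg : Integrable (fun q : ℝ × Space =>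
      (‖q.2 + q.1 • θ‖ ^ 2)⁻¹ * ((1 + ‖x - q.2‖) ^ 6)⁻¹) (volume.prod volume) := by
    refine (integrable_prod_iff' (Measurable.aestronglyMeasurable (by fun_prop))).2 ⟨?_, ?_⟩
    · filter_upwards [ae_transverse_ne_zero θ] with z hz
      exact (integral_inv_norm_sq_line hθ hz).1.mul_const _
    · refine ((integrable_inv_transverse hθ x).const_mul Real.pi).congr ?_
      filter_upwards [ae_transverse_ne_zero θ] with z hz
      have : ∀ s : ℝ, ‖(‖z + s • θ‖ ^ 2)⁻¹ * ((1 + ‖x - z‖) ^ 6)⁻¹‖ =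
          (‖z + s • θ‖ ^ 2)⁻¹ * ((1 + ‖x - z‖) ^ 6)⁻¹ := fun s => by
        rw [Real.norm_eq_abs, abs_of_nonneg (by positivity)]
      simp only [this]
      rw [integral_mul_const, (integral_inv_norm_sq_line hθ hz).2, mul_assoc]
  refine (hg.const_mul (2 * C)).mono' (StronglyMeasurable.aestronglyMeasurable ?_)
    (Eventually.of_forall fun q => ?_)
  · exact stronglyMeasurable_cross (measurable_inverseSquare.comp (by fun_prop))
      (Continuous.stronglyMeasurable (by fun_prop))
  · refine (norm_cross_le _ _).trans ?_
    rw [norm_inverseSquare]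
    have := hF.norm_le (x - q.2)
    calc _ ≤ 2 * (‖q.2 + q.1 • θ‖ ^ 2)⁻¹ * (C * ((1 + ‖x - q.2‖) ^ 6)⁻¹) := by gcongr
      _ = _ := by ring

/-- Line integrals of the Biot–Savart integral against a bounded weight. -/
theorem Decaying.integral_biotSavart_line (hF : Decaying F C) (hθ : ‖θ‖ = 1) (x : Space)
    {c : ℝ → ℝ} (hc : Measurable c) (hc1 : ∀ s, |c s| ≤ 1) {v : Space → Space}
    (hv : ∀ z, transverse θ z ≠ 0 → ∫ s, c s • inverseSquare (z + s • θ) = v z) :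
    Integrable (fun s => c s • biotSavart F (x + s • θ)) ∧
    ∫ s, c s • biotSavart F (x + s • θ) =
      -(4 * Real.pi)⁻¹ • ∫ z, cross (v z) (F (x - z)) := by
  have hI := hF.integrable_line hθ x
  have hcI : Integrable (fun q : ℝ × Space =>
      c q.1 • cross (inverseSquare (q.2 + q.1 • θ)) (F (x - q.2))) (volume.prod volume) :=
    hI.bdd_smul 1 (hc.comp measurable_fst).aestronglyMeasurable
      (Eventually.of_forall fun q => hc1 q.1)
  have e1 : (fun s => c s • biotSavart F (x + s • θ)) = fun s => -(4 * Real.pi)⁻¹ •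
      ∫ z, c s • cross (inverseSquare (z + s • θ)) (F (x - z)) := by
    funext s
    rw [hF.biotSavart_line, smul_comm, integral_smul]
  rw [e1]
  refine ⟨hcI.integral_prod_left.smul (-(4 * Real.pi)⁻¹), ?_⟩
  rw [integral_smul, integral_integral_swap hcI]
  congr 1
  refine integral_congr_ae ?_
  filter_upwards [ae_transverse_ne_zero θ] with z hz
  have hi : Integrable fun s : ℝ => c s • inverseSquare (z + s • θ) := by
    refine (integral_inv_norm_sq_line hθ hz).1.mono' ?_ (Eventually.of_forall fun s => ?_)
    · exact (hc.smul (measurable_inverseSquare.comp (by fun_prop))).aestronglyMeasurable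
    · rw [norm_smul, norm_inverseSquare]
      exact mul_le_of_le_one_left (by positivity) (hc1 s)
  rw [← hv z hz, ← integral_cross_left _ hi]
  simp only [cross_smul_left]

/-- The X-ray transforms of the Biot–Savart integral as volume integrals. -/
theorem Decaying.xray_biotSavart (hF : Decaying F C) (hθ : ‖θ‖ = 1) (x : Space) :
    Integrable (fun s : ℝ => biotSavart F (x + s • θ)) ∧
    xray (biotSavart F) θ x = -(4 * Real.pi)⁻¹ • (2 : ℝ) • ∫ z,
      cross ((‖transverse θ z‖ ^ 2)⁻¹ • transverse θ z) (F (x - z)) ∧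
    signedXray (biotSavart F) θ x =
      -(4 * Real.pi)⁻¹ • (2 : ℝ) • ∫ z, cross (perpKernel θ z) (F (x - z)) := by
  obtain ⟨h1, h2⟩ := hF.integral_biotSavart_line hθ x (c := fun _ => 1) measurable_const (by simp)
    (fun z hz => by simpa using integral_inverseSquare_line hθ hz)
  obtain ⟨h3, h4⟩ := hF.integral_biotSavart_line hθ x measurable_sign abs_sign_le_one
    (fun z hz => integral_sign_inverseSquare_line hθ hz)
  simp only [one_smul, cross_smul_left, integral_smul] at h1 h2 h4
  refine ⟨h1, ?_, ?_⟩
  · rw [xray_eq_integral _ _ _ h1, h2]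
    simp only [cross_smul_left]
  · rw [← h4]
    exact (intervalIntegral_tendsto_integral h3 tendsto_neg_atTop_atBot tendsto_id).limUnder_eq

end XraySide

/-! ### Gaussian weights on a plane -/

section PlaneGaussian

variable {κ : Space}

theorem integrable_norm_mul_gaussian_plane (hκ : ‖κ‖ = 1) :
    Integrable fun y : (Submodule.span ℝ {κ})ᗮ => ‖y‖ * Real.exp (-‖y‖ ^ 2) := by
  obtain ⟨C, hC, hb⟩ := exp_neg_mul_sq_mul_pow_le (t := 1 / 2) (by norm_num) 1
  refine ((integrable_gaussian_plane hκ (ε := 1 / 2) (by norm_num)).const_mul C).mono'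
    (Continuous.aestronglyMeasurable (by fun_prop)) (Eventually.of_forall fun y => ?_)
  have h1 := hb ‖y‖ (norm_nonneg y)
  have h2 : Real.exp (-‖y‖ ^ 2) =
      Real.exp (-(1 / 2) * ‖y‖ ^ 2) * Real.exp (-(1 / 2) * ‖y‖ ^ 2) := by
    rw [← Real.exp_add]; congr 1; ring
  rw [Real.norm_eq_abs, abs_of_nonneg (by positivity), h2]
  have h3 := Real.exp_pos (-(1 / 2) * ‖y‖ ^ 2)
  calc ‖y‖ * (Real.exp (-(1 / 2) * ‖y‖ ^ 2) * Real.exp (-(1 / 2) * ‖y‖ ^ 2))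
      = (Real.exp (-(1 / 2) * ‖y‖ ^ 2) * ‖y‖) * Real.exp (-(1 / 2) * ‖y‖ ^ 2) := by ring
    _ ≤ (Real.exp (-(1 / 2) * ‖y‖ ^ 2) * (1 + ‖y‖) ^ 1) * Real.exp (-(1 / 2) * ‖y‖ ^ 2) := by
        rw [pow_one]; gcongr; linarith
    _ ≤ _ := by gcongr

theorem norm_plane_add_sq (hκ : ‖κ‖ = 1) (p : ℝ) (y : (Submodule.span ℝ {κ})ᗮ) :
    ‖p • κ + (y : Space)‖ ^ 2 = p ^ 2 + ‖y‖ ^ 2 := by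
  have h := Submodule.mem_orthogonal_singleton_iff_inner_right.1 y.2
  rw [norm_add_sq_real, inner_smul_left, h, norm_smul, hκ, Real.norm_eq_abs, mul_one, sq_abs]
  simp

theorem norm_le_norm_plane_add (hκ : ‖κ‖ = 1) (p : ℝ) (y : (Submodule.span ℝ {κ})ᗮ) :
    ‖y‖ ≤ ‖p • κ + (y : Space)‖ := by
  refine (sq_le_sq₀ (norm_nonneg _) (norm_nonneg _)).1 ?_
  rw [norm_plane_add_sq hκ]
  linarith [sq_nonneg p]

theorem integral_gaussian_plane_scale (hκ : ‖κ‖ = 1) (f : (Submodule.span ℝ {κ})ᗮ → Vec) {ε : ℝ}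
    (hε : 0 < ε) : ∫ y, Real.exp (-ε * ‖y‖ ^ 2) • f y =
      ((√ε)⁻¹ ^ 2) • ∫ ζ, Real.exp (-‖ζ‖ ^ 2) • f ((√ε)⁻¹ • ζ) := by
  have hs := Real.sqrt_pos.2 hε
  have h := Measure.integral_comp_smul (volume : Measure (Submodule.span ℝ {κ})ᗮ)
    (fun y => Real.exp (-ε * ‖y‖ ^ 2) • f y) (√ε)⁻¹
  rw [finrank_plane hκ, abs_of_pos (by positivity), eq_comm, inv_smul_eq_iff₀ (by positivity)] at h
  rw [h]
  congr 2; funext ζ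
  congr 2
  rw [norm_smul, norm_inv, Real.norm_eq_abs, abs_of_pos hs, mul_pow, inv_pow, Real.sq_sqrt hε.le]
  field_simp

theorem ae_plane_ne_zero (hκ : ‖κ‖ = 1) : ∀ᵐ y : (Submodule.span ℝ {κ})ᗮ, y ≠ 0 := by
  have : Nontrivial (Submodule.span ℝ {κ})ᗮ :=
    Module.nontrivial_of_finrank_pos (R := ℝ) (by rw [finrank_plane hκ]; norm_num)
  have h := measure_eq_zero_iff_ae_notMem.1
    (measure_singleton (μ := (volume : Measure (Submodule.span ℝ {κ})ᗮ)) 0)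
  filter_upwards [h] with z hz using hz

end PlaneGaussian

/-! ### Plane integrals of the tangential derivatives -/

section RadonSide

variable {F : Space → Vec} {C : ℝ} {κ : Space}

/-- In the scaled variable a tangential derivative carries a factor `R`. Integration by parts moves
it to the Gaussian and leaves `R` times the potential, which is bounded by a multiple of `1/|ζ|`
uniformly in `R`. -/
theorem Decaying.integral_gaussian_tangential (hF : Decaying F C) (hκ : ‖κ‖ = 1) (p R : ℝ)
    (v : (Submodule.span ℝ {κ})ᗮ) :
    (R ^ 2) • ∫ ζ : (Submodule.span ℝ {κ})ᗮ, Real.exp (-‖ζ‖ ^ 2) •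
        fderiv ℝ (rieszPotential F) (p • κ + ((R • ζ : (Submodule.span ℝ {κ})ᗮ) : Space)) v =
      ∫ ζ : (Submodule.span ℝ {κ})ᗮ, (2 * inner ℝ ζ v * Real.exp (-‖ζ‖ ^ 2)) •
        R • rieszPotential F (p • κ + ((R • ζ : (Submodule.span ℝ {κ})ᗮ) : Space)) := by
  obtain ⟨K, hK0, hK⟩ := hF.rieszPotential_asymptotic
  obtain ⟨L, hL⟩ := hF.norm_fderiv_rieszPotential_le (v : Space)
  have hA := hF.continuous_rieszPotential
  have hD := hF.continuous_fderiv_rieszPotential (v : Space)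
  have hg : Integrable fun y : (Submodule.span ℝ {κ})ᗮ => Real.exp (-‖y‖ ^ 2) := by
    simpa using integrable_gaussian_plane hκ one_pos
  have c1 : Continuous fun ζ : (Submodule.span ℝ {κ})ᗮ =>
    rieszPotential F (p • κ + ((R • ζ : (Submodule.span ℝ {κ})ᗮ) : Space)) := by fun_prop
  have c2 : Continuous fun ζ : (Submodule.span ℝ {κ})ᗮ => fderiv ℝ (rieszPotential F)
    (p • κ + ((R • ζ : (Submodule.span ℝ {κ})ᗮ) : Space)) v := hD.comp (by fun_prop)
  have i1 : Integrable fun ζ : (Submodule.span ℝ {κ})ᗮ => Real.exp (-‖ζ‖ ^ 2) •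
      rieszPotential F (p • κ + ((R • ζ : (Submodule.span ℝ {κ})ᗮ) : Space)) :=
    hg.smul_bdd K c1.aestronglyMeasurable (Eventually.of_forall fun ζ => (hK _).1)
  have i2 : Integrable fun ζ : (Submodule.span ℝ {κ})ᗮ => Real.exp (-‖ζ‖ ^ 2) •
      fderiv ℝ (rieszPotential F) (p • κ + ((R • ζ : (Submodule.span ℝ {κ})ᗮ) : Space)) v :=
    hg.smul_bdd L c2.aestronglyMeasurable (Eventually.of_forall fun ζ => hL _)
  have i3 : Integrable fun ζ : (Submodule.span ℝ {κ})ᗮ =>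
      (2 * inner ℝ ζ v * Real.exp (-‖ζ‖ ^ 2)) •
        rieszPotential F (p • κ + ((R • ζ : (Submodule.span ℝ {κ})ᗮ) : Space)) := by
    suffices hk : Integrable fun ζ : (Submodule.span ℝ {κ})ᗮ =>
        2 * inner ℝ ζ v * Real.exp (-‖ζ‖ ^ 2) from
      hk.smul_bdd K c1.aestronglyMeasurable (Eventually.of_forall fun ζ => (hK _).1)
    refine ((integrable_norm_mul_gaussian_plane hκ).const_mul (2 * ‖v‖)).mono'
      (Continuous.aestronglyMeasurable (by fun_prop)) (Eventually.of_forall fun ζ => ?_)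
    rw [norm_mul, norm_mul, Real.norm_eq_abs (Real.exp _), Real.abs_exp, Real.norm_ofNat]
    have := norm_inner_le_norm (𝕜 := ℝ) ζ v
    calc _ ≤ 2 * (‖ζ‖ * ‖v‖) * Real.exp (-‖ζ‖ ^ 2) := by gcongr
      _ = _ := by ring
  have h := integral_bilinear_hasFDerivAt_right_eq_neg_left_of_integrable
    (μ := (volume : Measure (Submodule.span ℝ {κ})ᗮ)) (B := ContinuousLinearMap.lsmul ℝ ℝ)
    (f := fun ζ => Real.exp (-‖ζ‖ ^ 2))
    (f' := fun ζ => -(2 * Real.exp (-‖ζ‖ ^ 2)) • innerSL ℝ ζ)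
    (g := fun ζ : (Submodule.span ℝ {κ})ᗮ =>
      rieszPotential F (p • κ + ((R • ζ : (Submodule.span ℝ {κ})ᗮ) : Space)))
    (g' := fun ζ => (fderiv ℝ (rieszPotential F)
      (p • κ + ((R • ζ : (Submodule.span ℝ {κ})ᗮ) : Space))).comp
        (R • (Submodule.span ℝ {κ})ᗮ.subtypeL)) (v := v)
    (i3.neg.congr (Eventually.of_forall fun ζ => by
      simp only [Pi.neg_apply, ContinuousLinearMap.lsmul_apply, smul_apply, innerSL_apply_apply,
        smul_eq_mul]
      module))
    ((i2.smul R).congr (Eventually.of_forall fun ζ => by simp [smul_comm R]))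
    (by simpa using i1)
    (fun ζ _ => by
      refine ((hasStrictFDerivAt_norm_sq ζ).hasFDerivAt.neg.exp).congr_fderiv ?_
      ext w
      simp
      ring)
    (fun ζ _ => by
      refine ((hF.hasFDerivAt_rieszPotential _).differentiableAt.hasFDerivAt).comp ζ ?_
      refine HasFDerivAt.const_add _ ?_
      exact (R • (Submodule.span ℝ {κ})ᗮ.subtypeL).hasFDerivAt)
  have e1 : ∀ ζ : (Submodule.span ℝ {κ})ᗮ, (2 * inner ℝ ζ v * Real.exp (-‖ζ‖ ^ 2)) •
        R • rieszPotential F (p • κ + ((R • ζ : (Submodule.span ℝ {κ})ᗮ) : Space)) =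
      R • -(-(2 * Real.exp (-‖ζ‖ ^ 2)) * inner ℝ ζ v) •
        rieszPotential F (p • κ + ((R • ζ : (Submodule.span ℝ {κ})ᗮ) : Space)) := by
    intro ζ; module
  simp only [ContinuousLinearMap.lsmul_apply, smul_apply, innerSL_apply_apply, smul_eq_mul,
    ContinuousLinearMap.comp_apply, Submodule.subtypeL_apply, map_smul] at h
  simp only [e1, neg_smul]
  rw [integral_smul, integral_neg, ← h, sq, mul_smul, ← integral_smul]

theorem Decaying.tendsto_smul_rieszPotential (hF : Decaying F C) (hκ : ‖κ‖ = 1) (p : ℝ)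
    {ζ : (Submodule.span ℝ {κ})ᗮ} (hζ : ζ ≠ 0) :
    Tendsto (fun R : ℝ => R • rieszPotential F
      (p • κ + ((R • ζ : (Submodule.span ℝ {κ})ᗮ) : Space))) atTop
      (𝓝 (‖ζ‖⁻¹ • (4 * Real.pi)⁻¹ • ∫ z, F z)) := by
  obtain ⟨K, hK0, hK⟩ := hF.rieszPotential_asymptotic
  have hζ' : 0 < ‖ζ‖ := norm_pos_iff.2 hζ
  set X : ℝ → Space := fun R => p • κ + ((R • ζ : (Submodule.span ℝ {κ})ᗮ) : Space) with hX
  have hXle : ∀ R > 0, R * ‖ζ‖ ≤ ‖X R‖ := fun R hR => by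
    have := norm_le_norm_plane_add hκ p (R • ζ)
    rwa [norm_smul, Real.norm_eq_abs, abs_of_pos hR] at this
  have hXtop : Tendsto (fun R => ‖X R‖) atTop atTop := by
    refine tendsto_atTop_mono' _ ?_ (tendsto_id.atTop_mul_const hζ')
    filter_upwards [eventually_gt_atTop 0] with R hR using hXle R hR
  have h1 : Tendsto (fun R => ‖X R‖ • rieszPotential F (X R)) atTop
      (𝓝 ((4 * Real.pi)⁻¹ • ∫ z, F z)) := by
    refine tendsto_iff_norm_sub_tendsto_zero.2 ?_
    have h2 : Tendsto (fun R => K * ‖X R‖⁻¹) atTop (𝓝 0) := by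
      simpa using hXtop.inv_tendsto_atTop.const_mul K
    refine squeeze_zero' (Eventually.of_forall fun R => norm_nonneg _) ?_ h2
    filter_upwards [eventually_gt_atTop 0] with R hR
    have h3 : 0 < ‖X R‖ := (mul_pos hR hζ').trans_le (hXle R hR)
    rw [← div_eq_mul_inv, le_div_iff₀ h3, mul_comm]
    exact (hK _).2.2
  have h2 : Tendsto (fun R => R * ‖X R‖⁻¹) atTop (𝓝 ‖ζ‖⁻¹) := by
    have h3 : Tendsto (fun R : ℝ => ‖(R⁻¹ * p) • κ + (ζ : Space)‖⁻¹) atTop (𝓝 ‖ζ‖⁻¹) := by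
      refine Tendsto.inv₀ ?_ hζ'.ne'
      have h4 : Continuous fun t : ℝ => ‖(t * p) • κ + (ζ : Space)‖ := by fun_prop
      simpa [Function.comp_def] using (h4.tendsto 0).comp tendsto_inv_atTop_zero
    refine h3.congr' ?_
    filter_upwards [eventually_gt_atTop 0] with R hR
    have h4 : X R = R • ((R⁻¹ * p) • κ + (ζ : Space)) := by
      simp only [hX, smul_add, smul_smul, mul_inv_cancel_left₀ hR.ne', Submodule.coe_smul]
    rw [h4, norm_smul, Real.norm_eq_abs, abs_of_pos hR, mul_inv, mul_inv_cancel_left₀ hR.ne']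
  refine (h2.smul h1).congr' ?_
  filter_upwards [eventually_gt_atTop 0] with R hR
  have h3 : 0 < ‖X R‖ := (mul_pos hR hζ').trans_le (hXle R hR)
  rw [smul_smul, mul_assoc, inv_mul_cancel₀ h3.ne', mul_one]

theorem integral_eq_zero_of_odd_plane {f : (Submodule.span ℝ {κ})ᗮ → Vec}
    (hf : ∀ y, f (-y) = -f y) : ∫ y, f y = 0 := by
  have h := integral_neg_eq_self f volume
  simp only [hf, integral_neg] at h
  exact self_eq_neg.1 h.symm

/-- The tangential derivatives of the Newtonian potential do not contribute to plane integrals. -/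
theorem Decaying.tendsto_gaussian_tangential (hF : Decaying F C) (hκ : ‖κ‖ = 1) (p : ℝ)
    (v : (Submodule.span ℝ {κ})ᗮ) :
    Tendsto (fun ε => ∫ y : (Submodule.span ℝ {κ})ᗮ, Real.exp (-ε * ‖y‖ ^ 2) •
      fderiv ℝ (rieszPotential F) (p • κ + (y : Space)) v) (𝓝[>] 0) (𝓝 0) := by
  obtain ⟨K, hK0, hK⟩ := hF.rieszPotential_asymptotic
  have hA := hF.continuous_rieszPotential
  have hg : Integrable fun y : (Submodule.span ℝ {κ})ᗮ => Real.exp (-‖y‖ ^ 2) := by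
    simpa using integrable_gaussian_plane hκ one_pos
  -- The limiting profile: the point-charge potential is even in `ζ`, while the derivative of the
  -- Gaussian is odd.
  have h0 : ∫ ζ : (Submodule.span ℝ {κ})ᗮ, (2 * inner ℝ ζ v * Real.exp (-‖ζ‖ ^ 2)) •
      ‖ζ‖⁻¹ • (4 * Real.pi)⁻¹ • ∫ z, F z = 0 :=
    integral_eq_zero_of_odd_plane fun ζ => by
      rw [norm_neg, inner_neg_left]; module
  have h1 : Tendsto (fun R : ℝ => ∫ ζ : (Submodule.span ℝ {κ})ᗮ,
      (2 * inner ℝ ζ v * Real.exp (-‖ζ‖ ^ 2)) •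
        R • rieszPotential F (p • κ + ((R • ζ : (Submodule.span ℝ {κ})ᗮ) : Space))) atTop (𝓝 0) := by
    rw [← h0]
    refine tendsto_integral_filter_of_dominated_convergence
      (fun ζ => 2 * ‖v‖ * K * Real.exp (-‖ζ‖ ^ 2)) ?_ ?_ (hg.const_mul _) ?_
    · exact Eventually.of_forall fun R => Continuous.aestronglyMeasurable (by fun_prop)
    · filter_upwards [eventually_gt_atTop 0] with R hR
      refine Eventually.of_forall fun ζ => ?_
      have e1 : ‖ζ‖ * ‖R • rieszPotential F
          (p • κ + ((R • ζ : (Submodule.span ℝ {κ})ᗮ) : Space))‖ ≤ K := by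
        have := norm_le_norm_plane_add hκ p (R • ζ)
        rw [norm_smul, Real.norm_eq_abs, abs_of_pos hR] at this
        rw [norm_smul, Real.norm_eq_abs, abs_of_pos hR]
        calc _ = (R * ‖ζ‖) * ‖rieszPotential F
              (p • κ + ((R • ζ : (Submodule.span ℝ {κ})ᗮ) : Space))‖ := by ring
          _ ≤ _ := by gcongr
          _ ≤ K := (hK _).2.1
      rw [norm_smul, norm_mul, norm_mul, Real.norm_eq_abs (Real.exp _), Real.abs_exp,
        Real.norm_ofNat]
      have := norm_inner_le_norm (𝕜 := ℝ) ζ v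
      calc _ ≤ 2 * (‖ζ‖ * ‖v‖) * Real.exp (-‖ζ‖ ^ 2) * ‖R • rieszPotential F
            (p • κ + ((R • ζ : (Submodule.span ℝ {κ})ᗮ) : Space))‖ := by gcongr
        _ = 2 * ‖v‖ * (‖ζ‖ * ‖R • rieszPotential F
            (p • κ + ((R • ζ : (Submodule.span ℝ {κ})ᗮ) : Space))‖) * Real.exp (-‖ζ‖ ^ 2) := by ring
        _ ≤ _ := by gcongr
    · filter_upwards [ae_plane_ne_zero hκ] with ζ hζ
      exact (hF.tendsto_smul_rieszPotential hκ p hζ).const_smul _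
  have h2 : Tendsto (fun ε : ℝ => (√ε)⁻¹) (𝓝[>] 0) atTop := by
    refine tendsto_inv_nhdsGT_zero.comp (tendsto_nhdsWithin_iff.2 ⟨?_, ?_⟩)
    · simpa using (Real.continuous_sqrt.tendsto 0).mono_left
        (nhdsWithin_le_nhds (s := Set.Ioi (0 : ℝ)))
    · filter_upwards [self_mem_nhdsWithin] with ε hε using Real.sqrt_pos.2 hε
  refine (h1.comp h2).congr' ?_
  filter_upwards [self_mem_nhdsWithin] with ε hε
  rw [integral_gaussian_plane_scale hκ (fun y => fderiv ℝ (rieszPotential F) (p • κ + (y : Space)) v)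
    hε, hF.integral_gaussian_tangential hκ p (√ε)⁻¹ v]
  rfl

end RadonSide

/-! ### Flux of the inverse-square kernel through a plane -/

section PlaneKernel

theorem integral_inv_sqrt_cube_plane {d : ℝ} (hd : 0 < d) :
    Integrable (fun b : ℝ × ℝ => (√(d ^ 2 + b.1 ^ 2 + b.2 ^ 2) ^ 3)⁻¹) ∧
    ∫ b : ℝ × ℝ, (√(d ^ 2 + b.1 ^ 2 + b.2 ^ 2) ^ 3)⁻¹ = 2 * Real.pi * d⁻¹ := by
  have hs : ∀ a : ℝ, 0 < √(d ^ 2 + a ^ 2) := sqrt_sq_add_sq_pos hd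
  have hsq : ∀ a : ℝ, √(d ^ 2 + a ^ 2) ^ 2 = d ^ 2 + a ^ 2 := fun a => Real.sq_sqrt (by positivity)
  have h1 : ∀ a : ℝ, Integrable (fun b : ℝ => (√(d ^ 2 + a ^ 2 + b ^ 2) ^ 3)⁻¹) ∧
      ∫ b : ℝ, (√(d ^ 2 + a ^ 2 + b ^ 2) ^ 3)⁻¹ = 2 * (d ^ 2 + a ^ 2)⁻¹ := by
    intro a
    have h2 := (integrable_inv_sqrt_cube (hs a)).1
    have h3 := integral_inv_sqrt_cube (hs a)
    rw [hsq a] at h2 h3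
    exact ⟨h2, h3⟩
  obtain ⟨h2, h3⟩ := integrable_inv_sq_add_sq hd
  have hI : Integrable (fun b : ℝ × ℝ => (√(d ^ 2 + b.1 ^ 2 + b.2 ^ 2) ^ 3)⁻¹)
      (volume.prod volume) := by
    refine (integrable_prod_iff (Measurable.aestronglyMeasurable (by fun_prop))).2
      ⟨Eventually.of_forall fun a => (h1 a).1, ?_⟩
    refine (h2.const_mul 2).congr (Eventually.of_forall fun a => ?_)
    have : ∀ b : ℝ, ‖(√(d ^ 2 + a ^ 2 + b ^ 2) ^ 3)⁻¹‖ = (√(d ^ 2 + a ^ 2 + b ^ 2) ^ 3)⁻¹ :=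
      fun b => by rw [Real.norm_eq_abs, abs_of_nonneg (by positivity)]
    simp only [this, (h1 a).2]
  refine ⟨hI, ?_⟩
  rw [Measure.volume_eq_prod, integral_prod _ hI]
  simp only [(h1 _).2]
  rw [integral_const_mul, h3]
  ring

/-- The normal component of the Biot–Savart kernel, in the coordinates of a frame. -/
def normalKernel (s : ℝ × ℝ × ℝ) : ℝ :=
  s.1 * (√(s.1 ^ 2 + s.2.1 ^ 2 + s.2.2 ^ 2) ^ 3)⁻¹

theorem measurable_normalKernel : Measurable normalKernel := by
  unfold normalKernel; fun_prop

/-- A plane subtends half of the full solid angle `4π`, at whatever distance. The kernel has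
constant sign on the plane, so its absolute integral is bounded independently of `t`. -/
theorem integral_normalKernel {t : ℝ} (ht : t ≠ 0) :
    Integrable (fun b : ℝ × ℝ => normalKernel (t, b)) ∧
    ∫ b : ℝ × ℝ, normalKernel (t, b) = 2 * Real.pi * Real.sign t ∧
    ∫ b : ℝ × ℝ, |normalKernel (t, b)| = 2 * Real.pi := by
  obtain ⟨h1, h2⟩ := integral_inv_sqrt_cube_plane (abs_pos.2 ht)
  rw [sq_abs] at h1 h2
  have h3 : ∀ b : ℝ × ℝ, |normalKernel (t, b)| =
      |t| * (√(t ^ 2 + b.1 ^ 2 + b.2 ^ 2) ^ 3)⁻¹ := fun b => by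
    rw [normalKernel, abs_mul, abs_of_nonneg (by positivity : 0 ≤ (√(t ^ 2 + b.1 ^ 2 + b.2 ^ 2) ^ 3)⁻¹)]
  refine ⟨h1.const_mul t, ?_, ?_⟩
  · simp only [normalKernel]
    rw [integral_const_mul, h2]
    rcases lt_or_gt_of_ne ht with h | h
    · rw [Real.sign_of_neg h, abs_of_neg h]; field_simp
    · rw [Real.sign_of_pos h, abs_of_pos h]; field_simp
  · simp only [h3]
    rw [integral_const_mul, h2]
    have := abs_pos.2 ht
    field_simp

theorem ae_ne_zero_real : ∀ᵐ t : ℝ, t ≠ 0 := by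
  have h := measure_eq_zero_iff_ae_notMem.1 (measure_singleton (μ := (volume : Measure ℝ)) 0)
  filter_upwards [h] with z hz using hz

theorem integrable_normalKernel_mul (p : ℝ) :
    Integrable (fun s : ℝ × ℝ × ℝ => normalKernel s * (1 + (p - s.1) ^ 2)⁻¹)
      (volume.prod volume) := by
  refine (integrable_prod_iff (Measurable.aestronglyMeasurable ?_)).2 ⟨?_, ?_⟩
  · have := measurable_normalKernel
    fun_prop
  · filter_upwards [ae_ne_zero_real] with t ht
    exact (integral_normalKernel ht).1.mul_const _
  · refine ((integrable_inv_one_add_sq.comp_sub_left p).const_mul (2 * Real.pi)).congr ?_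
    filter_upwards [ae_ne_zero_real] with t ht
    simp only [norm_mul, Real.norm_eq_abs]
    rw [integral_mul_const, (integral_normalKernel ht).2.2, abs_of_nonneg (by positivity)]

end PlaneKernel

/-! ### The normal derivative and the Radon transform of the Biot–Savart integral -/

section NormalPart

variable {F : Space → Vec} {C : ℝ} {e₁ e₂ κ : Space}

theorem Decaying.fderiv_rieszPotential_normal (hF : Decaying F C) (h : IsFrame e₁ e₂ κ) (p : ℝ)
    (q : ℝ × ℝ) : fderiv ℝ (rieszPotential F) (p • κ + (q.1 • e₁ + q.2 • e₂)) κ =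
      -(4 * Real.pi)⁻¹ • ∫ s : ℝ × ℝ × ℝ, normalKernel s •
        F ((p - s.1) • κ + ((q - s.2).1 • e₁ + (q - s.2).2 • e₂)) := by
  have h' : IsFrame κ e₁ e₂ := h.cycle.cycle
  obtain ⟨⟨h1, h2, h3⟩, h12, h13, h23⟩ := isFrame_iff.1 h'
  rw [hF.fderiv_rieszPotential, h'.integral_frame]
  congr 2; funext s
  have e1 : inner ℝ (framePoint κ e₁ e₂ s) κ = s.1 := by
    rw [real_inner_comm]; simp [framePoint, inner_add_right, inner_smul_right, h12, h13, h1]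
  have e2 : ‖framePoint κ e₁ e₂ s‖ = √(s.1 ^ 2 + s.2.1 ^ 2 + s.2.2 ^ 2) := by
    rw [← h'.norm_sq, Real.sqrt_sq (norm_nonneg _), framePoint]
  rw [e1, e2, normalKernel]
  congr 2
  simp only [framePoint, Prod.fst_sub, Prod.snd_sub]
  module

/-- The plane integral of `‖F‖` is `O(1/(1 + (p - t)²))` at offset `t`, and the absolute flux of the
kernel is `2π` for every `t ≠ 0`. Hence the normal derivative, unlike the tangential ones, is
treated by absolute convergence. -/
theorem Decaying.integrable_normal (hF : Decaying F C) (h : IsFrame e₁ e₂ κ) (p : ℝ) :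
    Integrable (fun r : (ℝ × ℝ × ℝ) × (ℝ × ℝ) => normalKernel r.1 •
      F ((p - r.1.1) • κ + ((r.2 - r.1.2).1 • e₁ + (r.2 - r.1.2).2 • e₂)))
      ((volume.prod volume).prod volume) := by
  have hc := hF.continuous
  have hm := measurable_normalKernel
  have hC := hF.nonneg
  have hms : AEStronglyMeasurable (fun r : (ℝ × ℝ × ℝ) × (ℝ × ℝ) => normalKernel r.1 •
      F ((p - r.1.1) • κ + ((r.2 - r.1.2).1 • e₁ + (r.2 - r.1.2).2 • e₂)))
      ((volume.prod volume).prod volume) := by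
    have h1 : Measurable fun r : (ℝ × ℝ × ℝ) × (ℝ × ℝ) => normalKernel r.1 := by fun_prop
    have h2 : Continuous fun r : (ℝ × ℝ × ℝ) × (ℝ × ℝ) =>
      F ((p - r.1.1) • κ + ((r.2 - r.1.2).1 • e₁ + (r.2 - r.1.2).2 • e₂)) := by fun_prop
    exact (h1.stronglyMeasurable.smul h2.stronglyMeasurable).aestronglyMeasurable
  refine (integrable_prod_iff hms).2 ⟨Eventually.of_forall fun s => ?_, ?_⟩
  · exact ((hF.integrable_plane_coord h (p - s.1)).comp_sub_right s.2).smul (normalKernel s)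
  · refine ((integrable_normalKernel_mul p).norm.const_mul (C * Real.pi ^ 2)).mono'
      hms.norm.integral_prod_right' (Eventually.of_forall fun s => ?_)
    rw [Real.norm_eq_abs, abs_of_nonneg (integral_nonneg fun q => norm_nonneg _)]
    simp only [norm_smul]
    rw [integral_const_mul, integral_sub_right_eq_self (fun q : ℝ × ℝ =>
      ‖F ((p - s.1) • κ + (q.1 • e₁ + q.2 • e₂))‖) s.2]
    have h1 : ∫ q : ℝ × ℝ, ‖F ((p - s.1) • κ + (q.1 • e₁ + q.2 • e₂))‖ ≤
        C * Real.pi ^ 2 * (1 + (p - s.1) ^ 2)⁻¹ := by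
      refine (integral_mono (hF.integrable_plane_coord h (p - s.1)).norm
        ((integrable_inv_one_add_sq_prod.const_mul (1 + (p - s.1) ^ 2)⁻¹).const_mul C)
        (fun q => hF.norm_plane_le h (p - s.1) q)).trans_eq ?_
      rw [integral_const_mul, integral_const_mul, integral_inv_one_add_sq_prod]
      ring
    rw [norm_mul, Real.norm_eq_abs (_⁻¹), abs_of_nonneg (by positivity : 0 ≤ (1 + (p - s.1) ^ 2)⁻¹)]
    calc _ ≤ ‖normalKernel s‖ * (C * Real.pi ^ 2 * (1 + (p - s.1) ^ 2)⁻¹) := by gcongr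
      _ = _ := by ring

/-- The plane integrals of the normal derivative of the Newtonian potential. -/
theorem Decaying.integral_normal (hF : Decaying F C) (h : IsFrame e₁ e₂ κ) (p : ℝ) :
    Integrable (fun q : ℝ × ℝ =>
      fderiv ℝ (rieszPotential F) (p • κ + (q.1 • e₁ + q.2 • e₂)) κ) ∧
    ∫ q : ℝ × ℝ, fderiv ℝ (rieszPotential F) (p • κ + (q.1 • e₁ + q.2 • e₂)) κ =
      -(2 : ℝ)⁻¹ • ∫ t, Real.sign t • radon F (p - t) κ := by
  have hI := hF.integrable_normal h p
  simp only [hF.fderiv_rieszPotential_normal h]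
  refine ⟨hI.integral_prod_right.smul (-(4 * Real.pi)⁻¹), ?_⟩
  have hr : ∀ s : ℝ × ℝ × ℝ, ∫ q : ℝ × ℝ, normalKernel s •
      F ((p - s.1) • κ + ((q - s.2).1 • e₁ + (q - s.2).2 • e₂)) =
        normalKernel s • radon F (p - s.1) κ := by
    intro s
    rw [integral_smul, integral_sub_right_eq_self (fun q : ℝ × ℝ =>
      F ((p - s.1) • κ + (q.1 • e₁ + q.2 • e₂))) s.2, hF.radon_eq h]
  have hI2 : Integrable (fun s : ℝ × ℝ × ℝ => normalKernel s • radon F (p - s.1) κ)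
      (volume.prod volume) := hI.integral_prod_left.congr (Eventually.of_forall hr)
  rw [integral_smul, Measure.volume_eq_prod ℝ (ℝ × ℝ), ← integral_integral_swap hI]
  simp only [hr]
  rw [integral_prod _ hI2]
  have h2 : ∫ t : ℝ, ∫ b : ℝ × ℝ, normalKernel (t, b) • radon F (p - t) κ =
      (2 * Real.pi) • ∫ t, Real.sign t • radon F (p - t) κ := by
    rw [← integral_smul]
    refine integral_congr_ae ?_
    filter_upwards [ae_ne_zero_real] with t ht
    rw [integral_smul_const, (integral_normalKernel ht).2.1, mul_smul]
  rw [h2, smul_smul]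
  congr 1
  have := Real.pi_pos
  field_simp
  norm_num

/-- The integral is that of `r` over `(-∞, p)` minus that over `(p, ∞)`, whose derivative in `p` is
`2 r(p)`. -/
theorem hasDerivAt_integral_sign {r : ℝ → Vec} (hc : Continuous r) (hi : Integrable r) (p : ℝ) :
    HasDerivAt (fun p => -(2 : ℝ)⁻¹ • ∫ t, Real.sign t • r (p - t)) (-r p) p := by
  have h1 : ∀ p, ∫ t, Real.sign t • r (p - t) =
      (2 : ℝ) • (∫ u in (0 : ℝ)..p, r u) + ((2 : ℝ) • (∫ u in Set.Iic 0, r u) - ∫ u, r u) := by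
    intro p
    have hs : Integrable fun u => Real.sign (p - u) • r u :=
      hi.bdd_smul 1 (measurable_sign.comp (by fun_prop)).aestronglyMeasurable
        (Eventually.of_forall fun u => abs_sign_le_one _)
    have e1 : ∫ t, Real.sign t • r (p - t) = ∫ u, Real.sign (p - u) • r u := by
      rw [← integral_sub_left_eq_self (fun u => Real.sign (p - u) • r u) volume p]
      simp only [sub_sub_cancel]
    have e2 : ∫ u in Set.Iic p, Real.sign (p - u) • r u = ∫ u in Set.Iic p, r u := by
      rw [integral_Iic_eq_integral_Iio, integral_Iic_eq_integral_Iio]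
      refine setIntegral_congr_fun measurableSet_Iio fun u hu => ?_
      simp only [Real.sign_of_pos (sub_pos.2 hu), one_smul]
    have e3 : ∫ u in Set.Ioi p, Real.sign (p - u) • r u = -∫ u in Set.Ioi p, r u := by
      rw [← integral_neg]
      refine setIntegral_congr_fun measurableSet_Ioi fun u hu => ?_
      simp only [Real.sign_of_neg (sub_neg.2 hu), neg_smul, one_smul]
    have e4 := integral_add_compl (measurableSet_Iic (a := p)) hi
    rw [Set.compl_Iic] at e4
    have e5 := intervalIntegral.integral_Iic_sub_Iic (a := 0) (b := p) hi.integrableOn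
      hi.integrableOn
    rw [e1, ← integral_add_compl (measurableSet_Iic (a := p)) hs, Set.compl_Iic, e2, e3, ← e4, ← e5]
    module
  simp only [h1]
  have h2 := intervalIntegral.integral_hasDerivAt_right (a := 0) (b := p)
    (hc.intervalIntegrable _ _) (hc.stronglyMeasurableAtFilter _ _) hc.continuousAt
  refine (((h2.const_smul (2 : ℝ)).add_const _).const_smul (-(2 : ℝ)⁻¹)).congr_deriv ?_
  module

/-- The Radon transform of the Biot–Savart integral. -/
theorem Decaying.radon_biotSavart (hF : Decaying F C) (hκ : ‖κ‖ = 1) (p : ℝ) :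
    RadonExists (biotSavart F) p κ ∧ radon (biotSavart F) p κ =
      cross κ (-(2 : ℝ)⁻¹ • ∫ t, Real.sign t • radon F (p - t) κ) := by
  obtain ⟨e₁, e₂, h⟩ := exists_isFrame hκ
  obtain ⟨hi, hN⟩ := hF.integral_normal h p
  have hiV : Integrable fun y : (Submodule.span ℝ {κ})ᗮ =>
      fderiv ℝ (rieszPotential F) (p • κ + (y : Space)) κ := (h.integrable_plane _).2 hi
  have hNV : ∫ y : (Submodule.span ℝ {κ})ᗮ,
      fderiv ℝ (rieszPotential F) (p • κ + (y : Space)) κ =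
        -(2 : ℝ)⁻¹ • ∫ t, Real.sign t • radon F (p - t) κ := by
    rw [h.integral_plane, ← hN]; rfl
  have hgi : ∀ e : Space, ∀ ε > 0, Integrable fun y : (Submodule.span ℝ {κ})ᗮ =>
      Real.exp (-ε * ‖y‖ ^ 2) • fderiv ℝ (rieszPotential F) (p • κ + (y : Space)) e := by
    intro e ε hε
    obtain ⟨L, hL⟩ := hF.norm_fderiv_rieszPotential_le e
    have hD := hF.continuous_fderiv_rieszPotential e
    exact (integrable_gaussian_plane hκ hε).smul_bdd L
      (Continuous.aestronglyMeasurable (hD.comp (by fun_prop))) (Eventually.of_forall fun y => hL _)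
  have hgc : ∀ e : Space, ∀ ε > 0, Integrable fun y : (Submodule.span ℝ {κ})ᗮ =>
      cross e (Real.exp (-ε * ‖y‖ ^ 2) • fderiv ℝ (rieszPotential F) (p • κ + (y : Space)) e) :=
    fun e ε hε => (crossL e).integrable_comp (hgi e ε hε)
  have hsplit : ∀ (ε : ℝ) (y : (Submodule.span ℝ {κ})ᗮ),
      Real.exp (-ε * ‖y‖ ^ 2) • biotSavart F (p • κ + (y : Space)) =
      cross e₁ (Real.exp (-ε * ‖y‖ ^ 2) • fderiv ℝ (rieszPotential F) (p • κ + (y : Space)) e₁) +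
      cross e₂ (Real.exp (-ε * ‖y‖ ^ 2) • fderiv ℝ (rieszPotential F) (p • κ + (y : Space)) e₂) +
      cross κ (Real.exp (-ε * ‖y‖ ^ 2) • fderiv ℝ (rieszPotential F) (p • κ + (y : Space)) κ) := by
    intro ε y
    rw [hF.biotSavart_eq_frame h]
    simp only [smul_add, cross_smul_right]
  have h12 : ∀ ε > 0, Integrable fun y : (Submodule.span ℝ {κ})ᗮ =>
      cross e₁ (Real.exp (-ε * ‖y‖ ^ 2) • fderiv ℝ (rieszPotential F) (p • κ + (y : Space)) e₁) +
      cross e₂ (Real.exp (-ε * ‖y‖ ^ 2) • fderiv ℝ (rieszPotential F) (p • κ + (y : Space)) e₂) :=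
    fun ε hε => (hgc e₁ ε hε).add (hgc e₂ ε hε)
  -- In the frame adapted to the plane, the two tangential terms vanish in the Gaussian limit.
  have hT := fun v => hF.tendsto_gaussian_tangential hκ p v
  have hT1 := hT (h.planePoint (1, 0))
  have hT2 := hT (h.planePoint (0, 1))
  simp only [IsFrame.planePoint, one_smul, zero_smul, add_zero, zero_add] at hT1 hT2
  -- The normal term converges absolutely, so its Gaussian limit is the ordinary integral.
  have hT3 : Tendsto (fun ε => ∫ y : (Submodule.span ℝ {κ})ᗮ, Real.exp (-ε * ‖y‖ ^ 2) •
      fderiv ℝ (rieszPotential F) (p • κ + (y : Space)) κ) (𝓝[>] 0)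
      (𝓝 (-(2 : ℝ)⁻¹ • ∫ t, Real.sign t • radon F (p - t) κ)) := by
    rw [← hNV]
    refine tendsto_integral_filter_of_dominated_convergence _ ?_ ?_ hiV.norm ?_
    · filter_upwards [self_mem_nhdsWithin] with ε hε using (hgi κ ε hε).aestronglyMeasurable
    · filter_upwards [self_mem_nhdsWithin] with ε hε
      refine Eventually.of_forall fun y => ?_
      rw [norm_smul, Real.norm_eq_abs, Real.abs_exp]
      refine mul_le_of_le_one_left (norm_nonneg _) (Real.exp_le_one_iff.2 ?_)
      have : 0 ≤ ε * ‖y‖ ^ 2 := mul_nonneg (le_of_lt hε) (sq_nonneg _)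
      linarith
    · refine Eventually.of_forall fun y => ?_
      have hc : Continuous fun ε : ℝ => Real.exp (-ε * ‖y‖ ^ 2) •
        fderiv ℝ (rieszPotential F) (p • κ + (y : Space)) κ := by fun_prop
      simpa using (hc.tendsto 0).mono_left (nhdsWithin_le_nhds (s := Set.Ioi (0 : ℝ)))
  have hlim : Tendsto (radonReg (biotSavart F) p κ) (𝓝[>] 0)
      (𝓝 (cross κ (-(2 : ℝ)⁻¹ • ∫ t, Real.sign t • radon F (p - t) κ))) := by
    have h3 := (((((crossL e₁).continuous.tendsto _).comp hT1).add
      (((crossL e₂).continuous.tendsto _).comp hT2)).add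
        (((crossL κ).continuous.tendsto _).comp hT3))
    simp only [map_zero, zero_add] at h3
    refine h3.congr' ?_
    filter_upwards [self_mem_nhdsWithin] with ε hε
    simp only [radonReg, hsplit, Function.comp, crossL_apply]
    rw [integral_add (h12 ε hε) (hgc κ ε hε), integral_add (hgc e₁ ε hε) (hgc e₂ ε hε),
      integral_cross _ (hgi _ ε hε), integral_cross _ (hgi _ ε hε), integral_cross _ (hgi _ ε hε)]
  refine ⟨⟨fun ε hε => ?_, _, hlim⟩, hlim.limUnder_eq⟩
  simp only [hsplit]
  exact (h12 ε hε).add (hgc κ ε hε)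

theorem Decaying.hasDerivAt_radon_biotSavart (hF : Decaying F C) (hκ : ‖κ‖ = 1) (p : ℝ) :
    HasDerivAt (fun q => radon (biotSavart F) q κ) (-cross κ (radon F p κ)) p := by
  simp only [fun q => (hF.radon_biotSavart hκ q).2]
  rw [← cross_neg]
  exact (crossL κ).hasFDerivAt.comp_hasDerivAt p
    (hasDerivAt_integral_sign (hF.continuous_radon hκ) (hF.integrable_radon hκ) p)

end NormalPart

/-! ### Comparison of the two sides for rapidly decreasing fields -/

section DecayingTransforms

theorem hilbert_neg_cross {r : ℝ → Vec} {x : ℝ} (h : HilbertExists r x) (κ : Space) :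
    hilbert (fun q => -cross κ (r q)) x = -cross κ (hilbert r x) := by
  obtain ⟨h1, v, hv⟩ := h
  have h2 : hilbert r x = v := hv.limUnder_eq
  rw [h2]
  refine Tendsto.limUnder_eq ((((crossL κ).continuous.tendsto v).comp hv).neg.congr' ?_)
  filter_upwards [self_mem_nhdsWithin] with ε hε
  simp only [Function.comp, crossL_apply, hilbertTrunc, cross_smul_right, smul_neg, integral_neg]
  rw [← integral_cross κ (h1 ε hε)]
  simp only [cross_smul_right]

/-- The transforms of the Biot–Savart integral of a rapidly decreasing field. -/
theorem schwartz_transforms (F : 𝓢(Space, Vec)) :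
    (∀ x, RieszExists F x) ∧ Differentiable ℝ (rieszPotential F) ∧
      (∀ (κ : Space) (p : ℝ), ‖κ‖ = 1 →
        Integrable (fun y : (Submodule.span ℝ {κ})ᗮ => F (p • κ + (y : Space))) ∧
        HilbertExists (fun q => radon F q κ) p ∧
        RadonExists (biotSavart F) p κ ∧
        HasDerivAt (fun q => radon (biotSavart F) q κ) (-cross κ (radon F p κ)) p) ∧
      (∀ θ x : Space, ‖θ‖ = 1 →
        Integrable (fun s : ℝ => biotSavart F (x + s • θ)) ∧
        FunkIntegrable (fun κ => cross κ (hilbert (fun q => radon F q κ) (inner ℝ κ x))) θ ∧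
        xray (biotSavart F) θ x =
          (1 / (4 * Real.pi)) • funk (fun κ =>
            hilbert (deriv fun q => radon (biotSavart F) q κ) (inner ℝ κ x)) θ ∧
        xray (biotSavart F) θ x =
          -(1 / (4 * Real.pi)) • funk (fun κ =>
            cross κ (hilbert (fun q => radon F q κ) (inner ℝ κ x))) θ ∧
        PvSphereExists (fun κ => cross κ (radon F (inner ℝ κ x) κ)) θ ∧
        signedXray (biotSavart F) θ x =
          -(1 / (2 * Real.pi) ^ 2) • pvSphere (fun κ => cross κ (radon F (inner ℝ κ x) κ)) θ) := by
  obtain ⟨C, hF⟩ := exists_decaying F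
  refine ⟨fun x => (hF.rieszExists x).1,
    fun x => (hF.hasFDerivAt_rieszPotential x).differentiableAt,
    fun κ p hκ => ⟨hF.integrable_plane hκ p, (hF.hilbert_radon hκ p).1, (hF.radon_biotSavart hκ p).1,
      hF.hasDerivAt_radon_biotSavart hκ p⟩, fun θ x hθ => ?_⟩
  obtain ⟨h1, h2, h3⟩ := hF.xray_biotSavart hθ x
  obtain ⟨h4, h5⟩ := hF.funk_hilbert hθ x
  obtain ⟨h6, h7⟩ := hF.pvSphere_radon hθ x
  have h8 : xray (biotSavart F) θ x = -(1 / (4 * Real.pi)) • funk (fun κ =>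
      cross κ (hilbert (fun q => radon F q κ) (inner ℝ κ x))) θ := by
    rw [h2, h5, one_div]
  refine ⟨h1, h4, ?_, h8, h6, ?_⟩
  · have h9 : funk (fun κ => hilbert (deriv fun q => radon (biotSavart F) q κ) (inner ℝ κ x)) θ =
        funk (fun κ => -cross κ (hilbert (fun q => radon F q κ) (inner ℝ κ x))) θ := by
      refine funk_congr θ fun κ hκ => ?_
      have : (deriv fun q => radon (biotSavart F) q κ) = fun q => -cross κ (radon F q κ) :=
        funext fun q => (hF.hasDerivAt_radon_biotSavart hκ q).deriv
      rw [this, hilbert_neg_cross (hF.hilbert_radon hκ _).1]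
    rw [h9, h8, funk, funk, integral_neg, neg_smul, smul_neg]
  · have := Real.pi_pos
    -- Both sides are the same volume integral against `perpKernel`, with the constant `-2/(4π) =
    -- -(2π)/(2π)²`.
    rw [h3, h7, smul_smul, smul_smul]
    congr 1
    field_simp
    norm_num

end DecayingTransforms

end BiotSavartXray

end

theorem mainTheorem12 :
    -- rapidly decreasing fields
    (∀ F : 𝓢(Space, Vec),
      (∀ x, RieszExists F x) ∧ Differentiable ℝ (rieszPotential F) ∧
      (∀ (κ : Space) (p : ℝ), ‖κ‖ = 1 →
        Integrable (fun y : (Submodule.span ℝ {κ})ᗮ => F (p • κ + (y : Space))) ∧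
        HilbertExists (fun q => radon F q κ) p ∧
        RadonExists (biotSavart F) p κ ∧
        HasDerivAt (fun q => radon (biotSavart F) q κ) (-cross κ (radon F p κ)) p) ∧
      (∀ θ x : Space, ‖θ‖ = 1 →
        Integrable (fun s : ℝ => biotSavart F (x + s • θ)) ∧
        FunkIntegrable (fun κ => cross κ (hilbert (fun q => radon F q κ) (inner ℝ κ x))) θ ∧
        xray (biotSavart F) θ x =
          (1 / (4 * Real.pi)) • funk (fun κ =>
            hilbert (deriv fun q => radon (biotSavart F) q κ) (inner ℝ κ x)) θ ∧
        xray (biotSavart F) θ x =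
          -(1 / (4 * Real.pi)) • funk (fun κ =>
            cross κ (hilbert (fun q => radon F q κ) (inner ℝ κ x))) θ ∧
        PvSphereExists (fun κ => cross κ (radon F (inner ℝ κ x) κ)) θ ∧
        signedXray (biotSavart F) θ x =
          -(1 / (2 * Real.pi) ^ 2) • pvSphere (fun κ => cross κ (radon F (inner ℝ κ x) κ)) θ)) ∧
    -- Trkalian fields
    (∀ (ν : ℝ) (F : Space → Vec), ν ≠ 0 → IsTrkalian ν F → PolynomialGrowth F →
      (∀ x, RieszExists F x) ∧ Differentiable ℝ (rieszPotential F) ∧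
      (∀ x, biotSavart F x = (1 / ν) • F x) ∧
      (∀ θ x : Space, ‖θ‖ = 1 →
        (XrayExists (biotSavart F) θ x ↔ XrayExists F θ x) ∧
        (XrayExists F θ x → xray (biotSavart F) θ x = (1 / ν) • xray F θ x) ∧
        (SignedExists (biotSavart F) θ x ↔ SignedExists F θ x) ∧
        (SignedExists F θ x →
          signedXray (biotSavart F) θ x = (1 / ν) • signedXray F θ x))) ∧
    -- Trkalian fields with a continuously differentiable amplitude on the sphere
    (∀ (ν : ℝ) (F g : Space → Vec), ν ≠ 0 → IsTrkalian ν F → ContDiff ℝ 1 g →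
      (∀ x, F x = sphereSuperposition ν g x) →
      (∀ (κ : Space) (p : ℝ), ‖κ‖ = 1 →
        RadonExists F p κ ∧
        HasDerivAt (fun q => radon F q κ) (-(ν • cross κ (radon F p κ))) p ∧
        HilbertExists (fun q => radon F q κ) p ∧
        HilbertExists (deriv fun q => radon F q κ) p) ∧
      (∀ θ x : Space, ‖θ‖ = 1 →
        XrayExists F θ x ∧ XrayExists (biotSavart F) θ x ∧
        FunkIntegrable (fun κ => cross κ (hilbert (fun q => radon F q κ) (inner ℝ κ x))) θ ∧
        FunkIntegrable (fun κ => hilbert (deriv fun q => radon F q κ) (inner ℝ κ x)) θ ∧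
        xray (biotSavart F) θ x =
          -(1 / (4 * Real.pi)) • funk (fun κ =>
            cross κ (hilbert (fun q => radon F q κ) (inner ℝ κ x))) θ ∧
        xray (biotSavart F) θ x =
          (1 / (4 * Real.pi) * (1 / ν)) • funk (fun κ =>
            hilbert (deriv fun q => radon F q κ) (inner ℝ κ x)) θ ∧
        xray (biotSavart F) θ x = (1 / ν) • xray F θ x ∧
        SignedExists F θ x ∧ SignedExists (biotSavart F) θ x ∧
        PvSphereExists (fun κ => cross κ (radon F (inner ℝ κ x) κ)) θ ∧
        signedXray (biotSavart F) θ x =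
          -(1 / (2 * Real.pi) ^ 2) • pvSphere (fun κ => cross κ (radon F (inner ℝ κ x) κ)) θ ∧
        signedXray (biotSavart F) θ x = (1 / ν) • signedXray F θ x)) := by
  refine ⟨?_, ?_, ?_⟩
  · exact fun F => schwartz_transforms F
  · exact fun ν F hν hF hg => trkalian_transforms hν hF hg
  · intro ν F g hν hF hg hsup
    obtain rfl : F = sphereSuperposition ν g := funext hsup
    refine ⟨fun κ p hκ => ?_, fun θ x hθ => trkalian_superposition_transforms hν hF hg hθ x⟩
    obtain ⟨h1, h2, h3, h4, -⟩ := sphereSuperposition_transforms hν hF hg κ p hκ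
    exact ⟨h1, h2, h3, h4⟩
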